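/- **Corollary 1.6.** Let $K$ be a field, let $m,n\ge 0$, and let $S=K[x_1,\dots,x_m,y_1,\dots,y_n]$ be bigraded by $\deg x_i=(1,0)$ and $\deg y_j=(d_j,1)$ with integers $d_j\ge 0$. Put $P=(x_1,\dots,x_m)$, $Q=(y_1,\dots,y_n)$, $T=K[x_1,\dots,x_m]$ with its standard grading, $P_0=(x_1,\dots,x_m)\subset T$, $s=m+n=\dim S$, and $\omega_S=S(-\sigma)$ with $\sigma=\deg(x_1\cdots x_my_1\cdots y_n)$. For a graded module $N$ over a graded $K$-algebra, $N^*$ denotes the graded dual, $(N^*)_\gamma=\operatorname{Hom}_K(N_{-\gamma},K)$. For a bigraded $S$-module $N$ and $k\in\mathbb Z$, $N_k=\bigoplus_j N_{(j,k)}$ denotes the graded $T$-module with $(N_k)_j=N_{(j,k)}$. Local cohomology is the cohomology of the Čech complex on the given variables; it is $0$ in negative cohomological degrees. $\operatorname{Ext}^j_S(M,\omega_S)$ carries the bigrading computed from a bigraded resolution of $M$ by free $S$-modules of finite rank. Let $M\neq 0$ be a finitely generated bigraded $S$-module and let $d=\dim M$. All isomorphisms and maps in (a)–(c) are homogeneous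 of degree $0$ and $S$-linear, and the isomorphisms in (d) and (e) are isomorphisms of graded $T$-modules. (a) $H^0_P(\operatorname{Ext}^{s-d}_S(M,\omega_S))\cong H^d_Q(M)^*$. (b) There is an exact sequence $$0\to H^1_P(\operatorname{Ext}^{s-d}_S(M,\omega_S))\to H^{d-1}_Q(M)^*\to H^0_P(\operatorname{Ext}^{s-d+1}_S(M,\omega_S)).$$ (c) Let $i\ge 2$. If $\operatorname{Ext}^j_S(M,\omega_S)$ is annihilated by a power of $P$ for all $s-d<j<s-d+i$, then there is an exact sequence $$\operatorname{Ext}^{s-d+i-1}_S(M,\omega_S)\to H^i_P(\operatorname{Ext}^{s-d}_S(M,\omega_S))\to H^{d-i}_Q(M)^*\to H^0_P(\operatorname{Ext}^{s-d+i}_S(M,\omega_S)).$$ (d) In particular, if $i_0$ is an integer such that $\operatorname{Ext}^j_S(M,\omega_S)$ has finite length for all $s-d<j\le s-d+i_0$, then there is $k_0$ such that $$H^i_{P_0}(\operatorname{Ext}^{s-d}_S(M,\omega_S)_k)\cong (H^{d-i}_Q(M)_{-k})^*\qquad\text{for all } i\le i_0 \text{ and all } k\ge k_0.$$ (e) Consequently,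 if $M$ is generalized Cohen–Macaulay, that is, $\operatorname{Ext}^{s-i}_S(M,\omega_S)$ has finite length for all $i\ne d$, and $N=\operatorname{Ext}^{s-d}_S(M,\omega_S)$, then there is $k_0$ such that $$H^i_{P_0}(N_k)\cong (H^{d-i}_Q(M)_{-k})^*\qquad\text{for all } i \text{ and all } k\ge k_0.$$ -/

import Mathlib

open MvPolynomial

namespace BigradedDuality

noncomputable section

/-! ### Graded modules, graded maps, graded subquotients

A grading of a module `N` by `Γ` is a family `𝒩 : Γ → AddSubgroup N` of homogeneous components. -/

section Graded

variable {Γ R A B : Type*} [CommRing R] [AddCommGroup A] [Module R A] [AddCommGroup B] [Module R B]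

/-- The linear map `f` is homogeneous of degree `0`. -/
def IsGradedHom (𝒜 : Γ → AddSubgroup A) (ℬ : Γ → AddSubgroup B) (f : A →ₗ[R] B) : Prop :=
  ∀ γ, ∀ a ∈ 𝒜 γ, f a ∈ ℬ γ

variable (R) in
/-- There is an `R`-linear isomorphism which identifies the homogeneous components. -/
def GradedIso (𝒜 : Γ → AddSubgroup A) (ℬ : Γ → AddSubgroup B) : Prop :=
  ∃ f : A ≃ₗ[R] B, ∀ γ a, a ∈ 𝒜 γ ↔ f a ∈ ℬ γ

/-- The subquotient `Z / (B ∩ Z)` of a module; this is `Z / B` if `B ⊆ Z`. -/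
abbrev Subquotient (Z B : Submodule R A) : Type _ := ↥Z ⧸ B.submoduleOf Z

/-- The grading induced on a subquotient: the classes of the homogeneous elements of `Z`. -/
def subquotientGrading (𝒜 : Γ → AddSubgroup A) (Z B : Submodule R A) :
    Γ → AddSubgroup (Subquotient Z B) := fun γ =>
  ((𝒜 γ).comap Z.subtype.toAddMonoidHom).map (B.submoduleOf Z).mkQ.toAddMonoidHom

end Graded

/-! ### The graded `K`-dual -/

section Dual

variable (K : Type*) {Γ : Type*} (R : Type*) {N : Type*} [Field K] [CommRing R] [Algebra K R]
  [AddCommGroup N] [Module R N]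

variable (N) in
/-- All `K`-linear functionals on the `R`-module `N`, where `R` is a `K`-algebra. -/
def FullDual : AddSubgroup (N →+ K) where
  carrier := {φ | ∀ (a : K) (v : N), φ (algebraMap K R a • v) = a * φ v}
  zero_mem' := fun a v => by simp
  add_mem' := fun {φ ψ} hφ hψ a v => by
    rw [AddMonoidHom.add_apply, AddMonoidHom.add_apply, hφ a v, hψ a v, mul_add]
  neg_mem' := fun {φ} hφ a v => by
    rw [AddMonoidHom.neg_apply, AddMonoidHom.neg_apply, hφ a v, mul_neg]

/-- `R` acts on functionals by `(r • φ) v = φ (r • v)`. -/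
instance : Module R (FullDual K R N) where
  smul r φ := ⟨(φ : N →+ K).comp (DistribSMul.toAddMonoidHom N r), fun a v => by
    change (φ : N →+ K) (r • algebraMap K R a • v) = a * (φ : N →+ K) (r • v)
    rw [smul_comm, φ.2]⟩
  one_smul φ := Subtype.ext <| AddMonoidHom.ext fun v =>
    congrArg (φ : N →+ K) (one_smul R v)
  mul_smul r s φ := Subtype.ext <| AddMonoidHom.ext fun v =>
    congrArg (φ : N →+ K) ((congrArg (· • v) (mul_comm r s)).trans (mul_smul s r v))
  smul_zero r := rfl
  smul_add r φ ψ := rfl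
  add_smul r s φ := Subtype.ext <| AddMonoidHom.ext fun v =>
    (congrArg (φ : N →+ K) (add_smul r s v)).trans (map_add _ _ _)
  zero_smul φ := Subtype.ext <| AddMonoidHom.ext fun v =>
    (congrArg (φ : N →+ K) (zero_smul R v)).trans (map_zero _)

variable [AddCommGroup Γ]

/-- The functionals of degree `γ`: those which vanish on all components `N_β` with `β ≠ -γ`,
that is, the functionals on `N_{-γ}`. -/
def fullDualGrading (𝒩 : Γ → AddSubgroup N) (γ : Γ) : AddSubgroup (FullDual K R N) where
  carrier := {φ | ∀ β, β ≠ -γ → ∀ v ∈ 𝒩 β, (φ : N →+ K) v = 0}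
  zero_mem' := fun _ _ _ _ => rfl
  add_mem' := fun {φ ψ} hφ hψ β hβ v hv => by
    rw [AddSubgroup.coe_add, AddMonoidHom.add_apply, hφ β hβ v hv, hψ β hβ v hv, add_zero]
  neg_mem' := fun {φ} hφ β hβ v hv => by
    rw [AddSubgroup.coe_neg, AddMonoidHom.neg_apply, hφ β hβ v hv, neg_zero]

/-- The graded dual `N^* = ⨁_γ Hom_K(N_{-γ}, K)`, realised as the `R`-module of those functionals
that are sums of homogeneous ones. -/
abbrev GradedDual (𝒩 : Γ → AddSubgroup N) : Submodule R (FullDual K R N) :=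
  Submodule.span R {φ | ∃ γ, φ ∈ fullDualGrading K R 𝒩 γ}

/-- The grading `(N^*)_γ = Hom_K(N_{-γ}, K)` of the graded dual. -/
def gradedDualGrading (𝒩 : Γ → AddSubgroup N) (γ : Γ) : AddSubgroup (GradedDual K R 𝒩) :=
  (fullDualGrading K R 𝒩 γ).comap (GradedDual K R 𝒩).subtype.toAddMonoidHom

end Dual

/-! ### Local cohomology through the Čech complex of a finite family of elements -/

section Cech

variable {ι R N : Type*} [Fintype ι] [LinearOrder ι] [CommRing R] [AddCommGroup N] [Module R N]

/-- The localization of `N` which inverts the elements `x i` for `i ∈ J`. -/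
abbrev CechLocal (x : ι → R) (N : Type*) [AddCommGroup N] [Module R N] (J : Finset ι) : Type _ :=
  LocalizedModule (Submonoid.closure (x '' (J : Set ι))) N

/-- All Čech cochains: the direct sum of the localizations, over all subsets of the index set. -/
abbrev CechCochain (x : ι → R) (N : Type*) [AddCommGroup N] [Module R N] : Type _ :=
  (J : Finset ι) → CechLocal x N J

/-- The canonical map between localizations for `I ⊆ J`. -/
def cechRestrict (x : ι → R) (N : Type*) [AddCommGroup N] [Module R N] {I J : Finset ι}
    (h : I ⊆ J) : CechLocal x N I →ₗ[R] CechLocal x N J :=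
  LocalizedModule.liftOfLE _ _
    (Submonoid.closure_mono (Set.image_mono (Finset.coe_subset.2 h)))

/-- The Čech differential
`(dc)_J = ∑_{i ∈ J} (-1)^{#{l ∈ J | l < i}} c_{J \ i}`. -/
def cechD (x : ι → R) (N : Type*) [AddCommGroup N] [Module R N] :
    CechCochain x N →ₗ[R] CechCochain x N :=
  LinearMap.pi fun J => ∑ i ∈ J, ((-1 : R) ^ (J.filter (· < i)).card) •
    (cechRestrict x N (J.erase_subset i) ∘ₗ LinearMap.proj (J.erase i))

/-- The cochains of cohomological degree `p`: those supported on the subsets with `p` elements.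
For `p < 0` only `0` is left. -/
def cechDegree (x : ι → R) (N : Type*) [AddCommGroup N] [Module R N] (p : ℤ) :
    Submodule R (CechCochain x N) where
  carrier := {c | ∀ J : Finset ι, (J.card : ℤ) ≠ p → c J = 0}
  zero_mem' := fun _ _ => rfl
  add_mem' := fun {a b} ha hb J hJ => by rw [Pi.add_apply, ha J hJ, hb J hJ, add_zero]
  smul_mem' := fun r a ha J hJ => by rw [Pi.smul_apply, ha J hJ, smul_zero]

/-- The cocycles of degree `p`. -/
def cechCocycle (x : ι → R) (N : Type*) [AddCommGroup N] [Module R N] (p : ℤ) :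
    Submodule R (CechCochain x N) :=
  LinearMap.ker (cechD x N) ⊓ cechDegree x N p

/-- The coboundaries of degree `p`: the images of the cochains of degree `p - 1`. -/
def cechCoboundary (x : ι → R) (N : Type*) [AddCommGroup N] [Module R N] (p : ℤ) :
    Submodule R (CechCochain x N) :=
  (cechDegree x N (p - 1)).map (cechD x N)

/-- The local cohomology `H^p_I(N)` with support in the ideal `I` generated by the family `x`, as
cohomology of the Čech complex; it is `0` for `p < 0`. -/
abbrev LocalCoh (x : ι → R) (N : Type*) [AddCommGroup N] [Module R N] (p : ℤ) : Type _ :=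
  Subquotient (cechCocycle x N p) (cechCoboundary x N p)

variable {K Γ : Type*} [Field K] [Algebra K R] [AddCommGroup Γ]

/-- The component of degree `γ` of a localization of the graded module `N` over the graded ring
`R`: it consists of the fractions `v / s` with `s ∈ R_β` and `v ∈ N_{γ+β}` for some `β`. -/
def cechLocalGrading (𝒜 : Γ → Submodule K R) (x : ι → R) (𝒩 : Γ → AddSubgroup N)
    (J : Finset ι) (γ : Γ) : AddSubgroup (CechLocal x N J) :=
  AddSubgroup.closure {z | ∃ (β : Γ) (s : Submonoid.closure (x '' (J : Set ι))) (v : N),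
    (s : R) ∈ 𝒜 β ∧ v ∈ 𝒩 (γ + β) ∧ z = LocalizedModule.mk v s}

/-- The grading of the Čech cochains. -/
def cechGrading (𝒜 : Γ → Submodule K R) (x : ι → R) (𝒩 : Γ → AddSubgroup N) (γ : Γ) :
    AddSubgroup (CechCochain x N) :=
  AddSubgroup.pi Set.univ fun J => cechLocalGrading 𝒜 x 𝒩 J γ

/-- The grading of local cohomology. -/
def localCohGrading (𝒜 : Γ → Submodule K R) (x : ι → R) (𝒩 : Γ → AddSubgroup N) (p : ℤ) :
    Γ → AddSubgroup (LocalCoh x N p) :=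
  subquotientGrading (cechGrading 𝒜 x 𝒩) _ _

end Cech

/-! ### The bigraded polynomial ring -/

/-- `S = K[x_1, …, x_m, y_1, …, y_n]`. -/
abbrev S (K : Type*) [Field K] (m n : ℕ) : Type _ := MvPolynomial (Fin m ⊕ Fin n) K

/-- `T = K[x_1, …, x_m]`. -/
abbrev T (K : Type*) [Field K] (m : ℕ) : Type _ := MvPolynomial (Fin m) K

/-- The bidegrees `deg x_i = (1, 0)` and `deg y_j = (e_j, 1)` of the variables. -/
def varDeg (m : ℕ) {n : ℕ} (e : Fin n → ℕ) : Fin m ⊕ Fin n → ℤ × ℤ :=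
  Sum.elim (fun _ => (1, 0)) (fun j => ((e j : ℤ), 1))

/-- The bigrading of `S`. -/
abbrev gradS (K : Type*) [Field K] (m : ℕ) {n : ℕ} (e : Fin n → ℕ) :
    ℤ × ℤ → Submodule K (S K m n) :=
  weightedHomogeneousSubmodule K (varDeg m e)

/-- The standard grading of `T`. -/
abbrev gradT (K : Type*) [Field K] (m : ℕ) : ℤ → Submodule K (T K m) :=
  weightedHomogeneousSubmodule K (fun _ : Fin m => (1 : ℤ))

/-- The degree `σ` of the product of all variables. -/
def sigma (m : ℕ) {n : ℕ} (e : Fin n → ℕ) : ℤ × ℤ := ∑ i, varDeg m e i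

/-- The grading of `ω_S = S(-σ)`: `(ω_S)_γ = S_{γ - σ}`. -/
def omegaGrading (K : Type*) [Field K] (m : ℕ) {n : ℕ} (e : Fin n → ℕ) (γ : ℤ × ℤ) :
    AddSubgroup (S K m n) :=
  (gradS K m e (γ - sigma m e)).toAddSubgroup

/-- The variables `x_i` of `S`, generators of the ideal `P`. -/
def xS (K : Type*) [Field K] (m n : ℕ) : Fin m → S K m n := fun i => X (Sum.inl i)

/-- The variables `y_j` of `S`, generators of the ideal `Q`. -/
def yS (K : Type*) [Field K] (m n : ℕ) : Fin n → S K m n := fun j => X (Sum.inr j)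

/-- The variables `x_i` of `T`, generators of the ideal `P₀`. -/
def xT (K : Type*) [Field K] (m : ℕ) : Fin m → T K m := fun i => X i

/-- The ideal `P = (x_1, …, x_m)` of `S`. -/
def idealP (K : Type*) [Field K] (m n : ℕ) : Ideal (S K m n) := Ideal.span (Set.range (xS K m n))

/-! ### The strands `N_k = ⨁_j N_{(j,k)}` of a bigraded `S`-module -/

section Strand

variable {K : Type*} [Field K] {m n : ℕ} {N : Type*} [AddCommGroup N] [Module (S K m n) N]

/-- The `S`-module `N`, viewed as a `T`-module. -/
def OverT (_K : Type*) (_m _n : ℕ) (N : Type*) : Type _ := N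

instance : AddCommGroup (OverT K m n N) := inferInstanceAs (AddCommGroup N)

instance : Module (T K m) (OverT K m n N) :=
  Module.compHom N (rename Sum.inl : T K m →ₐ[K] S K m n).toRingHom

variable (K m n N) in
/-- The identity map. -/
def ofOverT : OverT K m n N ≃+ N := AddEquiv.refl N

variable (K m n) in
/-- The `T`-module `N_k = ⨁_j N_{(j,k)}`. -/
abbrev Strand (𝒩 : ℤ × ℤ → AddSubgroup N) (k : ℤ) : Submodule (T K m) (OverT K m n N) :=
  Submodule.span (T K m) {v | ∃ j : ℤ, ofOverT K m n N v ∈ 𝒩 (j, k)}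

variable (K m n) in
/-- The grading `(N_k)_j = N_{(j,k)}`. -/
def strandGrading (𝒩 : ℤ × ℤ → AddSubgroup N) (k j : ℤ) : AddSubgroup (Strand K m n 𝒩 k) :=
  (𝒩 (j, k)).comap
    ((ofOverT K m n N).toAddMonoidHom.comp (Strand K m n 𝒩 k).subtype.toAddMonoidHom)

end Strand

/-! ### Bigraded free resolutions and `Ext` -/

section Resolution

/-- The grading of the free module `⨁_k S(-a_k)`. -/
def freeGrading (K : Type*) [Field K] (m : ℕ) {n : ℕ} (e : Fin n → ℕ) {r : ℕ}
    (a : Fin r → ℤ × ℤ) (γ : ℤ × ℤ) : AddSubgroup (Fin r → S K m n) :=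
  AddSubgroup.pi Set.univ fun k => (gradS K m e (γ - a k)).toAddSubgroup

/-- A bigraded resolution `⋯ → F_1 → F_0 → M → 0` of `M` by free `S`-modules of finite rank
`F_i = ⨁_k S(-a_{i,k})`, with maps of degree `0`. -/
structure FreeResolution (K : Type*) [Field K] (m : ℕ) {n : ℕ} {M : Type*} [AddCommGroup M]
    [Module (S K m n) M] (e : Fin n → ℕ) (ℳ : ℤ × ℤ → AddSubgroup M) where
  /-- the rank of `F_i` -/
  rank : ℕ → ℕ
  /-- the degrees of the basis elements of `F_i` -/
  deg : ∀ i, Fin (rank i) → ℤ × ℤ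
  /-- the differential `F_{i+1} → F_i` -/
  diff : ∀ i, (Fin (rank (i + 1)) → S K m n) →ₗ[S K m n] (Fin (rank i) → S K m n)
  /-- the augmentation `F_0 → M` -/
  aug : (Fin (rank 0) → S K m n) →ₗ[S K m n] M
  diff_graded : ∀ i, IsGradedHom (freeGrading K m e (deg (i + 1))) (freeGrading K m e (deg i))
    (diff i)
  aug_graded : IsGradedHom (freeGrading K m e (deg 0)) ℳ aug
  aug_surjective : Function.Surjective aug
  exact_aug : Function.Exact (diff 0) aug
  exact_diff : ∀ i, Function.Exact (diff (i + 1)) (diff i)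

namespace FreeResolution

variable {K : Type*} [Field K] {m n : ℕ} {M : Type*} [AddCommGroup M] [Module (S K m n) M]
  {e : Fin n → ℕ} {ℳ : ℤ × ℤ → AddSubgroup M} (F : FreeResolution K m e ℳ)

/-- The module `Hom_S(F_j, ω_S)`. -/
abbrev HomOmega (j : ℕ) : Type _ := (Fin (F.rank j) → S K m n) →ₗ[S K m n] S K m n

/-- The homomorphisms `F_j → ω_S` of degree `γ`. -/
def homGrading (j : ℕ) (γ : ℤ × ℤ) : AddSubgroup (F.HomOmega j) where
  carrier := {φ | ∀ β, ∀ v ∈ freeGrading K m e (F.deg j) β, φ v ∈ omegaGrading K m e (β + γ)}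
  zero_mem' := fun _ _ _ => AddSubgroup.zero_mem _
  add_mem' := fun ha hb β v hv => AddSubgroup.add_mem _ (ha β v hv) (hb β v hv)
  neg_mem' := fun ha β v hv => AddSubgroup.neg_mem _ (ha β v hv)

/-- The differential `Hom_S(F_j, ω_S) → Hom_S(F_{j+1}, ω_S)`. -/
def homD (j : ℕ) : F.HomOmega j →ₗ[S K m n] F.HomOmega (j + 1) :=
  LinearMap.lcomp (S K m n) (S K m n) (F.diff j)

/-- The coboundaries in `Hom_S(F_j, ω_S)`. -/
def extCoboundary : (j : ℕ) → Submodule (S K m n) (F.HomOmega j)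
  | 0 => ⊥
  | j + 1 => LinearMap.range (F.homD j)

/-- `Ext^j_S(M, ω_S)`, the cohomology of the complex `Hom_S(F, ω_S)`. -/
abbrev Ext (j : ℕ) : Type _ := Subquotient (LinearMap.ker (F.homD j)) (F.extCoboundary j)

/-- The bigrading of `Ext^j_S(M, ω_S)`. -/
def extGrading (j : ℕ) : ℤ × ℤ → AddSubgroup (F.Ext j) :=
  subquotientGrading (F.homGrading j) _ _

end FreeResolution

end Resolution

/-! ### Existence of bigraded free resolutions -/

section Existence

variable {K : Type*} [Field K] {m n : ℕ}

/-- A submodule generated by homogeneous elements. -/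
def HomogeneouslyGenerated {B : Type*} [AddCommGroup B] [Module (S K m n) B]
    (𝒢 : ℤ × ℤ → AddSubgroup B) (U : Submodule (S K m n) B) : Prop :=
  U ≤ Submodule.span (S K m n) {u | u ∈ U ∧ ∃ γ, u ∈ 𝒢 γ}

/-- Homogeneous components are independent. -/
def IndependentComponents {B : Type*} [AddCommGroup B] (𝒢 : ℤ × ℤ → AddSubgroup B) : Prop :=
  ∀ (s : Finset (ℤ × ℤ)) (b : ℤ × ℤ → B), (∀ γ, b γ ∈ 𝒢 γ) → ∑ γ ∈ s, b γ = 0 →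
    ∀ γ ∈ s, b γ = 0

theorem independentComponents_of_decomposition {B : Type*} [AddCommGroup B]
    (𝒢 : ℤ × ℤ → AddSubgroup B) [DirectSum.Decomposition 𝒢] : IndependentComponents 𝒢 := by
  classical
  intro s b hb h γ hγ
  have h1 : (DirectSum.decompose 𝒢 (∑ δ ∈ s, b δ) γ : B) = b γ := by
    rw [DirectSum.decompose_sum, DFinsupp.finsetSum_apply, AddSubgroup.val_finsetSum,
      Finset.sum_eq_single γ]
    · exact DirectSum.decompose_of_mem_same 𝒢 (hb γ)
    · intro δ _ hδ
      exact DirectSum.decompose_of_mem_ne 𝒢 (hb δ) hδ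
    · exact fun h => absurd hγ h
  rw [h] at h1
  simpa using h1.symm

theorem independentComponents_free (e : Fin n → ℕ) {r : ℕ} (a : Fin r → ℤ × ℤ) :
    IndependentComponents (freeGrading K m e a) := by
  classical
  let _ : GradedAlgebra (gradS K m e) := weightedGradedAlgebra K (varDeg m e)
  intro s b hb h γ hγ
  funext k
  have h1 : (DirectSum.decompose (gradS K m e) (∑ δ ∈ s, b δ k) (γ - a k) : S K m n) = b γ k := by
    rw [DirectSum.decompose_sum, DFinsupp.finsetSum_apply, AddSubmonoidClass.coe_finsetSum,
      Finset.sum_eq_single γ]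
    · exact DirectSum.decompose_of_mem_same _ (hb γ k trivial)
    · intro δ _ hδ
      exact DirectSum.decompose_of_mem_ne _ (hb δ k trivial) (fun h => hδ (sub_left_inj.1 h))
    · exact fun h => absurd hγ h
  have h2 : ∑ δ ∈ s, b δ k = 0 := by
    have := congrFun h k
    rwa [Finset.sum_apply] at this
  rw [h2] at h1
  simpa using h1.symm

theorem exists_components_free (e : Fin n → ℕ) {r : ℕ} (a : Fin r → ℤ × ℤ)
    (v : Fin r → S K m n) : ∃ (s : Finset (ℤ × ℤ)) (b : ℤ × ℤ → Fin r → S K m n),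
      (∀ γ, b γ ∈ freeGrading K m e a γ) ∧ ∑ γ ∈ s, b γ = v := by
  classical
  let _ : GradedAlgebra (gradS K m e) := weightedGradedAlgebra K (varDeg m e)
  refine ⟨Finset.univ.biUnion fun k =>
      ((DirectSum.decompose (gradS K m e) (v k)).support).image (· + a k),
    fun γ k => (DirectSum.decompose (gradS K m e) (v k) (γ - a k) : S K m n),
    fun γ k _ => (DirectSum.decompose (gradS K m e) (v k) (γ - a k)).2, ?_⟩
  funext k
  rw [Finset.sum_apply]
  conv_rhs => rw [← DirectSum.sum_support_decompose (gradS K m e) (v k)]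
  rw [← Finset.sum_subset (Finset.subset_biUnion_of_mem (fun k =>
      ((DirectSum.decompose (gradS K m e) (v k)).support).image (· + a k)) (Finset.mem_univ k)),
    Finset.sum_image (fun _ _ _ _ h => add_left_injective _ h)]
  · exact Finset.sum_congr rfl fun γ _ => by rw [add_sub_cancel_right]
  · intro γ _ hγ
    by_contra hne
    refine hγ (Finset.mem_image.2 ⟨γ - a k, ?_, sub_add_cancel _ _⟩)
    rw [DFinsupp.mem_support_toFun]
    exact fun h => hne (by rw [h]; rfl)

theorem homogeneouslyGenerated_ker {B : Type*} [AddCommGroup B] [Module (S K m n) B]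
    {𝒢 : ℤ × ℤ → AddSubgroup B} (h𝒢 : IndependentComponents 𝒢) {e : Fin n → ℕ} {r : ℕ}
    {a : Fin r → ℤ × ℤ} {φ : (Fin r → S K m n) →ₗ[S K m n] B}
    (hφ : IsGradedHom (freeGrading K m e a) 𝒢 φ) :
    HomogeneouslyGenerated (freeGrading K m e a) (LinearMap.ker φ) := by
  intro v hv
  obtain ⟨s, b, hb, rfl⟩ := exists_components_free e a v
  rw [LinearMap.mem_ker, map_sum] at hv
  have h := h𝒢 s (fun γ => φ (b γ)) (fun γ => hφ γ _ (hb γ)) hv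
  exact Submodule.sum_mem _ fun γ hγ => Submodule.subset_span ⟨h γ hγ, γ, hb γ⟩

theorem exists_free_cover {B : Type*} [AddCommGroup B] [Module (S K m n) B] (e : Fin n → ℕ)
    (𝒢 : ℤ × ℤ → AddSubgroup B)
    (hsmul : ∀ β γ, ∀ p ∈ gradS K m e β, ∀ v ∈ 𝒢 γ, p • v ∈ 𝒢 (β + γ))
    (U : Submodule (S K m n) B) (hfg : U.FG) (hU : HomogeneouslyGenerated 𝒢 U) :
    ∃ (r : ℕ) (a : Fin r → ℤ × ℤ) (φ : (Fin r → S K m n) →ₗ[S K m n] B),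
      IsGradedHom (freeGrading K m e a) 𝒢 φ ∧ LinearMap.range φ = U := by
  classical
  have hspan : Submodule.span (S K m n) {u | u ∈ U ∧ ∃ γ, u ∈ 𝒢 γ} = U :=
    le_antisymm (Submodule.span_le.2 fun u hu => hu.1) hU
  obtain ⟨t, ht, htU⟩ := (Submodule.fg_span_iff_fg_span_finset_subset _).1 (hspan.symm ▸ hfg)
  rw [hspan] at htU
  have hmem : ∀ k : Fin t.card, ∃ γ, (t.equivFin.symm k : B) ∈ 𝒢 γ := fun k =>
    (ht (t.equivFin.symm k).2).2
  choose a ha using hmem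
  refine ⟨t.card, a, Fintype.linearCombination (S K m n) fun k => (t.equivFin.symm k : B), ?_, ?_⟩
  · intro γ v hv
    rw [Fintype.linearCombination_apply]
    refine AddSubgroup.sum_mem _ fun k _ => ?_
    have := hsmul _ _ _ (hv k trivial) _ (ha k)
    rwa [sub_add_cancel] at this
  · rw [Fintype.range_linearCombination, htU]
    congr 1
    ext u
    constructor
    · rintro ⟨k, rfl⟩
      exact (t.equivFin.symm k).2
    · intro hu
      exact ⟨t.equivFin ⟨u, hu⟩, by simp⟩

theorem free_smul_mem (e : Fin n → ℕ) {r : ℕ} (a : Fin r → ℤ × ℤ) (β γ : ℤ × ℤ) (p : S K m n)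
    (hp : p ∈ gradS K m e β) (v : Fin r → S K m n) (hv : v ∈ freeGrading K m e a γ) :
    p • v ∈ freeGrading K m e a (β + γ) := by
  intro k _
  have h := IsWeightedHomogeneous.mul (w := varDeg m e) hp (hv k trivial)
  rw [← add_sub_assoc] at h
  exact h

/-- Every finitely generated bigraded `S`-module has a bigraded free resolution. -/
theorem FreeResolution.nonempty (e : Fin n → ℕ) {M : Type*} [AddCommGroup M]
    [Module (S K m n) M] [Module.Finite (S K m n) M] (ℳ : ℤ × ℤ → AddSubgroup M)
    [DirectSum.Decomposition ℳ] [SetLike.GradedSMul (gradS K m e) ℳ] :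
    Nonempty (FreeResolution K m e ℳ) := by
  classical
  have htop : HomogeneouslyGenerated (K := K) (m := m) (n := n) ℳ ⊤ := by
    intro v _
    rw [← DirectSum.sum_support_decompose ℳ v]
    exact Submodule.sum_mem _ fun γ _ =>
      Submodule.subset_span ⟨trivial, γ, SetLike.coe_mem _⟩
  obtain ⟨r₀, a₀, ε, hε, hrange⟩ := exists_free_cover e ℳ
    (fun _ _ _ hp _ hv => SetLike.GradedSMul.smul_mem hp hv) ⊤ Module.Finite.fg_top htop
  let Stage := Σ' (r : ℕ) (a : Fin r → ℤ × ℤ) (U : Submodule (S K m n) (Fin r → S K m n)),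
    HomogeneouslyGenerated (freeGrading K m e a) U
  have step : ∀ st : Stage, ∃ (st' : Stage)
      (φ : (Fin st'.1 → S K m n) →ₗ[S K m n] (Fin st.1 → S K m n)),
      IsGradedHom (freeGrading K m e st'.2.1) (freeGrading K m e st.2.1) φ ∧
        LinearMap.range φ = st.2.2.1 ∧ st'.2.2.1 = LinearMap.ker φ := by
    rintro ⟨r, a, U, hU⟩
    obtain ⟨r', a', φ, hφ, hφU⟩ := exists_free_cover e (freeGrading K m e a)
      (fun β γ p hp v hv => free_smul_mem e a β γ p hp v hv) U (IsNoetherian.noetherian U) hU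
    exact ⟨⟨r', a', LinearMap.ker φ,
      homogeneouslyGenerated_ker (independentComponents_free e a) hφ⟩, φ, hφ, hφU, rfl⟩
  choose next φ hφ hφU hker using step
  let st : ℕ → Stage := fun i => Nat.rec ⟨r₀, a₀, LinearMap.ker ε,
    homogeneouslyGenerated_ker (independentComponents_of_decomposition ℳ) hε⟩
    (fun _ x => next x) i
  exact ⟨{
    rank := fun i => (st i).1
    deg := fun i => (st i).2.1
    diff := fun i => φ (st i)
    aug := ε
    diff_graded := fun i => hφ (st i)
    aug_graded := hε
    aug_surjective := LinearMap.range_eq_top.1 hrange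
    exact_aug := LinearMap.exact_iff.2 (hφU (st 0)).symm
    exact_diff := fun i => LinearMap.exact_iff.2 ((hφU (st (i + 1))).trans (hker (st i))).symm }⟩

end Existence

end

end BigradedDuality

/-!
Let `F` be a free resolution of `M` of the kind fixed in the statement. The complex `Hom(F, ω)` has
the modules `Ext^j(M, ω)` as cohomology, and everything is read off from its hypercohomology with
respect to the variables `x_i`, that is, from the cohomology of the total complex of its Čech
complex.

*Duality.* Expand elements of localizations of free modules as Laurent polynomials, and pair
`Hom(F, ω)` with `F` by taking the coefficient of `(x_1 ⋯ x_m y_1 ⋯ y_n)⁻¹` in the dot product. For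
complementary families of variables this residue pairing makes the hypercohomology of `Hom(F, ω)`
with respect to the `x_i` the graded dual of the hypercohomology of `F` with respect to the `y_j`:
only monomials with negative exponents at all the inverted variables take part in the pairing, and
the remaining, regular, cochains form an acyclic complex (`exists_primitive_of_isRegular`). In each
degree only finitely many monomials are left, so that a functional is represented by a cochain
(`IsDualPair.exists_representative`), and linear algebra over `K` gives the duality
(`IsDualPair.gradedIso_hyperCoh`). Since `F` resolves `M`, its hypercohomology is the local
cohomology of `M` (`FreeResolution.gradedIso_localCoh_hyperCoh`).

*Vanishing of the lower `Ext`-modules.* The same duality, for the empty family and the family of all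
variables, turns Grothendieck vanishing (`cechCocycle_le_of_supportDim_lt`) into `Ext^j(M, ω) = 0`
for `j < s - d` (`FreeResolution.ext_eq_zero`).

*Comparison.* A complex without cohomology below degree `c` has a map from the `i`-th local
cohomology of its cohomology in degree `c` to its hypercohomology in degree `c + i`
(`IsCohomologyAt.exists_hyperCohMap`). Instead of the spectral sequence, cocycles of the total
complex are cleared one Čech degree at a time (`GradedComplex.exists_clear`); a component can be
cleared where the localized complex is exact (`LocExact`), which holds if the `Ext`-module in
question is torsion with respect to the denominators. At Čech degree `0` nothing is inverted, and the
obstructions there are the two outer terms of the exact sequences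
(`IsCohomologyAt.exists_exact_edge`, `IsCohomologyAt.exists_exact_connecting`).

*Strands.* An `Ext`-module of finite length vanishes in large `y`-degrees
(`exists_forall_eq_zero_of_isFiniteLength`), and inverting the `x_i` does not change the `y`-degree.
Hence in these degrees the higher `Ext`-modules do not obstruct, and the comparison map is an
isomorphism. It remains that passing to strands commutes with local cohomology and, up to a sign of
the degree, with graded duals (`IsStrand.gradedIso_localCoh`, `IsStrand.gradedIso_gradedDual`).

A complex is encoded as a single module, the direct sum of its terms, with a differential and with
submodules `V j`, its terms. All maps between (hyper)cohomology modules are constructed from relations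
between homogeneous cocycles by `exists_linearMap_of_rel`.
-/


namespace BigradedDuality

set_option linter.unusedSectionVars false

noncomputable section

/-! ### Internal gradings -/

section Gradings

variable {Γ A B : Type*} [AddCommGroup A] [AddCommGroup B]

/-- The family `𝒢` is an internal direct sum decomposition of `A`: every element is a finite sum
of homogeneous ones, and homogeneous components are independent. -/
structure IsGrading (𝒢 : Γ → AddSubgroup A) : Prop where
  exists_sum : ∀ a, ∃ (s : Finset Γ) (b : Γ → A), (∀ γ, b γ ∈ 𝒢 γ) ∧ ∑ γ ∈ s, b γ = a
  eq_zero : ∀ (s : Finset Γ) (b : Γ → A), (∀ γ, b γ ∈ 𝒢 γ) → ∑ γ ∈ s, b γ = 0 →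
    ∀ γ ∈ s, b γ = 0

namespace IsGrading

variable {𝒢 : Γ → AddSubgroup A} (h : IsGrading 𝒢)

include h in
theorem exists_sum_support (a : A) : ∃ (s : Finset Γ) (b : Γ → A), (∀ γ, b γ ∈ 𝒢 γ) ∧
    (∀ γ ∉ s, b γ = 0) ∧ ∑ γ ∈ s, b γ = a := by
  classical
  obtain ⟨s, b, hb, hs⟩ := h.exists_sum a
  refine ⟨s, fun γ => if γ ∈ s then b γ else 0, fun γ => ?_, fun γ hγ => if_neg hγ, ?_⟩
  · dsimp only
    split_ifs
    · exact hb γ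
    · exact zero_mem _
  · rw [← hs]
    exact Finset.sum_congr rfl fun γ hγ => if_pos hγ

include h in
theorem unique {s t : Finset Γ} {b c : Γ → A} (hb : ∀ γ, b γ ∈ 𝒢 γ) (hc : ∀ γ, c γ ∈ 𝒢 γ)
    (hbs : ∀ γ ∉ s, b γ = 0) (hct : ∀ γ ∉ t, c γ = 0) (heq : ∑ γ ∈ s, b γ = ∑ γ ∈ t, c γ)
    (γ : Γ) : b γ = c γ := by
  classical
  have hb' : ∑ γ ∈ s ∪ t, b γ = ∑ γ ∈ s, b γ :=
    (Finset.sum_subset Finset.subset_union_left fun γ _ hγ => hbs γ hγ).symm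
  have hc' : ∑ γ ∈ s ∪ t, c γ = ∑ γ ∈ t, c γ :=
    (Finset.sum_subset Finset.subset_union_right fun γ _ hγ => hct γ hγ).symm
  by_cases hγ : γ ∈ s ∪ t
  · have := h.eq_zero (s ∪ t) (fun γ => b γ - c γ) (fun γ => sub_mem (hb γ) (hc γ))
      (by rw [Finset.sum_sub_distrib, hb', hc', heq, sub_self]) γ hγ
    exact sub_eq_zero.1 this
  · rw [Finset.mem_union, not_or] at hγ
    rw [hbs γ hγ.1, hct γ hγ.2]

/-- The homogeneous component of degree `γ`. -/
def proj (γ : Γ) : A →+ A :=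
  AddMonoidHom.mk' (fun a => (h.exists_sum_support a).choose_spec.choose γ) fun a b => by
    classical
    obtain ⟨ha, has, ha'⟩ := (h.exists_sum_support a).choose_spec.choose_spec
    obtain ⟨hb, hbs, hb'⟩ := (h.exists_sum_support b).choose_spec.choose_spec
    obtain ⟨hc, hcs, hc'⟩ := (h.exists_sum_support (a + b)).choose_spec.choose_spec
    refine h.unique hc (t := (h.exists_sum_support a).choose ∪ (h.exists_sum_support b).choose)
      (c := fun γ => (h.exists_sum_support a).choose_spec.choose γ +
        (h.exists_sum_support b).choose_spec.choose γ)
      (fun γ => add_mem (ha γ) (hb γ)) hcs (fun γ hγ => ?_) ?_ γ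
    · rw [Finset.mem_union, not_or] at hγ
      rw [has γ hγ.1, hbs γ hγ.2, add_zero]
    · rw [hc', Finset.sum_add_distrib,
        ← Finset.sum_subset Finset.subset_union_left fun γ _ hγ => has γ hγ,
        ← Finset.sum_subset Finset.subset_union_right fun γ _ hγ => hbs γ hγ, ha', hb']

theorem proj_mem (γ : Γ) (a : A) : h.proj γ a ∈ 𝒢 γ :=
  (h.exists_sum_support a).choose_spec.choose_spec.1 γ

theorem sum_proj (a : A) : ∃ s : Finset Γ, (∀ γ ∉ s, h.proj γ a = 0) ∧
    ∑ γ ∈ s, h.proj γ a = a :=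
  ⟨(h.exists_sum_support a).choose, (h.exists_sum_support a).choose_spec.choose_spec.2.1,
    (h.exists_sum_support a).choose_spec.choose_spec.2.2⟩

theorem proj_eq {s : Finset Γ} {b : Γ → A} (hb : ∀ γ, b γ ∈ 𝒢 γ) (hs : ∀ γ ∉ s, b γ = 0) (γ : Γ) :
    h.proj γ (∑ γ ∈ s, b γ) = b γ := by
  obtain ⟨t, ht, hsum⟩ := h.sum_proj (∑ γ ∈ s, b γ)
  exact h.unique (fun γ => h.proj_mem γ _) hb ht hs hsum γ

theorem proj_of_mem {γ : Γ} {a : A} (ha : a ∈ 𝒢 γ) : h.proj γ a = a := by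
  classical
  have := h.proj_eq (s := {γ}) (b := Pi.single γ a) (fun β => ?_) (fun β hβ => ?_) γ
  · simpa using this
  · rcases eq_or_ne β γ with rfl | hne
    · simpa using ha
    · rw [Pi.single_eq_of_ne hne]
      exact zero_mem _
  · exact Pi.single_eq_of_ne (by simpa using hβ) _

theorem proj_of_mem_ne {γ β : Γ} {a : A} (ha : a ∈ 𝒢 β) (hne : γ ≠ β) : h.proj γ a = 0 := by
  classical
  have := h.proj_eq (s := {β}) (b := Pi.single β a) (fun β' => ?_) (fun β' hβ => ?_) γ
  · simpa [Pi.single_eq_of_ne hne] using this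
  · rcases eq_or_ne β' β with rfl | hne
    · simpa using ha
    · rw [Pi.single_eq_of_ne hne]
      exact zero_mem _
  · exact Pi.single_eq_of_ne (by simpa using hβ) _

theorem ext_proj {a : A} (ha : ∀ γ, h.proj γ a = 0) : a = 0 := by
  obtain ⟨s, -, hs⟩ := h.sum_proj a
  rw [← hs]
  exact Finset.sum_eq_zero fun γ _ => ha γ

include h in
theorem induction {P : A → Prop} (h0 : P 0) (hadd : ∀ a b, P a → P b → P (a + b))
    (hom : ∀ γ, ∀ a ∈ 𝒢 γ, P a) (a : A) : P a := by
  obtain ⟨s, -, hs⟩ := h.sum_proj a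
  rw [← hs]
  exact Finset.sum_induction _ P hadd h0 fun γ _ => hom γ _ (h.proj_mem γ a)

theorem map_proj {ℬ : Γ → AddSubgroup B} (hB : IsGrading ℬ) (f : A →+ B)
    (hf : ∀ γ, ∀ a ∈ 𝒢 γ, f a ∈ ℬ γ) (γ : Γ) (a : A) : f (h.proj γ a) = hB.proj γ (f a) := by
  refine h.induction (P := fun a => f (h.proj γ a) = hB.proj γ (f a)) ?_ ?_ ?_ a
  · simp
  · intro a b ha hb
    rw [map_add, map_add, map_add, map_add, ha, hb]
  · intro β a ha
    rcases eq_or_ne γ β with rfl | hne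
    · rw [h.proj_of_mem ha, hB.proj_of_mem (hf _ _ ha)]
    · rw [h.proj_of_mem_ne ha hne, hB.proj_of_mem_ne (hf _ _ ha) hne, map_zero]

/-- A grading is given by a family of projections. -/
theorem of_proj (π : Γ → A →+ A) (hmem : ∀ γ a, π γ a ∈ 𝒢 γ) (hself : ∀ γ, ∀ a ∈ 𝒢 γ, π γ a = a)
    (hne : ∀ γ β, γ ≠ β → ∀ a ∈ 𝒢 β, π γ a = 0)
    (hsum : ∀ a, ∃ s : Finset Γ, ∑ γ ∈ s, π γ a = a) : IsGrading 𝒢 where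
  exists_sum a := by
    obtain ⟨s, hs⟩ := hsum a
    exact ⟨s, fun γ => π γ a, fun γ => hmem γ a, hs⟩
  eq_zero s b hb h γ hγ := by
    have := congrArg (π γ) h
    rw [map_sum, map_zero, Finset.sum_eq_single_of_mem γ hγ] at this
    · rwa [hself γ _ (hb γ)] at this
    · exact fun β _ hβ => hne γ β hβ.symm _ (hb β)

/-- A grading of each factor induces a grading of a finite product. -/
theorem pi {ι : Type*} [Finite ι] {N : ι → Type*} [∀ i, AddCommGroup (N i)]
    {𝒩 : ∀ i, Γ → AddSubgroup (N i)} (hN : ∀ i, IsGrading (𝒩 i)) :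
    IsGrading fun γ => AddSubgroup.pi Set.univ fun i => 𝒩 i γ := by
  classical
  have := Fintype.ofFinite ι
  refine of_proj (fun γ => AddMonoidHom.pi fun i => ((hN i).proj γ).comp (Pi.evalAddMonoidHom N i))
    (fun γ a i _ => (hN i).proj_mem γ (a i)) ?_ ?_ ?_
  · intro γ a ha
    exact funext fun i => (hN i).proj_of_mem (ha i trivial)
  · intro γ β hne a ha
    exact funext fun i => (hN i).proj_of_mem_ne (ha i trivial) hne
  · intro a
    choose s hs hs' using fun i => (hN i).sum_proj (a i)
    refine ⟨Finset.univ.biUnion s, funext fun i => ?_⟩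
    rw [Finset.sum_apply]
    change ∑ γ ∈ _, (hN i).proj γ (a i) = a i
    conv_rhs => rw [← hs' i]
    exact (Finset.sum_subset (Finset.subset_biUnion_of_mem s (Finset.mem_univ i))
      fun γ _ hγ => hs i γ hγ).symm

theorem proj_pi {ι : Type*} [Finite ι] {N : ι → Type*} [∀ i, AddCommGroup (N i)]
    {𝒩 : ∀ i, Γ → AddSubgroup (N i)} (hN : ∀ i, IsGrading (𝒩 i))
    (h : IsGrading fun γ => AddSubgroup.pi Set.univ fun i => 𝒩 i γ) (γ : Γ) (a : ∀ i, N i) (i : ι) :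
    h.proj γ a i = (hN i).proj γ (a i) :=
  h.map_proj (hN i) (Pi.evalAddMonoidHom N i) (fun _ _ ha => ha i trivial) γ a

/-- An injective homomorphism whose range is stable under the projections to homogeneous components
pulls a grading back. -/
theorem comap {ℬ : Γ → AddSubgroup B} (hB : IsGrading ℬ) (f : A →+ B)
    (hinj : Function.Injective f) (hf : ∀ γ a, hB.proj γ (f a) ∈ f.range) :
    IsGrading fun γ => (ℬ γ).comap f where
  exists_sum a := by
    choose b hb using fun γ => hf γ a
    obtain ⟨s, -, hs⟩ := hB.sum_proj (f a)
    refine ⟨s, b, fun γ => ?_, hinj ?_⟩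
    · rw [AddSubgroup.mem_comap, hb]
      exact hB.proj_mem _ _
    · rw [map_sum]
      exact (Finset.sum_congr rfl fun γ _ => hb γ).trans hs
  eq_zero s b hb hs γ hγ := hinj <| by
    rw [map_zero]
    exact hB.eq_zero s (fun γ => f (b γ)) hb (by rw [← map_sum, hs, map_zero]) γ hγ

theorem of_decomposition [DecidableEq Γ] (𝒢 : Γ → AddSubgroup A) [DirectSum.Decomposition 𝒢] :
    IsGrading 𝒢 := by
  classical
  refine of_proj (fun γ => (𝒢 γ).subtype.comp
    ((DFinsupp.evalAddMonoidHom γ).comp (DirectSum.decomposeAddEquiv 𝒢).toAddMonoidHom)) ?_ ?_ ?_ ?_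
  · exact fun γ a => (DirectSum.decompose 𝒢 a γ).2
  · exact fun γ a ha => DirectSum.decompose_of_mem_same 𝒢 ha
  · exact fun γ β hne a ha => DirectSum.decompose_of_mem_ne 𝒢 ha hne.symm
  · exact fun a => ⟨_, DirectSum.sum_support_decompose 𝒢 a⟩

end IsGrading

end Gradings

/-! ### Graded modules and their homogeneous submodules -/

section GradedModules

variable {Γ K R : Type*} [Field K] [CommRing R] [Algebra K R]

/-- Multiplication by scalars of degree `β` shifts degrees by `β`. -/
def GradedSMul [AddCommGroup Γ] {N : Type*} [AddCommGroup N] [Module R N] (𝒜 : Γ → Submodule K R)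
    (𝒩 : Γ → AddSubgroup N) : Prop :=
  ∀ β γ, ∀ p ∈ 𝒜 β, ∀ v ∈ 𝒩 γ, p • v ∈ 𝒩 (β + γ)

variable {A H H' Q Q' : Type*} [AddCommGroup A] [Module R A] [AddCommGroup H] [Module R H]
  [AddCommGroup H'] [Module R H'] [AddCommGroup Q] [Module R Q] [AddCommGroup Q'] [Module R Q']

/-- A submodule which contains the homogeneous components of its elements. -/
def IsHomog {𝒢 : Γ → AddSubgroup A} (h : IsGrading 𝒢) (Z : Submodule R A) : Prop :=
  ∀ γ, ∀ z ∈ Z, h.proj γ z ∈ Z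

theorem IsHomog.inf {𝒢 : Γ → AddSubgroup A} {h : IsGrading 𝒢} {Z W : Submodule R A}
    (hZ : IsHomog h Z) (hW : IsHomog h W) : IsHomog h (Z ⊓ W) :=
  fun γ z hz => ⟨hZ γ z hz.1, hW γ z hz.2⟩

theorem IsHomog.map {𝒢 : Γ → AddSubgroup A} {h : IsGrading 𝒢} {ℋ : Γ → AddSubgroup H}
    {hH : IsGrading ℋ} {Z : Submodule R A} (hZ : IsHomog h Z) {f : A →ₗ[R] H}
    (hf : IsGradedHom 𝒢 ℋ f) : IsHomog hH (Z.map f) := by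
  rintro γ _ ⟨z, hz, rfl⟩
  exact ⟨h.proj γ z, hZ γ z hz, h.map_proj hH f.toAddMonoidHom hf γ z⟩

theorem IsHomog.ker {𝒢 : Γ → AddSubgroup A} {h : IsGrading 𝒢} {ℋ : Γ → AddSubgroup H}
    (hH : IsGrading ℋ) {f : A →ₗ[R] H} (hf : IsGradedHom 𝒢 ℋ f) :
    IsHomog h (LinearMap.ker f) := by
  intro γ z hz
  have := h.map_proj hH f.toAddMonoidHom hf γ z
  rw [LinearMap.mem_ker] at hz ⊢
  refine this.trans ?_
  change hH.proj γ (f z) = 0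
  rw [hz, map_zero]

theorem isGrading_subquotient {𝒢 : Γ → AddSubgroup A} (h : IsGrading 𝒢) {Z B : Submodule R A}
    (hZ : IsHomog h Z) (hB : IsHomog h B) : IsGrading (subquotientGrading 𝒢 Z B) where
  exists_sum q := by
    obtain ⟨z, rfl⟩ := Submodule.Quotient.mk_surjective _ q
    obtain ⟨s, -, hs⟩ := h.sum_proj (z : A)
    refine ⟨s, fun γ => (B.submoduleOf Z).mkQ ⟨h.proj γ z, hZ γ z z.2⟩,
      fun γ => ⟨⟨h.proj γ z, hZ γ z z.2⟩, h.proj_mem γ z, rfl⟩, ?_⟩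
    rw [← map_sum]
    refine congrArg (B.submoduleOf Z).mkQ (Subtype.ext ?_)
    rw [AddSubmonoidClass.coe_finsetSum]
    exact hs
  eq_zero s b hb hs γ hγ := by
    classical
    choose z hz hzb using hb
    replace hz : ∀ γ, (z γ : A) ∈ 𝒢 γ := hz
    have h1 : (B.submoduleOf Z).mkQ (∑ γ ∈ s, z γ) = 0 := by
      rw [map_sum, ← hs]
      exact Finset.sum_congr rfl fun γ _ => hzb γ
    rw [Submodule.mkQ_apply, Submodule.Quotient.mk_eq_zero,
      show _ ∈ B.submoduleOf Z ↔ _ from Submodule.mem_comap, Submodule.subtype_apply,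
      AddSubmonoidClass.coe_finsetSum] at h1
    have h2 := hB γ _ h1
    rw [map_sum, Finset.sum_eq_single_of_mem γ hγ fun β _ hβ =>
      h.proj_of_mem_ne (hz β) hβ.symm, h.proj_of_mem (hz γ)] at h2
    rw [← hzb γ]
    exact (Submodule.Quotient.mk_eq_zero _).2 h2

theorem gradedSMul_subquotient [AddCommGroup Γ] {𝒜 : Γ → Submodule K R} {𝒢 : Γ → AddSubgroup A}
    (h : GradedSMul 𝒜 𝒢) (Z B : Submodule R A) : GradedSMul 𝒜 (subquotientGrading 𝒢 Z B) := by
  rintro β γ p hp _ ⟨z, hz, rfl⟩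
  exact ⟨p • z, h β γ p hp z hz, rfl⟩

theorem subquotient_mk_eq_zero {Z B : Submodule R A} (z : Z) :
    (B.submoduleOf Z).mkQ z = 0 ↔ (z : A) ∈ B := by
  rw [Submodule.mkQ_apply, Submodule.Quotient.mk_eq_zero]
  exact Iff.rfl

/-- Exactness of graded maps can be tested on homogeneous elements. -/
theorem exact_of_homogeneous {𝒬 : Γ → AddSubgroup Q} {ℋ : Γ → AddSubgroup H}
    {ℋ' : Γ → AddSubgroup H'} (hQ : IsGrading 𝒬) (hH : IsGrading ℋ) (hH' : IsGrading ℋ')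
    {f : Q →ₗ[R] H} {g : H →ₗ[R] H'} (hg : IsGradedHom ℋ ℋ' g)
    (hgf : ∀ γ, ∀ a ∈ 𝒬 γ, g (f a) = 0)
    (hex : ∀ γ, ∀ b ∈ ℋ γ, g b = 0 → ∃ a, f a = b) : Function.Exact f g := by
  intro b
  constructor
  · intro hb
    obtain ⟨s, -, hs⟩ := hH.sum_proj b
    have h1 : ∀ γ, ∃ a, f a = hH.proj γ b := fun γ => hex γ _ (hH.proj_mem γ b) <| by
      have := hH.map_proj hH' g.toAddMonoidHom hg γ b
      refine this.trans ?_
      change hH'.proj γ (g b) = 0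
      rw [hb, map_zero]
    choose a ha using h1
    refine ⟨∑ γ ∈ s, a γ, ?_⟩
    rw [map_sum, ← hs]
    exact Finset.sum_congr rfl fun γ _ => ha γ
  · rintro ⟨a, rfl⟩
    exact hQ.induction (P := fun a => g (f a) = 0) (by simp)
      (fun a b ha hb => by rw [map_add, map_add, ha, hb, add_zero]) hgf a

theorem injective_of_homogeneous {ℋ : Γ → AddSubgroup H} {ℋ' : Γ → AddSubgroup H'}
    (hH : IsGrading ℋ) (hH' : IsGrading ℋ') {g : H →ₗ[R] H'} (hg : IsGradedHom ℋ ℋ' g)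
    (hinj : ∀ γ, ∀ b ∈ ℋ γ, g b = 0 → b = 0) : Function.Injective g := by
  rw [injective_iff_map_eq_zero]
  refine fun b hb => hH.ext_proj fun γ => hinj γ _ (hH.proj_mem γ b) ?_
  have := hH.map_proj hH' g.toAddMonoidHom hg γ b
  refine this.trans ?_
  change hH'.proj γ (g b) = 0
  rw [hb, map_zero]

variable [AddCommGroup Γ] [DecidableEq Γ] (𝒜 : Γ → Submodule K R) [GradedAlgebra 𝒜]

/-- A degreewise additive relation which is single-valued, total, and compatible with homogeneous
scalars is the graph of a linear map. Here `H` and `H'` are graded quotients of `Q` and `Q'`, and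
the relation is given on representatives. -/
theorem exists_linearMap_of_rel {𝒬 : Γ → AddSubgroup Q} {𝒬' : Γ → AddSubgroup Q'}
    {ℋ : Γ → AddSubgroup H} (hH : IsGrading ℋ) (h𝒬 : GradedSMul 𝒜 𝒬) (h𝒬' : GradedSMul 𝒜 𝒬')
    (q : Q →ₗ[R] H) (q' : Q' →ₗ[R] H') (hq : ∀ γ h, h ∈ ℋ γ ↔ ∃ z ∈ 𝒬 γ, q z = h)
    (Rel : Submodule R (Q × Q'))
    (tot : ∀ γ, ∀ z ∈ 𝒬 γ, ∃ z' ∈ 𝒬' γ, (z, z') ∈ Rel)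
    (uniq : ∀ γ, ∀ z ∈ 𝒬 γ, ∀ z' ∈ 𝒬' γ, (z, z') ∈ Rel → q z = 0 → q' z' = 0) :
    ∃ f : H →ₗ[R] H', ∀ γ, ∀ z ∈ 𝒬 γ, ∀ z' ∈ 𝒬' γ, (z, z') ∈ Rel → f (q z) = q' z' := by
  classical
  -- In each degree the relation is the graph of a function `g γ`.
  have key : ∀ γ (h : H), h ∈ ℋ γ → ∃ h' : H', ∀ z ∈ 𝒬 γ, ∀ z' ∈ 𝒬' γ, (z, z') ∈ Rel → q z = h →
      q' z' = h' := by
    intro γ h hh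
    obtain ⟨z₀, hz₀, rfl⟩ := (hq γ h).1 hh
    obtain ⟨z₀', hz₀', hrel⟩ := tot γ z₀ hz₀
    refine ⟨q' z₀', fun z hz z' hz' hr heq => ?_⟩
    have := uniq γ (z - z₀) (sub_mem hz hz₀) (z' - z₀') (sub_mem hz' hz₀') (Rel.sub_mem hr hrel)
      (by rw [map_sub, heq, sub_self])
    rwa [map_sub, sub_eq_zero] at this
  choose! g hg using key
  have gadd : ∀ γ, ∀ h₁ ∈ ℋ γ, ∀ h₂ ∈ ℋ γ, g γ (h₁ + h₂) = g γ h₁ + g γ h₂ := by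
    intro γ h₁ hh₁ h₂ hh₂
    obtain ⟨z₁, hz₁, e₁⟩ := (hq γ h₁).1 hh₁
    obtain ⟨z₂, hz₂, e₂⟩ := (hq γ h₂).1 hh₂
    obtain ⟨w₁, hw₁, r₁⟩ := tot γ z₁ hz₁
    obtain ⟨w₂, hw₂, r₂⟩ := tot γ z₂ hz₂
    rw [← hg γ h₁ hh₁ z₁ hz₁ w₁ hw₁ r₁ e₁, ← hg γ h₂ hh₂ z₂ hz₂ w₂ hw₂ r₂ e₂, ← map_add]
    exact (hg γ _ (add_mem hh₁ hh₂) (z₁ + z₂) (add_mem hz₁ hz₂) (w₁ + w₂) (add_mem hw₁ hw₂)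
      (Rel.add_mem r₁ r₂) (by rw [map_add, e₁, e₂])).symm
  have gzero : ∀ γ, g γ 0 = 0 := fun γ => by
    have := gadd γ 0 (zero_mem _) 0 (zero_mem _)
    simpa using this
  have gsmul : ∀ β γ, ∀ p ∈ 𝒜 β, ∀ h ∈ ℋ γ, p • h ∈ ℋ (β + γ) ∧
      g (β + γ) (p • h) = p • g γ h := by
    intro β γ p hp h hh
    obtain ⟨z, hz, e⟩ := (hq γ h).1 hh
    obtain ⟨w, hw, r⟩ := tot γ z hz
    have hmem : p • h ∈ ℋ (β + γ) :=
      (hq _ _).2 ⟨p • z, h𝒬 β γ p hp z hz, by rw [map_smul, e]⟩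
    refine ⟨hmem, ?_⟩
    rw [← hg γ h hh z hz w hw r e, ← map_smul]
    exact (hg _ _ hmem (p • z) (h𝒬 β γ p hp z hz) (p • w) (h𝒬' β γ p hp w hw)
      (Rel.smul_mem p r) (by rw [map_smul, e])).symm
  choose s hs hs' using hH.sum_proj
  have hext : ∀ h (t : Finset Γ), s h ⊆ t →
      ∑ γ ∈ s h, g γ (hH.proj γ h) = ∑ γ ∈ t, g γ (hH.proj γ h) := fun h t ht =>
    Finset.sum_subset ht fun γ _ hγ => by rw [hs h γ hγ, gzero]
  -- The map is `g γ` on the component of degree `γ`, summed over all components.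
  let F : H →+ H' := AddMonoidHom.mk' (fun h => ∑ γ ∈ s h, g γ (hH.proj γ h)) fun h₁ h₂ => by
    rw [hext h₁ (s h₁ ∪ s h₂ ∪ s (h₁ + h₂)) (fun _ h => by simp [h]),
      hext h₂ (s h₁ ∪ s h₂ ∪ s (h₁ + h₂)) (fun _ h => by simp [h]),
      hext (h₁ + h₂) (s h₁ ∪ s h₂ ∪ s (h₁ + h₂)) (fun _ h => by simp [h]),
      ← Finset.sum_add_distrib]
    exact Finset.sum_congr rfl fun γ _ => by
      rw [map_add, gadd γ _ (hH.proj_mem _ _) _ (hH.proj_mem _ _)]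
  have hF : ∀ γ, ∀ h ∈ ℋ γ, F h = g γ h := by
    intro γ h hh
    change ∑ γ ∈ s h, g γ (hH.proj γ h) = _
    rw [hext h (s h ∪ {γ}) Finset.subset_union_left, Finset.sum_eq_single_of_mem γ (by simp),
      hH.proj_of_mem hh]
    intro β _ hβ
    rw [hH.proj_of_mem_ne hh hβ, gzero]
  have hFsmul : ∀ (p : R) (h : H), F (p • h) = p • F h := by
    intro p h
    refine DirectSum.Decomposition.inductionOn 𝒜 (motive := fun p => F (p • h) = p • F h)
      ?_ ?_ ?_ p
    · simp
    · intro β p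
      refine hH.induction (P := fun h => F ((p : R) • h) = (p : R) • F h) ?_ ?_ ?_ h
      · simp
      · intro a b ha hb
        rw [smul_add, map_add, map_add, smul_add, ha, hb]
      · intro γ h hh
        have := gsmul β γ p p.2 h hh
        rw [hF γ h hh, hF _ _ this.1, this.2]
    · intro p p' hp hp'
      rw [add_smul, map_add, hp, hp', add_smul]
  refine ⟨{ F with map_smul' := hFsmul }, fun γ z hz z' hz' hr => ?_⟩
  change F (q z) = q' z'
  have hmem : q z ∈ ℋ γ := (hq γ _).2 ⟨z, hz, rfl⟩
  rw [hF γ _ hmem]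
  exact (hg γ _ hmem z hz z' hz' hr rfl).symm

end GradedModules

/-! ### Graded isomorphisms -/

section GradedIso

variable {Γ R A B C : Type*} [CommRing R] [AddCommGroup A] [Module R A] [AddCommGroup B]
  [Module R B] [AddCommGroup C] [Module R C] {𝒜 : Γ → AddSubgroup A} {ℬ : Γ → AddSubgroup B}
  {𝒞 : Γ → AddSubgroup C}

/-- An injective graded map which is surjective on homogeneous components, and whose target is
generated by homogeneous elements, is a graded isomorphism. -/
theorem exists_equiv_of_bijective {f : A →ₗ[R] B} (hf : IsGradedHom 𝒜 ℬ f)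
    (hinj : Function.Injective f) (hsurj : ∀ γ, ∀ b ∈ ℬ γ, ∃ a ∈ 𝒜 γ, f a = b)
    (hspan : ∀ b, b ∈ Submodule.span R {b | ∃ γ, b ∈ ℬ γ}) :
    ∃ g : A ≃ₗ[R] B, (∀ a, g a = f a) ∧ ∀ γ a, a ∈ 𝒜 γ ↔ g a ∈ ℬ γ := by
  have hs : Function.Surjective f := by
    intro b
    have : Submodule.span R {b | ∃ γ, b ∈ ℬ γ} ≤ LinearMap.range f := by
      rw [Submodule.span_le]
      rintro b ⟨γ, hb⟩
      obtain ⟨a, -, ha⟩ := hsurj γ b hb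
      exact ⟨a, ha⟩
    exact this (hspan b)
  refine ⟨LinearEquiv.ofBijective f ⟨hinj, hs⟩, fun _ => rfl, fun γ a => ⟨fun ha => hf γ a ha,
    fun ha => ?_⟩⟩
  obtain ⟨a', ha', h⟩ := hsurj γ _ ha
  rwa [← hinj h]

theorem IsGrading.mem_span (h : IsGrading ℬ) (b : B) :
    b ∈ Submodule.span R {b | ∃ γ, b ∈ ℬ γ} :=
  h.induction (P := fun b => b ∈ Submodule.span R {b | ∃ γ, b ∈ ℬ γ}) (zero_mem _)
    (fun _ _ => add_mem) (fun γ _ hb => Submodule.subset_span ⟨γ, hb⟩) b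

theorem GradedIso.trans (h : GradedIso R 𝒜 ℬ) (h' : GradedIso R ℬ 𝒞) : GradedIso R 𝒜 𝒞 := by
  obtain ⟨f, hf⟩ := h
  obtain ⟨g, hg⟩ := h'
  exact ⟨f.trans g, fun γ a => (hf γ a).trans (hg γ (f a))⟩

theorem GradedIso.symm (h : GradedIso R 𝒜 ℬ) : GradedIso R ℬ 𝒜 := by
  obtain ⟨f, hf⟩ := h
  exact ⟨f.symm, fun γ a => by rw [hf, f.apply_symm_apply]⟩

theorem GradedIso.of_subsingleton [Subsingleton A] [Subsingleton B] : GradedIso R 𝒜 ℬ :=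
  ⟨0, fun γ a => by
    rw [Subsingleton.elim a 0, map_zero]
    exact ⟨fun _ => zero_mem _, fun _ => zero_mem _⟩⟩

end GradedIso

/-! ### Localizations in the Čech complex -/

section CechLocal

variable {ι R N N' N'' : Type*} [CommRing R] [AddCommGroup N] [Module R N] [AddCommGroup N']
  [Module R N'] [AddCommGroup N''] [Module R N''] {x : ι → R}

/-- The denominators of the localization `CechLocal x N J`. -/
abbrev cechDen (x : ι → R) (J : Finset ι) : Submonoid R := Submonoid.closure (x '' (J : Set ι))

/-- Division by the denominator `s`. -/
def cechMk (x : ι → R) (J : Finset ι) (s : cechDen x J) : N →ₗ[R] CechLocal x N J where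
  toFun v := LocalizedModule.mk v s
  map_add' v w := by
    rw [IsLocalizedModule.mk_eq_mk', IsLocalizedModule.mk'_add, IsLocalizedModule.mk_eq_mk',
      IsLocalizedModule.mk_eq_mk']
  map_smul' r v := (LocalizedModule.smul'_mk r v s).symm

theorem cechMk_eq_iff {J : Finset ι} {v w : N} {s t : cechDen x J} :
    cechMk x J s v = cechMk x J t w ↔
      ∃ u : cechDen x J, (u : R) • (t : R) • v = (u : R) • (s : R) • w :=
  LocalizedModule.mk_eq

theorem cechMk_eq_zero {J : Finset ι} {v : N} {s : cechDen x J} :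
    cechMk x J s v = 0 ↔ ∃ u : cechDen x J, (u : R) • v = 0 := by
  rw [← map_zero (cechMk x J s), cechMk_eq_iff]
  constructor
  · rintro ⟨u, hu⟩
    exact ⟨u * s, by rw [Submonoid.coe_mul, mul_smul, hu, smul_zero, smul_zero]⟩
  · rintro ⟨u, hu⟩
    exact ⟨u, by rw [smul_comm, hu, smul_zero, smul_zero]⟩

theorem cechMk_cancel {J : Finset ι} (v : N) (s t : cechDen x J) :
    cechMk x J (t * s) ((t : R) • v) = cechMk x J s v :=
  LocalizedModule.mk_cancel_common_left t s v

theorem smul_cechMk {J : Finset ι} (v : N) (s : cechDen x J) :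
    (s : R) • cechMk x J s v = cechMk x J 1 v := by
  rw [← map_smul]
  exact LocalizedModule.mk_cancel s v

theorem exists_cechMk {J : Finset ι} (z : CechLocal x N J) : ∃ s v, z = cechMk x J s v := by
  induction z using LocalizedModule.induction_on with
  | h v s => exact ⟨s, v, rfl⟩

/-- The map of localizations induced by a linear map. -/
def locMap (x : ι → R) (J : Finset ι) (f : N →ₗ[R] N') : CechLocal x N J →ₗ[R] CechLocal x N' J :=
  IsLocalizedModule.map (cechDen x J) (LocalizedModule.mkLinearMap (cechDen x J) N)
    (LocalizedModule.mkLinearMap (cechDen x J) N') f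

@[simp]
theorem locMap_cechMk {J : Finset ι} (f : N →ₗ[R] N') (s : cechDen x J) (v : N) :
    locMap x J f (cechMk x J s v) = cechMk x J s (f v) := by
  change locMap x J f (LocalizedModule.mk v s) = LocalizedModule.mk (f v) s
  rw [IsLocalizedModule.mk_eq_mk', IsLocalizedModule.mk_eq_mk']
  exact IsLocalizedModule.map_mk' _ _ _ f v s

@[simp]
theorem cechRestrict_cechMk {I J : Finset ι} (h : I ⊆ J) (s : cechDen x I) (v : N) :
    cechRestrict x N h (cechMk x I s v) = cechMk x J
      ⟨s, Submonoid.closure_mono (Set.image_mono (Finset.coe_subset.2 h)) s.2⟩ v := by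
  change cechRestrict x N h (LocalizedModule.mk v s) = LocalizedModule.mk v _
  rw [IsLocalizedModule.mk_eq_mk', IsLocalizedModule.mk_eq_mk']
  exact IsLocalizedModule.liftOfLE_mk' _ _ _ _ _ v s

theorem locMap_comp {J : Finset ι} (f : N →ₗ[R] N') (g : N' →ₗ[R] N'') (z : CechLocal x N J) :
    locMap x J g (locMap x J f z) = locMap x J (g ∘ₗ f) z := by
  obtain ⟨s, v, rfl⟩ := exists_cechMk z
  simp

@[simp]
theorem locMap_zero {J : Finset ι} (z : CechLocal x N J) :
    locMap x J (0 : N →ₗ[R] N') z = 0 := by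
  obtain ⟨s, v, rfl⟩ := exists_cechMk z
  simp

theorem locMap_cechRestrict {I J : Finset ι} (h : I ⊆ J) (f : N →ₗ[R] N') (z : CechLocal x N I) :
    locMap x J f (cechRestrict x N h z) = cechRestrict x N' h (locMap x I f z) := by
  obtain ⟨s, v, rfl⟩ := exists_cechMk z
  simp

theorem cechRestrict_comp {I J L : Finset ι} (h : I ⊆ J) (h' : J ⊆ L) (z : CechLocal x N I) :
    cechRestrict x N h' (cechRestrict x N h z) = cechRestrict x N (h.trans h') z := by
  obtain ⟨s, v, rfl⟩ := exists_cechMk z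
  simp

theorem locMap_injective {J : Finset ι} {f : N →ₗ[R] N'} (hf : Function.Injective f) :
    Function.Injective (locMap x J f) := by
  rw [injective_iff_map_eq_zero]
  intro z hz
  obtain ⟨s, v, rfl⟩ := exists_cechMk z
  rw [locMap_cechMk, cechMk_eq_zero] at hz
  obtain ⟨u, hu⟩ := hz
  rw [← map_smul] at hu
  exact cechMk_eq_zero.2 ⟨u, hf (by rw [hu, map_zero])⟩

/-- The localization of a submodule. -/
def locSub (x : ι → R) (J : Finset ι) (V : Submodule R N) : Submodule R (CechLocal x N J) where
  carrier := {z | ∃ s, ∃ v ∈ V, z = cechMk x J s v}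
  zero_mem' := ⟨1, 0, zero_mem _, (map_zero _).symm⟩
  add_mem' := by
    rintro _ _ ⟨s, v, hv, rfl⟩ ⟨t, w, hw, rfl⟩
    refine ⟨t * s, (t : R) • v + (s : R) • w, add_mem (V.smul_mem _ hv) (V.smul_mem _ hw), ?_⟩
    rw [map_add, cechMk_cancel, mul_comm t s, cechMk_cancel]
  smul_mem' := by
    rintro r _ ⟨s, v, hv, rfl⟩
    exact ⟨s, r • v, V.smul_mem r hv, (map_smul _ _ _).symm⟩

theorem cechMk_mem_locSub {J : Finset ι} {V : Submodule R N} {v : N} (hv : v ∈ V)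
    (s : cechDen x J) : cechMk x J s v ∈ locSub x J V := ⟨s, v, hv, rfl⟩

theorem locMap_mem_locSub {J : Finset ι} {V : Submodule R N} {V' : Submodule R N'} {f : N →ₗ[R] N'}
    (hf : ∀ v ∈ V, f v ∈ V') {z : CechLocal x N J} (hz : z ∈ locSub x J V) :
    locMap x J f z ∈ locSub x J V' := by
  obtain ⟨s, v, hv, rfl⟩ := hz
  rw [locMap_cechMk]
  exact cechMk_mem_locSub (hf v hv) s

theorem cechRestrict_mem_locSub {I J : Finset ι} (h : I ⊆ J) {V : Submodule R N}
    {z : CechLocal x N I} (hz : z ∈ locSub x I V) : cechRestrict x N h z ∈ locSub x J V := by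
  obtain ⟨s, v, hv, rfl⟩ := hz
  rw [cechRestrict_cechMk]
  exact cechMk_mem_locSub hv _

end CechLocal

/-! ### Gradings of localizations -/

section CechLocalGrading

variable {ι K Γ R N N' : Type*} [Field K] [CommRing R] [Algebra K R] [AddCommGroup Γ]
  [DecidableEq Γ] {𝒜 : Γ → Submodule K R} [GradedAlgebra 𝒜] [AddCommGroup N] [Module R N]
  [AddCommGroup N'] [Module R N'] {x : ι → R} {𝒩 : Γ → AddSubgroup N} {𝒩' : Γ → AddSubgroup N'}
  {J : Finset ι}

theorem exists_degree (hx : ∀ i, ∃ β, x i ∈ 𝒜 β) (s : cechDen x J) : ∃ β, (s : R) ∈ 𝒜 β := by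
  refine Submonoid.closure_induction (motive := fun s _ => ∃ β, s ∈ 𝒜 β) ?_ ?_ ?_ s.2
  · rintro _ ⟨i, -, rfl⟩
    exact hx i
  · exact ⟨0, SetLike.GradedOne.one_mem⟩
  · rintro s t - - ⟨β, hs⟩ ⟨β', ht⟩
    exact ⟨β + β', SetLike.GradedMul.mul_mem hs ht⟩

theorem cechMk_mem_grading {γ β : Γ} {s : cechDen x J} {v : N} (hs : (s : R) ∈ 𝒜 β)
    (hv : v ∈ 𝒩 (γ + β)) : cechMk x J s v ∈ cechLocalGrading 𝒜 x 𝒩 J γ :=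
  AddSubgroup.subset_closure ⟨β, s, v, hs, hv, rfl⟩

theorem mem_cechLocalGrading (hN : GradedSMul 𝒜 𝒩) {γ : Γ} {z : CechLocal x N J} :
    z ∈ cechLocalGrading 𝒜 x 𝒩 J γ ↔
      ∃ (β : Γ) (s : cechDen x J), ∃ v ∈ 𝒩 (γ + β), (s : R) ∈ 𝒜 β ∧ z = cechMk x J s v := by
  constructor
  · intro hz
    induction hz using AddSubgroup.closure_induction with
    | mem z hz =>
      obtain ⟨β, s, v, hs, hv, rfl⟩ := hz
      exact ⟨β, s, v, hv, hs, rfl⟩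
    | zero => exact ⟨0, 1, 0, zero_mem _, SetLike.GradedOne.one_mem, (map_zero _).symm⟩
    | add z w _ _ hz hw =>
      obtain ⟨β, s, v, hv, hs, rfl⟩ := hz
      obtain ⟨β', t, w, hw, ht, rfl⟩ := hw
      refine ⟨β' + β, t * s, (t : R) • v + (s : R) • w, add_mem ?_ ?_,
        SetLike.GradedMul.mul_mem ht hs, ?_⟩
      · have := hN _ _ _ ht _ hv
        rwa [add_left_comm] at this
      · have := hN _ _ _ hs _ hw
        rwa [add_left_comm, add_comm β β'] at this
      · rw [map_add, cechMk_cancel, mul_comm t s, cechMk_cancel]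
    | neg z _ hz =>
      obtain ⟨β, s, v, hv, hs, rfl⟩ := hz
      exact ⟨β, s, -v, neg_mem hv, hs, (map_neg _ _).symm⟩
  · rintro ⟨β, s, v, hv, hs, rfl⟩
    exact cechMk_mem_grading hs hv

/-- A homogeneous fraction in the localization of a submodule `V` is represented by a homogeneous
numerator in `V`. -/
theorem exists_homogeneous_rep (hx : ∀ i, ∃ β, x i ∈ 𝒜 β) (hN : GradedSMul 𝒜 𝒩)
    {V : Submodule R N} {γ : Γ} {z : CechLocal x N J} (hz : z ∈ cechLocalGrading 𝒜 x 𝒩 J γ)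
    (hzV : z ∈ locSub x J V) :
    ∃ (β : Γ) (s : cechDen x J), ∃ v ∈ 𝒩 (γ + β), v ∈ V ∧ (s : R) ∈ 𝒜 β ∧ z = cechMk x J s v := by
  obtain ⟨β, s, v, hv, hs, rfl⟩ := (mem_cechLocalGrading hN).1 hz
  obtain ⟨t, w, hw, h⟩ := hzV
  obtain ⟨u, hu⟩ := cechMk_eq_iff.1 h
  obtain ⟨β', hut⟩ := exists_degree hx (u * t)
  refine ⟨β' + β, u * t * s, ((u * t : cechDen x J) : R) • v, ?_, ?_,
    SetLike.GradedMul.mul_mem hut hs, (cechMk_cancel _ _ _).symm⟩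
  · have := hN _ _ _ hut _ hv
    rwa [add_left_comm] at this
  · rw [Submonoid.coe_mul, mul_smul, hu]
    exact V.smul_mem _ (V.smul_mem _ hw)

theorem gradedSMul_cechLocal (hN : GradedSMul 𝒜 𝒩) :
    GradedSMul 𝒜 (cechLocalGrading 𝒜 x 𝒩 J) := by
  intro β γ p hp z hz
  obtain ⟨β', s, v, hv, hs, rfl⟩ := (mem_cechLocalGrading hN).1 hz
  rw [← map_smul]
  refine cechMk_mem_grading hs ?_
  rw [add_assoc]
  exact hN _ _ _ hp _ hv

/-- Finitely many homogeneous fractions have a homogeneous common denominator. -/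
theorem exists_common_denominator (hN : GradedSMul 𝒜 𝒩) (F : Finset Γ)
    (b : Γ → CechLocal x N J) (hb : ∀ γ, b γ ∈ cechLocalGrading 𝒜 x 𝒩 J γ) :
    ∃ β, ∃ s : cechDen x J, (s : R) ∈ 𝒜 β ∧ ∀ γ ∈ F, ∃ v ∈ 𝒩 (γ + β), b γ = cechMk x J s v := by
  induction F using Finset.induction_on with
  | empty => exact ⟨0, 1, SetLike.GradedOne.one_mem, by simp⟩
  | insert δ F _ ih =>
    obtain ⟨β, s, hs, h⟩ := ih
    obtain ⟨β', t, v, hv, ht, hbv⟩ := (mem_cechLocalGrading hN).1 (hb δ)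
    refine ⟨β + β', s * t, SetLike.GradedMul.mul_mem hs ht, fun γ hγ => ?_⟩
    rcases Finset.mem_insert.1 hγ with rfl | hγ
    · refine ⟨(s : R) • v, ?_, by rw [hbv, cechMk_cancel]⟩
      have := hN _ _ _ hs _ hv
      rwa [add_left_comm] at this
    · obtain ⟨w, hw, hbw⟩ := h γ hγ
      refine ⟨(t : R) • w, ?_, by rw [hbw, mul_comm s t, cechMk_cancel]⟩
      have := hN _ _ _ ht _ hw
      rwa [add_left_comm, add_comm β' β] at this

theorem isGrading_cechLocal (hx : ∀ i, ∃ β, x i ∈ 𝒜 β) (h : IsGrading 𝒩) (hN : GradedSMul 𝒜 𝒩)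
    (J : Finset ι) : IsGrading (cechLocalGrading 𝒜 x 𝒩 J) where
  exists_sum z := by
    obtain ⟨s, v, rfl⟩ := exists_cechMk z
    obtain ⟨β, hs⟩ := exists_degree hx s
    obtain ⟨F, -, hF⟩ := h.sum_proj v
    refine ⟨F.image (· - β), fun γ => cechMk x J s (h.proj (γ + β) v),
      fun γ => cechMk_mem_grading hs (h.proj_mem _ _), ?_⟩
    rw [Finset.sum_image fun _ _ _ _ h => sub_left_injective h]
    simp only [sub_add_cancel]
    rw [← map_sum, hF]
  eq_zero F b hb hsum γ hγ := by
    obtain ⟨β, s, hs, hv⟩ := exists_common_denominator hN F b hb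
    choose! v hv hbv using hv
    have hsum' : cechMk x J s (∑ γ ∈ F, v γ) = 0 := by
      rw [map_sum, ← hsum]
      exact Finset.sum_congr rfl fun γ hγ => (hbv γ hγ).symm
    -- Clearing the common denominator, of degree `β`, and then multiplying by `u`, of degree `β'`,
    -- gives elements of `N` of distinct degrees with sum zero.
    obtain ⟨u, hu⟩ := cechMk_eq_zero.1 hsum'
    obtain ⟨β', hu'⟩ := exists_degree hx u
    have hmem : ∀ δ, (if δ - (β' + β) ∈ F then (u : R) • v (δ - (β' + β)) else 0) ∈ 𝒩 δ := by
      intro δ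
      split_ifs with hδ
      · have := hN _ _ _ hu' _ (hv _ hδ)
        rwa [show β' + (δ - (β' + β) + β) = δ by abel] at this
      · exact zero_mem _
    have key := h.eq_zero (F.image (· + (β' + β))) _ hmem (by
      rw [Finset.sum_image fun _ _ _ _ h => add_left_injective _ h]
      simp only [add_sub_cancel_right]
      rw [Finset.sum_ite_mem, Finset.inter_self, ← Finset.smul_sum, hu]) (γ + (β' + β))
      (Finset.mem_image_of_mem _ hγ)
    rw [add_sub_cancel_right, if_pos hγ] at key
    rw [hbv γ hγ]
    exact cechMk_eq_zero.2 ⟨u, key⟩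

theorem proj_cechMk (hx : ∀ i, ∃ β, x i ∈ 𝒜 β) (h : IsGrading 𝒩) (hN : GradedSMul 𝒜 𝒩)
    {β : Γ} {s : cechDen x J} (hs : (s : R) ∈ 𝒜 β) (γ : Γ) (v : N) :
    (isGrading_cechLocal hx h hN J).proj γ (cechMk x J s v) =
      cechMk x J s (h.proj (γ + β) v) := by
  refine h.induction (P := fun v => (isGrading_cechLocal hx h hN J).proj γ (cechMk x J s v) =
      cechMk x J s (h.proj (γ + β) v)) ?_ ?_ ?_ v
  · simp
  · intro v w hv hw
    simp only [map_add, hv, hw]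
  · intro δ v hv
    have hmem : cechMk x J s v ∈ cechLocalGrading 𝒜 x 𝒩 J (δ - β) :=
      cechMk_mem_grading hs (by rwa [sub_add_cancel])
    rcases eq_or_ne (γ + β) δ with rfl | hne
    · rw [add_sub_cancel_right] at hmem
      rw [h.proj_of_mem hv, IsGrading.proj_of_mem _ hmem]
    · rw [h.proj_of_mem_ne hv hne, map_zero, IsGrading.proj_of_mem_ne _ hmem]
      exact fun h => hne (by rw [h, sub_add_cancel])

theorem isHomog_locSub (hx : ∀ i, ∃ β, x i ∈ 𝒜 β) (h : IsGrading 𝒩) (hN : GradedSMul 𝒜 𝒩)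
    {V : Submodule R N} (hV : IsHomog h V) :
    IsHomog (isGrading_cechLocal hx h hN J) (locSub x J V) := by
  rintro γ _ ⟨s, v, hv, rfl⟩
  obtain ⟨β, hs⟩ := exists_degree hx s
  rw [proj_cechMk hx h hN hs]
  exact cechMk_mem_locSub (hV _ v hv) s

theorem isGradedHom_locMap (hN : GradedSMul 𝒜 𝒩) {f : N →ₗ[R] N'} (hf : IsGradedHom 𝒩 𝒩' f) :
    IsGradedHom (cechLocalGrading 𝒜 x 𝒩 J) (cechLocalGrading 𝒜 x 𝒩' J) (locMap x J f) := by
  intro γ z hz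
  obtain ⟨β, s, v, hv, hs, rfl⟩ := (mem_cechLocalGrading hN).1 hz
  rw [locMap_cechMk]
  exact cechMk_mem_grading hs (hf _ _ hv)

theorem isGradedHom_cechRestrict (hN : GradedSMul 𝒜 𝒩) {I : Finset ι} (h : I ⊆ J) :
    IsGradedHom (cechLocalGrading 𝒜 x 𝒩 I) (cechLocalGrading 𝒜 x 𝒩 J) (cechRestrict x N h) := by
  intro γ z hz
  obtain ⟨β, s, v, hv, hs, rfl⟩ := (mem_cechLocalGrading hN).1 hz
  rw [cechRestrict_cechMk]
  exact cechMk_mem_grading hs hv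

end CechLocalGrading

/-! ### The Čech complex -/

section Cech

variable {ι R N N' N'' : Type*} [LinearOrder ι] [CommRing R] [AddCommGroup N] [Module R N]
  [AddCommGroup N'] [Module R N'] [AddCommGroup N''] [Module R N''] {x : ι → R}

/-- The exponent of the sign with which the restriction from `J \ i` enters the differential. -/
abbrev cechSign (J : Finset ι) (i : ι) : ℕ := (J.filter (· < i)).card

theorem cechSign_eq_succ {J : Finset ι} {i l : ι} (hl : l ∈ J) (h : l < i) :
    cechSign J i = cechSign (J.erase l) i + 1 := by
  rw [cechSign, cechSign, Finset.filter_erase, Finset.card_erase_add_one]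
  exact Finset.mem_filter.2 ⟨hl, h⟩

theorem cechSign_erase {J : Finset ι} {i l : ι} (h : ¬ l < i) :
    cechSign (J.erase l) i = cechSign J i := by
  rw [cechSign, cechSign, Finset.filter_erase, Finset.erase_eq_of_notMem]
  exact fun hl => h (Finset.mem_filter.1 hl).2

/-- Omitting `i` and then `l` has the opposite sign of omitting `l` and then `i`. -/
theorem cechSign_swap (R : Type*) [CommRing R] {J : Finset ι} {i l : ι} (hi : i ∈ J) (hl : l ∈ J)
    (h : i ≠ l) :
    (-1 : R) ^ cechSign J i * (-1) ^ cechSign (J.erase i) l =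
      -((-1) ^ cechSign J l * (-1) ^ cechSign (J.erase l) i) := by
  rcases lt_or_gt_of_ne h with h | h
  · rw [cechSign_eq_succ hi h, cechSign_erase h.not_gt]
    ring
  · rw [cechSign_eq_succ hl h, cechSign_erase h.not_gt]
    ring

theorem cechD_apply (c : CechCochain x N) (J : Finset ι) :
    cechD x N c J = ∑ i ∈ J, (-1 : R) ^ cechSign J i •
      cechRestrict x N (J.erase_subset i) (c (J.erase i)) := by
  simp [cechD]

theorem cechRestrict_congr (c : CechCochain x N) {I I' J : Finset ι} (h : I ⊆ J) (h' : I' ⊆ J)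
    (e : I = I') : cechRestrict x N h (c I) = cechRestrict x N h' (c I') := by
  subst e
  rfl

theorem cechD_cechD (c : CechCochain x N) : cechD x N (cechD x N c) = 0 := by
  funext J
  rw [cechD_apply]
  simp only [cechD_apply, map_sum, map_smul, cechRestrict_comp, Finset.smul_sum, smul_smul]
  have h1 : ∀ i ∈ J, ∑ l ∈ J.erase i, ((-1 : R) ^ cechSign J i * (-1) ^ cechSign (J.erase i) l) •
        cechRestrict x N (((J.erase i).erase_subset l).trans (J.erase_subset i))
          (c ((J.erase i).erase l)) =
      ∑ l ∈ J, if l = i then 0 else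
        ((-1 : R) ^ cechSign J i * (-1) ^ cechSign (J.erase i) l) •
          cechRestrict x N (((J.erase i).erase_subset l).trans (J.erase_subset i))
            (c ((J.erase i).erase l)) := by
    intro i hi
    rw [← Finset.sum_erase_add J _ hi, if_pos rfl, add_zero]
    exact Finset.sum_congr rfl fun l hl => (if_neg (Finset.ne_of_mem_erase hl)).symm
  rw [Finset.sum_congr rfl h1, ← Finset.sum_product', Pi.zero_apply]
  refine Finset.sum_involution (fun a _ => a.swap) ?_ ?_ ?_ ?_
  · rintro ⟨i, l⟩ ha
    rw [Finset.mem_product] at ha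
    by_cases h : l = i
    · simp [h]
    · simp only [Prod.swap, if_neg h, if_neg (Ne.symm h)]
      rw [cechSign_swap R ha.1 ha.2 (Ne.symm h), neg_smul, neg_add_eq_zero]
      refine congrArg _ (cechRestrict_congr c _ _ ?_)
      exact Finset.erase_right_comm
  · rintro ⟨i, l⟩ ha hne heq
    rw [Prod.swap, Prod.mk.injEq] at heq
    exact hne (if_pos heq.1)
  · rintro ⟨i, l⟩ ha
    rw [Finset.mem_product] at ha ⊢
    exact ⟨ha.2, ha.1⟩
  · rintro ⟨i, l⟩ _
    rfl

/-- The map of Čech cochains induced by a linear map. -/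
def cechMap (x : ι → R) (f : N →ₗ[R] N') : CechCochain x N →ₗ[R] CechCochain x N' :=
  LinearMap.pi fun J => locMap x J f ∘ₗ LinearMap.proj J

@[simp]
theorem cechMap_apply (f : N →ₗ[R] N') (c : CechCochain x N) (J : Finset ι) :
    cechMap x f c J = locMap x J f (c J) := rfl

theorem cechD_cechMap (f : N →ₗ[R] N') (c : CechCochain x N) :
    cechD x N' (cechMap x f c) = cechMap x f (cechD x N c) := by
  funext J
  simp only [cechMap_apply, cechD_apply, map_sum, map_smul, locMap_cechRestrict]

theorem cechD_eq_zero {c : CechCochain x N} {J : Finset ι}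
    (h : ∀ I : Finset ι, I.card + 1 = J.card → c I = 0) : cechD x N c J = 0 := by
  rw [cechD_apply]
  refine Finset.sum_eq_zero fun i hi => ?_
  rw [h _ (Finset.card_erase_add_one hi), map_zero, smul_zero]

theorem cechD_congr {c c' : CechCochain x N} {J : Finset ι}
    (h : ∀ I : Finset ι, I.card + 1 = J.card → c I = c' I) :
    cechD x N c J = cechD x N c' J := by
  rw [← sub_eq_zero, ← Pi.sub_apply, ← map_sub]
  exact cechD_eq_zero fun I hI => by rw [Pi.sub_apply, h I hI, sub_self]

end Cech

section CechGrading

variable {ι K Γ R N N' : Type*} [LinearOrder ι] [Field K] [CommRing R] [Algebra K R]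
  [AddCommGroup Γ] [DecidableEq Γ] {𝒜 : Γ → Submodule K R} [GradedAlgebra 𝒜] [AddCommGroup N]
  [Module R N] [AddCommGroup N'] [Module R N'] {x : ι → R} {𝒩 : Γ → AddSubgroup N}
  {𝒩' : Γ → AddSubgroup N'}

theorem isGrading_cechCochain [Finite ι] (hx : ∀ i, ∃ β, x i ∈ 𝒜 β) (h : IsGrading 𝒩)
    (hN : GradedSMul 𝒜 𝒩) : IsGrading (cechGrading 𝒜 x 𝒩) :=
  IsGrading.pi fun J => isGrading_cechLocal hx h hN J

theorem gradedSMul_cechCochain (hN : GradedSMul 𝒜 𝒩) : GradedSMul 𝒜 (cechGrading 𝒜 x 𝒩) :=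
  fun β γ p hp c hc J _ => gradedSMul_cechLocal hN β γ p hp (c J) (hc J trivial)

theorem isGradedHom_cechD (hN : GradedSMul 𝒜 𝒩) :
    IsGradedHom (cechGrading 𝒜 x 𝒩) (cechGrading 𝒜 x 𝒩) (cechD x N) := by
  intro γ c hc J _
  rw [cechD_apply]
  refine AddSubgroup.sum_mem _ fun i _ => ?_
  have := isGradedHom_cechRestrict (x := x) hN (J.erase_subset i) γ _ (hc (J.erase i) trivial)
  rcases neg_one_pow_eq_or R (cechSign J i) with h | h
  · rwa [h, one_smul]
  · rw [h, neg_one_smul]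
    exact neg_mem this

theorem isGradedHom_cechMap (hN : GradedSMul 𝒜 𝒩) {f : N →ₗ[R] N'} (hf : IsGradedHom 𝒩 𝒩' f) :
    IsGradedHom (cechGrading 𝒜 x 𝒩) (cechGrading 𝒜 x 𝒩') (cechMap x f) :=
  fun γ c hc J _ => isGradedHom_locMap hN hf γ (c J) (hc J trivial)

theorem isHomog_cechDegree [Finite ι] (h : IsGrading (cechGrading 𝒜 x 𝒩))
    (h' : ∀ J, IsGrading (cechLocalGrading 𝒜 x 𝒩 J)) (p : ℤ) :
    IsHomog h (cechDegree x N p) := by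
  intro γ c hc J hJ
  have := IsGrading.proj_pi h' h γ c J
  rw [hc J hJ, map_zero] at this
  exact this

theorem isHomog_cechCocycle [Finite ι] (hx : ∀ i, ∃ β, x i ∈ 𝒜 β) (h : IsGrading 𝒩)
    (hN : GradedSMul 𝒜 𝒩) (p : ℤ) :
    IsHomog (isGrading_cechCochain hx h hN) (cechCocycle x N p) :=
  (IsHomog.ker (isGrading_cechCochain hx h hN) (isGradedHom_cechD hN)).inf
    (isHomog_cechDegree _ (fun J => isGrading_cechLocal hx h hN J) p)

theorem isHomog_cechCoboundary [Finite ι] (hx : ∀ i, ∃ β, x i ∈ 𝒜 β) (h : IsGrading 𝒩)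
    (hN : GradedSMul 𝒜 𝒩) (p : ℤ) :
    IsHomog (isGrading_cechCochain hx h hN) (cechCoboundary x N p) :=
  (isHomog_cechDegree (isGrading_cechCochain hx h hN)
    (fun J => isGrading_cechLocal hx h hN J) (p - 1)).map (isGradedHom_cechD hN)

theorem isGrading_localCoh [Finite ι] (hx : ∀ i, ∃ β, x i ∈ 𝒜 β) (h : IsGrading 𝒩)
    (hN : GradedSMul 𝒜 𝒩) (p : ℤ) : IsGrading (localCohGrading 𝒜 x 𝒩 p) :=
  isGrading_subquotient (isGrading_cechCochain hx h hN) (isHomog_cechCocycle hx h hN p)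
    (isHomog_cechCoboundary hx h hN p)

end CechGrading

/-! ### The total Čech complex of a complex -/

section Total

variable {ι R A : Type*} [LinearOrder ι] [CommRing R] [AddCommGroup A] [Module R A] {x : ι → R}

/-- The differential of the total complex of the Čech complex of a complex. The complex is given
by a single module `A`, the direct sum of its terms, with the differential `d`. -/
def totD (x : ι → R) (d : A →ₗ[R] A) : CechCochain x A →ₗ[R] CechCochain x A :=
  cechD x A + LinearMap.pi fun J => (-1 : R) ^ J.card • (locMap x J d ∘ₗ LinearMap.proj J)

theorem totD_apply (d : A →ₗ[R] A) (c : CechCochain x A) (J : Finset ι) :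
    totD x d c J = cechD x A c J + (-1 : R) ^ J.card • locMap x J d (c J) := rfl

theorem totD_totD {d : A →ₗ[R] A} (hd : ∀ a, d (d a) = 0) (c : CechCochain x A) :
    totD x d (totD x d c) = 0 := by
  have h1 : ∀ J, locMap x J d (locMap x J d (c J)) = 0 := fun J => by
    rw [locMap_comp, show d ∘ₗ d = 0 from LinearMap.ext hd, locMap_zero]
  have h2 : totD x d c = cechD x A c + fun J => (-1 : R) ^ J.card • locMap x J d (c J) := rfl
  funext J
  rw [totD_apply, totD_apply, map_add, map_smul, h1, smul_zero, add_zero, h2, map_add,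
    Pi.add_apply, cechD_cechD, Pi.zero_apply, zero_add]
  simp only [cechD_apply, map_sum, map_smul, Finset.smul_sum, locMap_cechRestrict]
  rw [← Finset.sum_add_distrib]
  refine Finset.sum_eq_zero fun i hi => ?_
  rw [← Finset.card_erase_add_one hi, pow_succ, smul_smul, smul_smul, ← add_smul]
  convert zero_smul R _ using 2
  ring

/-- The cochains of total degree `t`: the component at `J` lies in the term of degree `t - #J` of
the complex, where `V j` is the term of degree `j`. -/
def totDeg (x : ι → R) (V : ℤ → Submodule R A) (t : ℤ) : Submodule R (CechCochain x A) :=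
  Submodule.pi Set.univ fun J => locSub x J (V (t - J.card))

/-- The cocycles of degree `t` of the total complex. -/
def totCocycle (x : ι → R) (d : A →ₗ[R] A) (V : ℤ → Submodule R A) (t : ℤ) :
    Submodule R (CechCochain x A) :=
  LinearMap.ker (totD x d) ⊓ totDeg x V t

/-- The coboundaries of degree `t` of the total complex. -/
def totCoboundary (x : ι → R) (d : A →ₗ[R] A) (V : ℤ → Submodule R A) (t : ℤ) :
    Submodule R (CechCochain x A) :=
  (totDeg x V (t - 1)).map (totD x d)

/-- The hypercohomology of a complex with respect to the family `x`. -/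
abbrev HyperCoh (x : ι → R) (d : A →ₗ[R] A) (V : ℤ → Submodule R A) (t : ℤ) : Type _ :=
  Subquotient (totCocycle x d V t) (totCoboundary x d V t)

end Total

section GradedComplex

variable {ι K Γ R A : Type*} [LinearOrder ι] [Finite ι] [Field K] [CommRing R] [Algebra K R]
  [AddCommGroup Γ] [DecidableEq Γ] {𝒜 : Γ → Submodule K R} [GradedAlgebra 𝒜] [AddCommGroup A]
  [Module R A] {x : ι → R} {𝒢 : Γ → AddSubgroup A} {V : ℤ → Submodule R A} {d : A →ₗ[R] A}

/-- A complex of graded `R`-modules, given as a single graded module with submodules `V j`, its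
terms, and a differential `d` which maps `V j` to `V (j + 1)`. -/
structure GradedComplex (𝒜 : Γ → Submodule K R) (𝒢 : Γ → AddSubgroup A) (V : ℤ → Submodule R A)
    (d : A →ₗ[R] A) : Prop where
  grading : IsGrading 𝒢
  smul : GradedSMul 𝒜 𝒢
  homog : ∀ j, IsHomog grading (V j)
  map_mem : ∀ j, ∀ a ∈ V j, d a ∈ V (j + 1)
  graded : IsGradedHom 𝒢 𝒢 d
  sq : ∀ a, d (d a) = 0

/-- The grading of hypercohomology. -/
def hyperGrading (𝒜 : Γ → Submodule K R) (x : ι → R) (𝒢 : Γ → AddSubgroup A) (d : A →ₗ[R] A)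
    (V : ℤ → Submodule R A) (t : ℤ) : Γ → AddSubgroup (HyperCoh x d V t) :=
  subquotientGrading (cechGrading 𝒜 x 𝒢) _ _

theorem smul_neg_one_pow_mem {M : Type*} [AddCommGroup M] [Module R M] (U : AddSubgroup M) (n : ℕ)
    {v : M} (hv : v ∈ U) : (-1 : R) ^ n • v ∈ U := by
  rcases neg_one_pow_eq_or R n with h | h
  · rwa [h, one_smul]
  · rw [h, neg_one_smul]
    exact neg_mem hv

namespace GradedComplex

variable (hA : GradedComplex 𝒜 𝒢 V d) (hx : ∀ i, ∃ β, x i ∈ 𝒜 β)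
include hA

theorem totD_mem {t : ℤ} {c : CechCochain x A} (hc : c ∈ totDeg x V t) :
    totD x d c ∈ totDeg x V (t + 1) := by
  intro J _
  rw [totD_apply, cechD_apply]
  refine add_mem (Submodule.sum_mem _ fun i hi => Submodule.smul_mem _ _ ?_)
    (Submodule.smul_mem _ _ ?_)
  · have := cechRestrict_mem_locSub (J.erase_subset i) (hc (J.erase i) trivial)
    change _ ∈ locSub x J (V (t + 1 - J.card))
    rw [← Finset.card_erase_add_one hi]
    push_cast
    rwa [add_sub_add_right_eq_sub]
  · refine locMap_mem_locSub (V := V (t - J.card)) (fun v hv => ?_) (hc J trivial)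
    have := hA.map_mem _ v hv
    rwa [sub_add_eq_add_sub] at this

theorem isGradedHom_totD : IsGradedHom (cechGrading 𝒜 x 𝒢) (cechGrading 𝒜 x 𝒢) (totD x d) := by
  intro γ c hc J hJ
  rw [totD_apply]
  exact add_mem (isGradedHom_cechD hA.smul γ c hc J trivial)
    (smul_neg_one_pow_mem _ _ (isGradedHom_locMap hA.smul hA.graded γ _ (hc J trivial)))

include hx

theorem isGrading_cochain : IsGrading (cechGrading 𝒜 x 𝒢) :=
  isGrading_cechCochain hx hA.grading hA.smul

theorem isHomog_totDeg (t : ℤ) : IsHomog (hA.isGrading_cochain hx) (totDeg x V t) := by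
  intro γ c hc J _
  have h1 := IsGrading.proj_pi (fun J => isGrading_cechLocal hx hA.grading hA.smul J)
    (hA.isGrading_cochain hx) γ c J
  have h2 := isHomog_locSub hx hA.grading hA.smul (hA.homog (t - J.card)) (J := J) γ _
    (hc J trivial)
  rw [← h1] at h2
  exact h2

theorem isHomog_totCocycle (t : ℤ) : IsHomog (hA.isGrading_cochain hx) (totCocycle x d V t) :=
  (IsHomog.ker (hA.isGrading_cochain hx) hA.isGradedHom_totD).inf (hA.isHomog_totDeg hx t)

theorem isHomog_totCoboundary (t : ℤ) :
    IsHomog (hA.isGrading_cochain hx) (totCoboundary x d V t) :=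
  (hA.isHomog_totDeg hx (t - 1)).map hA.isGradedHom_totD

theorem isGrading_hyperCoh (t : ℤ) : IsGrading (hyperGrading 𝒜 x 𝒢 d V t) :=
  isGrading_subquotient (hA.isGrading_cochain hx) (hA.isHomog_totCocycle hx t)
    (hA.isHomog_totCoboundary hx t)

/-- A homogeneous coboundary is the coboundary of a homogeneous cochain. -/
theorem exists_homogeneous_preimage {t : ℤ} {γ : Γ} {c : CechCochain x A}
    (hc : c ∈ cechGrading 𝒜 x 𝒢 γ) (h : c ∈ totCoboundary x d V t) :
    ∃ b ∈ totDeg x V (t - 1), b ∈ cechGrading 𝒜 x 𝒢 γ ∧ totD x d b = c := by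
  obtain ⟨b, hb, rfl⟩ := h
  refine ⟨(hA.isGrading_cochain hx).proj γ b, hA.isHomog_totDeg hx _ γ b hb,
    IsGrading.proj_mem _ _ _, ?_⟩
  have := (hA.isGrading_cochain hx).map_proj (hA.isGrading_cochain hx) (totD x d).toAddMonoidHom
    hA.isGradedHom_totD γ b
  exact this.trans (IsGrading.proj_of_mem _ hc)

end GradedComplex

/-- The localized complex is exact at the term of degree `j`, in the internal degree `γ`. -/
def LocExact (𝒜 : Γ → Submodule K R) (x : ι → R) (𝒢 : Γ → AddSubgroup A) (d : A →ₗ[R] A)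
    (V : ℤ → Submodule R A) (J : Finset ι) (j : ℤ) (γ : Γ) : Prop :=
  ∀ z ∈ locSub x J (V j), z ∈ cechLocalGrading 𝒜 x 𝒢 J γ → locMap x J d z = 0 →
    ∃ y ∈ locSub x J (V (j - 1)), y ∈ cechLocalGrading 𝒜 x 𝒢 J γ ∧ locMap x J d y = z

namespace GradedComplex

variable (hA : GradedComplex 𝒜 𝒢 V d) (hx : ∀ i, ∃ β, x i ∈ 𝒜 β)
include hA

include hx in
/-- The localized complex is exact where the cohomology of the complex is torsion with respect to
the denominators. Only finitely many degrees enter, which is needed for strands. -/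
theorem locExact {J : Finset ι} {j : ℤ} {γ : Γ}
    (h : ∀ β, ∀ s : cechDen x J, (s : R) ∈ 𝒜 β → ∀ a ∈ V j, a ∈ 𝒢 (γ + β) → d a = 0 →
      ∃ u : cechDen x J, ∃ b ∈ V (j - 1), d b = (u : R) • a) :
    LocExact 𝒜 x 𝒢 d V J j γ := by
  intro z hzV hz hdz
  obtain ⟨β, s, v, hv, hvV, hs, rfl⟩ := exists_homogeneous_rep hx hA.smul hz hzV
  rw [locMap_cechMk, cechMk_eq_zero] at hdz
  obtain ⟨t, ht⟩ := hdz
  obtain ⟨β', ht'⟩ := exists_degree hx t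
  obtain ⟨u, b, hb, hdb⟩ := h (β' + β) (t * s) (SetLike.GradedMul.mul_mem ht' hs) ((t : R) • v)
    (Submodule.smul_mem _ _ hvV) (by
      have := hA.smul _ _ _ ht' _ hv
      rwa [add_left_comm] at this) (by rw [map_smul, ht])
  have hy : locMap x J d (cechMk x J (u * t * s) b) = cechMk x J s v := by
    rw [locMap_cechMk, hdb, mul_assoc, cechMk_cancel, cechMk_cancel]
  refine ⟨(isGrading_cechLocal hx hA.grading hA.smul J).proj γ (cechMk x J (u * t * s) b),
    isHomog_locSub hx hA.grading hA.smul (hA.homog _) _ _ (cechMk_mem_locSub hb _),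
    IsGrading.proj_mem _ _ _, ?_⟩
  have := (isGrading_cechLocal hx hA.grading hA.smul J).map_proj
    (isGrading_cechLocal hx hA.grading hA.smul J) (locMap x J d).toAddMonoidHom
    (isGradedHom_locMap hA.smul hA.graded) γ (cechMk x J (u * t * s) b)
  refine this.trans ?_
  change IsGrading.proj _ γ (locMap x J d (cechMk x J (u * t * s) b)) = _
  rw [hy, IsGrading.proj_of_mem _ hz]

/-- If the components of a cochain of lowest Čech degree `p` are boundaries, they can be removed
by subtracting a coboundary. -/
theorem exists_clear_step {t p : ℤ} {γ : Γ} {c : CechCochain x A}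
    (hsupp : ∀ J : Finset ι, (J.card : ℤ) < p → c J = 0)
    (hbd : ∀ J : Finset ι, (J.card : ℤ) = p → ∃ y ∈ locSub x J (V (t - p - 1)),
      y ∈ cechLocalGrading 𝒜 x 𝒢 J γ ∧ locMap x J d y = c J) :
    ∃ v ∈ totDeg x V (t - 1), v ∈ cechGrading 𝒜 x 𝒢 γ ∧
      (∀ J : Finset ι, (J.card : ℤ) ≠ p → v J = 0) ∧
      ∀ J : Finset ι, (J.card : ℤ) < p + 1 → (c - totD x d v) J = 0 := by
  classical
  choose y hyV hyg hy using hbd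
  refine ⟨fun J => if h : (J.card : ℤ) = p then (-1 : R) ^ J.card • y J h else 0, ?_, ?_, ?_, ?_⟩
  · intro J _
    dsimp only
    split_ifs with h
    · have := hyV J h
      rw [← h, sub_right_comm] at this
      exact Submodule.smul_mem _ _ this
    · exact zero_mem _
  · intro J _
    dsimp only
    split_ifs with h
    · exact smul_neg_one_pow_mem _ _ (hyg J h)
    · exact (cechLocalGrading 𝒜 x 𝒢 J γ).zero_mem
  · exact fun J hJ => dif_neg hJ
  · intro J hJ
    rw [Pi.sub_apply, totD_apply, cechD_eq_zero, zero_add]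
    · rcases eq_or_ne (J.card : ℤ) p with h | h
      · rw [dif_pos h, map_smul, smul_smul, hy J h, ← mul_pow, neg_one_mul, neg_neg, one_pow,
          one_smul, sub_self]
      · rw [dif_neg h, map_zero, smul_zero, sub_zero]
        exact hsupp J (lt_of_le_of_ne (Int.lt_add_one_iff.1 hJ) h)
    · intro I hI
      have : (I.card : ℤ) + 1 = J.card := by exact_mod_cast hI
      exact dif_neg (by omega)

/-- The components of a cochain of Čech degrees from `p` to `p + k - 1` can be removed by
subtracting a coboundary, if the coboundary of the cochain vanishes in these Čech degrees, and the
localized complexes are exact in the corresponding degrees. -/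
theorem exists_clear (k : ℕ) {t p : ℤ} {γ : Γ} {c : CechCochain x A}
    (hc : c ∈ totDeg x V t) (hcg : c ∈ cechGrading 𝒜 x 𝒢 γ)
    (hsupp : ∀ J : Finset ι, (J.card : ℤ) < p → c J = 0)
    (hD : ∀ J : Finset ι, (J.card : ℤ) < p + k → totD x d c J = 0)
    (hex : ∀ J : Finset ι, p ≤ J.card → (J.card : ℤ) < p + k →
      LocExact 𝒜 x 𝒢 d V J (t - J.card) γ) :
    ∃ v ∈ totDeg x V (t - 1), v ∈ cechGrading 𝒜 x 𝒢 γ ∧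
      (∀ J : Finset ι, (J.card : ℤ) < p → v J = 0) ∧
      ∀ J : Finset ι, (J.card : ℤ) < p + k → (c - totD x d v) J = 0 := by
  induction k generalizing p c with
  | zero =>
    refine ⟨0, zero_mem _, zero_mem _, fun _ _ => rfl, fun J hJ => ?_⟩
    rw [map_zero, sub_zero]
    exact hsupp J (by simpa using hJ)
  | succ k ih =>
    obtain ⟨v, hv, hvg, hv0, hv1⟩ := hA.exists_clear_step (t := t) (p := p) (γ := γ) hsupp (by
      intro J hJ
      have h1 := hD J (by rw [hJ]; push_cast; omega)
      rw [totD_apply, cechD_eq_zero, zero_add] at h1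
      · have h2 : locMap x J d (c J) = 0 := by
          rcases neg_one_pow_eq_or R J.card with h | h
          · rwa [h, one_smul] at h1
          · rwa [h, neg_one_smul, neg_eq_zero] at h1
        have := hex J hJ.ge (by rw [hJ]; push_cast; omega) (c J) (hc J trivial) (hcg J trivial) h2
        rwa [hJ] at this
      · intro I hI
        have : (I.card : ℤ) + 1 = J.card := by exact_mod_cast hI
        exact hsupp I (by omega))
    have hDv : totD x d v ∈ totDeg x V t := by
      have := hA.totD_mem hv
      rwa [sub_add_cancel] at this
    obtain ⟨w, hw, hwg, hw0, hw1⟩ := ih (p := p + 1) (c := c - totD x d v) (sub_mem hc hDv)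
      (sub_mem hcg (hA.isGradedHom_totD γ v hvg)) hv1 (fun J hJ => by
        rw [map_sub, totD_totD hA.sq, sub_zero]
        exact hD J (by push_cast at hJ ⊢; omega))
      (fun J hJ hJ' => hex J (by omega) (by push_cast at hJ' ⊢; omega))
    refine ⟨v + w, add_mem hv hw, add_mem hvg hwg, fun J hJ => ?_, fun J hJ => ?_⟩
    · rw [Pi.add_apply, hv0 J hJ.ne, hw0 J (by omega), add_zero]
    · rw [map_add, ← sub_sub]
      exact hw1 J (by push_cast at hJ ⊢; omega)

/-- A cocycle which is supported in Čech degrees `≥ p` is a coboundary if the localized complexes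
are exact in the corresponding degrees. -/
theorem exists_primitive {t p : ℤ} {γ : Γ} {c : CechCochain x A}
    (hc : c ∈ totDeg x V t) (hcg : c ∈ cechGrading 𝒜 x 𝒢 γ) (hD : totD x d c = 0)
    (hsupp : ∀ J : Finset ι, (J.card : ℤ) < p → c J = 0)
    (hex : ∀ J : Finset ι, p ≤ J.card → LocExact 𝒜 x 𝒢 d V J (t - J.card) γ) :
    ∃ v ∈ totDeg x V (t - 1), v ∈ cechGrading 𝒜 x 𝒢 γ ∧
      (∀ J : Finset ι, (J.card : ℤ) < p → v J = 0) ∧ totD x d v = c := by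
  obtain ⟨v, hv, hvg, hv0, hv1⟩ := hA.exists_clear (Nat.card ι + 1 + p.natAbs) hc hcg hsupp
    (fun J _ => by rw [hD]; rfl) (fun J hJ _ => hex J hJ)
  refine ⟨v, hv, hvg, hv0, funext fun J => ?_⟩
  have := Fintype.ofFinite ι
  have h1 : J.card ≤ Nat.card ι := by
    rw [Nat.card_eq_fintype_card]
    exact J.card_le_univ
  have := hv1 J (by omega)
  rw [Pi.sub_apply, sub_eq_zero] at this
  exact this.symm

end GradedComplex

end GradedComplex

/-! ### Local cohomology of a cohomology module and hypercohomology -/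

section CohomologyAt

variable {ι K Γ R A Z N : Type*} [LinearOrder ι] [Finite ι] [Field K] [CommRing R] [Algebra K R]
  [AddCommGroup Γ] [DecidableEq Γ] {𝒜 : Γ → Submodule K R} [GradedAlgebra 𝒜] [AddCommGroup A]
  [Module R A] [AddCommGroup Z] [Module R Z] [AddCommGroup N] [Module R N]
  {x : ι → R} {𝒢 : Γ → AddSubgroup A} {V : ℤ → Submodule R A} {d : A →ₗ[R] A}
  {𝒵 : Γ → AddSubgroup Z} {𝒩 : Γ → AddSubgroup N} {incl : Z →ₗ[R] A} {quot : Z →ₗ[R] N} {c : ℤ}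

/-- The graded module `N`, with the map `quot` from the module `Z` of cocycles, is the cohomology of
the complex in degree `c`. -/
structure IsCohomologyAt (𝒢 : Γ → AddSubgroup A) (V : ℤ → Submodule R A) (d : A →ₗ[R] A) (c : ℤ)
    (𝒵 : Γ → AddSubgroup Z) (𝒩 : Γ → AddSubgroup N) (incl : Z →ₗ[R] A) (quot : Z →ₗ[R] N) :
    Prop where
  incl_injective : Function.Injective incl
  incl_mem : ∀ z, incl z ∈ V c
  d_incl : ∀ z, d (incl z) = 0
  exists_incl : ∀ a ∈ V c, d a = 0 → ∃ z, incl z = a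
  mem_iff : ∀ γ z, z ∈ 𝒵 γ ↔ incl z ∈ 𝒢 γ
  quot_graded : IsGradedHom 𝒵 𝒩 quot
  exists_quot : ∀ γ, ∀ v ∈ 𝒩 γ, ∃ z ∈ 𝒵 γ, quot z = v
  quot_eq_zero : ∀ z, quot z = 0 ↔ ∃ b ∈ V (c - 1), d b = incl z

namespace IsCohomologyAt

variable (hC : IsCohomologyAt 𝒢 V d c 𝒵 𝒩 incl quot) (hA : GradedComplex 𝒜 𝒢 V d)
  (hx : ∀ i, ∃ β, x i ∈ 𝒜 β) (hN : GradedSMul 𝒜 𝒩)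
include hC

theorem incl_graded : IsGradedHom 𝒵 𝒢 incl := fun γ z hz => (hC.mem_iff γ z).1 hz

/-- Homogeneous elements of a localization of the cohomology lift to homogeneous elements of the
localized cocycles. -/
theorem exists_lift {J : Finset ι} {γ : Γ} {v : CechLocal x N J} (hN : GradedSMul 𝒜 𝒩)
    (hv : v ∈ cechLocalGrading 𝒜 x 𝒩 J γ) :
    ∃ ζ ∈ cechLocalGrading 𝒜 x 𝒵 J γ, locMap x J quot ζ = v := by
  obtain ⟨β, s, n, hn, hs, rfl⟩ := (mem_cechLocalGrading hN).1 hv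
  obtain ⟨z, hz, rfl⟩ := hC.exists_quot _ n hn
  exact ⟨cechMk x J s z, cechMk_mem_grading hs hz, locMap_cechMk _ _ _⟩

theorem locMap_incl_mem {J : Finset ι} (ζ : CechLocal x Z J) :
    locMap x J incl ζ ∈ locSub x J (V c) := by
  obtain ⟨s, z, rfl⟩ := exists_cechMk ζ
  rw [locMap_cechMk]
  exact cechMk_mem_locSub (hC.incl_mem z) s

theorem locMap_d_incl {J : Finset ι} (ζ : CechLocal x Z J) :
    locMap x J d (locMap x J incl ζ) = 0 := by
  obtain ⟨s, z, rfl⟩ := exists_cechMk ζ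
  rw [locMap_cechMk, locMap_cechMk, hC.d_incl, map_zero]

theorem quot_eq_zero_of_boundary {J : Finset ι} {ζ : CechLocal x Z J} {y : CechLocal x A J}
    (hy : y ∈ locSub x J (V (c - 1))) (h : locMap x J d y = locMap x J incl ζ) :
    locMap x J quot ζ = 0 := by
  obtain ⟨s, b, hb, rfl⟩ := hy
  obtain ⟨t, z, rfl⟩ := exists_cechMk ζ
  rw [locMap_cechMk, locMap_cechMk, cechMk_eq_iff] at h
  obtain ⟨u, hu⟩ := h
  rw [locMap_cechMk, cechMk_eq_zero]
  refine ⟨u * s, ?_⟩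
  rw [← map_smul, hC.quot_eq_zero]
  refine ⟨(u : R) • (t : R) • b, Submodule.smul_mem _ _ (Submodule.smul_mem _ _ hb), ?_⟩
  rw [map_smul, map_smul, hu, Submonoid.coe_mul, mul_smul, map_smul, map_smul]

include hA

theorem gradedSMul_cocycles : GradedSMul 𝒜 𝒵 := fun β γ p hp z hz => by
  rw [hC.mem_iff, map_smul]
  exact hA.smul β γ p hp _ ((hC.mem_iff _ _).1 hz)

theorem isGrading_cocycles : IsGrading 𝒵 := by
  have h := hA.grading.comap incl.toAddMonoidHom hC.incl_injective fun γ z => by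
    have h1 : d (hA.grading.proj γ (incl z)) = 0 :=
      IsHomog.ker hA.grading hA.graded γ (incl z) (hC.d_incl z)
    obtain ⟨z', hz'⟩ := hC.exists_incl _ (hA.homog c γ _ (hC.incl_mem z)) h1
    exact ⟨z', hz'⟩
  convert h using 2 with γ
  ext z
  exact hC.mem_iff γ z

include hx

theorem exists_cocycle {J : Finset ι} {γ : Γ} {w : CechLocal x A J} (hw : w ∈ locSub x J (V c))
    (hwg : w ∈ cechLocalGrading 𝒜 x 𝒢 J γ) (hd : locMap x J d w = 0) :
    ∃ ζ ∈ cechLocalGrading 𝒜 x 𝒵 J γ, locMap x J incl ζ = w := by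
  obtain ⟨β, s, v, hv, hvV, hs, rfl⟩ := exists_homogeneous_rep hx hA.smul hwg hw
  rw [locMap_cechMk, cechMk_eq_zero] at hd
  obtain ⟨t, ht⟩ := hd
  obtain ⟨β', ht'⟩ := exists_degree hx t
  obtain ⟨z, hz⟩ := hC.exists_incl ((t : R) • v) (Submodule.smul_mem _ _ hvV)
    (by rw [map_smul, ht])
  refine ⟨cechMk x J (t * s) z, cechMk_mem_grading (SetLike.GradedMul.mul_mem ht' hs) ?_, ?_⟩
  · rw [hC.mem_iff, hz, add_left_comm]
    exact hA.smul _ _ _ ht' _ hv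
  · rw [locMap_cechMk, hz, cechMk_cancel]

theorem exists_boundary {J : Finset ι} {γ : Γ} {ζ : CechLocal x Z J}
    (hζ : locMap x J incl ζ ∈ cechLocalGrading 𝒜 x 𝒢 J γ) (h : locMap x J quot ζ = 0) :
    ∃ y ∈ locSub x J (V (c - 1)), y ∈ cechLocalGrading 𝒜 x 𝒢 J γ ∧
      locMap x J d y = locMap x J incl ζ := by
  obtain ⟨s, z, rfl⟩ := exists_cechMk ζ
  rw [locMap_cechMk, cechMk_eq_zero] at h
  obtain ⟨u, hu⟩ := h
  rw [← map_smul, hC.quot_eq_zero] at hu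
  obtain ⟨b, hb, hdb⟩ := hu
  have hy : locMap x J d (cechMk x J (u * s) b) = locMap x J incl (cechMk x J s z) := by
    rw [locMap_cechMk, locMap_cechMk, hdb, map_smul, cechMk_cancel]
  refine ⟨(isGrading_cechLocal hx hA.grading hA.smul J).proj γ (cechMk x J (u * s) b),
    isHomog_locSub hx hA.grading hA.smul (hA.homog _) _ _ (cechMk_mem_locSub hb _),
    IsGrading.proj_mem _ _ _, ?_⟩
  have := (isGrading_cechLocal hx hA.grading hA.smul J).map_proj
    (isGrading_cechLocal hx hA.grading hA.smul J) (locMap x J d).toAddMonoidHom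
    (isGradedHom_locMap hA.smul hA.graded) γ (cechMk x J (u * s) b)
  refine this.trans ?_
  change IsGrading.proj _ γ (locMap x J d (cechMk x J (u * s) b)) = _
  rw [hy, IsGrading.proj_of_mem _ hζ]

end IsCohomologyAt

/-- A Čech cochain `z` of degree `i` with values in the cohomology module `N` corresponds to a
cochain `w` of the total complex if the components of `w` of Čech degree `< i` vanish, and those of
Čech degree `i` are cocycles which represent `z`. -/
def cohRel (x : ι → R) (incl : Z →ₗ[R] A) (quot : Z →ₗ[R] N) (i : ℤ) :
    Submodule R (CechCochain x N × CechCochain x A) where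
  carrier := {p | ∃ ζ : CechCochain x Z, (∀ J : Finset ι, (J.card : ℤ) ≠ i → ζ J = 0) ∧
    cechMap x quot ζ = p.1 ∧ ∀ J : Finset ι, (J.card : ℤ) ≤ i → p.2 J = locMap x J incl (ζ J)}
  zero_mem' := ⟨0, fun _ _ => rfl, map_zero _, fun J _ => (map_zero _).symm⟩
  add_mem' := by
    rintro _ _ ⟨ζ, h1, h2, h3⟩ ⟨ζ', h1', h2', h3'⟩
    exact ⟨ζ + ζ', fun J hJ => by rw [Pi.add_apply, h1 J hJ, h1' J hJ, add_zero],
      by rw [map_add, h2, h2']; rfl,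
      fun J hJ => by rw [Pi.add_apply, map_add, ← h3 J hJ, ← h3' J hJ]; rfl⟩
  smul_mem' := by
    rintro r _ ⟨ζ, h1, h2, h3⟩
    exact ⟨r • ζ, fun J hJ => by rw [Pi.smul_apply, h1 J hJ, smul_zero],
      by rw [map_smul, h2]; rfl,
      fun J hJ => by rw [Pi.smul_apply, map_smul, ← h3 J hJ]; rfl⟩

/-- A variant of `exists_primitive` in which the components of lowest Čech degree `p` are known to
be boundaries, so that exactness is needed only in Čech degrees `> p`. -/
theorem GradedComplex.exists_primitive_of_boundary (hA : GradedComplex 𝒜 𝒢 V d)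
    {t p : ℤ} {γ : Γ} {w : CechCochain x A}
    (hw : w ∈ totDeg x V t) (hwg : w ∈ cechGrading 𝒜 x 𝒢 γ) (hD : totD x d w = 0)
    (hsupp : ∀ J : Finset ι, (J.card : ℤ) < p → w J = 0)
    (hbd : ∀ J : Finset ι, (J.card : ℤ) = p → ∃ y ∈ locSub x J (V (t - p - 1)),
      y ∈ cechLocalGrading 𝒜 x 𝒢 J γ ∧ locMap x J d y = w J)
    (hex : ∀ J : Finset ι, p < J.card → LocExact 𝒜 x 𝒢 d V J (t - J.card) γ) :
    ∃ v ∈ totDeg x V (t - 1), v ∈ cechGrading 𝒜 x 𝒢 γ ∧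
      (∀ J : Finset ι, (J.card : ℤ) < p → v J = 0) ∧ totD x d v = w := by
  obtain ⟨v, hv, hvg, hv0, hv1⟩ := hA.exists_clear_step hsupp hbd
  have hDv : totD x d v ∈ totDeg x V t := by
    have := hA.totD_mem hv
    rwa [sub_add_cancel] at this
  obtain ⟨v', hv', hvg', hv0', hv1'⟩ := hA.exists_primitive (c := w - totD x d v) (p := p + 1)
    (sub_mem hw hDv) (sub_mem hwg (hA.isGradedHom_totD γ v hvg))
    (by rw [map_sub, hD, totD_totD hA.sq, sub_zero]) hv1 (fun J hJ => hex J (by omega))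
  refine ⟨v + v', add_mem hv hv', add_mem hvg hvg', fun J hJ => ?_, ?_⟩
  · rw [Pi.add_apply, hv0 J hJ.ne, hv0' J (by omega), add_zero]
  · rw [map_add, hv1', add_sub_cancel]

namespace IsCohomologyAt

variable (hC : IsCohomologyAt 𝒢 V d c 𝒵 𝒩 incl quot) (hA : GradedComplex 𝒜 𝒢 V d)
  (hx : ∀ i, ∃ β, x i ∈ 𝒜 β) (hN : GradedSMul 𝒜 𝒩)
include hC hA hx hN

theorem exists_cochain_lift {i : ℤ} {γ : Γ} {z : CechCochain x N} (hz : z ∈ cechDegree x N i)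
    (hzg : z ∈ cechGrading 𝒜 x 𝒩 γ) : ∃ ζ : CechCochain x Z,
      (∀ J : Finset ι, (J.card : ℤ) ≠ i → ζ J = 0) ∧ cechMap x quot ζ = z ∧
      ζ ∈ cechGrading 𝒜 x 𝒵 γ := by
  choose ζ hζ hζ' using fun J => hC.exists_lift (γ := γ) hN (hzg J trivial)
  classical
  refine ⟨fun J => if (J.card : ℤ) = i then ζ J else 0, fun J hJ => if_neg hJ, funext fun J => ?_,
    fun J _ => ?_⟩
  · rw [cechMap_apply]
    split_ifs with h
    · exact hζ' J
    · rw [map_zero, hz J h]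
  · dsimp only
    split_ifs
    · exact hζ J
    · exact (cechLocalGrading 𝒜 x 𝒵 J γ).zero_mem

theorem cechMap_incl_mem {i t : ℤ} (ht : t = c + i) {ζ : CechCochain x Z}
    (hζ : ∀ J : Finset ι, (J.card : ℤ) ≠ i → ζ J = 0) : cechMap x incl ζ ∈ totDeg x V t := by
  intro J _
  rw [cechMap_apply]
  by_cases h : (J.card : ℤ) = i
  · have := hC.locMap_incl_mem (ζ J)
    change _ ∈ locSub x J (V (t - J.card))
    rwa [show t - J.card = c by omega]
  · rw [hζ J h, map_zero]
    exact (locSub x J _).zero_mem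

theorem totD_cechMap_incl (ζ : CechCochain x Z) :
    totD x d (cechMap x incl ζ) = cechMap x incl (cechD x Z ζ) := by
  funext J
  rw [totD_apply, cechD_cechMap, cechMap_apply, cechMap_apply, hC.locMap_d_incl, smul_zero, add_zero]

/-- Every Čech cocycle with values in the cohomology in degree `c` extends to a cocycle of the total
complex, if the complex is exact in degrees `< c`. -/
theorem exists_extension {i t : ℤ} (ht : t = c + i) {γ : Γ}
    (hex : ∀ (J : Finset ι) (j : ℤ), j < c → LocExact 𝒜 x 𝒢 d V J j γ)
    {z : CechCochain x N} (hz : z ∈ cechCocycle x N i) (hzg : z ∈ cechGrading 𝒜 x 𝒩 γ) :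
    ∃ w ∈ totCocycle x d V t, w ∈ cechGrading 𝒜 x 𝒢 γ ∧ (z, w) ∈ cohRel x incl quot i := by
  -- Lift `z` to a cochain `ζ` of cocycles of the complex. The total differential of `ζ` is its Čech
  -- differential, whose components represent the Čech differential of `z`, hence are boundaries.
  -- The part above is a coboundary by exactness, so `ζ` can be corrected by some `v` in Čech
  -- degrees `> i`.
  obtain ⟨ζ, hζ0, hζ, hζg⟩ := hC.exists_cochain_lift hA hx hN hz.2 hzg
  have hw := hC.cechMap_incl_mem hA hx hN ht hζ0
  have hwg := isGradedHom_cechMap (hC.gradedSMul_cocycles hA) hC.incl_graded γ ζ hζg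
  have hlow : ∀ J : Finset ι, (J.card : ℤ) < i + 1 → cechD x Z ζ J = 0 := fun J hJ =>
    cechD_eq_zero fun I hI => hζ0 I (by have : (I.card : ℤ) + 1 = J.card := (by exact_mod_cast hI)
                                        omega)
  obtain ⟨v, hv, hvg, hv0, hDv⟩ := hA.exists_primitive_of_boundary (p := i + 1)
    (w := totD x d (cechMap x incl ζ)) (hA.totD_mem hw) (hA.isGradedHom_totD γ _ hwg)
    (totD_totD hA.sq _)
    (fun J hJ => by
      rw [hC.totD_cechMap_incl hA hx hN, cechMap_apply, hlow J hJ, map_zero])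
    (fun J hJ => by
      have hg := hA.isGradedHom_totD γ _ hwg J trivial
      rw [hC.totD_cechMap_incl hA hx hN, cechMap_apply] at hg ⊢
      rw [show t + 1 - (i + 1) - 1 = c - 1 by omega]
      refine hC.exists_boundary hA hx hg ?_
      rw [← cechMap_apply, ← cechD_cechMap, hζ, LinearMap.mem_ker.1 hz.1]
      rfl)
    (fun J hJ => hex J _ (by omega))
  rw [add_sub_cancel_right] at hv
  refine ⟨cechMap x incl ζ - v, ⟨?_, sub_mem hw hv⟩, sub_mem hwg hvg, ζ, hζ0, hζ, fun J hJ => ?_⟩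
  · change totD x d _ = 0
    rw [map_sub, hDv, sub_self]
  · change (cechMap x incl ζ - v) J = _
    rw [Pi.sub_apply, hv0 J (by omega), sub_zero, cechMap_apply]

/-- Corresponding classes: if the Čech cocycle is a coboundary, so is the cocycle of the total
complex. -/
theorem mem_totCoboundary {i t : ℤ} (ht : t = c + i) {γ : Γ} (hNg : IsGrading 𝒩)
    (hex : ∀ (J : Finset ι) (j : ℤ), j < c → LocExact 𝒜 x 𝒢 d V J j γ)
    {z : CechCochain x N} {w : CechCochain x A} (hzg : z ∈ cechGrading 𝒜 x 𝒩 γ)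
    (hw : w ∈ totCocycle x d V t) (hwg : w ∈ cechGrading 𝒜 x 𝒢 γ)
    (hrel : (z, w) ∈ cohRel x incl quot i) (hz : z ∈ cechCoboundary x N i) :
    w ∈ totCoboundary x d V t := by
  obtain ⟨ζ, hζ0, hζ, hζw⟩ := hrel
  dsimp only at hζ
  obtain ⟨z', hz', hzz'⟩ := hz
  -- Replace the primitive `z'` of `z` by its component of degree `γ`, and lift it to a cochain `ζ'`
  -- of cocycles. After subtracting the coboundary of `ζ'`, the components of `w` of lowest Čech
  -- degree `i` represent `z - D z' = 0`, so they are boundaries.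
  have hgr := isGrading_cechCochain (x := x) hx hNg hN
  have hproj : cechD x N (hgr.proj γ z') = z := by
    have := hgr.map_proj hgr (cechD x N).toAddMonoidHom (isGradedHom_cechD hN) γ z'
    refine this.trans ?_
    change hgr.proj γ (cechD x N z') = z
    rw [hzz', hgr.proj_of_mem hzg]
  obtain ⟨ζ', hζ0', hζ', hζg'⟩ := hC.exists_cochain_lift hA hx hN
    (isHomog_cechDegree hgr (fun J => isGrading_cechLocal hx hNg hN J) (i - 1) γ z' hz')
    (hgr.proj_mem γ z')
  have hv := hC.cechMap_incl_mem hA hx hN (t := t - 1) (i := i - 1) (by omega) hζ0'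
  have hvg := isGradedHom_cechMap (hC.gradedSMul_cocycles hA) hC.incl_graded γ ζ' hζg'
  have hDv : totD x d (cechMap x incl ζ') ∈ totDeg x V t := by
    have := hA.totD_mem hv
    rwa [sub_add_cancel] at this
  have hcomp : ∀ J : Finset ι, (J.card : ℤ) ≤ i → (w - totD x d (cechMap x incl ζ')) J =
      locMap x J incl ((ζ - cechD x Z ζ') J) := fun J hJ => by
    have h := hζw J hJ
    dsimp only at h
    rw [Pi.sub_apply, hC.totD_cechMap_incl hA hx hN, cechMap_apply, h, ← map_sub, Pi.sub_apply]
  obtain ⟨u, hu, -, -, hDu⟩ := hA.exists_primitive_of_boundary (p := i)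
    (w := w - totD x d (cechMap x incl ζ')) (sub_mem hw.2 hDv)
    (sub_mem hwg (hA.isGradedHom_totD γ _ hvg))
    (by rw [map_sub, LinearMap.mem_ker.1 hw.1, totD_totD hA.sq, sub_zero])
    (fun J hJ => by
      rw [hcomp J hJ.le, Pi.sub_apply, hζ0 J hJ.ne, cechD_eq_zero, sub_zero, map_zero]
      intro I hI
      have : (I.card : ℤ) + 1 = J.card := by exact_mod_cast hI
      exact hζ0' I (by omega))
    (fun J hJ => by
      have hg : (w - totD x d (cechMap x incl ζ')) J ∈ cechLocalGrading 𝒜 x 𝒢 J γ :=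
        sub_mem hwg (hA.isGradedHom_totD γ _ hvg) J trivial
      rw [hcomp J hJ.le] at hg ⊢
      rw [show t - i - 1 = c - 1 by omega]
      refine hC.exists_boundary hA hx hg ?_
      rw [← cechMap_apply, map_sub, ← cechD_cechMap, hζ, hζ', hproj, sub_self]
      rfl)
    (fun J hJ => hex J _ (by omega))
  refine ⟨u + cechMap x incl ζ', add_mem hu hv, ?_⟩
  rw [map_add, hDu, sub_add_cancel]

/-- If a corresponding cocycle of the total complex is the coboundary of a cochain without
components of Čech degree `< i - 1`, then the Čech cocycle is a coboundary. -/
theorem mem_cechCoboundary {i t : ℤ} (ht : t = c + i) {γ : Γ}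
    {z : CechCochain x N} {v : CechCochain x A} (hv : v ∈ totDeg x V (t - 1))
    (hvg : v ∈ cechGrading 𝒜 x 𝒢 γ) (hsupp : ∀ J : Finset ι, (J.card : ℤ) < i - 1 → v J = 0)
    (hrel : (z, totD x d v) ∈ cohRel x incl quot i) :
    z ∈ cechCoboundary x N i := by
  classical
  obtain ⟨ζ, hζ0, rfl, hζw⟩ := hrel
  -- In Čech degree `i - 1` the total differential of `v` vanishes, and only `d v` contributes to
  -- it: the lowest components of `v` are cocycles of the complex, with classes `z'`. In Čech degree
  -- `i` the total differential is the Čech differential of these cocycles up to boundaries, so that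
  -- `D z' = z`.
  have h1 : ∀ J : Finset ι, (J.card : ℤ) = i - 1 → ∃ ζ', locMap x J incl ζ' = v J := by
    intro J hJ
    have h2 := hζw J (by omega)
    dsimp only at h2
    rw [hζ0 J (by omega), map_zero, totD_apply, cechD_eq_zero, zero_add] at h2
    · have h3 : locMap x J d (v J) = 0 := by
        rcases neg_one_pow_eq_or R J.card with h | h
        · rwa [h, one_smul] at h2
        · rwa [h, neg_one_smul, neg_eq_zero] at h2
      have h4 : v J ∈ locSub x J (V (t - 1 - J.card)) := hv J trivial
      rw [show t - 1 - J.card = c by omega] at h4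
      obtain ⟨ζ', -, h⟩ := hC.exists_cocycle hA hx h4 (hvg J trivial) h3
      exact ⟨ζ', h⟩
    · intro I hI
      have : (I.card : ℤ) + 1 = J.card := by exact_mod_cast hI
      exact hsupp I (by omega)
  choose! ζ' hζ' using h1
  have hlow : ∀ J : Finset ι, (J.card : ℤ) ≠ i →
      cechD x Z (fun J => if (J.card : ℤ) = i - 1 then ζ' J else 0) J = 0 := fun J hJ =>
    cechD_eq_zero fun I hI => by
      have : (I.card : ℤ) + 1 = J.card := by exact_mod_cast hI
      exact if_neg (by omega)
  refine ⟨cechMap x quot (fun J => if (J.card : ℤ) = i - 1 then ζ' J else 0), fun J hJ => ?_, ?_⟩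
  · rw [cechMap_apply, if_neg hJ, map_zero]
  · rw [cechD_cechMap]
    funext J
    rw [cechMap_apply, cechMap_apply]
    by_cases hJ : (J.card : ℤ) = i
    · rw [eq_comm, ← sub_eq_zero, ← map_sub]
      have h4 : v J ∈ locSub x J (V (t - 1 - J.card)) := hv J trivial
      rw [show t - 1 - J.card = c - 1 by omega] at h4
      refine hC.quot_eq_zero_of_boundary (y := (-1 : R) ^ J.card • v J)
        (Submodule.smul_mem _ _ h4) ?_
      have h5 := hζw J hJ.le
      dsimp only at h5
      rw [map_sub, ← h5, totD_apply, ← cechMap_apply incl, ← cechD_cechMap,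
        cechD_congr (c := cechMap x incl _) (c' := v), map_smul, add_sub_cancel_left]
      intro I hI
      have : (I.card : ℤ) + 1 = J.card := by exact_mod_cast hI
      rw [cechMap_apply, if_pos (by omega), hζ' I (by omega)]
    · rw [hlow J hJ, hζ0 J hJ]

/-- A cocycle of the total complex without components of Čech degree `< i` corresponds to a Čech
cocycle of degree `i`. -/
theorem exists_restriction {i t : ℤ} (ht : t = c + i) {γ : Γ} {w : CechCochain x A}
    (hw : w ∈ totCocycle x d V t) (hwg : w ∈ cechGrading 𝒜 x 𝒢 γ)
    (hsupp : ∀ J : Finset ι, (J.card : ℤ) < i → w J = 0) :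
    ∃ z ∈ cechCocycle x N i, z ∈ cechGrading 𝒜 x 𝒩 γ ∧ (z, w) ∈ cohRel x incl quot i := by
  classical
  have hDw : ∀ J, totD x d w J = 0 := fun J => by rw [LinearMap.mem_ker.1 hw.1]; rfl
  -- The components of lowest Čech degree are cocycles of the complex, by the cocycle condition in
  -- Čech degree `i`; in Čech degree `i + 1` it says that their Čech differential is a boundary.
  have h1 : ∀ J : Finset ι, (J.card : ℤ) = i →
      ∃ ζ ∈ cechLocalGrading 𝒜 x 𝒵 J γ, locMap x J incl ζ = w J := by
    intro J hJ
    have h2 := hDw J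
    rw [totD_apply, cechD_eq_zero, zero_add] at h2
    · have h3 : locMap x J d (w J) = 0 := by
        rcases neg_one_pow_eq_or R J.card with h | h
        · rwa [h, one_smul] at h2
        · rwa [h, neg_one_smul, neg_eq_zero] at h2
      have h4 : w J ∈ locSub x J (V (t - J.card)) := hw.2 J trivial
      rw [show t - J.card = c by omega] at h4
      exact hC.exists_cocycle hA hx h4 (hwg J trivial) h3
    · intro I hI
      have : (I.card : ℤ) + 1 = J.card := by exact_mod_cast hI
      exact hsupp I (by omega)
  choose! ζ hζg hζ using h1
  set ζ₀ : CechCochain x Z := fun J => if (J.card : ℤ) = i then ζ J else 0 with hζ₀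
  have h0 : ∀ J : Finset ι, (J.card : ℤ) ≠ i → ζ₀ J = 0 := fun J hJ => if_neg hJ
  refine ⟨cechMap x quot ζ₀, ⟨?_, fun J hJ => by rw [cechMap_apply, h0 J hJ, map_zero]⟩, ?_, ζ₀, h0,
    rfl, fun J hJ => ?_⟩
  · change cechD x N _ = 0
    rw [cechD_cechMap]
    funext J
    rw [cechMap_apply, Pi.zero_apply]
    by_cases hJ : (J.card : ℤ) = i + 1
    · have h4 : w J ∈ locSub x J (V (t - J.card)) := hw.2 J trivial
      rw [show t - J.card = c - 1 by omega] at h4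
      refine hC.quot_eq_zero_of_boundary (y := -((-1 : R) ^ J.card • w J))
        (neg_mem (Submodule.smul_mem _ _ h4)) ?_
      have h5 := hDw J
      rw [totD_apply, cechD_congr (c' := cechMap x incl ζ₀), cechD_cechMap, cechMap_apply] at h5
      · rw [map_neg, map_smul, eq_comm]
        exact eq_neg_of_add_eq_zero_left h5
      · intro I hI
        have : (I.card : ℤ) + 1 = J.card := by exact_mod_cast hI
        rw [cechMap_apply, hζ₀]
        dsimp only
        rw [if_pos (by omega), hζ I (by omega)]
    · rw [cechD_eq_zero, map_zero]
      intro I hI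
      have : (I.card : ℤ) + 1 = J.card := by exact_mod_cast hI
      exact h0 I (by omega)
  · refine isGradedHom_cechMap (hC.gradedSMul_cocycles hA) hC.quot_graded γ ζ₀ fun J _ => ?_
    by_cases hJ : (J.card : ℤ) = i
    · rw [hζ₀]
      dsimp only
      rw [if_pos hJ]
      exact hζg J hJ
    · rw [h0 J hJ]
      exact (cechLocalGrading 𝒜 x 𝒵 J γ).zero_mem
  · dsimp only
    by_cases hJ' : (J.card : ℤ) = i
    · rw [hζ₀]
      dsimp only
      rw [if_pos hJ', hζ J hJ']
    · rw [h0 J hJ', map_zero, hsupp J (by omega)]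

end IsCohomologyAt

end CohomologyAt

/-! ### The exact sequence comparing local cohomology and hypercohomology -/

section SubquotientMap

variable {K Γ R A A' : Type*} [Field K] [CommRing R] [Algebra K R] [AddCommGroup Γ] [DecidableEq Γ]
  {𝒜 : Γ → Submodule K R} [GradedAlgebra 𝒜] [AddCommGroup A] [Module R A] [AddCommGroup A']
  [Module R A'] {𝒢 : Γ → AddSubgroup A} {𝒢' : Γ → AddSubgroup A'} {Z B : Submodule R A}
  {Z' B' : Submodule R A'}

/-- A relation between homogeneous cycles which is total and takes boundaries to boundaries induces
a graded map of subquotients. -/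
theorem exists_subquotientMap (h𝒢 : GradedSMul 𝒜 𝒢) (h𝒢' : GradedSMul 𝒜 𝒢')
    (hH : IsGrading (subquotientGrading 𝒢 Z B)) (Rel : Submodule R (A × A'))
    (tot : ∀ γ, ∀ z ∈ Z, z ∈ 𝒢 γ → ∃ z' ∈ Z', z' ∈ 𝒢' γ ∧ (z, z') ∈ Rel)
    (uniq : ∀ γ, ∀ z ∈ Z, z ∈ 𝒢 γ → ∀ z' ∈ Z', z' ∈ 𝒢' γ → (z, z') ∈ Rel → z ∈ B → z' ∈ B') :
    ∃ f : Subquotient Z B →ₗ[R] Subquotient Z' B',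
      IsGradedHom (subquotientGrading 𝒢 Z B) (subquotientGrading 𝒢' Z' B') f ∧
      ∀ γ (z : Z) (z' : Z'), (z : A) ∈ 𝒢 γ → (z' : A') ∈ 𝒢' γ → ((z : A), (z' : A')) ∈ Rel →
        f ((B.submoduleOf Z).mkQ z) = (B'.submoduleOf Z').mkQ z' := by
  obtain ⟨f, hf⟩ := exists_linearMap_of_rel 𝒜
    (𝒬 := fun γ => (𝒢 γ).comap Z.subtype.toAddMonoidHom)
    (𝒬' := fun γ => (𝒢' γ).comap Z'.subtype.toAddMonoidHom) hH
    (fun β γ p hp z hz => h𝒢 β γ p hp _ hz) (fun β γ p hp z hz => h𝒢' β γ p hp _ hz)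
    (B.submoduleOf Z).mkQ (B'.submoduleOf Z').mkQ (fun γ h => Iff.rfl)
    (Rel.comap (Z.subtype.prodMap Z'.subtype))
    (fun γ z hz => by
      obtain ⟨z', hz', hg, hr⟩ := tot γ z z.2 hz
      exact ⟨⟨z', hz'⟩, hg, hr⟩)
    (fun γ z hz z' hz' hr h0 => by
      rw [subquotient_mk_eq_zero] at h0 ⊢
      exact uniq γ z z.2 hz z' z'.2 hz' hr h0)
  refine ⟨f, ?_, fun γ z z' hz hz' hr => hf γ z hz z' hz' hr⟩
  rintro γ _ ⟨z, hz, rfl⟩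
  obtain ⟨z', hz', hg, hr⟩ := tot γ z z.2 hz
  exact ⟨⟨z', hz'⟩, hg, (hf γ z hz ⟨z', hz'⟩ hg hr).symm⟩

end SubquotientMap

section ExactSequence

variable {ι K Γ R A Z N : Type*} [LinearOrder ι] [Finite ι] [Field K] [CommRing R] [Algebra K R]
  [AddCommGroup Γ] [DecidableEq Γ] {𝒜 : Γ → Submodule K R} [GradedAlgebra 𝒜] [AddCommGroup A]
  [Module R A] [AddCommGroup Z] [Module R Z] [AddCommGroup N] [Module R N]
  {x : ι → R} {𝒢 : Γ → AddSubgroup A} {V : ℤ → Submodule R A} {d : A →ₗ[R] A}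
  {𝒵 : Γ → AddSubgroup Z} {𝒩 : Γ → AddSubgroup N} {incl : Z →ₗ[R] A} {quot : Z →ₗ[R] N} {c : ℤ}
  {Z' N' : Type*} [AddCommGroup Z'] [Module R Z'] [AddCommGroup N'] [Module R N']
  {𝒵' : Γ → AddSubgroup Z'} {𝒩' : Γ → AddSubgroup N'} {incl' : Z' →ₗ[R] A} {quot' : Z' →ₗ[R] N'}
  {c' : ℤ}

theorem cechCoboundary_zero {z : CechCochain x N} (hz : z ∈ cechCoboundary x N 0) : z = 0 := by
  obtain ⟨b, hb, rfl⟩ := hz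
  have : b = 0 := funext fun J => hb J (by omega)
  rw [this, map_zero]

theorem mem_cechDen_empty (s : cechDen x ∅) : s = 1 := by
  have h := s.2
  simp only [cechDen, Finset.coe_empty, Set.image_empty, Submonoid.closure_empty,
    Submonoid.mem_bot] at h
  exact Subtype.ext h

/-- A variant of `exists_clear` in which the components of lowest Čech degree `p` are known to be
boundaries, so that exactness is needed only in Čech degrees `> p`. -/
theorem GradedComplex.exists_clear_of_boundary (hA : GradedComplex 𝒜 𝒢 V d) (k : ℕ) {t p : ℤ}
    {γ : Γ} {w : CechCochain x A} (hw : w ∈ totDeg x V t) (hwg : w ∈ cechGrading 𝒜 x 𝒢 γ)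
    (hsupp : ∀ J : Finset ι, (J.card : ℤ) < p → w J = 0)
    (hD : ∀ J : Finset ι, (J.card : ℤ) < p + 1 + k → totD x d w J = 0)
    (hbd : ∀ J : Finset ι, (J.card : ℤ) = p → ∃ y ∈ locSub x J (V (t - p - 1)),
      y ∈ cechLocalGrading 𝒜 x 𝒢 J γ ∧ locMap x J d y = w J)
    (hex : ∀ J : Finset ι, p + 1 ≤ J.card → (J.card : ℤ) < p + 1 + k →
      LocExact 𝒜 x 𝒢 d V J (t - J.card) γ) :
    ∃ v ∈ totDeg x V (t - 1), v ∈ cechGrading 𝒜 x 𝒢 γ ∧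
      ∀ J : Finset ι, (J.card : ℤ) < p + 1 + k → (w - totD x d v) J = 0 := by
  obtain ⟨v, hv, hvg, -, hv1⟩ := hA.exists_clear_step hsupp hbd
  have hDv : totD x d v ∈ totDeg x V t := by
    have := hA.totD_mem hv
    rwa [sub_add_cancel] at this
  obtain ⟨v', hv', hvg', -, hv1'⟩ := hA.exists_clear k (p := p + 1) (c := w - totD x d v)
    (sub_mem hw hDv) (sub_mem hwg (hA.isGradedHom_totD γ v hvg)) hv1
    (fun J hJ => by rw [map_sub, totD_totD hA.sq, sub_zero]; exact hD J hJ) hex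
  refine ⟨v + v', add_mem hv hv', add_mem hvg hvg', fun J hJ => ?_⟩
  rw [map_add, ← sub_sub]
  exact hv1' J hJ

theorem GradedComplex.gradedSMul_cochain (hA : GradedComplex 𝒜 𝒢 V d) :
    GradedSMul 𝒜 (cechGrading 𝒜 x 𝒢) := gradedSMul_cechCochain hA.smul

theorem mk_eq_of_sub_mem {Q : Type*} [AddCommGroup Q] [Module R Q] {Z B : Submodule R Q} {a b : Q}
    (ha : a ∈ Z) (hb : b ∈ Z) (h : a - b ∈ B) :
    (B.submoduleOf Z).mkQ ⟨a, ha⟩ = (B.submoduleOf Z).mkQ ⟨b, hb⟩ := by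
  rw [← sub_eq_zero, ← map_sub, subquotient_mk_eq_zero]
  exact h

namespace IsCohomologyAt

variable (hC : IsCohomologyAt 𝒢 V d c 𝒵 𝒩 incl quot) (hA : GradedComplex 𝒜 𝒢 V d)
  (hx : ∀ i, ∃ β, x i ∈ 𝒜 β) (hN : GradedSMul 𝒜 𝒩) (hNg : IsGrading 𝒩)
  (hC' : IsCohomologyAt 𝒢 V d c' 𝒵' 𝒩' incl' quot') (hN' : GradedSMul 𝒜 𝒩') (hNg' : IsGrading 𝒩')

include hC hA hx hN hNg in
/-- The map from local cohomology of the cohomology module in degree `c`, below which the complex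
is exact, to hypercohomology. It is bijective in the internal degrees where the localized complex
is exact in the relevant range above `c`. -/
theorem exists_hyperCohMap {i t : ℤ} (ht : t = c + i)
    (hex : ∀ γ (J : Finset ι) (j : ℤ), j < c → LocExact 𝒜 x 𝒢 d V J j γ) :
    ∃ g : LocalCoh x N i →ₗ[R] HyperCoh x d V t,
      IsGradedHom (localCohGrading 𝒜 x 𝒩 i) (hyperGrading 𝒜 x 𝒢 d V t) g ∧
      (∀ γ (z : cechCocycle x N i) (w : totCocycle x d V t), (z : CechCochain x N) ∈
        cechGrading 𝒜 x 𝒩 γ → (w : CechCochain x A) ∈ cechGrading 𝒜 x 𝒢 γ →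
        ((z : CechCochain x N), (w : CechCochain x A)) ∈ cohRel x incl quot i →
        g (Submodule.mkQ _ z) = Submodule.mkQ _ w) ∧
      (∀ γ, (∀ (J : Finset ι) (j : ℤ), c < j → j < c + i → LocExact 𝒜 x 𝒢 d V J j γ) →
        ∀ a ∈ localCohGrading 𝒜 x 𝒩 i γ, g a = 0 → a = 0) ∧
      (∀ γ, (∀ (J : Finset ι) (j : ℤ), c < j → j ≤ c + i → LocExact 𝒜 x 𝒢 d V J j γ) →
        ∀ b ∈ hyperGrading 𝒜 x 𝒢 d V t γ, ∃ a ∈ localCohGrading 𝒜 x 𝒩 i γ, g a = b) := by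
  obtain ⟨g, hg, hrel⟩ := exists_subquotientMap (𝒜 := 𝒜) (Z := cechCocycle x N i)
    (B := cechCoboundary x N i) (Z' := totCocycle x d V t) (B' := totCoboundary x d V t)
    (gradedSMul_cechCochain hN) hA.gradedSMul_cochain (isGrading_localCoh hx hNg hN i)
    (cohRel x incl quot i)
    (fun γ z hz hzg => hC.exists_extension hA hx hN ht (hex γ) hz hzg)
    (fun γ z hz hzg w hw hwg hr hzB => hC.mem_totCoboundary hA hx hN ht hNg (hex γ) hzg hw hwg hr hzB)
  refine ⟨g, hg, hrel, ?_, ?_⟩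
  · rintro γ hexγ _ ⟨z, hz, rfl⟩ h0
    change g (Submodule.mkQ _ z) = 0 at h0
    change Submodule.mkQ _ z = 0
    obtain ⟨w, hw, hwg, hr⟩ := hC.exists_extension hA hx hN ht (hex γ) z.2 hz
    rw [hrel γ z ⟨w, hw⟩ hz hwg hr, subquotient_mk_eq_zero] at h0
    obtain ⟨v, hv, hvg, hDv⟩ := hA.exists_homogeneous_preimage hx hwg h0
    obtain ⟨ζ, hζ0, hζ, hζw⟩ := hr
    have hw0 : ∀ J : Finset ι, (J.card : ℤ) < i → w J = 0 := fun J hJ => by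
      have := hζw J hJ.le
      dsimp only at this
      rw [this, hζ0 J hJ.ne, map_zero]
    -- If `w` is the coboundary of `v`, then clearing the components of `v` in Čech degrees `< i -
    -- 1` shows that `z` is a Čech coboundary.
    obtain ⟨u, hu, hug, -, hu1⟩ := hA.exists_clear (i - 1).toNat (p := 0) hv hvg
      (fun J hJ => by omega) (fun J hJ => by rw [hDv]; exact hw0 J (by omega))
      (fun J hJ hJ' => hexγ J _ (by omega) (by omega))
    have hDu : totD x d u ∈ totDeg x V (t - 1) := by
      have := hA.totD_mem hu
      rwa [sub_add_cancel] at this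
    rw [subquotient_mk_eq_zero]
    refine hC.mem_cechCoboundary hA hx hN ht (v := v - totD x d u) (sub_mem hv hDu)
      (sub_mem hvg (hA.isGradedHom_totD γ u hug)) (fun J hJ => hu1 J (by omega)) ?_
    rw [map_sub, totD_totD hA.sq, sub_zero, hDv]
    exact ⟨ζ, hζ0, hζ, hζw⟩
  · rintro γ hexγ _ ⟨w, hw, rfl⟩
    -- Clearing the components of `w` in Čech degrees `< i` does not change its class, and the
    -- result corresponds to a Čech cocycle.
    obtain ⟨u, hu, hug, -, hu1⟩ := hA.exists_clear i.toNat (p := 0) w.2.2 hw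
      (fun J hJ => by omega) (fun J hJ => by rw [LinearMap.mem_ker.1 w.2.1]; rfl)
      (fun J hJ hJ' => hexγ J _ (by omega) (by omega))
    have hDu : totD x d u ∈ totDeg x V t := by
      have := hA.totD_mem hu
      rwa [sub_add_cancel] at this
    have hwu : (w : CechCochain x A) - totD x d u ∈ totCocycle x d V t :=
      ⟨by change totD x d _ = 0
          rw [map_sub, totD_totD hA.sq, LinearMap.mem_ker.1 w.2.1, sub_zero], sub_mem w.2.2 hDu⟩
    have hwug : (w : CechCochain x A) - totD x d u ∈ cechGrading 𝒜 x 𝒢 γ :=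
      sub_mem (show (w : CechCochain x A) ∈ cechGrading 𝒜 x 𝒢 γ from hw)
        (hA.isGradedHom_totD γ u hug)
    obtain ⟨z, hz, hzg, hr⟩ := hC.exists_restriction hA hx hN ht hwu hwug
      (fun J hJ => hu1 J (by omega))
    refine ⟨_, ⟨⟨z, hz⟩, hzg, rfl⟩, (hrel γ ⟨z, hz⟩ ⟨_, hwu⟩ hzg hwug hr).trans ?_⟩
    refine mk_eq_of_sub_mem _ _ ?_
    rw [sub_sub_cancel_left]
    exact neg_mem ⟨u, hu, rfl⟩

include hC' hA hx hN' in
/-- The edge map from hypercohomology to the sections with support of the cohomology. -/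
theorem exists_edgeMap :
    ∃ h : HyperCoh x d V c' →ₗ[R] LocalCoh x N' 0,
      IsGradedHom (hyperGrading 𝒜 x 𝒢 d V c') (localCohGrading 𝒜 x 𝒩' 0) h ∧
      ∀ γ (w : totCocycle x d V c') (z : cechCocycle x N' 0), (w : CechCochain x A) ∈
        cechGrading 𝒜 x 𝒢 γ → (z : CechCochain x N') ∈ cechGrading 𝒜 x 𝒩' γ →
        ((z : CechCochain x N'), (w : CechCochain x A)) ∈ cohRel x incl' quot' 0 →
        h (Submodule.mkQ _ w) = Submodule.mkQ _ z := by
  have ht : c' = c' + 0 := (add_zero _).symm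
  refine exists_subquotientMap (𝒜 := 𝒜) (Z := totCocycle x d V c') (B := totCoboundary x d V c')
    (Z' := cechCocycle x N' 0) (B' := cechCoboundary x N' 0)
    hA.gradedSMul_cochain (gradedSMul_cechCochain hN') (hA.isGrading_hyperCoh hx c')
    ((cohRel x incl' quot' 0).comap (LinearEquiv.prodComm R _ _).toLinearMap) ?_ ?_
  · intro γ w hw hwg
    obtain ⟨z, hz, hzg, hr⟩ := hC'.exists_restriction hA hx hN' ht hw hwg (fun J hJ => by omega)
    exact ⟨z, hz, hzg, hr⟩
  · intro γ w hw hwg z hz hzg hr hwB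
    obtain ⟨v, hv, hvg, rfl⟩ := hA.exists_homogeneous_preimage hx hwg hwB
    exact hC'.mem_cechCoboundary hA hx hN' ht hv hvg (fun J hJ => by omega) hr

include hC hA hx hN hNg hC' hN' hNg' in
/-- The comparison map `g` and the edge map `h` form an exact sequence if the localized complex is
exact between the two degrees, for non-trivial localizations. -/
theorem exists_exact_edge {i : ℤ} (hi : 1 ≤ i) (hc : c' = c + i)
    (hex : ∀ γ (J : Finset ι) (j : ℤ), j < c → LocExact 𝒜 x 𝒢 d V J j γ)
    (hex' : ∀ γ (J : Finset ι) (j : ℤ), J.Nonempty → c < j → j < c + i →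
      LocExact 𝒜 x 𝒢 d V J j γ)
    {g : LocalCoh x N i →ₗ[R] HyperCoh x d V c'}
    (hrel : ∀ γ (z : cechCocycle x N i) (w : totCocycle x d V c'), (z : CechCochain x N) ∈
        cechGrading 𝒜 x 𝒩 γ → (w : CechCochain x A) ∈ cechGrading 𝒜 x 𝒢 γ →
        ((z : CechCochain x N), (w : CechCochain x A)) ∈ cohRel x incl quot i →
        g (Submodule.mkQ _ z) = Submodule.mkQ _ w) :
    ∃ h : HyperCoh x d V c' →ₗ[R] LocalCoh x N' 0,
      IsGradedHom (hyperGrading 𝒜 x 𝒢 d V c') (localCohGrading 𝒜 x 𝒩' 0) h ∧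
      Function.Exact g h := by
  obtain ⟨h, hh, hhrel⟩ := hC'.exists_edgeMap hA hx hN'
  refine ⟨h, hh, exact_of_homogeneous (isGrading_localCoh hx hNg hN i) (hA.isGrading_hyperCoh hx c')
    (isGrading_localCoh hx hNg' hN' 0) hh ?_ ?_⟩
  · rintro γ _ ⟨z, hz, rfl⟩
    change h (g (Submodule.mkQ _ z)) = 0
    obtain ⟨w, hw, hwg, hr⟩ := hC.exists_extension hA hx hN hc (hex γ) z.2 hz
    rw [hrel γ z ⟨w, hw⟩ hz hwg hr]
    obtain ⟨z', hz', hzg', hr'⟩ := hC'.exists_restriction hA hx hN' (add_zero c').symm hw hwg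
      (fun J hJ => by omega)
    rw [hhrel γ ⟨w, hw⟩ ⟨z', hz'⟩ hwg hzg' hr', subquotient_mk_eq_zero]
    -- The edge map only depends on the component at `∅`, which vanishes for the cocycles in the
    -- image of `g` because `i ≥ 1`.
    obtain ⟨ζ, hζ0, -, hζw⟩ := hr
    obtain ⟨ζ', hζ0', hζ', hζw'⟩ := hr'
    have h1 := hζw ∅ (by simp; omega)
    have h2 := hζw' ∅ (by simp)
    rw [hζ0 ∅ (by simp; omega), map_zero] at h1
    rw [h1] at h2
    have h3 : ζ' ∅ = 0 := locMap_injective hC'.incl_injective (by rw [← h2, map_zero])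
    have h4 : ζ' = 0 := by
      funext J
      by_cases hJ : J = ∅
      · rw [hJ, h3]; rfl
      · exact hζ0' J (by simpa using hJ)
    dsimp only at hζ' ⊢
    rw [← hζ', h4, map_zero]
    exact zero_mem _
  · rintro γ _ ⟨w, hwg, rfl⟩ h0
    change h (Submodule.mkQ _ w) = 0 at h0
    obtain ⟨z', hz', hzg', hr'⟩ := hC'.exists_restriction hA hx hN' (add_zero c').symm w.2 hwg
      (fun J hJ => by omega)
    rw [hhrel γ w ⟨z', hz'⟩ hwg hzg' hr', subquotient_mk_eq_zero] at h0
    obtain ⟨ζ', hζ0', hζ', hζw'⟩ := hr'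
    dsimp only at h0 hζ' hζw'
    -- There are no coboundaries in degree `0`, so the component of `w` at `∅` is a boundary. Once
    -- it is removed, the remaining components in Čech degrees `< i` can be cleared by exactness of
    -- the non-trivial localizations.
    rw [cechCoboundary_zero h0] at hζ'
    obtain ⟨u, hu, hug, hu1⟩ := hA.exists_clear_of_boundary (i - 1).toNat (p := 0) w.2.2 hwg
      (fun J hJ => by omega) (fun J hJ => by rw [LinearMap.mem_ker.1 w.2.1]; rfl)
      (fun J hJ => by
        have h1 := hζw' J hJ.le
        have h2 : (w : CechCochain x A) J ∈ cechLocalGrading 𝒜 x 𝒢 J γ := hwg J trivial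
        rw [h1] at h2 ⊢
        rw [sub_zero]
        exact hC'.exists_boundary hA hx h2 (by rw [← cechMap_apply, hζ']; rfl))
      (fun J hJ hJ' => hex' γ J _ (Finset.card_pos.1 (by omega)) (by omega) (by omega))
    have hDu : totD x d u ∈ totDeg x V c' := by
      have := hA.totD_mem hu
      rwa [sub_add_cancel] at this
    have hwu : (w : CechCochain x A) - totD x d u ∈ totCocycle x d V c' :=
      ⟨by change totD x d _ = 0
          rw [map_sub, totD_totD hA.sq, LinearMap.mem_ker.1 w.2.1, sub_zero], sub_mem w.2.2 hDu⟩
    have hwug : (w : CechCochain x A) - totD x d u ∈ cechGrading 𝒜 x 𝒢 γ :=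
      sub_mem (show (w : CechCochain x A) ∈ cechGrading 𝒜 x 𝒢 γ from hwg)
        (hA.isGradedHom_totD γ u hug)
    obtain ⟨z, hz, hzg, hr⟩ := hC.exists_restriction hA hx hN hc hwu hwug
      (fun J hJ => hu1 J (by omega))
    refine ⟨Submodule.mkQ _ ⟨z, hz⟩, (hrel γ ⟨z, hz⟩ ⟨_, hwu⟩ hzg hwug hr).trans ?_⟩
    refine mk_eq_of_sub_mem _ _ ?_
    rw [sub_sub_cancel_left]
    exact neg_mem ⟨u, hu, rfl⟩

include hC hA hx hN hNg hC' in
/-- The connecting map `f` to the local cohomology of `N`, whose image is the kernel of the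
comparison map `g`. It maps the class of a cocycle `a` of degree `c + i - 1` to `z` if the cochain
with the single component `a`, of Čech degree `0`, can be completed to a cochain whose coboundary
corresponds to `z`. -/
theorem exists_exact_connecting {i t : ℤ} (hi : 2 ≤ i) (ht : t = c + i) (hc : c' = c + i - 1)
    (hNg' : IsGrading 𝒩')
    (hex : ∀ γ (J : Finset ι) (j : ℤ), j < c → LocExact 𝒜 x 𝒢 d V J j γ)
    (hex' : ∀ γ (J : Finset ι) (j : ℤ), J.Nonempty → c < j → j < c + i →
      LocExact 𝒜 x 𝒢 d V J j γ)
    {g : LocalCoh x N i →ₗ[R] HyperCoh x d V t}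
    (hg : IsGradedHom (localCohGrading 𝒜 x 𝒩 i) (hyperGrading 𝒜 x 𝒢 d V t) g)
    (hrel : ∀ γ (z : cechCocycle x N i) (w : totCocycle x d V t), (z : CechCochain x N) ∈
        cechGrading 𝒜 x 𝒩 γ → (w : CechCochain x A) ∈ cechGrading 𝒜 x 𝒢 γ →
        ((z : CechCochain x N), (w : CechCochain x A)) ∈ cohRel x incl quot i →
        g (Submodule.mkQ _ z) = Submodule.mkQ _ w) :
    ∃ f : N' →ₗ[R] LocalCoh x N i,
      IsGradedHom 𝒩' (localCohGrading 𝒜 x 𝒩 i) f ∧ Function.Exact f g := by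
  classical
  let Rel : Submodule R (Z' × cechCocycle x N i) :=
    { carrier := {p | ∃ v ∈ totDeg x V (t - 1), v ∅ = cechMk x ∅ 1 (incl' p.1) ∧
        ((p.2 : CechCochain x N), totD x d v) ∈ cohRel x incl quot i}
      zero_mem' := ⟨0, zero_mem _, by simp, by
        rw [map_zero]; exact (cohRel x incl quot i).zero_mem⟩
      add_mem' := by
        rintro _ _ ⟨v, h1, h2, h3⟩ ⟨v', h1', h2', h3'⟩
        refine ⟨v + v', add_mem h1 h1', ?_, ?_⟩
        · rw [Pi.add_apply, h2, h2', Prod.fst_add, map_add, map_add]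
        · rw [map_add]
          exact (cohRel x incl quot i).add_mem h3 h3'
      smul_mem' := by
        rintro r _ ⟨v, h1, h2, h3⟩
        refine ⟨r • v, Submodule.smul_mem _ _ h1, ?_, ?_⟩
        · rw [Pi.smul_apply, h2, Prod.smul_fst, map_smul, map_smul]
        · rw [map_smul]
          exact (cohRel x incl quot i).smul_mem r h3 }
  have tot : ∀ γ, ∀ a ∈ 𝒵' γ, ∃ z : cechCocycle x N i, (z : CechCochain x N) ∈ cechGrading 𝒜 x 𝒩 γ ∧
      ∃ v ∈ totDeg x V (t - 1), v ∈ cechGrading 𝒜 x 𝒢 γ ∧ v ∅ = cechMk x ∅ 1 (incl' a) ∧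
        ((z : CechCochain x N), totD x d v) ∈ cohRel x incl quot i := by
    intro γ a ha
    -- The total differential of `v₀` is supported in Čech degree `1`, because `a` is a cocycle; its
    -- components in Čech degrees from `1` to `i - 1` can be cleared.
    set v₀ : CechCochain x A := Pi.single ∅ (cechMk x ∅ 1 (incl' a)) with hv₀
    have hv₀' : ∀ J : Finset ι, J ≠ ∅ → v₀ J = 0 := fun J hJ => Pi.single_eq_of_ne hJ _
    have hv₀'' : v₀ ∅ = cechMk x ∅ 1 (incl' a) := Pi.single_eq_same _ _
    have hV : v₀ ∈ totDeg x V (t - 1) := by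
      intro J _
      by_cases hJ : J = ∅
      · subst hJ
        rw [hv₀'']
        have := cechMk_mem_locSub (x := x) (J := ∅) (hC'.incl_mem a) 1
        rw [hc, ← ht] at this
        change _ ∈ locSub x ∅ (V (t - 1 - ((∅ : Finset ι).card : ℤ)))
        simpa using this
      · rw [hv₀' J hJ]
        exact zero_mem _
    have hVg : v₀ ∈ cechGrading 𝒜 x 𝒢 γ := by
      intro J _
      by_cases hJ : J = ∅
      · subst hJ
        rw [hv₀'']
        exact cechMk_mem_grading (β := 0) SetLike.GradedOne.one_mem
          (by rw [add_zero]; exact (hC'.mem_iff γ a).1 ha)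
      · rw [hv₀' J hJ]
        exact (cechLocalGrading 𝒜 x 𝒢 J γ).zero_mem
    have hDV : totD x d v₀ ∈ totDeg x V t := by
      have := hA.totD_mem hV
      rwa [sub_add_cancel] at this
    obtain ⟨u, hu, hug, hu0, hu1⟩ := hA.exists_clear (i - 1).toNat (p := 1) hDV
      (hA.isGradedHom_totD γ _ hVg) (fun J hJ => by
        have hJ0 : J = ∅ := Finset.card_eq_zero.1 (by omega)
        subst hJ0
        rw [totD_apply, hv₀'', locMap_cechMk, hC'.d_incl, map_zero, smul_zero, add_zero,
          cechD_apply, Finset.sum_empty])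
      (fun J hJ => by rw [totD_totD hA.sq]; rfl)
      (fun J hJ hJ' => hex' γ J _ (Finset.card_pos.1 (by omega)) (by omega) (by omega))
    have hDu : totD x d u ∈ totDeg x V t := by
      have := hA.totD_mem hu
      rwa [sub_add_cancel] at this
    have hcoc : totD x d (v₀ - u) ∈ totCocycle x d V t :=
      ⟨totD_totD hA.sq _, by rw [map_sub]; exact sub_mem hDV hDu⟩
    obtain ⟨z, hz, hzg, hr⟩ := hC.exists_restriction hA hx hN ht hcoc
      (hA.isGradedHom_totD γ _ (sub_mem hVg hug))
      (fun J hJ => by rw [map_sub]; exact hu1 J (by omega))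
    exact ⟨⟨z, hz⟩, hzg, v₀ - u, sub_mem hV hu, sub_mem hVg hug,
      by rw [Pi.sub_apply, hu0 ∅ (by simp), sub_zero, hv₀''], hr⟩
  have hgr := hA.isGrading_cochain hx
  have hgrZ := hC.isGrading_cocycles hA
  have hsZ := hC.gradedSMul_cocycles hA
  have hgrCZ := isGrading_cechCochain (x := x) hx hgrZ hsZ
  have hgrN := isGrading_cechCochain (x := x) hx hNg hN
  -- The cochain `v` of the relation need not be homogeneous, but it may be replaced by its
  -- homogeneous component.
  have hprojRel : ∀ γ (z : CechCochain x N) (w : CechCochain x A), z ∈ cechGrading 𝒜 x 𝒩 γ →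
      (z, w) ∈ cohRel x incl quot i → (z, hgr.proj γ w) ∈ cohRel x incl quot i := by
    rintro γ z w hz ⟨ζ, hζ0, hζ, hζw⟩
    dsimp only at hζ hζw
    have hloc := fun J => isGrading_cechLocal hx hgrZ hsZ (x := x) J
    have hpi : ∀ J, hgrCZ.proj γ ζ J = (hloc J).proj γ (ζ J) := fun J =>
      IsGrading.proj_pi hloc hgrCZ γ ζ J
    refine ⟨hgrCZ.proj γ ζ, fun J hJ => by rw [hpi, hζ0 J hJ, map_zero], ?_, fun J hJ => ?_⟩
    · have := hgrCZ.map_proj hgrN (cechMap x quot).toAddMonoidHom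
        (isGradedHom_cechMap hsZ hC.quot_graded) γ ζ
      refine this.trans ?_
      change hgrN.proj γ (cechMap x quot ζ) = z
      rw [hζ, hgrN.proj_of_mem hz]
    · dsimp only
      have hlocA := fun J => isGrading_cechLocal hx hA.grading hA.smul (x := x) J
      rw [hpi]
      refine (IsGrading.proj_pi hlocA hgr γ w J).trans ?_
      rw [hζw J hJ]
      exact ((hloc J).map_proj (hlocA J) (locMap x J incl).toAddMonoidHom
        (isGradedHom_locMap hsZ hC.incl_graded) γ (ζ J)).symm
  obtain ⟨f, hf⟩ := exists_linearMap_of_rel 𝒜 (𝒬 := 𝒵')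
    (𝒬' := fun γ => (cechGrading 𝒜 x 𝒩 γ).comap (cechCocycle x N i).subtype.toAddMonoidHom)
    (H' := LocalCoh x N i) hNg'
    (hC'.gradedSMul_cocycles hA) (fun β γ p hp z hz => gradedSMul_cechCochain hN β γ p hp _ hz)
    quot' (Submodule.mkQ _) (fun γ h => ⟨hC'.exists_quot γ h, by
      rintro ⟨z, hz, rfl⟩
      exact hC'.quot_graded γ z hz⟩) Rel
    (fun γ a ha => by
      obtain ⟨z, hz, v, hv, -, hv', hr⟩ := tot γ a ha
      exact ⟨z, hz, v, hv, hv', hr⟩)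
    (by
      rintro γ a ha z hz ⟨v, hv, hv0, hr⟩ h0
      rw [subquotient_mk_eq_zero]
      dsimp only at hv0 hr
      have hpi : ∀ J, hgr.proj γ v J = (isGrading_cechLocal hx hA.grading hA.smul J).proj γ (v J) :=
        fun J => IsGrading.proj_pi _ hgr γ v J
      have hDp : totD x d (hgr.proj γ v) = hgr.proj γ (totD x d v) :=
        hgr.map_proj hgr (totD x d).toAddMonoidHom hA.isGradedHom_totD γ v
      have hr' := hprojRel γ _ _ hz hr
      rw [← hDp] at hr'
      have hpv := hA.isHomog_totDeg hx _ γ v hv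
      have ha' : cechMk x ∅ 1 (incl' a) ∈ cechLocalGrading 𝒜 x 𝒢 ∅ γ :=
        cechMk_mem_grading (β := 0) SetLike.GradedOne.one_mem
          (by rw [add_zero]; exact (hC'.mem_iff γ a).1 ha)
      -- If `a` is a boundary, all components of `v` in Čech degrees `< i - 1` can be cleared, and
      -- `z` is a Čech coboundary.
      have hlow : ∀ J : Finset ι, (J.card : ℤ) < i → totD x d (hgr.proj γ v) J = 0 := by
        obtain ⟨ζ, hζ0, -, hζw⟩ := hr'
        intro J hJ
        have := hζw J hJ.le
        dsimp only at this
        rw [this, hζ0 J hJ.ne, map_zero]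
      obtain ⟨u, hu, hug, hu1⟩ := hA.exists_clear_of_boundary (i - 2).toNat (p := 0) hpv
        (hgr.proj_mem γ v) (fun J hJ => by omega) (fun J hJ => hlow J (by omega))
        (fun J hJ => by
          have hJ0 : J = ∅ := Finset.card_eq_zero.1 (by omega)
          subst hJ0
          rw [hpi, hv0, IsGrading.proj_of_mem _ ha', show t - 1 - 0 - 1 = c' - 1 by omega]
          have := hC'.exists_boundary hA hx (ζ := cechMk x ∅ 1 a) (γ := γ)
            (by rwa [locMap_cechMk]) (by rw [locMap_cechMk, h0, map_zero])
          rwa [locMap_cechMk] at this)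
        (fun J hJ hJ' => hex' γ J _ (Finset.card_pos.1 (by omega)) (by omega) (by omega))
      have hDu : totD x d u ∈ totDeg x V (t - 1) := by
        have := hA.totD_mem hu
        rwa [sub_add_cancel] at this
      refine hC.mem_cechCoboundary hA hx hN ht (v := hgr.proj γ v - totD x d u) (sub_mem hpv hDu)
        (sub_mem (hgr.proj_mem γ v) (hA.isGradedHom_totD γ u hug)) (fun J hJ => hu1 J (by omega)) ?_
      rwa [map_sub, totD_totD hA.sq, sub_zero])
  have hfγ : ∀ γ, ∀ a ∈ 𝒵' γ, ∀ z : cechCocycle x N i, (z : CechCochain x N) ∈ cechGrading 𝒜 x 𝒩 γ →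
      (a, z) ∈ Rel → f (quot' a) = Submodule.mkQ _ z := hf
  have hfg : IsGradedHom 𝒩' (localCohGrading 𝒜 x 𝒩 i) f := by
    intro γ b hb
    obtain ⟨a, ha, rfl⟩ := hC'.exists_quot γ b hb
    obtain ⟨z, hz, v, hv, -, hv', hr⟩ := tot γ a ha
    exact ⟨z, hz, (hfγ γ a ha z hz ⟨v, hv, hv', hr⟩).symm⟩
  refine ⟨f, hfg, exact_of_homogeneous hNg' (isGrading_localCoh hx hNg hN i)
    (hA.isGrading_hyperCoh hx t) hg ?_ ?_⟩
  · intro γ b hb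
    obtain ⟨a, ha, rfl⟩ := hC'.exists_quot γ b hb
    obtain ⟨z, hz, v, hv, hvg, hv', hr⟩ := tot γ a ha
    have hcoc : totD x d v ∈ totCocycle x d V t := ⟨totD_totD hA.sq _, by
      have := hA.totD_mem hv
      rwa [sub_add_cancel] at this⟩
    rw [hfγ γ a ha z hz ⟨v, hv, hv', hr⟩,
      hrel γ z ⟨_, hcoc⟩ hz (hA.isGradedHom_totD γ v hvg) hr, subquotient_mk_eq_zero]
    exact ⟨v, hv, rfl⟩
  · rintro γ _ ⟨z, hz, rfl⟩ h0
    change g (Submodule.mkQ _ z) = 0 at h0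
    obtain ⟨w, hw, hwg, hr⟩ := hC.exists_extension hA hx hN ht (hex γ) z.2 hz
    rw [hrel γ z ⟨w, hw⟩ hz hwg hr, subquotient_mk_eq_zero] at h0
    -- If `w` is the coboundary of `v`, then the component of `v` at `∅` is a cocycle of the
    -- complex, because `w` has no component there. Its class maps to `z`.
    obtain ⟨v, hv, hvg, hDv⟩ := hA.exists_homogeneous_preimage hx hwg h0
    have hv0 : locMap x ∅ d (v ∅) = 0 := by
      obtain ⟨ζ, hζ0, -, hζw⟩ := hr
      have h1 := hζw ∅ (by simp; omega)
      dsimp only at h1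
      rw [hζ0 ∅ (by simp; omega), map_zero, ← hDv, totD_apply, cechD_apply, Finset.sum_empty,
        zero_add, Finset.card_empty, pow_zero, one_smul] at h1
      exact h1
    have hvV : v ∅ ∈ locSub x ∅ (V c') := by
      have := hv ∅ trivial
      change _ ∈ locSub x ∅ (V (t - 1 - ((∅ : Finset ι).card : ℤ))) at this
      rwa [Finset.card_empty, show t - 1 - ((0 : ℕ) : ℤ) = c' by push_cast; omega] at this
    obtain ⟨ζ, hζg, hζ⟩ := hC'.exists_cocycle hA hx hvV (hvg ∅ trivial) hv0
    obtain ⟨s, a, rfl⟩ := exists_cechMk ζ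
    rw [mem_cechDen_empty s] at hζ hζg
    have hgrZ' := hC'.isGrading_cocycles hA
    have hp := (hgrZ'.map_proj (isGrading_cechLocal hx hgrZ' (hC'.gradedSMul_cocycles hA) ∅)
      (cechMk x ∅ 1).toAddMonoidHom (fun γ z hz => cechMk_mem_grading (β := 0)
        SetLike.GradedOne.one_mem (by rwa [add_zero])) γ a).trans
      (IsGrading.proj_of_mem _ hζg)
    change cechMk x ∅ 1 (hgrZ'.proj γ a) = cechMk x ∅ 1 a at hp
    rw [← hp, locMap_cechMk] at hζ
    exact ⟨_, hfγ γ _ (hgrZ'.proj_mem γ a) z hz ⟨v, hv, hζ.symm, by rw [hDv]; exact hr⟩⟩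

end IsCohomologyAt

end ExactSequence

/-! ### Laurent expansions of fractions with monomial denominators -/

section Laurent

variable (K ι : Type*) [Field K]

/-- The ring of Laurent polynomials in the variables `ι`. -/
def Laurent : Type _ := AddMonoidAlgebra K (ι → ℤ)

instance : CommRing (Laurent K ι) := inferInstanceAs (CommRing (AddMonoidAlgebra K (ι → ℤ)))

variable {ι} in
/-- A natural exponent, viewed as an integral one. -/
def intExp : (ι →₀ ℕ) →+ (ι → ℤ) where
  toFun a i := a i
  map_zero' := rfl
  map_add' a b := funext fun i => by simp

theorem intExp_apply {ι : Type*} (a : ι →₀ ℕ) (i : ι) : intExp a i = a i := rfl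

theorem intExp_injective {ι : Type*} : Function.Injective (intExp (ι := ι)) := fun _ _ h =>
  Finsupp.ext fun i => Nat.cast_injective (R := ℤ) (congrFun h i)

instance : Algebra (MvPolynomial ι K) (Laurent K ι) :=
  (AddMonoidAlgebra.mapDomainRingHom K (intExp (ι := ι)) :
    MvPolynomial ι K →+* AddMonoidAlgebra K (ι → ℤ)).toAlgebra

variable {K ι}

/-- The Laurent monomial with exponent `u` and coefficient `a`. -/
def lmono (u : ι → ℤ) (a : K) : Laurent K ι := AddMonoidAlgebra.single u a

/-- The coefficient of a Laurent polynomial. -/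
def lcoeff (u : ι → ℤ) : Laurent K ι →+ K where
  toFun p := AddMonoidAlgebra.coeff p u
  map_zero' := rfl
  map_add' _ _ := rfl

theorem lcoeff_lmono [DecidableEq (ι → ℤ)] (u v : ι → ℤ) (a : K) :
    lcoeff u (lmono v a) = if v = u then a else 0 :=
  Finsupp.single_apply

theorem lcoeff_ext {p q : Laurent K ι} (h : ∀ u, lcoeff u p = lcoeff u q) : p = q :=
  AddMonoidAlgebra.ext (Finsupp.ext h)

theorem algebraMap_monomial (a : ι →₀ ℕ) (r : K) :
    algebraMap (MvPolynomial ι K) (Laurent K ι) (monomial a r) = lmono (intExp a) r :=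
  AddMonoidAlgebra.mapDomain_single ..

theorem lmono_mul_lmono (u v : ι → ℤ) (a b : K) :
    lmono u a * lmono v b = lmono (u + v) (a * b) := AddMonoidAlgebra.single_mul_single ..

theorem lmono_zero_one : lmono 0 1 = (1 : Laurent K ι) := rfl

theorem lcoeff_lmono_mul (u v : ι → ℤ) (p : Laurent K ι) :
    lcoeff u (lmono v 1 * p) = lcoeff (u - v) p := by
  have := AddMonoidAlgebra.coeff_single_mul_apply (R := K) (1 : K) v (x := p) u
  refine this.trans ?_
  rw [one_mul, neg_add_eq_sub]
  rfl

theorem lcoeff_algebraMap (a : ι →₀ ℕ) (p : MvPolynomial ι K) :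
    lcoeff (intExp a) (algebraMap (MvPolynomial ι K) (Laurent K ι) p) = p.coeff a :=
  Finsupp.mapDomain_apply intExp_injective ..

theorem algebraMap_laurent_injective :
    Function.Injective (algebraMap (MvPolynomial ι K) (Laurent K ι)) := fun p q h => by
  ext a
  rw [← lcoeff_algebraMap, h, lcoeff_algebraMap]

theorem exists_of_lcoeff_algebraMap_ne_zero {u : ι → ℤ} {p : MvPolynomial ι K}
    (h : lcoeff u (algebraMap (MvPolynomial ι K) (Laurent K ι) p) ≠ 0) :
    ∃ a, intExp a = u ∧ p.coeff a ≠ 0 := by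
  classical
  induction p using MvPolynomial.induction_on' with
  | monomial a r =>
    rw [algebraMap_monomial, lcoeff_lmono] at h
    split_ifs at h with h'
    · exact ⟨a, h', by rwa [coeff_monomial, if_pos rfl]⟩
    · exact absurd rfl h
  | add p q hp hq =>
    by_cases hu : ∃ a, intExp a = u
    · obtain ⟨a, rfl⟩ := hu
      exact ⟨a, rfl, by rwa [lcoeff_algebraMap] at h⟩
    · rw [map_add, map_add] at h
      by_cases h1 : lcoeff u (algebraMap (MvPolynomial ι K) (Laurent K ι) p) = 0
      · rw [h1, zero_add] at h
        obtain ⟨a, ha, -⟩ := hq h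
        exact absurd ⟨a, ha⟩ hu
      · obtain ⟨a, ha, -⟩ := hp h1
        exact absurd ⟨a, ha⟩ hu

theorem exists_of_lcoeff_mul_ne_zero {u : ι → ℤ} {p q : Laurent K ι} (h : lcoeff u (p * q) ≠ 0) :
    ∃ v, lcoeff v p ≠ 0 ∧ lcoeff (u - v) q ≠ 0 := by
  classical
  have h1 : u ∈ (AddMonoidAlgebra.coeff (p * q : AddMonoidAlgebra K (ι → ℤ))).support :=
    Finsupp.mem_support_iff.2 h
  obtain ⟨v, hv, w, hw, rfl⟩ := Finset.mem_add.1 (AddMonoidAlgebra.support_coeff_mul_subset _ _ h1)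
  exact ⟨v, Finsupp.mem_support_iff.1 hv, by
    rw [add_sub_cancel_left]; exact Finsupp.mem_support_iff.1 hw⟩

end Laurent

/-! ### Coefficients of Čech cochains with values in a free module -/

section Coefficients

variable {K ι α σ : Type*} [Field K] {f : α → ι}

/-- The family of variables indexed by `f`. -/
abbrev varFam (K : Type*) [Field K] {ι α : Type*} (f : α → ι) : α → MvPolynomial ι K :=
  fun i => X (f i)

theorem exists_monomial_of_mem_cechDen {J : Finset α} (s : cechDen (varFam K f) J) :
    ∃ a : ι →₀ ℕ, (∀ i ∉ f '' (J : Set α), a i = 0) ∧ (s : MvPolynomial ι K) = monomial a 1 := by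
  obtain ⟨s, hs⟩ := s
  dsimp only
  induction hs using Submonoid.closure_induction with
  | mem y hy =>
    obtain ⟨j, hj, rfl⟩ := hy
    refine ⟨Finsupp.single (f j) 1, fun i hi => Finsupp.single_eq_of_ne ?_, rfl⟩
    rintro rfl
    exact hi ⟨j, hj, rfl⟩
  | one => exact ⟨0, fun _ _ => rfl, rfl⟩
  | mul y z _ _ hy hz =>
    obtain ⟨a, ha, rfl⟩ := hy
    obtain ⟨b, hb, rfl⟩ := hz
    exact ⟨a + b, fun i hi => by rw [Finsupp.add_apply, ha i hi, hb i hi], by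
      rw [monomial_mul, one_mul]⟩

theorem monomial_mem_cechDen {J : Finset α} {a : ι →₀ ℕ}
    (ha : ∀ i ∉ f '' (J : Set α), a i = 0) : monomial a (1 : K) ∈ cechDen (varFam K f) J := by
  rw [← prod_X_pow_eq_monomial]
  refine Submonoid.prod_mem _ fun i hi => Submonoid.pow_mem _ ?_ _
  by_contra h
  refine Finsupp.mem_support_iff.1 hi (ha i fun hi' => h ?_)
  obtain ⟨j, hj, rfl⟩ := hi'
  exact Submonoid.subset_closure ⟨j, hj, rfl⟩

theorem isUnit_cechDen {J : Finset α} {M : Type*} [AddCommGroup M] [Module (MvPolynomial ι K) M]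
    [Module (Laurent K ι) M] [IsScalarTower (MvPolynomial ι K) (Laurent K ι) M]
    (s : cechDen (varFam K f) J) :
    IsUnit (algebraMap (MvPolynomial ι K) (Module.End (MvPolynomial ι K) M) s) := by
  obtain ⟨a, -, hs⟩ := exists_monomial_of_mem_cechDen s
  rw [Module.End.isUnit_iff]
  have h1 : ∀ v : M, (s : MvPolynomial ι K) • v = (lmono (intExp a) 1 : Laurent K ι) • v :=
    fun v => by rw [← algebraMap_smul (Laurent K ι), hs, algebraMap_monomial]
  have h2 : ∀ v : M, (lmono (-intExp a) 1 : Laurent K ι) • (s : MvPolynomial ι K) • v = v :=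
    fun v => by rw [h1, smul_smul, lmono_mul_lmono, neg_add_cancel, one_mul, lmono_zero_one, one_smul]
  refine ⟨fun v w h => ?_, fun v => ⟨(lmono (-intExp a) 1 : Laurent K ι) • v, ?_⟩⟩
  · change (s : MvPolynomial ι K) • v = (s : MvPolynomial ι K) • w at h
    rw [← h2 v, h, h2]
  · change (s : MvPolynomial ι K) • (lmono (-intExp a) 1 : Laurent K ι) • v = v
    rw [h1, smul_smul, lmono_mul_lmono, add_neg_cancel, one_mul, lmono_zero_one, one_smul]

/-- The Laurent expansion of an element of a localization of a free module. -/
def expand (f : α → ι) (J : Finset α) :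
    CechLocal (varFam K f) (σ →₀ MvPolynomial ι K) J →ₗ[MvPolynomial ι K] (σ →₀ Laurent K ι) :=
  LocalizedModule.lift _ (Finsupp.mapRange.linearMap (Algebra.linearMap _ _)) isUnit_cechDen

theorem expand_cechMk_one (J : Finset α) (v : σ →₀ MvPolynomial ι K) (i : σ) :
    expand f J (cechMk _ J 1 v) i = algebraMap _ (Laurent K ι) (v i) := by
  have := LocalizedModule.lift_mk_one (S := cechDen (varFam K f) J)
    (Finsupp.mapRange.linearMap (Algebra.linearMap (MvPolynomial ι K) (Laurent K ι)))
    isUnit_cechDen v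
  exact DFunLike.congr_fun this i

theorem algebraMap_mul_expand_cechMk {J : Finset α} (s : cechDen (varFam K f) J)
    (v : σ →₀ MvPolynomial ι K) (i : σ) : algebraMap _ (Laurent K ι) (s : MvPolynomial ι K) *
      expand f J (cechMk _ J s v) i = algebraMap _ (Laurent K ι) (v i) := by
  rw [← expand_cechMk_one J v i, ← smul_cechMk v s, map_smul, Finsupp.smul_apply, Algebra.smul_def]

theorem expand_cechRestrict {I J : Finset α} (h : I ⊆ J)
    (z : CechLocal (varFam K f) (σ →₀ MvPolynomial ι K) I) :
    expand f J (cechRestrict _ _ h z) = expand f I z := by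
  obtain ⟨s, v, rfl⟩ := exists_cechMk z
  rw [cechRestrict_cechMk]
  ext i
  obtain ⟨a, -, hs⟩ := exists_monomial_of_mem_cechDen s
  have h1 := algebraMap_mul_expand_cechMk s v i
  have h2 := algebraMap_mul_expand_cechMk (f := f) (J := J)
    ⟨s, Submonoid.closure_mono (Set.image_mono (Finset.coe_subset.2 h)) s.2⟩ v i
  dsimp only at h2
  have h4 : algebraMap (MvPolynomial ι K) (Laurent K ι) s = lmono (intExp a) 1 := by
    rw [hs, algebraMap_monomial]
  rw [← h1, h4] at h2
  have h3 := congrArg (fun p => (lmono (-intExp a) 1 : Laurent K ι) * p) h2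
  simpa only [← mul_assoc, lmono_mul_lmono, neg_add_cancel, one_mul, lmono_zero_one] using h3

/-- The coefficient of an element of a localization of a free module at the Laurent monomial with
exponent `u` times the basis element `i`. -/
def coef (f : α → ι) (J : Finset α) (i : σ) (u : ι → ℤ) :
    CechLocal (varFam K f) (σ →₀ MvPolynomial ι K) J →+ K :=
  (lcoeff u).comp ((Finsupp.applyAddHom i).comp (expand f J).toAddMonoidHom)

theorem coef_apply (J : Finset α) (i : σ) (u : ι → ℤ)
    (z : CechLocal (varFam K f) (σ →₀ MvPolynomial ι K) J) :
    coef f J i u z = lcoeff u (expand f J z i) := rfl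

theorem coef_cechRestrict {I J : Finset α} (h : I ⊆ J)
    (z : CechLocal (varFam K f) (σ →₀ MvPolynomial ι K) I) (i : σ) (u : ι → ℤ) :
    coef f J i u (cechRestrict _ _ h z) = coef f I i u z := by
  rw [coef_apply, expand_cechRestrict, coef_apply]

theorem coef_cechMk {J : Finset α} {s : cechDen (varFam K f) J} {a : ι →₀ ℕ}
    (hs : (s : MvPolynomial ι K) = monomial a 1) (v : σ →₀ MvPolynomial ι K) (i : σ) (u : ι → ℤ) :
    coef f J i u (cechMk _ J s v) =
      lcoeff (u + intExp a) (algebraMap _ (Laurent K ι) (v i)) := by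
  rw [← algebraMap_mul_expand_cechMk s v i, hs, algebraMap_monomial, lcoeff_lmono_mul,
    add_sub_cancel_right, coef_apply]

theorem eq_of_coef {J : Finset α} {z w : CechLocal (varFam K f) (σ →₀ MvPolynomial ι K) J}
    (h : ∀ i u, coef f J i u z = coef f J i u w) : z = w := by
  rw [← sub_eq_zero]
  have h0 : ∀ i u, coef f J i u (z - w) = 0 := fun i u => by rw [map_sub, h, sub_self]
  obtain ⟨s, v, hz⟩ := exists_cechMk (z - w)
  rw [hz] at h0 ⊢
  have hv : v = 0 := by
    ext1 i
    refine algebraMap_laurent_injective ?_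
    rw [← algebraMap_mul_expand_cechMk s v i, show expand f J (cechMk _ J s v) i = 0 from
      lcoeff_ext fun u => by rw [← coef_apply, h0, map_zero], mul_zero, Finsupp.zero_apply, map_zero]
  rw [hv, map_zero]

theorem coef_neg_one_pow_smul (J : Finset α) (i : σ) (u : ι → ℤ) (n : ℕ)
    (z : CechLocal (varFam K f) (σ →₀ MvPolynomial ι K) J) :
    coef f J i u ((-1 : MvPolynomial ι K) ^ n • z) = (-1) ^ n * coef f J i u z := by
  rcases Nat.even_or_odd n with h | h
  · rw [h.neg_one_pow, h.neg_one_pow, one_smul, one_mul]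
  · rw [h.neg_one_pow, h.neg_one_pow, neg_one_smul, map_neg, neg_one_mul]

/-- Only the inverted variables have negative exponents. -/
theorem nonneg_of_coef_ne_zero {J : Finset α} {i : σ} {u : ι → ℤ}
    {z : CechLocal (varFam K f) (σ →₀ MvPolynomial ι K) J} (h : coef f J i u z ≠ 0) {l : ι}
    (hl : l ∉ f '' (J : Set α)) : 0 ≤ u l := by
  obtain ⟨s, v, rfl⟩ := exists_cechMk z
  obtain ⟨a, ha, hs⟩ := exists_monomial_of_mem_cechDen s
  rw [coef_cechMk hs] at h
  obtain ⟨b, hb, -⟩ := exists_of_lcoeff_algebraMap_ne_zero h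
  have := congrFun hb l
  rw [Pi.add_apply, intExp_apply, intExp_apply, ha l hl] at this
  push_cast at this
  omega

/-- The submodule of the free module spanned by the basis elements of level `j`. -/
def freeLevel (K ι : Type*) [Field K] {σ : Type*} (lev : σ → ℤ) (j : ℤ) :
    Submodule (MvPolynomial ι K) (σ →₀ MvPolynomial ι K) :=
  Finsupp.supported _ _ {i | lev i = j}

theorem mem_freeLevel {lev : σ → ℤ} {j : ℤ} {v : σ →₀ MvPolynomial ι K} :
    v ∈ freeLevel K ι lev j ↔ ∀ i, lev i ≠ j → v i = 0 := by
  rw [freeLevel, Finsupp.mem_supported']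
  exact Iff.rfl

variable {Γ : Type*} [AddCommGroup Γ] [DecidableEq Γ] {wt : ι → Γ}

attribute [local instance] weightedGradedAlgebra

/-- The grading of the free module for which the basis element `i` has degree `w i`. -/
def freeGr (wt : ι → Γ) (w : σ → Γ) (γ : Γ) : AddSubgroup (σ →₀ MvPolynomial ι K) where
  carrier := {v | ∀ i, v i ∈ weightedHomogeneousSubmodule K wt (γ - w i)}
  zero_mem' := fun _ => zero_mem _
  add_mem' := fun ha hb i => add_mem (ha i) (hb i)
  neg_mem' := fun ha i => neg_mem (ha i)

theorem gradedSMul_freeGr (w : σ → Γ) :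
    GradedSMul (weightedHomogeneousSubmodule K wt) (freeGr (K := K) wt w) := by
  intro β γ p hp v hv i
  have h := IsWeightedHomogeneous.mul (w := wt) hp (hv i)
  rw [← add_sub_assoc] at h
  exact h

theorem level_of_coef_ne_zero {J : Finset α} {i : σ} {u : ι → ℤ} {lev : σ → ℤ} {j : ℤ}
    {z : CechLocal (varFam K f) (σ →₀ MvPolynomial ι K) J} (hz : z ∈ locSub _ J (freeLevel K ι lev j))
    (h : coef f J i u z ≠ 0) : lev i = j := by
  obtain ⟨s, v, hv, rfl⟩ := hz
  obtain ⟨a, ha, hs⟩ := exists_monomial_of_mem_cechDen s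
  rw [coef_cechMk hs] at h
  by_contra hne
  rw [mem_freeLevel.1 hv i hne, map_zero, map_zero] at h
  exact h rfl

variable [Fintype ι]

/-- The weight of an integral exponent. -/
def intWt (wt : ι → Γ) (u : ι → ℤ) : Γ := ∑ l, u l • wt l

theorem intWt_add (u v : ι → ℤ) : intWt wt (u + v) = intWt wt u + intWt wt v := by
  simp only [intWt, Pi.add_apply, add_smul, Finset.sum_add_distrib]

theorem intWt_sub (u v : ι → ℤ) : intWt wt (u - v) = intWt wt u - intWt wt v := by
  simp only [intWt, Pi.sub_apply, sub_smul, Finset.sum_sub_distrib]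

theorem intWt_intExp (a : ι →₀ ℕ) : intWt wt (intExp a) = Finsupp.weight wt a := by
  rw [Finsupp.weight_apply, Finsupp.sum_fintype _ _ fun l => zero_smul ℕ (wt l)]
  exact Finset.sum_congr rfl fun l _ => by rw [intExp_apply, natCast_zsmul]

theorem degree_of_coef_ne_zero {J : Finset α} {i : σ} {u : ι → ℤ} {w : σ → Γ} {γ : Γ}
    {z : CechLocal (varFam K f) (σ →₀ MvPolynomial ι K) J}
    (hz : z ∈ cechLocalGrading (weightedHomogeneousSubmodule K wt) (varFam K f) (freeGr wt w) J γ)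
    (h : coef f J i u z ≠ 0) : intWt wt u + w i = γ := by
  classical
  obtain ⟨β, s, v, hv, hs', rfl⟩ := (mem_cechLocalGrading (gradedSMul_freeGr w)).1 hz
  obtain ⟨a, ha, hs⟩ := exists_monomial_of_mem_cechDen s
  rw [coef_cechMk hs] at h
  obtain ⟨b, hb, hb'⟩ := exists_of_lcoeff_algebraMap_ne_zero h
  have h1 : Finsupp.weight wt b = γ + β - w i := hv i hb'
  have h2 : Finsupp.weight wt a = β := by
    rw [hs] at hs'
    exact hs' (by rw [coeff_monomial, if_pos rfl]; exact one_ne_zero)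
  rw [← intWt_intExp] at h1 h2
  rw [hb, intWt_add, h2, add_sub_right_comm, add_left_inj] at h1
  rw [h1, sub_add_cancel]

/-- There are elements of the localization with a single prescribed coefficient. -/
theorem exists_coef_single [DecidableEq σ] [DecidableEq (ι → ℤ)] {J : Finset α} (lev : σ → ℤ)
    (w : σ → Γ) (i : σ) (u : ι → ℤ) (c : K) (hu : ∀ l ∉ f '' (J : Set α), 0 ≤ u l) :
    ∃ z ∈ locSub (varFam K f) J (freeLevel K ι lev (lev i)),
      z ∈ cechLocalGrading (weightedHomogeneousSubmodule K wt) (varFam K f) (freeGr wt w) J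
        (intWt wt u + w i) ∧ ∀ i' u', coef f J i' u' z = if i = i' ∧ u = u' then c else 0 := by
  classical
  -- The Laurent monomial with exponent `u` is the quotient of the monomials with exponents `b`, the
  -- positive part of `u`, and `a`, the negative part.
  let a : ι →₀ ℕ := Finsupp.equivFunOnFinite.symm fun l => (-u l).toNat
  let b : ι →₀ ℕ := Finsupp.equivFunOnFinite.symm fun l => (u l).toNat
  have hab : u + intExp a = intExp b := by
    funext l
    change u l + ((-u l).toNat : ℤ) = ((u l).toNat : ℤ)
    omega
  have ha : ∀ l ∉ f '' (J : Set α), a l = 0 := fun l hl => by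
    have := hu l hl
    change (-u l).toNat = 0
    omega
  refine ⟨cechMk _ J ⟨monomial a 1, monomial_mem_cechDen ha⟩ (Finsupp.single i (monomial b c)),
    cechMk_mem_locSub ?_ _, ?_, fun i' u' => ?_⟩
  · rw [mem_freeLevel]
    intro i' hi'
    refine Finsupp.single_eq_of_ne ?_
    rintro rfl
    exact hi' rfl
  · refine cechMk_mem_grading (β := intWt wt (intExp a)) ?_ ?_
    · rw [intWt_intExp]
      exact isWeightedHomogeneous_monomial _ _ _ rfl
    · intro i'
      by_cases hi' : i' = i
      · subst hi'
        rw [Finsupp.single_eq_same, add_right_comm, add_sub_cancel_right, ← intWt_add, hab,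
          intWt_intExp]
        exact isWeightedHomogeneous_monomial _ _ _ rfl
      · rw [Finsupp.single_eq_of_ne hi']
        exact zero_mem _
  · rw [coef_cechMk rfl]
    by_cases hi' : i = i'
    · subst hi'
      rw [Finsupp.single_eq_same, algebraMap_monomial, lcoeff_lmono, ← hab]
      simp
    · rw [Finsupp.single_eq_of_ne (Ne.symm hi'), map_zero, map_zero, if_neg fun h => hi' h.1]

/-- Elements of the localization can be prescribed by their coefficients. -/
theorem exists_of_coef {J : Finset α} {lev : σ → ℤ} {w : σ → Γ} {j : ℤ} {γ : Γ}
    (F : σ × (ι → ℤ) →₀ K) (h1 : ∀ i u, F (i, u) ≠ 0 → ∀ l ∉ f '' (J : Set α), 0 ≤ u l)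
    (h2 : ∀ i u, F (i, u) ≠ 0 → lev i = j) (h3 : ∀ i u, F (i, u) ≠ 0 → intWt wt u + w i = γ) :
    ∃ z ∈ locSub (varFam K f) J (freeLevel K ι lev j),
      z ∈ cechLocalGrading (weightedHomogeneousSubmodule K wt) (varFam K f) (freeGr wt w) J γ ∧
      ∀ i u, coef f J i u z = F (i, u) := by
  classical
  have key : ∀ p : σ × (ι → ℤ), ∃ z : CechLocal (varFam K f) (σ →₀ MvPolynomial ι K) J,
      F p ≠ 0 → z ∈ locSub (varFam K f) J (freeLevel K ι lev j) ∧
      z ∈ cechLocalGrading (weightedHomogeneousSubmodule K wt) (varFam K f) (freeGr wt w) J γ ∧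
      ∀ i' u', coef f J i' u' z = if p = (i', u') then F p else 0 := by
    rintro ⟨i, u⟩
    by_cases hF : F (i, u) = 0
    · exact ⟨0, fun h => absurd hF h⟩
    · obtain ⟨z, hz, hzg, hz'⟩ := exists_coef_single (f := f) (J := J) (wt := wt) lev w i u (F (i, u))
        (h1 i u hF)
      rw [h2 i u hF] at hz
      rw [h3 i u hF] at hzg
      exact ⟨z, fun _ => ⟨hz, hzg, fun i' u' => by rw [hz']; simp only [Prod.mk.injEq]⟩⟩
  choose z hz using key
  refine ⟨∑ p ∈ F.support, z p,
    Submodule.sum_mem _ fun p hp => (hz p (Finsupp.mem_support_iff.1 hp)).1,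
    AddSubgroup.sum_mem _ fun p hp => (hz p (Finsupp.mem_support_iff.1 hp)).2.1, fun i u => ?_⟩
  rw [map_sum, Finset.sum_congr rfl fun p hp => (hz p (Finsupp.mem_support_iff.1 hp)).2.2 i u,
    Finset.sum_ite_eq' F.support (i, u) fun p => F p]
  split_ifs with h
  · rfl
  · exact (Finsupp.notMem_support_iff.1 h).symm

/-- Only finitely many coefficients are nonzero. -/
theorem finite_coef {J : Finset α} (z : CechLocal (varFam K f) (σ →₀ MvPolynomial ι K) J) :
    {p : σ × (ι → ℤ) | coef f J p.1 p.2 z ≠ 0}.Finite := by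
  classical
  refine ((expand f J z).support.finite_toSet.biUnion (t := fun i => (fun u => (i, u)) ''
    {u | lcoeff u (expand f J z i) ≠ 0}) fun i _ => Set.Finite.image _ ?_).subset ?_
  · exact (AddMonoidAlgebra.coeff (expand f J z i : AddMonoidAlgebra K (ι → ℤ))).hasFiniteSupport
  · rintro ⟨i, u⟩ h
    refine Set.mem_biUnion (x := i) (Finsupp.mem_support_iff.2 fun h0 => h ?_) ⟨u, h, rfl⟩
    rw [coef_apply, h0, map_zero]

end Coefficients

/-! ### Acyclicity of the regular part -/

section Acyclic

variable {K ι α σ Γ : Type*} [Field K] [Fintype ι] [LinearOrder α] [Fintype α] [AddCommGroup Γ]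
  [DecidableEq Γ] {f : α → ι} {wt : ι → Γ} {lev : σ → ℤ} {w : σ → Γ}
  {d : (σ →₀ MvPolynomial ι K) →ₗ[MvPolynomial ι K] (σ →₀ MvPolynomial ι K)}

attribute [local instance] weightedGradedAlgebra

/-- The component at the full index set has no coefficient at a monomial in which all the variables
of the family `f` have negative exponents. Only such coefficients contribute to the Čech cohomology
of a free module. -/
def IsRegular (f : α → ι) (c : CechCochain (varFam K f) (σ →₀ MvPolynomial ι K)) : Prop :=
  ∀ i u, (∀ a, u (f a) < 0) → coef f Finset.univ i u (c Finset.univ) = 0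

theorem coef_cechD (c : CechCochain (varFam K f) (σ →₀ MvPolynomial ι K)) (J : Finset α) (i : σ)
    (u : ι → ℤ) : coef f J i u (cechD _ _ c J) =
      ∑ a ∈ J, (-1) ^ cechSign J a * coef f (J.erase a) i u (c (J.erase a)) := by
  rw [cechD_apply, map_sum]
  exact Finset.sum_congr rfl fun a ha => by rw [coef_neg_one_pow_smul, coef_cechRestrict]

theorem isRegular_cechD (hf : Function.Injective f)
    (c : CechCochain (varFam K f) (σ →₀ MvPolynomial ι K)) : IsRegular f (cechD _ _ c) := by
  intro i u hu
  rw [coef_cechD]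
  refine Finset.sum_eq_zero fun a _ => ?_
  by_contra h
  have h1 : f a ∉ f '' ((Finset.univ.erase a : Finset α) : Set α) := by
    rintro ⟨b, hb, hba⟩
    rw [hf hba] at hb
    simp at hb
  exact absurd (nonneg_of_coef_ne_zero (right_ne_zero_of_mul h) h1) (hu a).not_ge

/-- The Čech complex of a free module is a direct sum over all Laurent monomials. The summand of a
monomial in which the variable `f a` has an exponent `≥ 0` has a contracting homotopy, which maps a
cochain `φ` to the cochain with the components `± φ (J ∪ a)` for `a ∉ J`, and `0` for `a ∈ J`. -/
theorem exists_cech_preimage (hf : Function.Injective f) {t : ℤ} {γ : Γ} {q : ℕ}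
    {c : CechCochain (varFam K f) (σ →₀ MvPolynomial ι K)}
    (hc : c ∈ totDeg _ (freeLevel K ι lev) t)
    (hcg : c ∈ cechGrading (weightedHomogeneousSubmodule K wt) (varFam K f) (freeGr wt w) γ)
    (hδ : ∀ J : Finset α, J.card = q + 1 → cechD _ _ c J = 0) (hreg : IsRegular f c) :
    ∃ v ∈ totDeg _ (freeLevel K ι lev) (t - 1),
      v ∈ cechGrading (weightedHomogeneousSubmodule K wt) (varFam K f) (freeGr wt w) γ ∧
      (∀ J : Finset α, q ≤ J.card → v J = 0) ∧
      ∀ J : Finset α, J.card = q → cechD _ _ v J = c J := by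
  classical
  -- The coefficients of the image under the homotopy: for each monomial one variable `f a` with an
  -- exponent `≥ 0` is chosen, if there is one.
  let F : Finset α → σ × (ι → ℤ) → K := fun J p =>
    if h : ∃ a, 0 ≤ p.2 (f a) then
      if h.choose ∈ J then 0
      else (-1) ^ cechSign (insert h.choose J) h.choose *
        coef f (insert h.choose J) p.1 p.2 (c (insert h.choose J))
    else 0
  have hF : ∀ J i u, F J (i, u) ≠ 0 → ∃ a ∉ J, 0 ≤ u (f a) ∧
      coef f (insert a J) i u (c (insert a J)) ≠ 0 := by
    intro J i u h
    by_cases h1 : ∃ a, 0 ≤ u (f a)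
    · by_cases h2 : h1.choose ∈ J
      · exact absurd (by simp only [F, dif_pos h1, if_pos h2]) h
      · simp only [F, dif_pos h1, if_neg h2] at h
        exact ⟨_, h2, h1.choose_spec, right_ne_zero_of_mul h⟩
    · exact absurd (by simp only [F, dif_neg h1]) h
  have hfin : ∀ J, (Function.support (F J)).Finite := fun J => by
    refine (Set.finite_iUnion fun a => finite_coef (c (insert a J))).subset ?_
    rintro ⟨i, u⟩ h
    obtain ⟨a, -, -, ha⟩ := hF J i u h
    exact Set.mem_iUnion.2 ⟨a, ha⟩
  have key : ∀ J : Finset α, ∃ z ∈ locSub (varFam K f) J (freeLevel K ι lev (t - 1 - J.card)),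
      z ∈ cechLocalGrading (weightedHomogeneousSubmodule K wt) (varFam K f) (freeGr wt w) J γ ∧
      ∀ i u, coef f J i u z = F J (i, u) := by
    intro J
    refine exists_of_coef (Finsupp.ofSupportFinite (F J) (hfin J)) ?_ ?_ ?_
    · intro i u h l hl
      obtain ⟨a, haJ, ha, hne⟩ := hF J i u h
      by_cases hla : l = f a
      · rwa [hla]
      · refine nonneg_of_coef_ne_zero hne ?_
        rintro ⟨b, hb, rfl⟩
        rcases Finset.mem_insert.1 hb with rfl | hb
        · exact hla rfl
        · exact hl ⟨b, hb, rfl⟩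
    · intro i u h
      obtain ⟨a, haJ, ha, hne⟩ := hF J i u h
      have := level_of_coef_ne_zero (hc (insert a J) trivial) hne
      rw [this, Finset.card_insert_of_notMem haJ]
      push_cast
      omega
    · intro i u h
      obtain ⟨a, haJ, ha, hne⟩ := hF J i u h
      exact degree_of_coef_ne_zero (hcg (insert a J) trivial) hne
  choose z hz hzg hzF using key
  refine ⟨fun J => if J.card + 1 = q then z J else 0, ?_, ?_, fun J hJ => if_neg (by omega), ?_⟩
  · intro J _
    dsimp only
    split_ifs
    · exact hz J
    · exact zero_mem _
  · intro J _
    dsimp only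
    split_ifs
    · exact hzg J
    · exact (cechLocalGrading (weightedHomogeneousSubmodule K wt) (varFam K f) (freeGr wt w) J
        γ).zero_mem
  · intro J hJ
    refine eq_of_coef fun i u => ?_
    set G : Finset α → K := fun J => coef f J i u (c J) with hG
    have h1 : coef f J i u (cechD _ _ (fun J => if J.card + 1 = q then z J else 0) J) =
        ∑ a ∈ J, (-1) ^ cechSign J a * F (J.erase a) (i, u) := by
      rw [coef_cechD]
      refine Finset.sum_congr rfl fun a ha => ?_
      rw [if_pos (by rw [Finset.card_erase_add_one ha, hJ]), hzF]
    rw [h1]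
    change _ = G J
    have hsq : ∀ n : ℕ, ((-1 : K) ^ n) * (-1) ^ n = 1 := fun n => by
      rw [← mul_pow, neg_one_mul, neg_neg, one_pow]
    -- If the chosen `a` lies in `J`, only the summand of `a` contributes; otherwise the cocycle
    -- condition at `J ∪ a` is used. Monomials with negative exponents at all variables occur only
    -- at the full index set, where they are excluded by regularity.
    by_cases h : ∃ a, 0 ≤ u (f a)
    · by_cases haJ : h.choose ∈ J
      · rw [Finset.sum_eq_single h.choose]
        · simp only [F, dif_pos h]
          rw [if_neg (Finset.notMem_erase _ _)]
          change _ * (_ * G (insert h.choose (J.erase h.choose))) = _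
          rw [Finset.insert_erase haJ, ← mul_assoc, hsq, one_mul]
        · intro b _ hb
          simp only [F, dif_pos h]
          rw [if_pos (Finset.mem_erase.2 ⟨hb.symm, haJ⟩), mul_zero]
        · exact fun h' => absurd haJ h'
      · set a := h.choose with ha
        have h2 := hδ (insert a J) (by rw [Finset.card_insert_of_notMem haJ, hJ])
        have h3 : coef f (insert a J) i u (cechD _ _ c (insert a J)) = 0 := by rw [h2, map_zero]
        rw [coef_cechD, Finset.sum_insert haJ] at h3
        change _ * G ((insert a J).erase a) + ∑ b ∈ J, _ * G ((insert a J).erase b) = 0 at h3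
        rw [Finset.erase_insert haJ] at h3
        have h4 : ∀ b ∈ J, (-1) ^ cechSign J b * F (J.erase b) (i, u) =
            -((-1) ^ cechSign (insert a J) a *
              ((-1) ^ cechSign (insert a J) b * G ((insert a J).erase b))) := by
          intro b hb
          have hab : a ≠ b := fun h => haJ (h ▸ hb)
          simp only [F, dif_pos h]
          rw [if_neg (fun h' => haJ (Finset.mem_of_mem_erase h'))]
          change _ * (_ * G (insert a (J.erase b))) = _
          rw [← Finset.erase_insert_of_ne hab]
          have h5 := cechSign_swap K (J := insert a J) (Finset.mem_insert_self a J)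
            (Finset.mem_insert_of_mem hb) hab
          rw [Finset.erase_insert haJ] at h5
          have h6 := hsq (cechSign (insert a J) a)
          have h7 := hsq (cechSign ((insert a J).erase b) a)
          linear_combination ((-1) ^ cechSign (insert a J) a *
            (-1) ^ cechSign ((insert a J).erase b) a * G ((insert a J).erase b)) * h5 -
            ((-1) ^ cechSign J b * (-1) ^ cechSign ((insert a J).erase b) a *
              G ((insert a J).erase b)) * h6 - ((-1) ^ cechSign (insert a J) a *
              (-1) ^ cechSign (insert a J) b * G ((insert a J).erase b)) * h7
        rw [Finset.sum_congr rfl h4, Finset.sum_neg_distrib, ← Finset.mul_sum]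
        linear_combination (-(-1) ^ cechSign (insert a J) a) * h3 + G J * hsq (cechSign (insert a J) a)
    · have h2 : ∀ b ∈ J, (-1) ^ cechSign J b * F (J.erase b) (i, u) = 0 := fun b _ => by
        simp only [F, dif_neg h]
        rw [mul_zero]
      rw [Finset.sum_eq_zero h2, eq_comm]
      push Not at h
      by_contra hne
      have h3 : J ≠ Finset.univ := by
        rintro rfl
        exact hne (hreg i u h)
      obtain ⟨a, ha⟩ : ∃ a, a ∉ J := by
        by_contra h'
        push Not at h'
        exact h3 (Finset.eq_univ_of_forall h')
      refine absurd (nonneg_of_coef_ne_zero hne (l := f a) ?_) (h a).not_ge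
      rintro ⟨b, hb, hba⟩
      exact ha (hf hba ▸ hb)

/-- A regular cocycle of the total complex is a coboundary. -/
theorem exists_primitive_of_isRegular (hf : Function.Injective f)
    (hA : GradedComplex (weightedHomogeneousSubmodule K wt) (freeGr wt w) (freeLevel K ι lev) d)
    {t : ℤ} {γ : Γ} {c : CechCochain (varFam K f) (σ →₀ MvPolynomial ι K)}
    (hc : c ∈ totDeg _ (freeLevel K ι lev) t)
    (hcg : c ∈ cechGrading (weightedHomogeneousSubmodule K wt) (varFam K f) (freeGr wt w) γ)
    (hD : totD _ d c = 0) (hreg : IsRegular f c) :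
    ∃ v ∈ totDeg _ (freeLevel K ι lev) (t - 1),
      v ∈ cechGrading (weightedHomogeneousSubmodule K wt) (varFam K f) (freeGr wt w) γ ∧
      v Finset.univ = 0 ∧ totD _ d v = c := by
  -- The components of highest Čech degree form a cocycle for the Čech differential, so they can be
  -- removed first.
  have key : ∀ q : ℕ, q ≤ Fintype.card α + 1 →
      ∀ c : CechCochain (varFam K f) (σ →₀ MvPolynomial ι K),
      c ∈ totDeg _ (freeLevel K ι lev) t →
      c ∈ cechGrading (weightedHomogeneousSubmodule K wt) (varFam K f) (freeGr wt w) γ →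
      totD _ d c = 0 → IsRegular f c → (∀ J : Finset α, q ≤ J.card → c J = 0) →
      ∃ v ∈ totDeg _ (freeLevel K ι lev) (t - 1),
        v ∈ cechGrading (weightedHomogeneousSubmodule K wt) (varFam K f) (freeGr wt w) γ ∧
        v Finset.univ = 0 ∧ totD _ d v = c := by
    intro q
    induction q with
    | zero =>
      intro _ c _ _ _ _ h0
      refine ⟨0, zero_mem _, zero_mem _, rfl, ?_⟩
      rw [map_zero]
      exact (funext fun J => h0 J J.card.zero_le).symm
    | succ q ih =>
      intro hq c hc hcg hD hreg h0
      obtain ⟨v, hv, hvg, hv0, hv1⟩ := exists_cech_preimage hf hc hcg (q := q) (fun J hJ => by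
        have h1 : totD _ d c J = 0 := by rw [hD]; rfl
        rwa [totD_apply, h0 J hJ.ge, map_zero, smul_zero, add_zero] at h1) hreg
      have hvu : v Finset.univ = 0 := hv0 _ (by rw [Finset.card_univ]; omega)
      have hDv : totD _ d v ∈ totDeg _ (freeLevel K ι lev) t := by
        have := hA.totD_mem hv
        rwa [sub_add_cancel] at this
      obtain ⟨v', hv', hvg', hvu', hDv'⟩ := ih (by omega) (c - totD _ d v) (sub_mem hc hDv)
        (sub_mem hcg (hA.isGradedHom_totD γ v hvg))
        (by rw [map_sub, hD, totD_totD hA.sq, sub_zero])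
        (fun i u hu => by
          rw [Pi.sub_apply, totD_apply, hvu, map_zero, smul_zero, add_zero, map_sub, hreg i u hu,
            isRegular_cechD hf v i u hu, sub_zero])
        (fun J hJ => by
          rw [Pi.sub_apply, totD_apply, hv0 J hJ, map_zero, smul_zero, add_zero]
          rcases hJ.eq_or_lt with h | h
          · rw [hv1 J h.symm, sub_self]
          · rw [h0 J h, zero_sub, neg_eq_zero]
            exact cechD_eq_zero fun I hI => hv0 I (by omega))
      refine ⟨v + v', add_mem hv hv', add_mem hvg hvg', ?_, ?_⟩
      · rw [Pi.add_apply, hvu, hvu', add_zero]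
      · rw [map_add, hDv', add_sub_cancel]
  exact key _ le_rfl c hc hcg hD hreg fun J hJ => absurd J.card_le_univ (by omega)

end Acyclic

/-! ### The residue pairing -/

section Dot

variable {L σ : Type*} [CommRing L]

/-- The dot product of two vectors in a free module. -/
def dot (p q : σ →₀ L) : L := p.sum fun i a => a * q i

theorem dot_add_left (p p' q : σ →₀ L) : dot (p + p') q = dot p q + dot p' q :=
  Finsupp.sum_add_index' (fun _ => zero_mul _) fun _ _ _ => add_mul _ _ _

theorem dot_add_right (p q q' : σ →₀ L) : dot p (q + q') = dot p q + dot p q' := by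
  simp only [dot, Finsupp.add_apply, mul_add, Finsupp.sum_add]

theorem dot_smul_left (a : L) (p q : σ →₀ L) : dot (a • p) q = a * dot p q := by
  rw [dot, Finsupp.sum_smul_index' fun _ => zero_mul _, dot, Finsupp.mul_sum]
  simp only [smul_eq_mul, mul_assoc]

theorem dot_smul_right (a : L) (p q : σ →₀ L) : dot p (a • q) = a * dot p q := by
  rw [dot, dot, Finsupp.mul_sum]
  simp only [Finsupp.smul_apply, smul_eq_mul, mul_left_comm]

theorem dot_single_right [DecidableEq σ] (p : σ →₀ L) (i : σ) (a : L) :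
    dot p (Finsupp.single i a) = p i * a := by
  rw [dot, Finsupp.sum, Finset.sum_eq_single i, Finsupp.single_eq_same]
  · intro j _ hj
    rw [Finsupp.single_eq_of_ne hj, mul_zero]
  · intro h
    rw [Finsupp.notMem_support_iff.1 h, zero_mul]

theorem dot_single_left (q : σ →₀ L) (i : σ) (a : L) : dot (Finsupp.single i a) q = a * q i :=
  Finsupp.sum_single_index (zero_mul _)

theorem dot_mapRange {L' : Type*} [CommRing L'] (φ : L →+* L') (p q : σ →₀ L) :
    dot (p.mapRange φ (map_zero φ)) (q.mapRange φ (map_zero φ)) = φ (dot p q) := by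
  rw [dot, Finsupp.sum_mapRange_index fun _ => zero_mul _, dot, map_finsuppSum]
  simp only [Finsupp.mapRange_apply, map_mul]

end Dot

section Pairing

variable {K ι α β σ Γ : Type*} [Field K] {f : α → ι} {g : β → ι}

/-- The coefficient of the product of the inverses of all variables in the dot product of the
Laurent expansions. -/
def pair (f : α → ι) (g : β → ι) (J : Finset α) (J' : Finset β)
    (z : CechLocal (varFam K f) (σ →₀ MvPolynomial ι K) J)
    (z' : CechLocal (varFam K g) (σ →₀ MvPolynomial ι K) J') : K :=
  lcoeff (fun _ => -1) (dot (expand f J z) (expand g J' z'))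

variable {J : Finset α} {J' : Finset β}

theorem pair_add_left (z₁ z₂ : CechLocal (varFam K f) (σ →₀ MvPolynomial ι K) J)
    (z' : CechLocal (varFam K g) (σ →₀ MvPolynomial ι K) J') :
    pair f g J J' (z₁ + z₂) z' = pair f g J J' z₁ z' + pair f g J J' z₂ z' := by
  rw [pair, map_add, dot_add_left, map_add]
  rfl

theorem pair_add_right (z : CechLocal (varFam K f) (σ →₀ MvPolynomial ι K) J)
    (z₁ z₂ : CechLocal (varFam K g) (σ →₀ MvPolynomial ι K) J') :
    pair f g J J' z (z₁ + z₂) = pair f g J J' z z₁ + pair f g J J' z z₂ := by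
  rw [pair, map_add, dot_add_right, map_add]
  rfl

theorem pair_smul_left (s : MvPolynomial ι K)
    (z : CechLocal (varFam K f) (σ →₀ MvPolynomial ι K) J)
    (z' : CechLocal (varFam K g) (σ →₀ MvPolynomial ι K) J') :
    pair f g J J' (s • z) z' = pair f g J J' z (s • z') := by
  rw [pair, pair, map_smul, map_smul, ← algebraMap_smul (Laurent K ι) s (expand f J z),
    ← algebraMap_smul (Laurent K ι) s (expand g J' z'), dot_smul_left, dot_smul_right]

theorem pair_C_smul_right (a : K) (z : CechLocal (varFam K f) (σ →₀ MvPolynomial ι K) J)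
    (z' : CechLocal (varFam K g) (σ →₀ MvPolynomial ι K) J') :
    pair f g J J' z (algebraMap K (MvPolynomial ι K) a • z') = a * pair f g J J' z z' := by
  rw [pair, pair, map_smul,
    ← algebraMap_smul (Laurent K ι) (algebraMap K (MvPolynomial ι K) a) (expand g J' z'),
    dot_smul_right]
  have h : algebraMap (MvPolynomial ι K) (Laurent K ι) (algebraMap K (MvPolynomial ι K) a) =
      lmono 0 a := algebraMap_monomial 0 a
  rw [h]
  have := AddMonoidAlgebra.coeff_single_mul_apply (R := K) a (0 : ι → ℤ)
    (x := (dot (expand f J z) (expand g J' z') : Laurent K ι)) fun _ => -1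
  rw [neg_zero, zero_add] at this
  exact this

/-- The pairing with a fixed element, as a homomorphism. -/
def pairHom (f : α → ι) (g : β → ι) (J : Finset α) (J' : Finset β)
    (z : CechLocal (varFam K f) (σ →₀ MvPolynomial ι K) J) :
    CechLocal (varFam K g) (σ →₀ MvPolynomial ι K) J' →+ K :=
  AddMonoidHom.mk' (pair f g J J' z) (pair_add_right z)

theorem pairHom_apply (z : CechLocal (varFam K f) (σ →₀ MvPolynomial ι K) J)
    (z' : CechLocal (varFam K g) (σ →₀ MvPolynomial ι K) J') :
    pairHom f g J J' z z' = pair f g J J' z z' := rfl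

theorem pair_zero_left (z' : CechLocal (varFam K g) (σ →₀ MvPolynomial ι K) J') :
    pair f g J J' 0 z' = 0 := by
  rw [pair, map_zero, dot, Finsupp.sum_zero_index, map_zero]

theorem pair_neg_left (z : CechLocal (varFam K f) (σ →₀ MvPolynomial ι K) J)
    (z' : CechLocal (varFam K g) (σ →₀ MvPolynomial ι K) J') :
    pair f g J J' (-z) z' = -pair f g J J' z z' := by
  rw [eq_neg_iff_add_eq_zero, ← pair_add_left, neg_add_cancel, pair_zero_left]

theorem exists_coef_of_pair_ne_zero {z : CechLocal (varFam K f) (σ →₀ MvPolynomial ι K) J}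
    {z' : CechLocal (varFam K g) (σ →₀ MvPolynomial ι K) J'} (h : pair f g J J' z z' ≠ 0) :
    ∃ i u, coef f J i u z ≠ 0 ∧ coef g J' i ((fun _ => -1) - u) z' ≠ 0 := by
  rw [pair, dot, Finsupp.sum, map_sum] at h
  obtain ⟨i, -, hi⟩ := Finset.exists_ne_zero_of_sum_ne_zero h
  obtain ⟨u, hu⟩ := exists_of_lcoeff_mul_ne_zero hi
  exact ⟨i, u, hu⟩

theorem expand_mul_left_cancel {J : Finset α} (s : cechDen (varFam K f) J) {p q : Laurent K ι}
    (h : algebraMap _ (Laurent K ι) (s : MvPolynomial ι K) * p =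
      algebraMap _ (Laurent K ι) (s : MvPolynomial ι K) * q) : p = q := by
  obtain ⟨a, -, hs⟩ := exists_monomial_of_mem_cechDen s
  rw [hs, algebraMap_monomial] at h
  have h3 := congrArg (fun p => (lmono (-intExp a) 1 : Laurent K ι) * p) h
  simpa only [← mul_assoc, lmono_mul_lmono, neg_add_cancel, one_mul, lmono_zero_one] using h3

theorem smul_expand_cechMk {J : Finset α} (s : cechDen (varFam K f) J)
    (v : σ →₀ MvPolynomial ι K) :
    algebraMap _ (Laurent K ι) (s : MvPolynomial ι K) • expand f J (cechMk _ J s v) =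
      v.mapRange (algebraMap _ (Laurent K ι)) (map_zero _) := by
  ext1 i
  rw [Finsupp.smul_apply, smul_eq_mul, algebraMap_mul_expand_cechMk, Finsupp.mapRange_apply]

/-- The pairing turns adjoint differentials into adjoint differentials. -/
theorem pair_locMap {dA dB : (σ →₀ MvPolynomial ι K) →ₗ[MvPolynomial ι K] (σ →₀ MvPolynomial ι K)}
    (hd : ∀ a b, dot (dA a) b = dot a (dB b))
    (z : CechLocal (varFam K f) (σ →₀ MvPolynomial ι K) J)
    (z' : CechLocal (varFam K g) (σ →₀ MvPolynomial ι K) J') :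
    pair f g J J' (locMap _ J dA z) z' = pair f g J J' z (locMap _ J' dB z') := by
  obtain ⟨s, v, rfl⟩ := exists_cechMk z
  obtain ⟨s', v', rfl⟩ := exists_cechMk z'
  rw [pair, pair]
  congr 1
  rw [locMap_cechMk, locMap_cechMk]
  refine expand_mul_left_cancel s (expand_mul_left_cancel s' ?_)
  have key : ∀ p q : σ →₀ Laurent K ι, algebraMap _ (Laurent K ι) (s' : MvPolynomial ι K) *
      (algebraMap _ (Laurent K ι) (s : MvPolynomial ι K) * dot p q) =
      dot (algebraMap _ (Laurent K ι) (s : MvPolynomial ι K) • p)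
        (algebraMap _ (Laurent K ι) (s' : MvPolynomial ι K) • q) := fun p q => by
    rw [dot_smul_left, dot_smul_right, mul_left_comm]
  rw [key, key, smul_expand_cechMk, smul_expand_cechMk, smul_expand_cechMk, smul_expand_cechMk,
    dot_mapRange, dot_mapRange, hd]

end Pairing

/-! ### Modules generated by homogeneous elements, and graded duals -/

section GradedSpan

variable {Γ K R A : Type*} [Field K] [CommRing R] [Algebra K R] [AddCommGroup A] [Module R A]
  [AddCommGroup Γ] [DecidableEq Γ] {𝒜 : Γ → Submodule K R} [GradedAlgebra 𝒜]

theorem mem_span_homogeneous {𝒢 : Γ → AddSubgroup A}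
    (a : Submodule.span R {v | ∃ γ, v ∈ 𝒢 γ}) :
    a ∈ Submodule.span R {v : Submodule.span R {v | ∃ γ, v ∈ 𝒢 γ} | ∃ γ, (v : A) ∈ 𝒢 γ} := by
  have := Submodule.span_span_coe_preimage (R := R) (s := {v | ∃ γ, v ∈ 𝒢 γ})
  exact this.symm ▸ Submodule.mem_top

/-- Independent homogeneous components, compatible with homogeneous scalars, define a grading of
the submodule which they generate. -/
theorem isGrading_span {𝒢 : Γ → AddSubgroup A} (hsmul : GradedSMul 𝒜 𝒢)
    (hind : ∀ (s : Finset Γ) (b : Γ → A), (∀ γ, b γ ∈ 𝒢 γ) → ∑ γ ∈ s, b γ = 0 →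
      ∀ γ ∈ s, b γ = 0) :
    IsGrading fun γ => (𝒢 γ).comap
      (Submodule.span R {v | ∃ γ, v ∈ 𝒢 γ}).subtype.toAddMonoidHom where
  exists_sum a := by
    classical
    let P : Submodule.span R {v | ∃ γ, v ∈ 𝒢 γ} → Prop := fun a =>
      ∃ (s : Finset Γ) (b : Γ → Submodule.span R {v | ∃ γ, v ∈ 𝒢 γ}),
        (∀ γ, (b γ : A) ∈ 𝒢 γ) ∧ (∀ γ ∉ s, b γ = 0) ∧ ∑ γ ∈ s, b γ = a
    have hadd : ∀ a a', P a → P a' → P (a + a') := by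
      rintro _ _ ⟨s, b, hb, hs, rfl⟩ ⟨s', b', hb', hs', rfl⟩
      refine ⟨s ∪ s', b + b', fun γ => add_mem (hb γ) (hb' γ), fun γ hγ => ?_, ?_⟩
      · rw [Finset.mem_union, not_or] at hγ
        rw [Pi.add_apply, hs γ hγ.1, hs' γ hγ.2, add_zero]
      · simp only [Pi.add_apply]
        rw [Finset.sum_add_distrib, ← Finset.sum_subset Finset.subset_union_left fun γ _ hγ => hs γ hγ,
          ← Finset.sum_subset Finset.subset_union_right fun γ _ hγ => hs' γ hγ]
    have hzero : P 0 := ⟨∅, 0, fun γ => zero_mem _, fun _ _ => rfl, rfl⟩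
    have hhom : ∀ γ (a : Submodule.span R {v | ∃ γ, v ∈ 𝒢 γ}), (a : A) ∈ 𝒢 γ → P a := fun γ a ha =>
      ⟨{γ}, fun δ => if δ = γ then a else 0, fun δ => by
        dsimp only
        split_ifs with h
        · rwa [h]
        · exact zero_mem _, fun δ hδ => if_neg (by simpa using hδ), by simp⟩
    have hall : ∀ a, P a := fun a => by
      have h1 := mem_span_homogeneous a
      refine Submodule.span_induction (p := fun a _ => P a) (fun a ha => hhom _ a ha.choose_spec) hzero
        (fun a a' _ _ => hadd a a') (fun r a _ ha => ?_) h1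
      obtain ⟨s, b, hb, -, rfl⟩ := ha
      rw [← DirectSum.sum_support_decompose 𝒜 r, Finset.sum_smul]
      refine Finset.sum_induction _ P hadd hzero fun β _ => ?_
      rw [Finset.smul_sum]
      refine Finset.sum_induction _ P hadd hzero fun γ _ => hhom (β + γ) _ ?_
      exact hsmul β γ _ (SetLike.coe_mem _) _ (hb γ)
    obtain ⟨s, b, hb, -, h⟩ := hall a
    exact ⟨s, b, hb, h⟩
  eq_zero s b hb h γ hγ := Subtype.ext <| hind s (fun γ => b γ) hb (by
    have := congrArg Subtype.val h
    rwa [AddSubmonoidClass.coe_finsetSum] at this) γ hγ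

end GradedSpan

section GradedDual

variable {Γ K R N : Type*} [Field K] [CommRing R] [Algebra K R] [AddCommGroup N] [Module R N]
  [AddCommGroup Γ] [DecidableEq Γ] {𝒜 : Γ → Submodule K R} [GradedAlgebra 𝒜]
  {𝒩 : Γ → AddSubgroup N}

theorem fullDual_smul_apply (r : R) (φ : FullDual K R N) (v : N) :
    ((r • φ : FullDual K R N) : N →+ K) v = (φ : N →+ K) (r • v) := rfl

theorem gradedSMul_fullDual (hN : GradedSMul 𝒜 𝒩) : GradedSMul 𝒜 (fullDualGrading K R 𝒩) := by
  intro β γ p hp φ hφ δ hδ v hv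
  rw [fullDual_smul_apply]
  refine hφ (β + δ) (fun h => hδ ?_) _ (hN β δ p hp v hv)
  rw [neg_add, ← h]
  abel

theorem gradedSMul_gradedDual (hN : GradedSMul 𝒜 𝒩) : GradedSMul 𝒜 (gradedDualGrading K R 𝒩) :=
  fun β γ p hp _ hφ => gradedSMul_fullDual hN β γ p hp _ hφ

theorem fullDual_ext_homogeneous (h : IsGrading 𝒩) {φ ψ : FullDual K R N}
    (hφ : ∀ γ, ∀ v ∈ 𝒩 γ, (φ : N →+ K) v = (ψ : N →+ K) v) : φ = ψ :=
  Subtype.ext <| AddMonoidHom.ext fun v => h.induction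
    (P := fun v => (φ : N →+ K) v = (ψ : N →+ K) v) (by rw [map_zero, map_zero])
    (fun a b ha hb => by rw [map_add, map_add, ha, hb]) hφ v

theorem isGrading_gradedDual (h : IsGrading 𝒩) (hN : GradedSMul 𝒜 𝒩) :
    IsGrading (gradedDualGrading K R 𝒩) := by
  refine isGrading_span (𝒜 := 𝒜) (gradedSMul_fullDual hN) fun s b hb hs γ hγ => ?_
  refine fullDual_ext_homogeneous h fun β v hv => ?_
  by_cases hβ : β = -γ
  · have h1 : ((∑ γ ∈ s, b γ : FullDual K R N) : N →+ K) v = 0 := by rw [hs]; rfl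
    rw [AddSubgroup.val_finsetSum, AddMonoidHom.finsetSum_apply, Finset.sum_eq_single γ] at h1
    · exact h1
    · exact fun δ _ hδ => hb δ β (fun h' => hδ (neg_injective (h'.symm.trans hβ))) v hv
    · exact fun h' => absurd hγ h'
  · exact hb γ β hβ v hv

theorem gradedDual_mem_span (φ : GradedDual K R 𝒩) :
    φ ∈ Submodule.span R {φ | ∃ γ, φ ∈ gradedDualGrading K R 𝒩 γ} :=
  mem_span_homogeneous φ

/-- A homogeneous functional, as an element of the graded dual. -/
theorem exists_gradedDual {γ : Γ} {φ : FullDual K R N} (hφ : φ ∈ fullDualGrading K R 𝒩 γ) :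
    ∃ ψ ∈ gradedDualGrading K R 𝒩 γ, (ψ : FullDual K R N) = φ :=
  ⟨⟨φ, Submodule.subset_span ⟨γ, hφ⟩⟩, hφ, rfl⟩

/-- Functionals on cycles which vanish on boundaries induce functionals on a subquotient. -/
theorem exists_functional_subquotient {Z B : Submodule R N} (ψ : Z →+ K)
    (hψ : ∀ (a : K) v, ψ (algebraMap K R a • v) = a * ψ v) (h0 : ∀ v : Z, (v : N) ∈ B → ψ v = 0) :
    ∃ φ : FullDual K R (Subquotient Z B), ∀ z : Z,
      (φ : Subquotient Z B →+ K) ((B.submoduleOf Z).mkQ z) = ψ z := by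
  have hs := (B.submoduleOf Z).mkQ_surjective
  have key : ∀ z z' : Z, (B.submoduleOf Z).mkQ z = (B.submoduleOf Z).mkQ z' → ψ z = ψ z' := by
    intro z z' h
    rw [← sub_eq_zero, ← map_sub]
    exact h0 _ ((subquotient_mk_eq_zero _).1 (by rw [map_sub, h, sub_self]))
  have hinv := Function.surjInv_eq hs
  refine ⟨⟨AddMonoidHom.mk' (fun q => ψ (Function.surjInv hs q)) fun a b => ?_, fun a v => ?_⟩,
    fun z => key _ _ (hinv _)⟩
  · rw [← map_add]
    exact key _ _ (by rw [hinv, map_add, hinv, hinv])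
  · change ψ _ = a * ψ _
    rw [← hψ]
    exact key _ _ (by rw [hinv, map_smul, hinv])

/-- A functional on a subspace `E` extends along a linear map `D`, with prescribed zeros `U`, if it
vanishes where `D` takes values in `U`. -/
theorem exists_functional_extension {N' : Type*} [AddCommGroup N'] [Module R N'] (D : N →ₗ[R] N')
    {E : AddSubgroup N} {U : AddSubgroup N'} (hE : ∀ (a : K), ∀ v ∈ E, algebraMap K R a • v ∈ E)
    (hU : ∀ (a : K), ∀ v ∈ U, algebraMap K R a • v ∈ U) (φ : E →+ K)
    (hφ : ∀ (a : K) (v : N) (hv : v ∈ E), φ ⟨_, hE a v hv⟩ = a * φ ⟨v, hv⟩)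
    (h0 : ∀ (v : N) (hv : v ∈ E), D v ∈ U → φ ⟨v, hv⟩ = 0) :
    ∃ ψ : FullDual K R N', (∀ (v : N) (hv : v ∈ E), (ψ : N' →+ K) (D v) = φ ⟨v, hv⟩) ∧
      ∀ u ∈ U, (ψ : N' →+ K) u = 0 := by
  let _ : Module K N := Module.compHom N (algebraMap K R)
  let _ : Module K N' := Module.compHom N' (algebraMap K R)
  let E' : Submodule K N := { E with smul_mem' := fun a v hv => hE a v hv }
  let U' : Submodule K N' := { U with smul_mem' := fun a v hv => hU a v hv }
  let φ' : E' →ₗ[K] K :=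
    { toFun := fun v => φ ⟨v, v.2⟩
      map_add' := fun v w => map_add φ ⟨v, v.2⟩ ⟨w, w.2⟩
      map_smul' := fun a v => hφ a v v.2 }
  -- Over the field `K`, a functional which vanishes on the kernel of the composite of `D` with the
  -- projection modulo `U` is a pullback along this composite.
  let D' : E' →ₗ[K] N' ⧸ U' := U'.mkQ ∘ₗ
    { toFun := fun v => D v
      map_add' := fun v w => map_add D _ _
      map_smul' := fun a v => map_smul D (algebraMap K R a) (v : N) }
  have h1 : φ' ∈ LinearMap.range D'.dualMap := by
    rw [LinearMap.range_dualMap_eq_dualAnnihilator_ker, Submodule.mem_dualAnnihilator]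
    intro v hv
    exact h0 v v.2 ((Submodule.Quotient.mk_eq_zero U').1 hv)
  obtain ⟨χ, hχ⟩ := h1
  refine ⟨⟨(χ ∘ₗ U'.mkQ).toAddMonoidHom, fun a v => (χ ∘ₗ U'.mkQ).map_smul a v⟩,
    fun v hv => LinearMap.congr_fun hχ (⟨v, hv⟩ : E'), fun u hu => ?_⟩
  change χ (U'.mkQ u) = 0
  rw [Submodule.mkQ_apply, (Submodule.Quotient.mk_eq_zero U').2 hu, map_zero]

end GradedDual

/-! ### Duality between hypercohomology for complementary families of variables -/

section Duality

variable {K ι α β σ Γ : Type*} [Field K] [Fintype ι] [LinearOrder α] [Fintype α] [LinearOrder β]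
  [Fintype β] [AddCommGroup Γ] [DecidableEq Γ] {f : α → ι} {g : β → ι} {wt : ι → Γ} {lev : σ → ℤ}
  {w w' : σ → Γ}
  {dA dB : (σ →₀ MvPolynomial ι K) →ₗ[MvPolynomial ι K] (σ →₀ MvPolynomial ι K)}

attribute [local instance] weightedGradedAlgebra

/-- Two complexes of graded free modules on the same basis, which are dual to each other up to a
twist by the canonical module, together with two complementary families of variables. -/
structure IsDualPair (f : α → ι) (g : β → ι) (wt : ι → Γ) (lev : σ → ℤ) (w w' : σ → Γ)
    (dA dB : (σ →₀ MvPolynomial ι K) →ₗ[MvPolynomial ι K] (σ →₀ MvPolynomial ι K)) : Prop where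
  left_injective : Function.Injective f
  right_injective : Function.Injective g
  compl : ∀ l, l ∈ Set.range f ↔ l ∉ Set.range g
  left : GradedComplex (weightedHomogeneousSubmodule K wt) (freeGr wt w) (freeLevel K ι lev) dA
  right : GradedComplex (weightedHomogeneousSubmodule K wt) (freeGr wt w')
    (freeLevel K ι fun i => -lev i) dB
  adjoint : ∀ a b, dot (dA a) b = dot a (dB b)
  weight : ∀ i, w i + w' i = ∑ l, wt l
  finite_level : ∀ j, {i | lev i = j}.Finite
  finite_exponent : ∀ γ, {u : ι → ℤ | (∀ a, 0 ≤ u (f a)) ∧ (∀ b, u (g b) < 0) ∧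
    intWt wt u = γ}.Finite

/-- The pairing of Čech cochains: the residue pairing of the components at the full index sets. -/
def cochainPair (f : α → ι) (g : β → ι) (c : CechCochain (varFam K f) (σ →₀ MvPolynomial ι K))
    (b : CechCochain (varFam K g) (σ →₀ MvPolynomial ι K)) : K :=
  pair f g Finset.univ Finset.univ (c Finset.univ) (b Finset.univ)

theorem coef_C_smul {J : Finset β} (a : K) (i : σ) (u : ι → ℤ)
    (z : CechLocal (varFam K g) (σ →₀ MvPolynomial ι K) J) :
    coef g J i u (algebraMap K (MvPolynomial ι K) a • z) = a * coef g J i u z := by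
  rw [coef_apply, map_smul, Finsupp.smul_apply, Algebra.smul_def]
  have h : algebraMap (MvPolynomial ι K) (Laurent K ι) (algebraMap K (MvPolynomial ι K) a) =
      lmono 0 a := algebraMap_monomial 0 a
  rw [h]
  have := AddMonoidAlgebra.coeff_single_mul_apply (R := K) a (0 : ι → ℤ)
    (x := (expand g J z i : Laurent K ι)) u
  rw [neg_zero, zero_add] at this
  exact this

theorem pair_of_coef_single [DecidableEq σ] [DecidableEq (ι → ℤ)] {J : Finset α} {J' : Finset β}
    {i : σ} {u : ι → ℤ} {E : CechLocal (varFam K g) (σ →₀ MvPolynomial ι K) J'}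
    (hE : ∀ i' u', coef g J' i' u' E = if i = i' ∧ u = u' then 1 else 0)
    (z : CechLocal (varFam K f) (σ →₀ MvPolynomial ι K) J) :
    pair f g J J' z E = coef f J i ((fun _ => -1) - u) z := by
  have h1 : expand g J' E = Finsupp.single i (lmono u 1) := by
    ext1 i'
    refine lcoeff_ext fun u' => ?_
    rw [← coef_apply, hE]
    by_cases hi : i = i'
    · subst hi
      rw [Finsupp.single_eq_same, lcoeff_lmono]
      simp
    · rw [Finsupp.single_eq_of_ne (Ne.symm hi), map_zero, if_neg fun h => hi h.1]
  rw [pair, h1, dot_single_right, mul_comm, lcoeff_lmono_mul, coef_apply]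

namespace IsDualPair

variable (h : IsDualPair f g wt lev w w' dA dB)
include h

theorem pair_eq_zero_left {z : CechLocal (varFam K f) (σ →₀ MvPolynomial ι K) Finset.univ}
    (hz : ∀ i u, (∀ a, u (f a) < 0) → coef f Finset.univ i u z = 0)
    (z' : CechLocal (varFam K g) (σ →₀ MvPolynomial ι K) Finset.univ) :
    pair f g Finset.univ Finset.univ z z' = 0 := by
  by_contra hne
  obtain ⟨i, u, h1, h2⟩ := exists_coef_of_pair_ne_zero hne
  refine h1 (hz i u fun a => ?_)
  have := nonneg_of_coef_ne_zero h2 (l := f a) (by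
    rintro ⟨b, -, hb⟩
    exact (h.compl (f a)).1 ⟨a, rfl⟩ ⟨b, hb⟩)
  rw [Pi.sub_apply] at this
  omega

theorem pair_eq_zero_right (z : CechLocal (varFam K f) (σ →₀ MvPolynomial ι K) Finset.univ)
    {z' : CechLocal (varFam K g) (σ →₀ MvPolynomial ι K) Finset.univ}
    (hz : ∀ i u, (∀ b, u (g b) < 0) → coef g Finset.univ i u z' = 0) :
    pair f g Finset.univ Finset.univ z z' = 0 := by
  by_contra hne
  obtain ⟨i, u, h1, h2⟩ := exists_coef_of_pair_ne_zero hne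
  refine h2 (hz i _ fun b => ?_)
  have := nonneg_of_coef_ne_zero h1 (l := g b) (by
    rintro ⟨a, -, ha⟩
    exact (h.compl (g b)).1 ⟨a, ha⟩ ⟨b, rfl⟩)
  rw [Pi.sub_apply]
  omega

/-- The differentials of the two total complexes are adjoint up to sign. -/
theorem cochainPair_totD (c : CechCochain (varFam K f) (σ →₀ MvPolynomial ι K))
    (b : CechCochain (varFam K g) (σ →₀ MvPolynomial ι K)) :
    cochainPair f g (totD _ dA c) b =
      (-1) ^ (Fintype.card α + Fintype.card β) * cochainPair f g c (totD _ dB b) := by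
  have hsign : ∀ (n : ℕ) z, pair f g Finset.univ Finset.univ
      ((-1 : MvPolynomial ι K) ^ n • z) (b Finset.univ) =
      (-1) ^ n * pair f g Finset.univ Finset.univ z (b Finset.univ) := fun n z => by
    rcases Nat.even_or_odd n with h | h
    · rw [h.neg_one_pow, h.neg_one_pow, one_smul, one_mul]
    · rw [h.neg_one_pow, h.neg_one_pow, neg_one_smul, pair_neg_left, neg_one_mul]
  have hsign' : ∀ (n : ℕ) z, pair f g Finset.univ Finset.univ (c Finset.univ)
      ((-1 : MvPolynomial ι K) ^ n • z) =
      (-1) ^ n * pair f g Finset.univ Finset.univ (c Finset.univ) z := fun n z => by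
    have := pair_C_smul_right (f := f) (g := g) ((-1) ^ n) (c Finset.univ) z
    rwa [map_pow, map_neg, map_one] at this
  rw [cochainPair, cochainPair, totD_apply, totD_apply, pair_add_left, pair_add_right,
    h.pair_eq_zero_left (isRegular_cechD h.left_injective c),
    h.pair_eq_zero_right _ (isRegular_cechD h.right_injective b), zero_add, zero_add, hsign, hsign',
    pair_locMap h.adjoint, Finset.card_univ, Finset.card_univ, ← mul_assoc, pow_add, mul_assoc _ _
    ((-1 : K) ^ Fintype.card β), ← mul_pow, neg_one_mul, neg_neg, one_pow, mul_one]

/-- Homogeneous cochains pair to zero unless their degrees are opposite. -/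
theorem cochainPair_eq_zero {γ δ : Γ} (hne : δ ≠ -γ)
    {c : CechCochain (varFam K f) (σ →₀ MvPolynomial ι K)}
    {b : CechCochain (varFam K g) (σ →₀ MvPolynomial ι K)}
    (hc : c ∈ cechGrading (weightedHomogeneousSubmodule K wt) (varFam K f) (freeGr wt w) γ)
    (hb : b ∈ cechGrading (weightedHomogeneousSubmodule K wt) (varFam K g) (freeGr wt w') δ) :
    cochainPair f g c b = 0 := by
  by_contra h0
  obtain ⟨i, u, h1, h2⟩ := exists_coef_of_pair_ne_zero h0
  have h3 := degree_of_coef_ne_zero (hc Finset.univ trivial) h1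
  have h4 := degree_of_coef_ne_zero (hb Finset.univ trivial) h2
  have h5 : intWt wt (fun _ => -1) = -∑ l, wt l := by
    simp only [intWt, neg_smul, one_smul, Finset.sum_neg_distrib]
  rw [intWt_sub, h5, ← h.weight i] at h4
  refine hne ?_
  rw [← h3, ← h4]
  abel

/-- The exponents and basis elements which contribute to the pairing with cochains of given degree. -/
theorem finite_exponents (j : ℤ) (γ : Γ) : {p : σ × (ι → ℤ) | -lev p.1 = j ∧
    (∀ a, 0 ≤ p.2 (f a)) ∧ (∀ b, p.2 (g b) < 0) ∧ intWt wt p.2 + w' p.1 = γ}.Finite := by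
  refine ((h.finite_level (-j)).biUnion (t := fun i => (fun u => (i, u)) ''
    {u : ι → ℤ | (∀ a, 0 ≤ u (f a)) ∧ (∀ b, u (g b) < 0) ∧ intWt wt u = γ - w' i}) fun i _ =>
    Set.Finite.image _ (h.finite_exponent _)).subset ?_
  rintro ⟨i, u⟩ ⟨h1, h2, h3, h4⟩
  exact Set.mem_biUnion (x := i) (by dsimp only at h1 ⊢; change lev i = -j; omega)
    ⟨u, ⟨h2, h3, by rw [← h4, add_sub_cancel_right]⟩, rfl⟩

/-- Functionals which vanish on regular cochains are represented by cochains. -/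
theorem exists_representative {t t' : ℤ} (ht : t + t' = Fintype.card α + Fintype.card β) (γ : Γ)
    (ψ : FullDual K (MvPolynomial ι K) (CechCochain (varFam K g) (σ →₀ MvPolynomial ι K)))
    (hψ : ∀ b, IsRegular g b → ψ.1 b = 0) :
    ∃ a ∈ totDeg (varFam K f) (freeLevel K ι lev) t,
      a ∈ cechGrading (weightedHomogeneousSubmodule K wt) (varFam K f) (freeGr wt w) γ ∧
      ∀ b ∈ totDeg (varFam K g) (freeLevel K ι fun i => -lev i) t',
        b ∈ cechGrading (weightedHomogeneousSubmodule K wt) (varFam K g) (freeGr wt w') (-γ) →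
        cochainPair f g a b = ψ.1 b := by
  classical
  have hfin := h.finite_exponents (t' - Fintype.card β) (-γ)
  have hE : ∀ p : σ × (ι → ℤ), ∃ E : CechLocal (varFam K g) (σ →₀ MvPolynomial ι K) Finset.univ,
      (∀ a, 0 ≤ p.2 (f a)) → ∀ i' u', coef g Finset.univ i' u' E =
        if p.1 = i' ∧ p.2 = u' then 1 else 0 := fun p => by
    by_cases hp : ∀ a, 0 ≤ p.2 (f a)
    · obtain ⟨E, -, -, hE⟩ := exists_coef_single (f := g) (J := Finset.univ) (wt := wt) lev w p.1 p.2
        (1 : K) (fun l hl => by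
          obtain ⟨a, rfl⟩ := (h.compl l).2 (by simpa using hl)
          exact hp a)
      exact ⟨E, fun _ => hE⟩
    · exact ⟨0, fun h => absurd h hp⟩
  -- For each of the finitely many monomials `p` which can contribute, `e p` is the cochain with the
  -- single coefficient `1` at `p`. Modulo regular cochains, these span the cochains of the given
  -- degree, and the inverse monomials `inv p` form the dual basis; hence the functional is
  -- represented by the cochain with the coefficient `ψ (e p)` at `inv p`.
  choose E hE using hE
  let e : σ × (ι → ℤ) → CechCochain (varFam K g) (σ →₀ MvPolynomial ι K) :=
    fun p => Pi.single Finset.univ (E p)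
  have he : ∀ p, e p Finset.univ = E p := fun p => Pi.single_eq_same _ _
  let inv : σ × (ι → ℤ) → σ × (ι → ℤ) := fun p => (p.1, (fun _ => -1) - p.2)
  have hinv : ∀ p, inv (inv p) = p := fun p => Prod.ext rfl (sub_sub_cancel _ _)
  let F : σ × (ι → ℤ) → K := fun p => if inv p ∈ hfin.toFinset then ψ.1 (e (inv p)) else 0
  have hFs : (Function.support F).Finite := by
    refine (hfin.image inv).subset fun p hp => ⟨inv p, ?_, hinv p⟩
    by_contra h'
    exact hp (if_neg fun h'' => h' (hfin.mem_toFinset.1 h''))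
  have hF : ∀ i u, F (i, u) ≠ 0 → inv (i, u) ∈ hfin.toFinset := fun i u hne => by
    by_contra h'
    exact hne (if_neg h')
  obtain ⟨z, hz, hzg, hzF⟩ := exists_of_coef (f := f) (J := Finset.univ) (lev := lev) (w := w)
    (wt := wt) (j := t - Fintype.card α) (γ := γ) (Finsupp.ofSupportFinite F hFs) (by
      intro i u hne l hl
      obtain ⟨-, -, h3, -⟩ := hfin.mem_toFinset.1 (hF i u hne)
      obtain ⟨b, rfl⟩ : l ∈ Set.range g := by
        by_contra h'
        obtain ⟨a, ha⟩ := (h.compl l).2 h'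
        exact hl ⟨a, by simp, ha⟩
      have := h3 b
      change -1 - u (g b) < 0 at this
      omega) (by
      intro i u hne
      obtain ⟨h1, -, -, -⟩ := hfin.mem_toFinset.1 (hF i u hne)
      change -lev i = _ at h1
      omega) (by
      intro i u hne
      obtain ⟨-, -, -, h4⟩ := hfin.mem_toFinset.1 (hF i u hne)
      change intWt wt ((fun _ => -1) - u) + w' i = -γ at h4
      have h5 : intWt wt (fun _ => -1) = -∑ l, wt l := by
        simp only [intWt, neg_smul, one_smul, Finset.sum_neg_distrib]
      rw [intWt_sub, h5, ← h.weight i] at h4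
      rw [← neg_injective.eq_iff, ← h4]
      abel)
  have ha : (Pi.single Finset.univ z : CechCochain (varFam K f) (σ →₀ MvPolynomial ι K))
    Finset.univ = z := Pi.single_eq_same _ _
  refine ⟨Pi.single Finset.univ z, ?_, ?_, ?_⟩
  · intro J _
    by_cases hJ : J = Finset.univ
    · subst hJ
      rw [ha]
      change z ∈ locSub _ _ (freeLevel K ι lev (t - (Finset.univ : Finset α).card))
      rwa [Finset.card_univ]
    · rw [Pi.single_eq_of_ne hJ]
      exact zero_mem _
  · intro J _
    by_cases hJ : J = Finset.univ
    · subst hJ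
      rw [ha]
      exact hzg
    · rw [Pi.single_eq_of_ne hJ]
      exact (cechLocalGrading (weightedHomogeneousSubmodule K wt) (varFam K f) (freeGr wt w) J
        γ).zero_mem
  · intro b hb hbg
    let c : σ × (ι → ℤ) → K := fun p => coef g Finset.univ p.1 p.2 (b Finset.univ)
    let b₁ : CechCochain (varFam K g) (σ →₀ MvPolynomial ι K) :=
      ∑ p ∈ hfin.toFinset, algebraMap K (MvPolynomial ι K) (c p) • e p
    have hb₁ : b₁ Finset.univ =
        ∑ p ∈ hfin.toFinset, algebraMap K (MvPolynomial ι K) (c p) • E p := by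
      simp only [b₁]
      refine (Finset.sum_apply _ _ _).trans (Finset.sum_congr rfl fun p _ => ?_)
      rw [Pi.smul_apply, he]
    have hreg : IsRegular g (b - b₁) := by
      intro i u hu
      have h1 : coef g Finset.univ i u (b₁ Finset.univ) =
          if (i, u) ∈ hfin.toFinset then c (i, u) else 0 := by
        rw [hb₁, map_sum, ← Finset.sum_ite_eq' hfin.toFinset (i, u) c]
        refine Finset.sum_congr rfl fun p hp => ?_
        rw [coef_C_smul, hE p (hfin.mem_toFinset.1 hp).2.1, mul_ite, mul_one,
          mul_zero]
        simp only [Prod.ext_iff]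
      rw [Pi.sub_apply, map_sub, h1, sub_eq_zero]
      split_ifs with hmem
      · rfl
      · by_contra hne
        refine hmem (hfin.mem_toFinset.2 ⟨?_, fun a => ?_, hu, ?_⟩)
        · have := level_of_coef_ne_zero (hb Finset.univ trivial) hne
          rwa [Finset.card_univ] at this
        · refine nonneg_of_coef_ne_zero hne ?_
          rintro ⟨b, -, hb⟩
          exact (h.compl (f a)).1 ⟨a, rfl⟩ ⟨b, hb⟩
        · exact degree_of_coef_ne_zero (hbg Finset.univ trivial) hne
    have h1 : ψ.1 b = ∑ p ∈ hfin.toFinset, c p * ψ.1 (e p) := by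
      have h2 := hψ _ hreg
      rw [map_sub, sub_eq_zero] at h2
      rw [h2, map_sum]
      exact Finset.sum_congr rfl fun p _ => ψ.2 _ _
    have h2 : cochainPair f g (Pi.single Finset.univ z) b = ∑ p ∈ hfin.toFinset, c p *
        pair f g Finset.univ Finset.univ z (E p) := by
      have h3 := h.pair_eq_zero_right z hreg
      rw [← pairHom_apply, Pi.sub_apply, map_sub, sub_eq_zero, hb₁, map_sum] at h3
      rw [cochainPair, ha, ← pairHom_apply, h3]
      refine Finset.sum_congr rfl fun p _ => ?_
      rw [pairHom_apply, pair_C_smul_right]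
    rw [h1, h2]
    refine Finset.sum_congr rfl fun p hp => ?_
    rw [pair_of_coef_single (hE p (hfin.mem_toFinset.1 hp).2.1), hzF]
    change _ * F (inv p) = _
    have h3 : F (inv p) = ψ.1 (e p) := by
      simp only [F, hinv]
      rw [if_pos hp]
    rw [h3]

/-- Cochains in the kernel of the pairing are regular. -/
theorem isRegular_of_cochainPair {t t' : ℤ} (ht : t + t' = Fintype.card α + Fintype.card β) {γ : Γ}
    {c : CechCochain (varFam K f) (σ →₀ MvPolynomial ι K)}
    (hc : c ∈ totDeg (varFam K f) (freeLevel K ι lev) t)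
    (hcg : c ∈ cechGrading (weightedHomogeneousSubmodule K wt) (varFam K f) (freeGr wt w) γ)
    (h0 : ∀ b ∈ totDeg (varFam K g) (freeLevel K ι fun i => -lev i) t',
        b ∈ cechGrading (weightedHomogeneousSubmodule K wt) (varFam K g) (freeGr wt w') (-γ) →
        cochainPair f g c b = 0) : IsRegular f c := by
  classical
  intro i u hu
  by_contra hne
  have h1 := level_of_coef_ne_zero (hc Finset.univ trivial) hne
  have h2 := degree_of_coef_ne_zero (hcg Finset.univ trivial) hne
  -- The pairing with the cochain with a single coefficient at the inverse monomial picks out the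
  -- coefficient in question.
  obtain ⟨E, hEl, hEg, hE⟩ := exists_coef_single (f := g) (J := Finset.univ) (wt := wt)
    (fun i => -lev i) w' i ((fun _ => -1) - u) (1 : K) (fun l hl => by
      obtain ⟨a, rfl⟩ := (h.compl l).2 (by simpa using hl)
      have := hu a
      rw [Pi.sub_apply]
      omega)
  have hb : (Pi.single Finset.univ E : CechCochain (varFam K g) (σ →₀ MvPolynomial ι K))
    Finset.univ = E := Pi.single_eq_same _ _
  have h3 := h0 (Pi.single Finset.univ E) (by
    intro J _
    by_cases hJ : J = Finset.univ
    · subst hJ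
      rw [hb]
      rw [Finset.card_univ] at h1
      change E ∈ locSub _ _ (freeLevel K ι (fun i => -lev i) (t' - (Finset.univ : Finset β).card))
      rwa [Finset.card_univ, show t' - (Fintype.card β : ℤ) = -lev i by omega]
    · rw [Pi.single_eq_of_ne hJ]
      exact zero_mem _) (by
    intro J _
    by_cases hJ : J = Finset.univ
    · subst hJ
      rw [hb]
      have h5 : intWt wt (fun _ => -1) = -∑ l, wt l := by
        simp only [intWt, neg_smul, one_smul, Finset.sum_neg_distrib]
      rw [show intWt wt ((fun _ => -1) - u) + w' i = -γ by
        rw [← h2, intWt_sub, h5, ← h.weight i]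
        abel] at hEg
      exact hEg
    · rw [Pi.single_eq_of_ne hJ]
      exact (cechLocalGrading (weightedHomogeneousSubmodule K wt) (varFam K g) (freeGr wt w') J
        _).zero_mem)
  rw [cochainPair, hb, pair_of_coef_single hE, sub_sub_cancel] at h3
  exact hne h3

end IsDualPair

end Duality

/-! ### The duality isomorphism -/

section DualMap

variable {Γ K R X Y : Type*} [Field K] [CommRing R] [Algebra K R] [AddCommGroup X] [Module R X]
  [AddCommGroup Y] [Module R Y] [AddCommGroup Γ] [DecidableEq Γ] {𝒜 : Γ → Submodule K R}
  [GradedAlgebra 𝒜] {𝒢 : Γ → AddSubgroup X} {𝒢' : Γ → AddSubgroup Y} {Z B : Submodule R X}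
  {Z' B' : Submodule R Y}

/-- A graded pairing between cycles under which boundaries are orthogonal to cycles induces a map
from one subquotient to the graded dual of the other. -/
theorem exists_dualMap (P : X → Y →+ K) (hadd : ∀ a a' b, P (a + a') b = P a b + P a' b)
    (hsmul : ∀ (r : R) a b, P (r • a) b = P a (r • b))
    (hC : ∀ (r : K) a b, P a (algebraMap K R r • b) = r * P a b)
    (hdeg : ∀ γ δ a b, δ ≠ -γ → a ∈ 𝒢 γ → b ∈ 𝒢' δ → P a b = 0)
    (hB : ∀ a ∈ B, ∀ b ∈ Z', P a b = 0) (hB' : ∀ a ∈ Z, ∀ b ∈ B', P a b = 0)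
    (h𝒢 : GradedSMul 𝒜 𝒢) (h𝒢' : GradedSMul 𝒜 𝒢') (hQ : IsGrading (subquotientGrading 𝒢 Z B))
    (hQ' : IsGrading (subquotientGrading 𝒢' Z' B')) :
    ∃ Φ : Subquotient Z B →ₗ[R] GradedDual K R (subquotientGrading 𝒢' Z' B'),
      ∀ γ (a : Z), (a : X) ∈ 𝒢 γ → Φ ((B.submoduleOf Z).mkQ a) ∈
        gradedDualGrading K R (subquotientGrading 𝒢' Z' B') γ ∧
        ∀ b : Z', (Φ ((B.submoduleOf Z).mkQ a)).1.1 ((B'.submoduleOf Z').mkQ b) = P a b := by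
  have hzero : ∀ b, P 0 b = 0 := fun b => by
    have := hadd 0 0 b
    rwa [add_zero, eq_comm, add_eq_left] at this
  let q' := (B'.submoduleOf Z').mkQ
  let 𝒟 := gradedDualGrading K R (subquotientGrading 𝒢' Z' B')
  let Rel : Submodule R (Z × GradedDual K R (subquotientGrading 𝒢' Z' B')) :=
    { carrier := {p | ∀ b : Z', p.2.1.1 (q' b) = P p.1 b}
      zero_mem' := fun b => (hzero b).symm
      add_mem' := fun {p p'} hp hp' b => by
        have h1 : (p + p').2.1.1 (q' b) = p.2.1.1 (q' b) + p'.2.1.1 (q' b) := rfl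
        rw [h1, hp b, hp' b, ← hadd]
        rfl
      smul_mem' := fun r p hp b => by
        have h1 : (r • p).2.1.1 (q' b) = p.2.1.1 (q' (r • b)) := by
          rw [map_smul]
          rfl
        rw [h1, hp (r • b)]
        exact (hsmul r p.1 b).symm }
  have tot : ∀ γ (a : Z), (a : X) ∈ 𝒢 γ → ∃ φ ∈ 𝒟 γ, (a, φ) ∈ Rel := fun γ a ha => by
    obtain ⟨φ, hφ⟩ := exists_functional_subquotient (K := K) (R := R) (Z := Z') (B := B')
      ((P a).comp Z'.subtype.toAddMonoidHom) (fun r v => hC r a v) (fun v hv => hB' a a.2 v hv)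
    have hφγ : φ ∈ fullDualGrading K R (subquotientGrading 𝒢' Z' B') γ := by
      rintro δ hδ _ ⟨b, hb, rfl⟩
      exact (hφ b).trans (hdeg γ δ a b hδ ha hb)
    obtain ⟨φ', hφ', rfl⟩ := exists_gradedDual hφγ
    exact ⟨φ', hφ', hφ⟩
  have hs' : GradedSMul 𝒜 (subquotientGrading 𝒢' Z' B') := gradedSMul_subquotient h𝒢' Z' B'
  obtain ⟨Φ, hΦ⟩ := exists_linearMap_of_rel 𝒜
    (𝒬 := fun γ => (𝒢 γ).comap Z.subtype.toAddMonoidHom) (𝒬' := 𝒟) hQ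
    (fun β γ p hp z hz => h𝒢 β γ p hp _ hz) (gradedSMul_gradedDual hs') (B.submoduleOf Z).mkQ
    LinearMap.id (fun γ q => Iff.rfl) Rel tot
    (fun γ a ha φ hφ hr h0 => by
      rw [subquotient_mk_eq_zero] at h0
      refine Subtype.ext (fullDual_ext_homogeneous hQ' ?_)
      rintro δ _ ⟨b, hb, rfl⟩
      exact (hr b).trans (hB a h0 b b.2))
  refine ⟨Φ, fun γ a ha => ?_⟩
  obtain ⟨φ, hφ, hr⟩ := tot γ a ha
  rw [hΦ γ a ha φ hφ hr]
  exact ⟨hφ, hr⟩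

/-- Two subquotients with a graded pairing are dual to each other if every cycle orthogonal to all
cycles is a boundary and every homogeneous functional is the pairing with a cycle. -/
theorem gradedIso_of_pairing (P : X → Y →+ K) (hadd : ∀ a a' b, P (a + a') b = P a b + P a' b)
    (hsmul : ∀ (r : R) a b, P (r • a) b = P a (r • b))
    (hC : ∀ (r : K) a b, P a (algebraMap K R r • b) = r * P a b)
    (hdeg : ∀ γ δ a b, δ ≠ -γ → a ∈ 𝒢 γ → b ∈ 𝒢' δ → P a b = 0)
    (hB : ∀ a ∈ B, ∀ b ∈ Z', P a b = 0) (hB' : ∀ a ∈ Z, ∀ b ∈ B', P a b = 0)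
    (h𝒢 : GradedSMul 𝒜 𝒢) (h𝒢' : GradedSMul 𝒜 𝒢') (hQ : IsGrading (subquotientGrading 𝒢 Z B))
    (hQ' : IsGrading (subquotientGrading 𝒢' Z' B'))
    (horth : ∀ γ, ∀ a ∈ Z, a ∈ 𝒢 γ → (∀ b ∈ Z', b ∈ 𝒢' (-γ) → P a b = 0) → a ∈ B)
    (hrep : ∀ (γ : Γ) (χ : FullDual K R (Subquotient Z' B')), ∃ a ∈ Z, a ∈ 𝒢 γ ∧
      ∀ b : Z', (b : Y) ∈ 𝒢' (-γ) → P a b = χ.1 ((B'.submoduleOf Z').mkQ b)) :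
    GradedIso R (subquotientGrading 𝒢 Z B)
      (gradedDualGrading K R (subquotientGrading 𝒢' Z' B')) := by
  obtain ⟨Φ, hrel⟩ := exists_dualMap P hadd hsmul hC hdeg hB hB' h𝒢 h𝒢' hQ hQ'
  have hs' : GradedSMul 𝒜 (subquotientGrading 𝒢' Z' B') := gradedSMul_subquotient h𝒢' Z' B'
  have hΦg : IsGradedHom (subquotientGrading 𝒢 Z B)
      (gradedDualGrading K R (subquotientGrading 𝒢' Z' B')) Φ := by
    rintro γ _ ⟨c, hc, rfl⟩
    exact (hrel γ c hc).1
  have hinj : Function.Injective Φ := by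
    refine injective_of_homogeneous hQ (isGrading_gradedDual hQ' hs') hΦg ?_
    rintro γ _ ⟨c, hc, rfl⟩ h0
    refine (subquotient_mk_eq_zero c).2 (horth γ c c.2 hc fun b hb hbg => ?_)
    rw [← (hrel γ c hc).2 ⟨b, hb⟩]
    have h1 : Φ ((B.submoduleOf Z).mkQ c) = 0 := h0
    rw [h1]
    rfl
  obtain ⟨e, -, he⟩ := exists_equiv_of_bijective hΦg hinj (fun γ χ hχ => by
    obtain ⟨c, hc, hcg, hcχ⟩ := hrep γ χ.1
    refine ⟨(B.submoduleOf Z).mkQ ⟨c, hc⟩, ⟨⟨c, hc⟩, hcg, rfl⟩, Subtype.ext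
      (fullDual_ext_homogeneous hQ' ?_)⟩
    rintro δ _ ⟨b, hb, rfl⟩
    refine ((hrel γ ⟨c, hc⟩ hcg).2 b).trans ?_
    by_cases hδ : δ = -γ
    · subst hδ
      exact hcχ b hb
    · rw [hdeg γ δ c b hδ hcg hb]
      exact (hχ δ hδ _ ⟨b, hb, rfl⟩).symm) gradedDual_mem_span
  exact ⟨e, he⟩

end DualMap

section DualityIso

variable {K ι α β σ Γ : Type*} [Field K] [Fintype ι] [LinearOrder α] [Fintype α] [LinearOrder β]
  [Fintype β] [AddCommGroup Γ] [DecidableEq Γ] {f : α → ι} {g : β → ι} {wt : ι → Γ} {lev : σ → ℤ}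
  {w w' : σ → Γ}
  {dA dB : (σ →₀ MvPolynomial ι K) →ₗ[MvPolynomial ι K] (σ →₀ MvPolynomial ι K)}

attribute [local instance] weightedGradedAlgebra

theorem varFam_mem (wt : ι → Γ) (f : α → ι) (i : α) :
    ∃ β, varFam K f i ∈ weightedHomogeneousSubmodule K wt β :=
  ⟨wt (f i), isWeightedHomogeneous_X K wt (f i)⟩

theorem C_smul_mem_grading {N : Type*} [AddCommGroup N] [Module (MvPolynomial ι K) N]
    {𝒩 : Γ → AddSubgroup N} (hN : GradedSMul (weightedHomogeneousSubmodule K wt) 𝒩) (a : K) {γ : Γ}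
    {v : N} (hv : v ∈ 𝒩 γ) : algebraMap K (MvPolynomial ι K) a • v ∈ 𝒩 γ := by
  have := hN 0 γ _ (SetLike.algebraMap_mem_graded (weightedHomogeneousSubmodule K wt) a) v hv
  rwa [zero_add] at this

/-- The regular cochains. -/
def regularCochains (K : Type*) [Field K] {ι α : Type*} (σ : Type*) [Fintype ι] [LinearOrder α]
    [Fintype α] (f : α → ι) : AddSubgroup (CechCochain (varFam K f) (σ →₀ MvPolynomial ι K)) where
  carrier := {c | IsRegular f c}
  zero_mem' := fun i u _ => by rw [Pi.zero_apply, map_zero]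
  add_mem' := fun ha hb i u hu => by rw [Pi.add_apply, map_add, ha i u hu, hb i u hu, add_zero]
  neg_mem' := fun ha i u hu => by rw [Pi.neg_apply, map_neg, ha i u hu, neg_zero]

theorem C_smul_mem_regularCochains (a : K)
    {c : CechCochain (varFam K f) (σ →₀ MvPolynomial ι K)} (hc : c ∈ regularCochains K σ f) :
    algebraMap K (MvPolynomial ι K) a • c ∈ regularCochains K σ f := fun i u hu => by
  rw [Pi.smul_apply, coef_C_smul, hc i u hu, mul_zero]

theorem cochainPair_add_left (c c' : CechCochain (varFam K f) (σ →₀ MvPolynomial ι K))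
    (b : CechCochain (varFam K g) (σ →₀ MvPolynomial ι K)) :
    cochainPair f g (c + c') b = cochainPair f g c b + cochainPair f g c' b := pair_add_left _ _ _

theorem cochainPair_smul_left (s : MvPolynomial ι K)
    (c : CechCochain (varFam K f) (σ →₀ MvPolynomial ι K))
    (b : CechCochain (varFam K g) (σ →₀ MvPolynomial ι K)) :
    cochainPair f g (s • c) b = cochainPair f g c (s • b) := pair_smul_left _ _ _

/-- The pairing with a fixed cochain, as a homomorphism. -/
def cochainPairHom (g : β → ι) (c : CechCochain (varFam K f) (σ →₀ MvPolynomial ι K)) :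
    CechCochain (varFam K g) (σ →₀ MvPolynomial ι K) →+ K :=
  AddMonoidHom.mk' (cochainPair f g c) fun _ _ => pair_add_right _ _ _

theorem cochainPairHom_apply (c : CechCochain (varFam K f) (σ →₀ MvPolynomial ι K))
    (b : CechCochain (varFam K g) (σ →₀ MvPolynomial ι K)) :
    cochainPairHom g c b = cochainPair f g c b := rfl

theorem cochainPairHom_C_smul (c : CechCochain (varFam K f) (σ →₀ MvPolynomial ι K)) (a : K)
    (b : CechCochain (varFam K g) (σ →₀ MvPolynomial ι K)) :
    cochainPairHom g c (algebraMap K (MvPolynomial ι K) a • b) = a * cochainPairHom g c b :=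
  pair_C_smul_right _ _ _

theorem cochainPair_sub_left (c c' : CechCochain (varFam K f) (σ →₀ MvPolynomial ι K))
    (b : CechCochain (varFam K g) (σ →₀ MvPolynomial ι K)) :
    cochainPair f g (c - c') b = cochainPair f g c b - cochainPair f g c' b := by
  rw [eq_sub_iff_add_eq, ← cochainPair_add_left, sub_add_cancel]

namespace IsDualPair

variable (h : IsDualPair f g wt lev w w' dA dB)
include h

theorem cochainPair_eq_zero_of_isRegular_right
    (c : CechCochain (varFam K f) (σ →₀ MvPolynomial ι K))
    {b : CechCochain (varFam K g) (σ →₀ MvPolynomial ι K)} (hb : IsRegular g b) :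
    cochainPair f g c b = 0 := h.pair_eq_zero_right _ hb

theorem mul_sign_self (c : K) : (-1 : K) ^ (Fintype.card α + Fintype.card β) *
    ((-1) ^ (Fintype.card α + Fintype.card β) * c) = c := by
  rw [← mul_assoc, ← mul_pow, neg_one_mul, neg_neg, one_pow, one_mul]

/-- A cocycle which is orthogonal to all cocycles is a coboundary. -/
theorem mem_totCoboundary_of_cochainPair {t t' : ℤ}
    (ht : t + t' = Fintype.card α + Fintype.card β) {γ : Γ}
    {c : CechCochain (varFam K f) (σ →₀ MvPolynomial ι K)}
    (hc : c ∈ totCocycle (varFam K f) dA (freeLevel K ι lev) t)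
    (hcg : c ∈ cechGrading (weightedHomogeneousSubmodule K wt) (varFam K f) (freeGr wt w) γ)
    (h0 : ∀ b ∈ totCocycle (varFam K g) dB (freeLevel K ι fun i => -lev i) t',
      b ∈ cechGrading (weightedHomogeneousSubmodule K wt) (varFam K g) (freeGr wt w') (-γ) →
      cochainPair f g c b = 0) :
    c ∈ totCoboundary (varFam K f) dA (freeLevel K ι lev) t := by
  set 𝒳 := cechGrading (weightedHomogeneousSubmodule K wt) (varFam K g)
    (freeGr (σ := σ) (K := K) wt w') with h𝒳
  -- The functional `b ↦ ⟨c, b⟩` on cochains vanishes where `D b` is regular: such a `D b` is the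
  -- coboundary of a regular cochain `v`, and `b - v` is a cocycle. So it factors through `D` by a
  -- functional `ψ` which vanishes on regular cochains, and `ψ` is represented by a cochain `a`.
  -- Then `c` and `± D a` differ by a regular cocycle, which is a coboundary.
  let E : AddSubgroup (CechCochain (varFam K g) (σ →₀ MvPolynomial ι K)) :=
    (totDeg (varFam K g) (freeLevel K ι fun i => -lev i) t').toAddSubgroup ⊓ 𝒳 (-γ)
  obtain ⟨ψ, hψ, hψ0⟩ := exists_functional_extension (K := K) (totD (varFam K g) dB) (E := E)
    (U := regularCochains K σ g)
    (fun a v hv => ⟨Submodule.smul_mem _ _ hv.1,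
      C_smul_mem_grading (gradedSMul_cechCochain (gradedSMul_freeGr w')) a hv.2⟩)
    (fun a v hv => C_smul_mem_regularCochains a hv)
    ((cochainPairHom g c).comp E.subtype)
    (fun a v hv => cochainPairHom_C_smul c a v)
    (by
      rintro b ⟨hb, hbg⟩ hreg
      change cochainPair f g c b = 0
      have hDb := h.right.totD_mem (x := varFam K g) hb
      obtain ⟨v, hv, hvg, hvu, hDv⟩ := exists_primitive_of_isRegular h.right_injective h.right hDb
        (h.right.isGradedHom_totD _ b hbg) (totD_totD h.right.sq b) hreg
      rw [add_sub_cancel_right] at hv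
      have h1 := h0 (b - v) ⟨by
        change totD _ dB (b - v) = 0
        rw [map_sub, hDv, sub_self], sub_mem hb hv⟩ (sub_mem hbg hvg)
      have h2 : cochainPair f g c v = 0 := h.cochainPair_eq_zero_of_isRegular_right c
        fun i u _ => by rw [hvu, map_zero]
      rw [← cochainPairHom_apply, map_sub, cochainPairHom_apply, cochainPairHom_apply, h2,
        sub_zero] at h1
      exact h1)
  obtain ⟨a, ha, hag, haψ⟩ := h.exists_representative (t := t - 1) (t' := t' + 1) (by omega) γ ψ hψ0
  have hDa : totD _ dA a ∈ totDeg (varFam K f) (freeLevel K ι lev) t := by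
    have := h.left.totD_mem ha
    rwa [sub_add_cancel] at this
  let ε : MvPolynomial ι K := (-1) ^ (Fintype.card α + Fintype.card β)
  have hε : ∀ v : CechCochain (varFam K g) (σ →₀ MvPolynomial ι K), ∀ c' :
      CechCochain (varFam K f) (σ →₀ MvPolynomial ι K), cochainPair f g (ε • c') v =
      (-1) ^ (Fintype.card α + Fintype.card β) * cochainPair f g c' v := fun v c' => by
    rw [cochainPair_smul_left]
    have := cochainPairHom_C_smul (g := g) c' ((-1) ^ (Fintype.card α + Fintype.card β)) v
    rwa [map_pow, map_neg, map_one] at this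
  have hεg : ε • totD _ dA a ∈ cechGrading (weightedHomogeneousSubmodule K wt) (varFam K f)
      (freeGr wt w) γ := smul_neg_one_pow_mem _ _ (h.left.isGradedHom_totD γ a hag)
  have hreg := h.isRegular_of_cochainPair ht (c := c - ε • totD _ dA a)
    (sub_mem hc.2 (Submodule.smul_mem _ _ hDa)) (sub_mem hcg hεg) (fun b hb hbg => by
      rw [cochainPair_sub_left, hε, h.cochainPair_totD, h.mul_sign_self,
        haψ _ (h.right.totD_mem hb) (h.right.isGradedHom_totD _ b hbg), hψ b ⟨hb, hbg⟩]
      exact sub_self _)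
  obtain ⟨v, hv, -, -, hDv⟩ := exists_primitive_of_isRegular h.left_injective h.left
    (sub_mem hc.2 (Submodule.smul_mem _ _ hDa)) (sub_mem hcg hεg)
    (by rw [map_sub, map_smul, totD_totD h.left.sq, smul_zero, sub_zero]; exact hc.1) hreg
  exact ⟨v + ε • a, add_mem hv (Submodule.smul_mem _ _ ha), by
    rw [map_add, hDv, map_smul, sub_add_cancel]⟩

/-- Every homogeneous functional on hypercohomology is the pairing with a cocycle. -/
theorem exists_cocycle_of_functional {t t' : ℤ}
    (ht : t + t' = Fintype.card α + Fintype.card β) {γ : Γ}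
    (χ : FullDual K (MvPolynomial ι K)
      (HyperCoh (varFam K g) dB (freeLevel K ι fun i => -lev i) t')) :
    ∃ c ∈ totCocycle (varFam K f) dA (freeLevel K ι lev) t,
      c ∈ cechGrading (weightedHomogeneousSubmodule K wt) (varFam K f) (freeGr wt w) γ ∧
      ∀ b : totCocycle (varFam K g) dB (freeLevel K ι fun i => -lev i) t',
        (b : CechCochain (varFam K g) (σ →₀ MvPolynomial ι K)) ∈
          cechGrading (weightedHomogeneousSubmodule K wt) (varFam K g) (freeGr wt w') (-γ) →
        cochainPair f g c b = χ.1 (Submodule.mkQ _ b) := by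
  set 𝒳 := cechGrading (weightedHomogeneousSubmodule K wt) (varFam K g)
    (freeGr (σ := σ) (K := K) wt w') with h𝒳
  -- The functional on cocycles vanishes on regular cocycles, which are coboundaries. Extend it to a
  -- functional on cochains which vanishes on all regular cochains, and represent the latter by a
  -- cochain `c`. Then `D c` is orthogonal to all cochains, hence regular, and it is the coboundary
  -- of a regular cochain `v`; the cocycle `c - v` represents the same functional.
  let E : AddSubgroup (CechCochain (varFam K g) (σ →₀ MvPolynomial ι K)) :=
    (totCocycle (varFam K g) dB (freeLevel K ι fun i => -lev i) t').toAddSubgroup ⊓ 𝒳 (-γ)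
  let φ : E →+ K := AddMonoidHom.mk'
    (fun v => χ.1 (Submodule.mkQ _ (⟨v, v.2.1⟩ : totCocycle (varFam K g) dB _ t')))
    (fun v v' => by rw [← map_add, ← map_add]; rfl)
  obtain ⟨ψ, hψ, hψ0⟩ := exists_functional_extension (K := K) (R := MvPolynomial ι K)
    (LinearMap.id : _ →ₗ[MvPolynomial ι K] CechCochain (varFam K g) (σ →₀ MvPolynomial ι K))
    (E := E) (U := regularCochains K σ g)
    (fun a v hv => ⟨Submodule.smul_mem _ _ hv.1,
      C_smul_mem_grading (gradedSMul_cechCochain (gradedSMul_freeGr w')) a hv.2⟩)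
    (fun a v hv => C_smul_mem_regularCochains a hv) φ
    (fun a v hv => χ.2 a (Submodule.mkQ _ (⟨v, hv.1⟩ : totCocycle (varFam K g) dB _ t')))
    (by
      rintro b ⟨hb, hbg⟩ hreg
      obtain ⟨v, hv, -, -, hDv⟩ := exists_primitive_of_isRegular h.right_injective h.right hb.2
        hbg hb.1 hreg
      have h1 : Submodule.mkQ ((totCoboundary (varFam K g) dB (freeLevel K ι fun i => -lev i)
          t').submoduleOf _) (⟨b, hb⟩ : totCocycle (varFam K g) dB _ t') = 0 :=
        (subquotient_mk_eq_zero _).2 ⟨v, hv, hDv⟩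
      exact (congrArg χ.1 h1).trans (map_zero χ.1))
  obtain ⟨c, hc, hcg, hcψ⟩ := h.exists_representative ht γ ψ hψ0
  have hreg := h.isRegular_of_cochainPair (t := t + 1) (t' := t' - 1) (by omega)
    (c := totD _ dA c) (h.left.totD_mem hc) (h.left.isGradedHom_totD γ c hcg) (fun b hb hbg => by
      have h1 : totD _ dB b ∈ totDeg (varFam K g) (freeLevel K ι fun i => -lev i) t' := by
        have := h.right.totD_mem hb
        rwa [sub_add_cancel] at this
      have h2 := h.right.isGradedHom_totD _ b hbg
      have h3 : totD _ dB b ∈ E := ⟨⟨totD_totD h.right.sq b, h1⟩, h2⟩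
      rw [h.cochainPair_totD, hcψ _ h1 h2]
      have h4 := hψ _ h3
      rw [LinearMap.id_apply] at h4
      rw [h4]
      have h5 : Submodule.mkQ ((totCoboundary (varFam K g) dB (freeLevel K ι fun i => -lev i)
          t').submoduleOf _) (⟨_, h3.1⟩ : totCocycle (varFam K g) dB _ t') = 0 :=
        (subquotient_mk_eq_zero _).2 ⟨b, hb, rfl⟩
      have h6 : φ ⟨_, h3⟩ = 0 := (congrArg χ.1 h5).trans (map_zero χ.1)
      rw [h6, mul_zero])
  obtain ⟨v, hv, hvg, hvu, hDv⟩ := exists_primitive_of_isRegular h.left_injective h.left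
    (h.left.totD_mem hc) (h.left.isGradedHom_totD γ c hcg) (totD_totD h.left.sq c) hreg
  rw [add_sub_cancel_right] at hv
  refine ⟨c - v, ⟨?_, sub_mem hc hv⟩, sub_mem hcg hvg, fun b hb => ?_⟩
  · change totD _ dA (c - v) = 0
    rw [map_sub, hDv, sub_self]
  · have h1 : cochainPair f g v b = 0 := by
      rw [cochainPair, hvu, pair_zero_left]
    rw [cochainPair_sub_left, h1, sub_zero, hcψ b b.2.2 hb]
    exact hψ b ⟨b.2, hb⟩

/-- Hypercohomology of a complex of free modules with respect to a family of variables is the graded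
dual of the hypercohomology of the dual complex with respect to the complementary family. -/
theorem gradedIso_hyperCoh {t t' : ℤ} (ht : t + t' = Fintype.card α + Fintype.card β) :
    GradedIso (MvPolynomial ι K)
      (hyperGrading (weightedHomogeneousSubmodule K wt) (varFam K f) (freeGr wt w) dA
        (freeLevel K ι lev) t)
      (gradedDualGrading K (MvPolynomial ι K) (hyperGrading (weightedHomogeneousSubmodule K wt)
        (varFam K g) (freeGr wt w') dB (freeLevel K ι fun i => -lev i) t')) := by
  have hx := varFam_mem (K := K) wt f
  have hy := varFam_mem (K := K) wt g
  refine gradedIso_of_pairing (𝒜 := weightedHomogeneousSubmodule K wt) (cochainPairHom g)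
    cochainPair_add_left cochainPair_smul_left (fun a c b => cochainPairHom_C_smul c a b)
    (fun γ δ a b hδ ha hb => h.cochainPair_eq_zero hδ ha hb) ?_ ?_
    (gradedSMul_cechCochain h.left.smul) (gradedSMul_cechCochain h.right.smul)
    (h.left.isGrading_hyperCoh hx t) (h.right.isGrading_hyperCoh hy t')
    (fun γ c hc hcg h0 => h.mem_totCoboundary_of_cochainPair ht hc hcg h0)
    (fun γ χ => h.exists_cocycle_of_functional ht χ)
  · rintro _ ⟨a, -, rfl⟩ b hb
    rw [cochainPairHom_apply, h.cochainPair_totD, LinearMap.mem_ker.1 hb.1,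
      ← cochainPairHom_apply, map_zero, mul_zero]
  · rintro a ha _ ⟨b, -, rfl⟩
    have h1 := h.cochainPair_totD a b
    rw [LinearMap.mem_ker.1 ha.1] at h1
    have h2 : cochainPair f g 0 b = 0 := pair_zero_left _
    rw [h2] at h1
    rw [cochainPairHom_apply, ← h.mul_sign_self (cochainPair f g a _), ← h1, mul_zero]

end IsDualPair

end DualityIso

/-! ### Torsion in local cohomology and vanishing above the dimension -/

section Vanishing

variable {ι R N N' N'' : Type*} [Fintype ι] [LinearOrder ι] [CommRing R] [AddCommGroup N] [Module R N]
  [AddCommGroup N'] [Module R N'] [AddCommGroup N''] [Module R N''] {x : ι → R}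

theorem locMap_surjective {J : Finset ι} {f : N →ₗ[R] N'} (hf : Function.Surjective f) :
    Function.Surjective (locMap x J f) := fun z => by
  obtain ⟨s, v, rfl⟩ := exists_cechMk z
  obtain ⟨w, rfl⟩ := hf v
  exact ⟨cechMk x J s w, locMap_cechMk f s w⟩

theorem locMap_exact {J : Finset ι} {f : N →ₗ[R] N'} {g : N' →ₗ[R] N''} (h : Function.Exact f g)
    {z : CechLocal x N' J} (hz : locMap x J g z = 0) : ∃ w, locMap x J f w = z := by
  obtain ⟨s, v, rfl⟩ := exists_cechMk z
  rw [locMap_cechMk, cechMk_eq_zero] at hz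
  obtain ⟨u, hu⟩ := hz
  rw [← map_smul, h] at hu
  obtain ⟨w, hw⟩ := hu
  exact ⟨cechMk x J (u * s) w, by rw [locMap_cechMk, hw, cechMk_cancel]⟩

theorem cechMap_surjective {f : N →ₗ[R] N'} (hf : Function.Surjective f) {p : ℤ}
    {c : CechCochain x N'} (hc : c ∈ cechDegree x N' p) :
    ∃ b ∈ cechDegree x N p, cechMap x f b = c := by
  classical
  choose w hw using fun J => locMap_surjective (x := x) hf (c J)
  refine ⟨fun J => if (J.card : ℤ) = p then w J else 0, fun J hJ => if_neg hJ, funext fun J => ?_⟩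
  rw [cechMap_apply]
  split_ifs with h
  · exact hw J
  · rw [map_zero, hc J h]

theorem cechMap_exact {f : N →ₗ[R] N'} {g : N' →ₗ[R] N''} (h : Function.Exact f g) {p : ℤ}
    {c : CechCochain x N'} (hc : c ∈ cechDegree x N' p) (h0 : cechMap x g c = 0) :
    ∃ b ∈ cechDegree x N p, cechMap x f b = c := by
  classical
  choose w hw using fun J => locMap_exact (x := x) h (z := c J) (congrFun h0 J)
  refine ⟨fun J => if (J.card : ℤ) = p then w J else 0, fun J hJ => if_neg hJ, funext fun J => ?_⟩
  rw [cechMap_apply]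
  split_ifs with h
  · exact hw J
  · rw [map_zero, hc J h]

theorem cechMap_injective {f : N →ₗ[R] N'} (hf : Function.Injective f) :
    Function.Injective (cechMap x f) := by
  intro b c h
  funext J
  apply locMap_injective hf
  rw [← cechMap_apply, ← cechMap_apply, h]

theorem cechD_mem_cechDegree {p : ℤ} {c : CechCochain x N} (hc : c ∈ cechDegree x N (p - 1)) :
    cechD x N c ∈ cechDegree x N p := fun J hJ => cechD_eq_zero fun I hI => hc I (by omega)

theorem cechMap_mem_cechDegree (f : N →ₗ[R] N') {p : ℤ} {c : CechCochain x N}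
    (hc : c ∈ cechDegree x N p) : cechMap x f c ∈ cechDegree x N' p := fun J hJ => by
  rw [cechMap_apply, hc J hJ, map_zero]

/-- Vanishing of local cohomology is inherited by extensions. -/
theorem cechCocycle_le_of_exact {f : N →ₗ[R] N'} {g : N' →ₗ[R] N''} (hf : Function.Injective f)
    (hg : Function.Surjective g) (h : Function.Exact f g) {p : ℤ}
    (h1 : cechCocycle x N p ≤ cechCoboundary x N p)
    (h2 : cechCocycle x N'' p ≤ cechCoboundary x N'' p) :
    cechCocycle x N' p ≤ cechCoboundary x N' p := by
  rintro c ⟨hc, hcp⟩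
  obtain ⟨b', hb', hbc'⟩ := h2 (x := cechMap x g c)
    ⟨LinearMap.mem_ker.2 (by rw [cechD_cechMap, LinearMap.mem_ker.1 hc, map_zero]),
      cechMap_mem_cechDegree g hcp⟩
  obtain ⟨b, hb, rfl⟩ := cechMap_surjective hg hb'
  obtain ⟨a, ha, hac⟩ := cechMap_exact h (c := c - cechD x N' b)
    (sub_mem hcp (cechD_mem_cechDegree hb)) (by rw [map_sub, ← cechD_cechMap, hbc', sub_self])
  obtain ⟨a', ha', rfl⟩ := h1 (x := a) ⟨by
    refine cechMap_injective hf ?_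
    rw [← cechD_cechMap, hac, map_sub, cechD_cechD, sub_zero, LinearMap.mem_ker.1 hc, map_zero], ha⟩
  refine ⟨b + cechMap x f a', add_mem hb (cechMap_mem_cechDegree f ha'), ?_⟩
  rw [map_add, cechD_cechMap, hac, add_sub_cancel]

theorem exists_pow_of_mem_cechDen_insert {J : Finset ι} {i : ι} {u : R}
    (hu : u ∈ cechDen x (insert i J)) : ∃ k : ℕ, ∃ s ∈ cechDen x J, u = x i ^ k * s := by
  induction hu using Submonoid.closure_induction with
  | mem y hy =>
    obtain ⟨j, hj, rfl⟩ := hy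
    rcases Finset.mem_insert.1 (Finset.mem_coe.1 hj) with rfl | hj
    · exact ⟨1, 1, one_mem _, by rw [pow_one, mul_one]⟩
    · exact ⟨0, x j, Submonoid.subset_closure ⟨j, hj, rfl⟩, by rw [pow_zero, one_mul]⟩
  | one => exact ⟨0, 1, one_mem _, by rw [pow_zero, one_mul]⟩
  | mul a b _ _ ha hb =>
    obtain ⟨k, s, hs, rfl⟩ := ha
    obtain ⟨l, t, ht, rfl⟩ := hb
    exact ⟨k + l, s * t, mul_mem hs ht, by ring⟩

theorem exists_pow_smul_eq_zero {J : Finset ι} {i : ι} {z : CechLocal x N J}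
    (hz : cechRestrict x N (Finset.subset_insert i J) z = 0) : ∃ k : ℕ, x i ^ k • z = 0 := by
  obtain ⟨s, v, rfl⟩ := exists_cechMk z
  rw [cechRestrict_cechMk, cechMk_eq_zero] at hz
  obtain ⟨⟨u, hu⟩, huv⟩ := hz
  obtain ⟨k, t, ht, rfl⟩ := exists_pow_of_mem_cechDen_insert hu
  refine ⟨k, ?_⟩
  rw [← map_smul, cechMk_eq_zero]
  refine ⟨⟨t, ht⟩, ?_⟩
  rw [← huv, smul_smul, mul_comm]

theorem exists_cechRestrict_eq_pow_smul {J : Finset ι} {i : ι} (z : CechLocal x N (insert i J)) :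
    ∃ (k : ℕ) (w : CechLocal x N J),
      cechRestrict x N (Finset.subset_insert i J) w = x i ^ k • z := by
  obtain ⟨⟨u, hu⟩, v, rfl⟩ := exists_cechMk z
  obtain ⟨k, t, ht, rfl⟩ := exists_pow_of_mem_cechDen_insert hu
  have hxi : x i ^ k ∈ cechDen x (insert i J) :=
    pow_mem (Submonoid.subset_closure (Set.mem_image_of_mem x (Finset.mem_coe.2
      (Finset.mem_insert_self i J)))) k
  refine ⟨k, cechMk x J ⟨t, ht⟩ v, ?_⟩
  rw [cechRestrict_cechMk, ← map_smul]
  have ht' : t ∈ cechDen x (insert i J) :=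
    Submonoid.closure_mono (Set.image_mono (Finset.coe_subset.2 (Finset.subset_insert i J))) ht
  exact (cechMk_cancel (x := x) v (⟨t, ht'⟩ : cechDen x (insert i J)) ⟨x i ^ k, hxi⟩).symm

theorem neg_one_pow_smul_self (k : ℕ) (v : N) : (-1 : R) ^ k • (-1 : R) ^ k • v = v := by
  rw [smul_smul, ← mul_pow, neg_one_mul, neg_neg, one_pow, one_smul]

/-- Local cohomology is torsion with respect to each member of the family. -/
theorem exists_pow_smul_mem_cechCoboundary (i : ι) {p : ℤ} {c : CechCochain x N}
    (hc : c ∈ cechCocycle x N p) : ∃ k : ℕ, x i ^ k • c ∈ cechCoboundary x N p := by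
  classical
  -- After multiplication by a power of `x i`, the components at the sets `J ∪ i` come from
  -- localizations in which `x i` is not inverted. These form a cochain `b`, up to sign; subtracting
  -- its coboundary leaves a cocycle `z` without components at sets which contain `i`. The
  -- components of such a cocycle vanish after inverting `x i`, so they are annihilated by a power
  -- of `x i`.
  choose k₀ w₀ hw₀ using fun J : Finset ι => exists_cechRestrict_eq_pow_smul (c (insert i J))
  obtain ⟨k, w, hw⟩ : ∃ (k : ℕ) (w : ∀ J : Finset ι, CechLocal x N J), ∀ J,
      cechRestrict x N (Finset.subset_insert i J) (w J) = x i ^ k • c (insert i J) := by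
    refine ⟨∑ J, k₀ J, fun J => x i ^ (∑ J, k₀ J - k₀ J) • w₀ J, fun J => ?_⟩
    rw [map_smul, hw₀, smul_smul, ← pow_add,
      Nat.sub_add_cancel (Finset.single_le_sum (fun _ _ => Nat.zero_le _) (Finset.mem_univ J))]
  let b : CechCochain x N := fun J =>
    if i ∉ J ∧ (J.card : ℤ) = p - 1 then (-1 : R) ^ cechSign (insert i J) i • w J else 0
  have hb : b ∈ cechDegree x N (p - 1) := fun J hJ => if_neg fun h => hJ h.2
  let z := x i ^ k • c - cechD x N b
  have hz : ∀ J, i ∈ J → z J = 0 := fun J hJ => by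
    have h0 : z J = x i ^ k • c J - cechD x N b J := rfl
    by_cases hp : (J.card : ℤ) = p
    · rw [h0, cechD_apply, Finset.sum_eq_single_of_mem i hJ fun l hl hli => ?_]
      · have h1 : b (J.erase i) = (-1 : R) ^ cechSign (insert i (J.erase i)) i • w (J.erase i) :=
          if_pos ⟨Finset.notMem_erase i J, by
            rw [Finset.card_erase_of_mem hJ, Nat.cast_sub (Finset.card_pos.2 ⟨i, hJ⟩), hp]; rfl⟩
        have h2 : ∀ (L : Finset ι) (hL : J.erase i ⊆ L), L = insert i (J.erase i) →
            cechRestrict x N hL (w (J.erase i)) = x i ^ k • c L := by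
          rintro _ _ rfl
          exact hw _
        rw [h1, map_smul, h2 J _ (Finset.insert_erase hJ).symm, Finset.insert_erase hJ,
          neg_one_pow_smul_self, sub_self]
      · have h1 : b (J.erase l) = 0 := if_neg fun h => h.1 (Finset.mem_erase.2 ⟨hli.symm, hJ⟩)
        rw [h1, map_zero, smul_zero]
    · rw [h0, hc.2 J hp, cechD_mem_cechDegree hb J hp, smul_zero, sub_zero]
  have hDz : cechD x N z = 0 := by
    rw [map_sub, map_smul, LinearMap.mem_ker.1 hc.1, smul_zero, cechD_cechD, sub_zero]
  have hz' : ∀ J, ∃ l : ℕ, x i ^ l • z J = 0 := fun J => by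
    by_cases hJ : i ∈ J
    · exact ⟨0, by rw [hz J hJ, smul_zero]⟩
    · refine exists_pow_smul_eq_zero (i := i) ?_
      have h1 := congrFun hDz (insert i J)
      rw [cechD_apply, Finset.sum_eq_single_of_mem i (Finset.mem_insert_self i J)
        fun l hl hli => by
          rw [hz _ (Finset.mem_erase.2 ⟨hli.symm, Finset.mem_insert_self i J⟩), map_zero,
            smul_zero]] at h1
      have h2 := congrArg (fun v => (-1 : R) ^ cechSign (insert i J) i • v) h1
      simp only [neg_one_pow_smul_self, Pi.zero_apply, smul_zero] at h2
      rw [← h2]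
      exact cechRestrict_congr z _ _ (Finset.erase_insert hJ).symm
  choose l hl using hz'
  have hl' : x i ^ (∑ J, l J) • z = 0 := funext fun J => by
    rw [Pi.smul_apply, ← Nat.sub_add_cancel (Finset.single_le_sum (f := l)
      (fun _ _ => Nat.zero_le _) (Finset.mem_univ J)), pow_add, mul_smul, hl, smul_zero]
    rfl
  refine ⟨∑ J, l J + k, x i ^ (∑ J, l J) • b, Submodule.smul_mem _ _ hb, ?_⟩
  rw [map_smul, pow_add, mul_smul, eq_comm, ← sub_eq_zero, ← smul_sub]
  exact hl'

/-- Multiplication by a member of the family which is regular on `N`: vanishing for the quotient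
gives vanishing for `N`, one degree higher. -/
theorem cechCocycle_le_of_regular (i : ι) {p : ℤ} {π : N →ₗ[R] N'}
    (hreg : ∀ v : N, x i • v = 0 → v = 0) (hπ : Function.Surjective π)
    (hex : Function.Exact (LinearMap.lsmul R N (x i)) π)
    (h : cechCocycle x N' (p - 1) ≤ cechCoboundary x N' (p - 1)) :
    cechCocycle x N p ≤ cechCoboundary x N p := by
  have hinj : Function.Injective (LinearMap.lsmul R N (x i)) :=
    (injective_iff_map_eq_zero _).2 hreg
  have hmap : ∀ c : CechCochain x N, cechMap x (LinearMap.lsmul R N (x i)) c = x i • c :=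
    fun c => funext fun J => by
      obtain ⟨s, v, hv⟩ := exists_cechMk (c J)
      rw [cechMap_apply, Pi.smul_apply, hv, locMap_cechMk, ← map_smul]
      rfl
  -- The long exact sequence of `0 → N → N → N' → 0`: multiplication by `x i` is injective on local
  -- cohomology in degree `p`. Local cohomology is torsion with respect to `x i`, so it vanishes.
  have step : ∀ c ∈ cechCocycle x N p, x i • c ∈ cechCoboundary x N p →
      c ∈ cechCoboundary x N p := by
    rintro c ⟨hc, hcp⟩ ⟨b, hb, hbc⟩
    have h0 : cechMap x π (x i • c) = 0 := by
      rw [← hmap]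
      funext J
      rw [cechMap_apply, cechMap_apply, locMap_comp, hex.linearMap_comp_eq_zero, locMap_zero]
      rfl
    obtain ⟨e', he', hbe⟩ := h (x := cechMap x π b) ⟨LinearMap.mem_ker.2 (by
      rw [cechD_cechMap, hbc, h0]), cechMap_mem_cechDegree π hb⟩
    obtain ⟨e, he, rfl⟩ := cechMap_surjective hπ he'
    obtain ⟨a, ha, hab⟩ := cechMap_exact hex (c := b - cechD x N e)
      (sub_mem hb (cechD_mem_cechDegree he)) (by rw [map_sub, ← cechD_cechMap, hbe, sub_self])
    refine ⟨a, ha, cechMap_injective hinj ?_⟩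
    rw [← cechD_cechMap, hab, map_sub, cechD_cechD, sub_zero, hbc, hmap]
  intro c hc
  obtain ⟨k, hk⟩ := exists_pow_smul_mem_cechCoboundary i hc
  induction k with
  | zero => rwa [pow_zero, one_smul] at hk
  | succ k ih =>
    rw [pow_succ', mul_smul] at hk
    exact ih (step _ (Submodule.smul_mem _ _ hc) hk)

/-- If the family annihilates `N`, there are no cochains of positive degree. -/
theorem cechCocycle_le_of_annihilated {p : ℤ} (hp : 0 < p) (h : ∀ i, ∀ v : N, x i • v = 0) :
    cechCocycle x N p ≤ cechCoboundary x N p := by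
  rintro c ⟨-, hc⟩
  have : c = 0 := funext fun J => by
    by_cases hJ : (J.card : ℤ) = p
    · obtain ⟨i, hi⟩ := Finset.card_pos.1 (show 0 < J.card by omega)
      obtain ⟨s, v, hv⟩ := exists_cechMk (c J)
      rw [hv, Pi.zero_apply, cechMk_eq_zero]
      exact ⟨⟨x i, Submonoid.subset_closure ⟨i, hi, rfl⟩⟩, h i v⟩
    · exact hc J hJ
  rw [this]
  exact zero_mem _

theorem cechCocycle_le_of_subsingleton [Subsingleton N] (p : ℤ) :
    cechCocycle x N p ≤ cechCoboundary x N p := fun c _ => by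
  have : c = 0 := funext fun J => by
    obtain ⟨s, v, hv⟩ := exists_cechMk (c J)
    rw [hv, Subsingleton.elim v 0, map_zero]
    rfl
  rw [this]
  exact zero_mem _

end Vanishing

section Grothendieck

universe u v

variable {ι : Type*} {R : Type u} [Fintype ι] [LinearOrder ι] [CommRing R] [IsNoetherianRing R]

/-- Grothendieck's vanishing theorem: local cohomology vanishes above the dimension. -/
theorem cechCocycle_le_of_supportDim_lt (x : ι → R) (n : ℕ) (N : Type v) [AddCommGroup N]
    [Module R N] [hN : Module.Finite R N] (hn : Module.supportDim R N < n) {p : ℤ} (hp : n ≤ p) :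
    cechCocycle x N p ≤ cechCoboundary x N p := by
  induction n generalizing N p with
  | zero =>
    have : Subsingleton N := by
      by_contra h
      rw [not_subsingleton_iff_nontrivial] at h
      have := Module.supportDim_ne_bot_of_nontrivial R N
      obtain ⟨a, ha⟩ := WithBot.ne_bot_iff_exists.1 this
      rw [← ha] at hn
      exact not_lt_zero (WithBot.coe_lt_coe.1 hn)
    exact cechCocycle_le_of_subsingleton p
  | succ n ih =>
    revert hn
    -- Dévissage to `N = R ⧸ 𝔭`. Either all `x i` annihilate `N`, or some `x i` is regular on `N`
    -- and the dimension of `N ⧸ x i N` is smaller.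
    induction hN using IsNoetherianRing.induction_on_isQuotientEquivQuotientPrime R with
    | subsingleton N => exact fun _ => cechCocycle_le_of_subsingleton p
    | exact N₁ N₂ N₃ f g hf hg hfg h₁ h₃ =>
      exact fun hn => cechCocycle_le_of_exact hf hg hfg
        (h₁ ((Module.supportDim_le_of_injective f hf).trans_lt hn))
        (h₃ ((Module.supportDim_le_of_surjective g hg).trans_lt hn))
    | quotient N 𝔭 φ =>
      intro hn
      by_cases hx : ∀ i, x i ∈ 𝔭.1
      · refine cechCocycle_le_of_annihilated (by omega) fun i v => φ.injective ?_
        obtain ⟨r, hr⟩ := Ideal.Quotient.mk_surjective (φ v)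
        rw [map_smul, map_zero, ← hr, Algebra.smul_def]
        have : algebraMap R (R ⧸ 𝔭.1) (x i) = 0 := Ideal.Quotient.eq_zero_iff_mem.2 (hx i)
        rw [this, zero_mul]
      · push Not at hx
        obtain ⟨i, hi⟩ := hx
        have hreg : ∀ v : N, x i • v = 0 → v = 0 := fun v hv => by
          have h1 : x i • φ v = 0 := by rw [← map_smul, hv, map_zero]
          have : algebraMap R (R ⧸ 𝔭.1) (x i) ≠ 0 := fun h =>
            hi (Ideal.Quotient.eq_zero_iff_mem.1 h)
          rw [Algebra.smul_def, mul_eq_zero] at h1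
          exact (LinearEquiv.map_eq_zero_iff φ).1 (h1.resolve_left this)
        have hann : Module.annihilator R N = 𝔭.1 := by
          rw [φ.annihilator_eq, Ideal.annihilator_quotient]
        have hdim := Module.supportDim_quotSMulTop_succ_le_of_notMem_minimalPrimes (R := R) (M := N)
          (x := x i) (fun 𝔮 h𝔮 => by
            rw [hann, Ideal.minimalPrimes_eq_subsingleton_self, Set.mem_singleton_iff] at h𝔮
            rwa [h𝔮])
        refine cechCocycle_le_of_regular i
          (π := (Submodule.mkQ _ : N →ₗ[R] QuotSMulTop (x i) N)) hreg (Submodule.mkQ_surjective _) ?_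
          (ih (QuotSMulTop (x i) N) ?_ (by omega))
        · intro v
          rw [Submodule.mkQ_apply, Submodule.Quotient.mk_eq_zero]
          constructor
          · rintro ⟨w, -, rfl⟩
            exact ⟨w, rfl⟩
          · rintro ⟨w, rfl⟩
            exact ⟨w, trivial, rfl⟩
        · have h1 := hdim.trans_lt hn
          generalize Module.supportDim R (QuotSMulTop (x i) N) = a at h1
          rcases a with _ | a
          · exact WithBot.bot_lt_coe _
          · rcases a with _ | a
            · exact absurd h1 (not_lt.2 le_top)
            · change ((a : ℕ∞) : WithBot ℕ∞) < ((n : ℕ∞) : WithBot ℕ∞)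
              change ((a : ℕ∞) : WithBot ℕ∞) + 1 < (((n + 1 : ℕ) : ℕ∞) : WithBot ℕ∞) at h1
              norm_cast at h1 ⊢
              omega

end Grothendieck

/-! ### The resolution and its dual as graded complexes -/

/-- The projection to a subquotient. -/
def subquotientMk {R A : Type*} [CommRing R] [AddCommGroup A] [Module R A] (Z B : Submodule R A) :
    Z →ₗ[R] Subquotient Z B :=
  (B.submoduleOf Z).mkQ

section FreeComplex

variable {K ι σ Γ : Type*} [Field K] [AddCommGroup Γ] [DecidableEq Γ] {wt : ι → Γ}

attribute [local instance] weightedGradedAlgebra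

theorem weightedHomogeneous_eq_zero (s : Finset Γ) (b : Γ → MvPolynomial ι K) (δ : Γ)
    (hb : ∀ γ, b γ ∈ weightedHomogeneousSubmodule K wt (γ - δ)) (h0 : ∑ γ ∈ s, b γ = 0) :
    ∀ γ ∈ s, b γ = 0 := by
  classical
  intro γ hγ
  have h1 : (DirectSum.decompose (weightedHomogeneousSubmodule K wt) (∑ β ∈ s, b β) (γ - δ) :
      MvPolynomial ι K) = b γ := by
    rw [DirectSum.decompose_sum, DFinsupp.finsetSum_apply, AddSubmonoidClass.coe_finsetSum,
      Finset.sum_eq_single_of_mem γ hγ]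
    · exact DirectSum.decompose_of_mem_same _ (hb γ)
    · intro β _ hβ
      exact DirectSum.decompose_of_mem_ne _ (hb β) (fun h => hβ (sub_left_inj.1 h))
  rw [h0] at h1
  simpa using h1.symm

theorem single_one_mem_freeGr (w : σ → Γ) (i : σ) :
    Finsupp.single i (1 : MvPolynomial ι K) ∈ freeGr wt w (w i) := fun j => by
  classical
  rw [Finsupp.single_apply]
  split_ifs with h
  · subst h
    rw [sub_self]
    exact SetLike.GradedOne.one_mem
  · exact zero_mem _

theorem mem_span_freeGr (w : σ → Γ) (v : σ →₀ MvPolynomial ι K) :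
    v ∈ Submodule.span (MvPolynomial ι K) {v | ∃ γ, v ∈ freeGr (K := K) wt w γ} := by
  induction v using Finsupp.induction_linear with
  | zero => exact zero_mem _
  | add a b ha hb => exact add_mem ha hb
  | single i p =>
    rw [← mul_one p, ← smul_eq_mul, ← Finsupp.smul_single]
    exact Submodule.smul_mem _ _ (Submodule.subset_span ⟨w i, single_one_mem_freeGr w i⟩)

theorem isGrading_freeGr (w : σ → Γ) : IsGrading (freeGr (K := K) wt w) where
  exists_sum v := by
    have h := isGrading_span (𝒜 := weightedHomogeneousSubmodule K wt)
      (gradedSMul_freeGr (K := K) (wt := wt) w) (fun s b hb h0 γ hγ => Finsupp.ext fun i =>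
        weightedHomogeneous_eq_zero s (fun γ => b γ i) (w i) (fun γ => hb γ i) (by
          rw [← Finsupp.finsetSum_apply, h0]; rfl) γ hγ)
    obtain ⟨s, b, hb, hv⟩ := h.exists_sum ⟨v, mem_span_freeGr w v⟩
    refine ⟨s, fun γ => b γ, hb, ?_⟩
    have := congrArg Subtype.val hv
    rwa [AddSubmonoidClass.coe_finsetSum] at this
  eq_zero s b hb h0 γ hγ := Finsupp.ext fun i =>
    weightedHomogeneous_eq_zero s (fun γ => b γ i) (w i) (fun γ => hb γ i) (by
      rw [← Finsupp.finsetSum_apply, h0]; rfl) γ hγ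

theorem isHomog_freeLevel {w : σ → Γ} (h : IsGrading (freeGr (K := K) wt w)) (lev : σ → ℤ) (j : ℤ) :
    IsHomog h (freeLevel K ι lev j) := by
  intro γ v hv
  rw [mem_freeLevel] at hv ⊢
  intro i hi
  obtain ⟨s, hs, hsum⟩ := h.sum_proj v
  by_cases hγ : γ ∈ s
  · refine weightedHomogeneous_eq_zero s (fun γ => h.proj γ v i) (w i)
      (fun γ => h.proj_mem γ v i) ?_ γ hγ
    rw [← Finsupp.finsetSum_apply, hsum, hv i hi]
  · rw [hs γ hγ]
    rfl

/-- A matrix whose rows are homogeneous of the right degree and level, and with square zero, defines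
a complex. -/
theorem gradedComplex_linearCombination {w : σ → Γ} {lev : σ → ℤ}
    {row : σ → σ →₀ MvPolynomial ι K} (hw : ∀ p, row p ∈ freeGr wt w (w p))
    (hl : ∀ p, row p ∈ freeLevel K ι lev (lev p + 1))
    (hsq : ∀ p, Finsupp.linearCombination (MvPolynomial ι K) row (row p) = 0) :
    GradedComplex (weightedHomogeneousSubmodule K wt) (freeGr wt w) (freeLevel K ι lev)
      (Finsupp.linearCombination (MvPolynomial ι K) row) where
  grading := isGrading_freeGr w
  smul := gradedSMul_freeGr w
  homog := isHomog_freeLevel _ lev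
  map_mem j a ha := by
    rw [Finsupp.linearCombination_apply]
    refine Submodule.sum_mem _ fun p hp => Submodule.smul_mem _ _ ?_
    have : lev p = j := by
      by_contra hne
      exact Finsupp.mem_support_iff.1 hp (mem_freeLevel.1 ha p hne)
    exact this ▸ hl p
  graded γ a ha := by
    rw [Finsupp.linearCombination_apply]
    refine AddSubgroup.sum_mem _ fun p _ => ?_
    have := gradedSMul_freeGr w _ _ _ (ha p) _ (hw p)
    rwa [sub_add_cancel] at this
  sq a := by
    induction a using Finsupp.induction_linear with
    | zero => rw [map_zero, map_zero]
    | add a b ha hb => rw [map_add, map_add, ha, hb, add_zero]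
    | single p c => rw [Finsupp.linearCombination_single, map_smul, hsq, smul_zero]

end FreeComplex

namespace FreeResolution

variable {K : Type*} [Field K] {m n : ℕ} {M : Type*} [AddCommGroup M] [Module (S K m n) M]
  {e : Fin n → ℕ} {ℳ : ℤ × ℤ → AddSubgroup M} (F : FreeResolution K m e ℳ)

attribute [local instance] weightedGradedAlgebra

/-- The index set of the bases of all modules of the resolution. -/
abbrev Index : Type := Σ j, Fin (F.rank j)

/-- The homological degree of a basis element. -/
def level (p : F.Index) : ℤ := p.1

/-- The bidegree of a basis element. -/
def basisDeg (p : F.Index) : ℤ × ℤ := F.deg p.1 p.2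

/-- The bidegree of the dual of a basis element in `Hom(F, ω)`. -/
def dualDeg (p : F.Index) : ℤ × ℤ := sigma m e - F.basisDeg p

/-- The inclusion of the `j`-th module of the resolution in the sum of all. -/
def levelIncl (j : ℕ) : (Fin (F.rank j) → S K m n) →ₗ[S K m n] (F.Index →₀ S K m n) :=
  ∑ k, Finsupp.lsingle (⟨j, k⟩ : F.Index) ∘ₗ LinearMap.proj k

theorem levelIncl_eq (j : ℕ) (v : Fin (F.rank j) → S K m n) :
    F.levelIncl j v = ∑ k, Finsupp.single (⟨j, k⟩ : F.Index) (v k) := by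
  simp [levelIncl]

theorem levelIncl_apply (j : ℕ) (v : Fin (F.rank j) → S K m n) (k : Fin (F.rank j)) :
    F.levelIncl j v ⟨j, k⟩ = v k := by
  rw [levelIncl_eq, Finsupp.finsetSum_apply, Finset.sum_eq_single_of_mem k (Finset.mem_univ k),
    Finsupp.single_eq_same]
  intro l _ hl
  refine Finsupp.single_eq_of_ne fun h => hl ?_
  simpa using h.symm

theorem levelIncl_apply_of_ne {i j : ℕ} (h : i ≠ j) (v : Fin (F.rank j) → S K m n)
    (k : Fin (F.rank i)) : F.levelIncl j v ⟨i, k⟩ = 0 := by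
  rw [levelIncl_eq, Finsupp.finsetSum_apply]
  exact Finset.sum_eq_zero fun l _ => Finsupp.single_eq_of_ne fun h' => h (congrArg Sigma.fst h')

theorem levelIncl_injective (j : ℕ) : Function.Injective (F.levelIncl j) := fun v w h => funext
  fun k => by rw [← F.levelIncl_apply j v, h, F.levelIncl_apply]

/-- A property of all coefficients of an element in the image of the inclusion can be checked on the
given coordinates. -/
theorem levelIncl_mem (j : ℕ) (v : Fin (F.rank j) → S K m n) {P : F.Index → S K m n → Prop}
    (h0 : ∀ p, P p 0) (h : ∀ k, P ⟨j, k⟩ (v k)) (p : F.Index) : P p (F.levelIncl j v p) := by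
  obtain ⟨i, k⟩ := p
  by_cases hij : i = j
  · subst hij
    rw [levelIncl_apply]
    exact h k
  · rw [F.levelIncl_apply_of_ne hij]
    exact h0 _

theorem levelIncl_mem_freeLevel (j : ℕ) (v : Fin (F.rank j) → S K m n) {lev : F.Index → ℤ} {i : ℤ}
    (h : ∀ k, lev ⟨j, k⟩ = i) : F.levelIncl j v ∈ freeLevel K (Fin m ⊕ Fin n) lev i :=
  mem_freeLevel.2 (F.levelIncl_mem j v (P := fun p a => lev p ≠ i → a = 0) (fun _ _ => rfl)
    fun k hk => absurd (h k) hk)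

theorem levelIncl_mem_freeGr (j : ℕ) (v : Fin (F.rank j) → S K m n) {w : F.Index → ℤ × ℤ}
    {γ : ℤ × ℤ} :
    F.levelIncl j v ∈ freeGr (varDeg m e) w γ ↔ ∀ k, v k ∈ gradS K m e (γ - w ⟨j, k⟩) := by
  constructor
  · intro h k
    have := h ⟨j, k⟩
    rwa [levelIncl_apply] at this
  · exact F.levelIncl_mem j v (P := fun p a => a ∈ gradS K m e (γ - w p)) fun p => zero_mem _

theorem exists_levelIncl (j : ℕ) {lev : F.Index → ℤ} {i : ℤ}
    (h : ∀ p : F.Index, p.1 ≠ j → lev p ≠ i) {a : F.Index →₀ S K m n}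
    (ha : a ∈ freeLevel K (Fin m ⊕ Fin n) lev i) : ∃ v, F.levelIncl j v = a := by
  refine ⟨fun k => a ⟨j, k⟩, Finsupp.ext fun p => ?_⟩
  obtain ⟨i', k⟩ := p
  by_cases hij : i' = j
  · subst hij
    rw [levelIncl_apply]
  · rw [F.levelIncl_apply_of_ne hij, mem_freeLevel.1 ha _ (h _ hij)]

/-- The image of a basis element under the differential of the resolution. -/
def col : F.Index → (F.Index →₀ S K m n)
  | ⟨0, _⟩ => 0
  | ⟨j + 1, k⟩ => F.levelIncl j (F.diff j (Pi.single k 1))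

/-- The image of an element of the dual basis under the differential of `Hom(F, ω)`. -/
def row : F.Index → (F.Index →₀ S K m n)
  | ⟨j, l⟩ => F.levelIncl (j + 1) fun k => F.diff j (Pi.single k 1) l

theorem row_apply (p q : F.Index) : F.row p q = F.col q p := by
  obtain ⟨j, l⟩ := p
  obtain ⟨i, k⟩ := q
  rcases i with _ | i
  · exact F.levelIncl_apply_of_ne (by omega) _ _
  · by_cases hij : i = j
    · subst hij
      rw [row, col, levelIncl_apply, levelIncl_apply]
    · rw [row, col, F.levelIncl_apply_of_ne (fun h => hij (by omega)),
        F.levelIncl_apply_of_ne (Ne.symm hij)]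

/-- The differential of the resolution. -/
def homologyD : (F.Index →₀ S K m n) →ₗ[S K m n] (F.Index →₀ S K m n) :=
  Finsupp.linearCombination _ F.col

/-- The differential of `Hom(F, ω)`. -/
def cohomologyD : (F.Index →₀ S K m n) →ₗ[S K m n] (F.Index →₀ S K m n) :=
  Finsupp.linearCombination _ F.row

theorem dot_cohomologyD (a b : F.Index →₀ S K m n) :
    dot (F.cohomologyD a) b = dot a (F.homologyD b) := by
  classical
  induction a using Finsupp.induction_linear with
  | zero => rw [map_zero, dot, dot, Finsupp.sum_zero_index, Finsupp.sum_zero_index]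
  | add a a' h h' => rw [map_add, dot_add_left, dot_add_left, h, h']
  | single p c =>
    rw [cohomologyD, Finsupp.linearCombination_single, dot_smul_left, dot_single_left]
    congr 1
    induction b using Finsupp.induction_linear with
    | zero => rw [map_zero, dot]; exact Finset.sum_eq_zero fun _ _ => mul_zero _
    | add b b' h h' => rw [map_add, dot_add_right, Finsupp.add_apply, h, h']
    | single q c' =>
      rw [dot_single_right, homologyD, Finsupp.linearCombination_single, Finsupp.smul_apply,
        row_apply, smul_eq_mul, mul_comm]

theorem homologyD_levelIncl_zero (v : Fin (F.rank 0) → S K m n) :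
    F.homologyD (F.levelIncl 0 v) = 0 := by
  rw [levelIncl_eq, map_sum]
  refine Finset.sum_eq_zero fun k _ => ?_
  rw [homologyD, Finsupp.linearCombination_single]
  exact smul_zero _

theorem homologyD_levelIncl (j : ℕ) (v : Fin (F.rank (j + 1)) → S K m n) :
    F.homologyD (F.levelIncl (j + 1) v) = F.levelIncl j (F.diff j v) := by
  conv_rhs => rw [pi_eq_sum_univ' v, map_sum, map_sum]
  rw [levelIncl_eq, map_sum]
  refine Finset.sum_congr rfl fun k _ => ?_
  rw [homologyD, Finsupp.linearCombination_single, map_smul, map_smul]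
  rfl

theorem homologyD_col (p : F.Index) : F.homologyD (F.col p) = 0 := by
  obtain ⟨_ | _ | j, k⟩ := p
  · exact map_zero _
  · exact F.homologyD_levelIncl_zero _
  · rw [col, homologyD_levelIncl, (F.exact_diff j).apply_apply_eq_zero, map_zero]

theorem homologyD_sq (b : F.Index →₀ S K m n) : F.homologyD (F.homologyD b) = 0 := by
  induction b using Finsupp.induction_linear with
  | zero => rw [map_zero, map_zero]
  | add a b ha hb => rw [map_add, map_add, ha, hb, add_zero]
  | single p c =>
    rw [homologyD, Finsupp.linearCombination_single, map_smul]
    exact (congrArg (c • ·) (F.homologyD_col p)).trans (smul_zero c)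

theorem cohomologyD_row (p : F.Index) : F.cohomologyD (F.row p) = 0 := by
  classical
  refine Finsupp.ext fun q => ?_
  have h1 : F.row p = F.cohomologyD (Finsupp.single p 1) := by
    rw [cohomologyD, Finsupp.linearCombination_single, one_smul]
  have h2 := (F.dot_cohomologyD (F.cohomologyD (Finsupp.single p 1)) (Finsupp.single q 1)).trans
    (F.dot_cohomologyD _ _)
  rw [homologyD_sq, dot_single_right, mul_one] at h2
  rw [h1, h2, dot]
  exact Finset.sum_eq_zero fun _ _ => mul_zero _

theorem single_one_mem_freeGrading (e : Fin n → ℕ) {r : ℕ} (a : Fin r → ℤ × ℤ) (k : Fin r) :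
    (Pi.single k 1 : Fin r → S K m n) ∈ freeGrading K m e a (a k) := by
  intro l _
  change (Pi.single k 1 : Fin r → S K m n) l ∈ gradS K m e (a k - a l)
  rw [Pi.single_apply]
  split_ifs with hl
  · subst hl
    rw [sub_self]
    exact SetLike.GradedOne.one_mem
  · exact zero_mem _

theorem diff_single_mem (j : ℕ) (k : Fin (F.rank (j + 1))) (l : Fin (F.rank j)) :
    F.diff j (Pi.single k 1) l ∈ gradS K m e (F.deg (j + 1) k - F.deg j l) := by
  exact F.diff_graded j _ _ (single_one_mem_freeGrading e _ k) l trivial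

theorem gradedComplex_homologyD :
    GradedComplex (gradS K m e) (freeGr (varDeg m e) F.basisDeg)
      (freeLevel K (Fin m ⊕ Fin n) fun p => -F.level p) F.homologyD := by
  refine gradedComplex_linearCombination ?_ ?_ F.homologyD_col
  · rintro ⟨_ | j, k⟩
    · exact zero_mem _
    · exact (F.levelIncl_mem_freeGr j _).2 (F.diff_single_mem j k)
  · rintro ⟨_ | j, k⟩
    · exact zero_mem _
    · refine F.levelIncl_mem_freeLevel j _ fun l => ?_
      simp only [level]
      push_cast
      ring

theorem gradedComplex_cohomologyD :
    GradedComplex (gradS K m e) (freeGr (varDeg m e) F.dualDeg)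
      (freeLevel K (Fin m ⊕ Fin n) F.level) F.cohomologyD := by
  refine gradedComplex_linearCombination ?_ ?_ F.cohomologyD_row
  · rintro ⟨j, l⟩
    refine (F.levelIncl_mem_freeGr (j + 1) _).2 fun k => ?_
    have := F.diff_single_mem j k l
    rwa [← sub_sub_sub_cancel_left _ _ (sigma m e)] at this
  · rintro ⟨j, l⟩
    refine F.levelIncl_mem_freeLevel (j + 1) _ fun k => ?_
    simp only [level]
    push_cast
    ring

/-! ### The cohomology of the two complexes -/

/-- The resolved module is the cohomology of the resolution in degree `0`. -/
theorem isCohomologyAt_aug (hℳ : IsGrading ℳ) :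
    IsCohomologyAt (freeGr (varDeg m e) F.basisDeg)
      (freeLevel K (Fin m ⊕ Fin n) fun p => -F.level p) F.homologyD 0
      (freeGrading K m e (F.deg 0)) ℳ (F.levelIncl 0) F.aug where
  incl_injective := F.levelIncl_injective 0
  incl_mem z := F.levelIncl_mem_freeLevel 0 z fun k => rfl
  d_incl := F.homologyD_levelIncl_zero
  exists_incl a ha _ := F.exists_levelIncl 0 (fun p hp h => hp (by
    simp only [level] at h; omega)) ha
  mem_iff γ z := by
    rw [levelIncl_mem_freeGr]
    exact ⟨fun h k => h k trivial, fun h k _ => h k⟩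
  quot_graded := F.aug_graded
  exists_quot γ v hv := by
    obtain ⟨z, rfl⟩ := F.aug_surjective v
    have hg : IsGrading (freeGrading K m e (F.deg 0)) :=
      ⟨fun a => exists_components_free e _ a, fun s b => independentComponents_free e _ s b⟩
    refine ⟨hg.proj γ z, hg.proj_mem γ z, ?_⟩
    exact (hg.map_proj hℳ F.aug.toAddMonoidHom F.aug_graded γ z).trans (hℳ.proj_of_mem hv)
  quot_eq_zero z := by
    rw [F.exact_aug]
    constructor
    · rintro ⟨v, rfl⟩
      exact ⟨F.levelIncl 1 v, F.levelIncl_mem_freeLevel 1 v fun k => rfl, F.homologyD_levelIncl 0 v⟩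
    · rintro ⟨b, hb, hbz⟩
      obtain ⟨v, rfl⟩ := F.exists_levelIncl 1 (fun p hp h => hp (by
        simp only [level] at h; omega)) hb
      exact ⟨v, F.levelIncl_injective 0 (by rw [← hbz, F.homologyD_levelIncl])⟩

/-- The values of a homomorphism on the basis. -/
def evalBasis (j : ℕ) : F.HomOmega j →ₗ[S K m n] (Fin (F.rank j) → S K m n) :=
  LinearMap.pi fun k => LinearMap.applyₗ (Pi.single k 1)

theorem evalBasis_apply (j : ℕ) (φ : F.HomOmega j) (k : Fin (F.rank j)) :
    F.evalBasis j φ k = φ (Pi.single k 1) := rfl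

theorem hom_apply (j : ℕ) (φ : F.HomOmega j) (v : Fin (F.rank j) → S K m n) :
    φ v = ∑ k, v k * φ (Pi.single k 1) := by
  conv_lhs => rw [pi_eq_sum_univ' v, map_sum]
  refine Finset.sum_congr rfl fun k _ => ?_
  rw [map_smul, smul_eq_mul]

theorem evalBasis_injective (j : ℕ) : Function.Injective (F.evalBasis j) := fun φ ψ h =>
  LinearMap.ext fun v => by
    rw [hom_apply, hom_apply]
    exact Finset.sum_congr rfl fun k _ => by rw [← evalBasis_apply, h, evalBasis_apply]

theorem evalBasis_surjective (j : ℕ) : Function.Surjective (F.evalBasis j) := fun v =>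
  ⟨Fintype.linearCombination (S K m n) v, funext fun k => by simp [evalBasis_apply]⟩

theorem cohomologyD_levelIncl (j : ℕ) (φ : F.HomOmega j) :
    F.cohomologyD (F.levelIncl j (F.evalBasis j φ)) =
      F.levelIncl (j + 1) (F.evalBasis (j + 1) (F.homD j φ)) := by
  rw [levelIncl_eq, map_sum]
  have h1 : F.evalBasis (j + 1) (F.homD j φ) = ∑ l, F.evalBasis j φ l •
      fun k => F.diff j (Pi.single k 1) l := by
    funext k
    rw [evalBasis_apply, Finset.sum_apply]
    refine (F.hom_apply j φ _).trans (Finset.sum_congr rfl fun l _ => ?_)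
    rw [Pi.smul_apply, smul_eq_mul, mul_comm]
    rfl
  rw [h1, map_sum]
  refine Finset.sum_congr rfl fun l _ => ?_
  rw [cohomologyD, Finsupp.linearCombination_single, map_smul]
  rfl

theorem mem_homGrading (j : ℕ) (φ : F.HomOmega j) (γ : ℤ × ℤ) :
    φ ∈ F.homGrading j γ ↔
      F.levelIncl j (F.evalBasis j φ) ∈ freeGr (varDeg m e) F.dualDeg γ := by
  rw [levelIncl_mem_freeGr]
  constructor
  · intro h k
    have h1 : φ (Pi.single k 1) ∈ gradS K m e (F.deg j k + γ - sigma m e) :=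
      h (F.deg j k) _ (single_one_mem_freeGrading e _ k)
    have h2 : γ - F.dualDeg ⟨j, k⟩ = F.deg j k + γ - sigma m e := by
      simp only [dualDeg, basisDeg]
      abel
    rw [h2]
    exact h1
  · intro h β v hv
    rw [hom_apply]
    refine AddSubgroup.sum_mem _ fun k _ => ?_
    have h1 := IsWeightedHomogeneous.mul (w := varDeg m e) (hv k trivial) (h k)
    have h2 : β - F.deg j k + (γ - F.dualDeg ⟨j, k⟩) = β + γ - sigma m e := by
      simp only [dualDeg, basisDeg]
      abel
    rw [h2] at h1
    exact h1

/-- The inclusion of the cocycles of degree `j` of `Hom(F, ω)`. -/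
def extIncl (j : ℕ) : LinearMap.ker (F.homD j) →ₗ[S K m n] (F.Index →₀ S K m n) :=
  F.levelIncl j ∘ₗ F.evalBasis j ∘ₗ (LinearMap.ker (F.homD j)).subtype

theorem extIncl_apply (j : ℕ) (z : LinearMap.ker (F.homD j)) :
    F.extIncl j z = F.levelIncl j (F.evalBasis j z) := rfl

/-- The projection from the cocycles to `Ext`. -/
def extQuot (j : ℕ) := subquotientMk (LinearMap.ker (F.homD j)) (F.extCoboundary j)

/-- The grading of the cocycles. -/
def extCocycleGrading (j : ℕ) (γ : ℤ × ℤ) : AddSubgroup (LinearMap.ker (F.homD j)) :=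
  (F.homGrading j γ).comap (LinearMap.ker (F.homD j)).subtype.toAddMonoidHom

/-- The `Ext`-modules are the cohomology of `Hom(F, ω)`. -/
theorem isCohomologyAt_ext (j : ℕ) :
    IsCohomologyAt (freeGr (varDeg m e) F.dualDeg) (freeLevel K (Fin m ⊕ Fin n) F.level)
      F.cohomologyD j (F.extCocycleGrading j) (F.extGrading j) (F.extIncl j) (F.extQuot j) where
  incl_injective z z' h :=
    Subtype.ext (F.evalBasis_injective j (F.levelIncl_injective j h))
  incl_mem z := F.levelIncl_mem_freeLevel j _ fun k => rfl
  d_incl z := by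
    rw [extIncl_apply, cohomologyD_levelIncl, LinearMap.mem_ker.1 z.2, map_zero, map_zero]
  exists_incl a ha h0 := by
    obtain ⟨v, rfl⟩ := F.exists_levelIncl j (fun p hp h => hp (by
      simp only [level] at h; omega)) ha
    obtain ⟨φ, rfl⟩ := F.evalBasis_surjective j v
    rw [cohomologyD_levelIncl] at h0
    refine ⟨⟨φ, F.evalBasis_injective _ (F.levelIncl_injective (j + 1) ?_)⟩, rfl⟩
    rw [h0, map_zero, map_zero]
  mem_iff γ z := F.mem_homGrading j z γ
  quot_graded γ z hz := ⟨z, hz, rfl⟩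
  exists_quot γ v hv := by
    obtain ⟨z, hz, rfl⟩ := hv
    exact ⟨z, hz, rfl⟩
  quot_eq_zero z := by
    refine (subquotient_mk_eq_zero z).trans ?_
    rw [extIncl_apply]
    rcases j with _ | j
    · constructor
      · intro h
        have h' : (z : F.HomOmega 0) = 0 := h
        exact ⟨0, zero_mem _, by rw [map_zero, h', map_zero, map_zero]⟩
      · rintro ⟨b, hb, hbz⟩
        have hb0 : b = 0 := Finsupp.ext fun p => mem_freeLevel.1 hb p (by
          simp only [level]; push_cast; omega)
        rw [hb0, map_zero] at hbz
        have h' : (z : F.HomOmega 0) = 0 := F.evalBasis_injective 0 (F.levelIncl_injective 0 (by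
          rw [← hbz, map_zero, map_zero]))
        exact h'
    · constructor
      · rintro ⟨φ, hφ⟩
        exact ⟨F.levelIncl j (F.evalBasis j φ), F.levelIncl_mem_freeLevel j _ fun k => by
          simp only [level]; push_cast; ring, by rw [cohomologyD_levelIncl, hφ]⟩
      · rintro ⟨b, hb, hbz⟩
        obtain ⟨v, rfl⟩ := F.exists_levelIncl j (fun p hp h => hp (by
          simp only [level] at h; push_cast at h; omega)) hb
        obtain ⟨φ, rfl⟩ := F.evalBasis_surjective j v
        rw [cohomologyD_levelIncl] at hbz
        exact ⟨φ, F.evalBasis_injective _ (F.levelIncl_injective _ hbz)⟩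

/-- The resolution is exact in negative degrees. -/
theorem exact_homologyD {j : ℤ} (hj : j < 0) {a : F.Index →₀ S K m n}
    (ha : a ∈ freeLevel K (Fin m ⊕ Fin n) (fun p => -F.level p) j) (h0 : F.homologyD a = 0) :
    ∃ b ∈ freeLevel K (Fin m ⊕ Fin n) (fun p => -F.level p) (j - 1), F.homologyD b = a := by
  obtain ⟨i, rfl⟩ : ∃ i : ℕ, j = -(i + 1 : ℕ) := ⟨(-j - 1).toNat, by omega⟩
  obtain ⟨v, rfl⟩ := F.exists_levelIncl (i + 1) (fun p hp h => hp (by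
    simp only [level] at h; omega)) ha
  rw [homologyD_levelIncl] at h0
  obtain ⟨u, rfl⟩ := (F.exact_diff i v).1 (F.levelIncl_injective i (by rw [h0, map_zero]))
  exact ⟨F.levelIncl (i + 2) u, F.levelIncl_mem_freeLevel (i + 2) _ fun k => by
    simp only [level]; push_cast; ring, F.homologyD_levelIncl (i + 1) u⟩

end FreeResolution

/-! ### Duality for a resolution and the vanishing of the lower `Ext`-modules -/

section GradedDualMap

variable {Γ K R A B : Type*} [Field K] [CommRing R] [Algebra K R] [AddCommGroup A] [Module R A]
  [AddCommGroup B] [Module R B] [AddCommGroup Γ] {𝒢 : Γ → AddSubgroup A} {ℋ : Γ → AddSubgroup B}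

variable (K) in
/-- The transpose of a linear map. -/
def fullDualMap (f : A →ₗ[R] B) : FullDual K R B →ₗ[R] FullDual K R A where
  toFun φ := ⟨φ.1.comp f.toAddMonoidHom, fun a v => by
    have h : f (algebraMap K R a • v) = algebraMap K R a • f v := map_smul _ _ _
    exact (congrArg φ.1 h).trans (φ.2 a (f v))⟩
  map_add' _ _ := rfl
  map_smul' r φ := Subtype.ext <| AddMonoidHom.ext fun v =>
    (congrArg φ.1 (map_smul f r v)).symm

theorem fullDualMap_mem {f : A →ₗ[R] B} (hf : IsGradedHom 𝒢 ℋ f) {γ : Γ} {φ : FullDual K R B}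
    (hφ : φ ∈ fullDualGrading K R ℋ γ) : fullDualMap K f φ ∈ fullDualGrading K R 𝒢 γ :=
  fun β hβ v hv => hφ β hβ _ (hf β v hv)

theorem fullDualMap_mem_gradedDual {f : A →ₗ[R] B} (hf : IsGradedHom 𝒢 ℋ f) {φ : FullDual K R B}
    (hφ : φ ∈ GradedDual K R ℋ) : fullDualMap K f φ ∈ GradedDual K R 𝒢 := by
  have : GradedDual K R ℋ ≤ (GradedDual K R 𝒢).comap (fullDualMap K f) := by
    rw [Submodule.span_le]
    rintro φ ⟨γ, hγ⟩
    exact Submodule.subset_span ⟨γ, fullDualMap_mem hf hγ⟩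
  exact this hφ

/-- Isomorphic graded modules have isomorphic graded duals. -/
theorem GradedIso.gradedDual (h : GradedIso R 𝒢 ℋ) :
    GradedIso R (gradedDualGrading K R 𝒢) (gradedDualGrading K R ℋ) := by
  obtain ⟨f, hf⟩ := h
  have h1 : IsGradedHom 𝒢 ℋ f.toLinearMap := fun γ a ha => (hf γ a).1 ha
  have h2 : IsGradedHom ℋ 𝒢 f.symm.toLinearMap := fun γ b hb =>
    (hf γ _).2 (by rw [LinearEquiv.coe_coe, f.apply_symm_apply]; exact hb)
  refine ⟨LinearEquiv.ofLinearMap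
    ((fullDualMap K f.symm.toLinearMap).restrict fun φ hφ => fullDualMap_mem_gradedDual h2 hφ)
    ((fullDualMap K f.toLinearMap).restrict fun φ hφ => fullDualMap_mem_gradedDual h1 hφ) ?_ ?_,
    fun γ φ => ⟨fun hφ => fullDualMap_mem h2 hφ, fun hφ => ?_⟩⟩
  · refine LinearMap.ext fun φ => Subtype.ext <| Subtype.ext <| AddMonoidHom.ext fun v => ?_
    exact congrArg φ.1.1 (f.apply_symm_apply v)
  · refine LinearMap.ext fun φ => Subtype.ext <| Subtype.ext <| AddMonoidHom.ext fun v => ?_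
    exact congrArg φ.1.1 (f.symm_apply_apply v)
  · intro β hβ v hv
    have h3 := hφ β hβ (f v) ((hf β v).1 hv)
    exact (congrArg φ.1.1 (f.symm_apply_apply v)).symm.trans h3

theorem subsingleton_fullDual [Subsingleton A] : Subsingleton (FullDual K R A) :=
  ⟨fun φ ψ => Subtype.ext <| AddMonoidHom.ext fun v => by
    rw [Subsingleton.elim v 0, map_zero, map_zero]⟩

theorem subsingleton_gradedDual [Subsingleton A] : Subsingleton (GradedDual K R 𝒢) :=
  have : Subsingleton (FullDual K R A) := subsingleton_fullDual
  inferInstance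

end GradedDualMap

section LocExactOfTorsion

variable {ι K Γ R A Z N : Type*} [LinearOrder ι] [Finite ι] [Field K] [CommRing R] [Algebra K R]
  [AddCommGroup Γ] [DecidableEq Γ] {𝒜 : Γ → Submodule K R} [GradedAlgebra 𝒜] [AddCommGroup A]
  [Module R A] [AddCommGroup Z] [Module R Z] [AddCommGroup N] [Module R N]
  {x : ι → R} {𝒢 : Γ → AddSubgroup A} {V : ℤ → Submodule R A} {d : A →ₗ[R] A}
  {𝒵 : Γ → AddSubgroup Z} {𝒩 : Γ → AddSubgroup N} {incl : Z →ₗ[R] A} {quot : Z →ₗ[R] N} {c : ℤ}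

/-- The localized complex is exact where the cohomology module is torsion with respect to the
denominators. -/
theorem IsCohomologyAt.locExact (hC : IsCohomologyAt 𝒢 V d c 𝒵 𝒩 incl quot)
    (hA : GradedComplex 𝒜 𝒢 V d) (hx : ∀ i, ∃ β, x i ∈ 𝒜 β) {J : Finset ι} {γ : Γ}
    (h : ∀ β, ∀ s : cechDen x J, (s : R) ∈ 𝒜 β → ∀ v ∈ 𝒩 (γ + β), ∃ u : cechDen x J,
      (u : R) • v = 0) : LocExact 𝒜 x 𝒢 d V J c γ := by
  refine hA.locExact hx fun β s hs a ha hag hda => ?_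
  obtain ⟨z, rfl⟩ := hC.exists_incl a ha hda
  obtain ⟨u, hu⟩ := h β s hs _ (hC.quot_graded _ z ((hC.mem_iff _ z).2 hag))
  rw [← map_smul, hC.quot_eq_zero] at hu
  obtain ⟨b, hb, hbz⟩ := hu
  exact ⟨u, b, hb, by rw [hbz, map_smul]⟩

/-- The localized complex is exact where the complex is zero. -/
theorem GradedComplex.locExact_of_eq_bot (hA : GradedComplex 𝒜 𝒢 V d)
    (hx : ∀ i, ∃ β, x i ∈ 𝒜 β) {J : Finset ι} {γ : Γ} {j : ℤ} (h : ∀ a ∈ V j, a = 0) :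
    LocExact 𝒜 x 𝒢 d V J j γ :=
  hA.locExact hx fun β s hs a ha hag hda => ⟨1, 0, zero_mem _, by
    rw [h a ha, map_zero, smul_zero]⟩

theorem IsCohomologyAt.isGrading (hC : IsCohomologyAt 𝒢 V d c 𝒵 𝒩 incl quot)
    (hA : GradedComplex 𝒜 𝒢 V d) (hq : Function.Surjective quot) : IsGrading 𝒩 where
  exists_sum v := by
    obtain ⟨z, rfl⟩ := hq v
    obtain ⟨s, -, hs⟩ := (hC.isGrading_cocycles hA).sum_proj z
    refine ⟨s, fun γ => quot ((hC.isGrading_cocycles hA).proj γ z),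
      fun γ => hC.quot_graded γ _ (IsGrading.proj_mem _ γ z), ?_⟩
    rw [← map_sum, hs]
  eq_zero s b hb hs γ hγ := by
    choose z hz hzb using fun γ => hC.exists_quot γ _ (hb γ)
    have h1 : quot (∑ γ ∈ s, z γ) = 0 := by
      rw [map_sum, ← hs]
      exact Finset.sum_congr rfl fun γ _ => hzb γ
    obtain ⟨a, ha, hda⟩ := (hC.quot_eq_zero _).1 h1
    rw [← hzb, hC.quot_eq_zero]
    refine ⟨hA.grading.proj γ a, hA.homog _ γ a ha, ?_⟩
    refine (hA.grading.map_proj hA.grading d.toAddMonoidHom hA.graded γ a).trans ?_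
    change hA.grading.proj γ (d a) = _
    rw [hda, map_sum, map_sum, Finset.sum_eq_single_of_mem γ hγ fun β _ hβ =>
      hA.grading.proj_of_mem_ne (hC.incl_graded β _ (hz β)) hβ.symm,
      hA.grading.proj_of_mem (hC.incl_graded γ _ (hz γ))]

theorem IsCohomologyAt.gradedSMul (hC : IsCohomologyAt 𝒢 V d c 𝒵 𝒩 incl quot)
    (hA : GradedComplex 𝒜 𝒢 V d) : GradedSMul 𝒜 𝒩 := fun β γ p hp v hv => by
  obtain ⟨z, hz, rfl⟩ := hC.exists_quot γ v hv
  rw [← map_smul]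
  exact hC.quot_graded _ _ (hC.gradedSMul_cocycles hA β γ p hp z hz)

end LocExactOfTorsion

namespace FreeResolution

variable {K : Type*} [Field K] {m n : ℕ} {M : Type*} [AddCommGroup M] [Module (S K m n) M]
  {e : Fin n → ℕ} {ℳ : ℤ × ℤ → AddSubgroup M} (F : FreeResolution K m e ℳ)

attribute [local instance] weightedGradedAlgebra

theorem finite_level (j : ℤ) : {p | F.level p = j}.Finite := by
  refine Set.Finite.subset (Set.finite_range fun k => (⟨j.toNat, k⟩ : F.Index)) ?_
  rintro ⟨i, k⟩ h
  have : i = j.toNat := by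
    simp only [level, Set.mem_ofPred_eq] at h
    omega
  subst this
  exact ⟨k, rfl⟩

theorem abs_le_of_sum {ι : Type*} [Fintype ι] (u : ι → ℤ) (h : (∀ i, 0 ≤ u i) ∨ ∀ i, u i ≤ 0)
    (i : ι) : |u i| ≤ |∑ i, u i| := by
  rcases h with h | h
  · rw [abs_of_nonneg (h i), abs_of_nonneg (Finset.sum_nonneg fun i _ => h i)]
    exact Finset.single_le_sum (fun i _ => h i) (Finset.mem_univ i)
  · rw [abs_of_nonpos (h i), abs_of_nonpos (Finset.sum_nonpos fun i _ => h i), ← Finset.sum_neg_distrib]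
    exact Finset.single_le_sum (f := fun i => -u i) (fun i _ => neg_nonneg.2 (h i))
      (Finset.mem_univ i)

/-- There are finitely many Laurent monomials of a given bidegree with prescribed signs of the
exponents, the exponents of the `y_j` being negative. -/
theorem finite_exponent (γ : ℤ × ℤ) {P : (Fin m ⊕ Fin n → ℤ) → Prop}
    (hx : ∀ u, P u → (∀ i, 0 ≤ u (Sum.inl i)) ∨ ∀ i, u (Sum.inl i) ≤ 0)
    (hy : ∀ u, P u → ∀ j, u (Sum.inr j) ≤ 0) (hw : ∀ u, P u → intWt (varDeg m e) u = γ) :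
    {u | P u}.Finite := by
  -- The second component of the degree bounds the exponents of the `y_j`, and then the first
  -- component bounds those of the `x_i`.
  let B : ℤ := |γ.1| + ∑ j, (e j : ℤ) * |γ.2| + |γ.2|
  refine Set.Finite.subset (Set.finite_Icc (fun _ : Fin m ⊕ Fin n => -B) fun _ => B) ?_
  intro u hu
  have h1 : ∑ i, u (Sum.inl i) + ∑ j, u (Sum.inr j) * e j = γ.1 := by
    rw [← hw u hu]
    simp [intWt, varDeg, Prod.fst_sum, Fintype.sum_sum_type]
  have h2 : ∑ j, u (Sum.inr j) = γ.2 := by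
    rw [← hw u hu]
    simp [intWt, varDeg, Prod.snd_sum, Fintype.sum_sum_type]
  have h3 : ∀ j, |u (Sum.inr j)| ≤ |γ.2| := fun j => by
    rw [← h2]
    exact abs_le_of_sum (fun j => u (Sum.inr j)) (Or.inr (hy u hu)) j
  have h4 : |∑ j, u (Sum.inr j) * e j| ≤ ∑ j, (e j : ℤ) * |γ.2| := by
    refine (Finset.abs_sum_le_sum_abs _ _).trans (Finset.sum_le_sum fun j _ => ?_)
    rw [abs_mul, mul_comm, Nat.abs_cast]
    exact mul_le_mul_of_nonneg_left (h3 j) (Int.natCast_nonneg _)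
  have h5 : ∀ i, |u (Sum.inl i)| ≤ |γ.1| + ∑ j, (e j : ℤ) * |γ.2| := fun i => by
    refine (abs_le_of_sum (fun i => u (Sum.inl i)) (hx u hu) i).trans ?_
    rw [eq_sub_of_add_eq h1]
    exact (abs_sub _ _).trans (add_le_add le_rfl h4)
  have h6 : 0 ≤ |γ.2| := abs_nonneg _
  have h7 : 0 ≤ |γ.1| + ∑ j, (e j : ℤ) * |γ.2| := add_nonneg (abs_nonneg _)
    (Finset.sum_nonneg fun j _ => mul_nonneg (Int.natCast_nonneg _) h6)
  have h8 : ∀ l, |u l| ≤ B := by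
    rintro (i | j)
    · exact (h5 i).trans (le_add_of_nonneg_right h6)
    · exact (h3 j).trans (le_add_of_nonneg_left h7)
  exact ⟨fun l => (abs_le.1 (h8 l)).1, fun l => (abs_le.1 (h8 l)).2⟩

theorem dualDeg_add_basisDeg (p : F.Index) : F.dualDeg p + F.basisDeg p = ∑ l, varDeg m e l :=
  sub_add_cancel _ _

/-- `Hom(F, ω)` and `F`, with the two families of variables. -/
theorem isDualPair : IsDualPair Sum.inl Sum.inr (varDeg m e) F.level F.dualDeg F.basisDeg
    F.cohomologyD F.homologyD where
  left_injective := Sum.inl_injective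
  right_injective := Sum.inr_injective
  compl := by rintro (i | j) <;> simp
  left := F.gradedComplex_cohomologyD
  right := F.gradedComplex_homologyD
  adjoint := F.dot_cohomologyD
  weight := F.dualDeg_add_basisDeg
  finite_level := F.finite_level
  finite_exponent γ := finite_exponent γ (fun u hu => Or.inl hu.1) (fun u hu j => (hu.2.1 j).le)
    fun u hu => hu.2.2

/-- `Hom(F, ω)` and `F`, with the empty family and the family of all variables. -/
theorem isDualPair_all : IsDualPair (Fin.elim0 : Fin 0 → Fin m ⊕ Fin n) finSumFinEquiv.symm
    (varDeg m e) F.level F.dualDeg F.basisDeg F.cohomologyD F.homologyD where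
  left_injective := fun i => i.elim0
  right_injective := finSumFinEquiv.symm.injective
  compl l := by
    constructor
    · rintro ⟨i, -⟩
      exact i.elim0
    · exact fun h => absurd (finSumFinEquiv.symm.surjective l) h
  left := F.gradedComplex_cohomologyD
  right := F.gradedComplex_homologyD
  adjoint := F.dot_cohomologyD
  weight := F.dualDeg_add_basisDeg
  finite_level := F.finite_level
  finite_exponent γ := by
    have h : ∀ u : Fin m ⊕ Fin n → ℤ, (∀ b, u (finSumFinEquiv.symm b) < 0) → ∀ l, u l ≤ 0 :=
      fun u hu l => by
        have := hu (finSumFinEquiv l)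
        rw [Equiv.symm_apply_apply] at this
        exact this.le
    exact finite_exponent γ (fun u hu => Or.inr fun i => h u hu.2.1 _)
      (fun u hu j => h u hu.2.1 _) fun u hu => hu.2.2

section Augmentation

variable {β : Type*} [LinearOrder β] [Fintype β] (g : β → Fin m ⊕ Fin n)

theorem locExact_homologyD (J : Finset β) {j : ℤ} (hj : j ≠ 0) (γ : ℤ × ℤ) :
    LocExact (gradS K m e) (varFam K g) (freeGr (varDeg m e) F.basisDeg) F.homologyD
      (freeLevel K (Fin m ⊕ Fin n) fun p => -F.level p) J j γ := by
  rcases lt_or_gt_of_ne hj with h | h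
  · refine F.gradedComplex_homologyD.locExact (varFam_mem _ g) fun β s hs a ha hag hda => ?_
    obtain ⟨b, hb, rfl⟩ := F.exact_homologyD h ha hda
    exact ⟨1, b, hb, (one_smul _ _).symm⟩
  · refine F.gradedComplex_homologyD.locExact_of_eq_bot (varFam_mem _ g) fun a ha =>
      Finsupp.ext fun p => mem_freeLevel.1 ha p ?_
    simp only [level]
    omega

/-- The local cohomology of the resolved module is the hypercohomology of its resolution. -/
theorem gradedIso_localCoh_hyperCoh (hℳ : IsGrading ℳ) (hs : GradedSMul (gradS K m e) ℳ) (q : ℤ) :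
    GradedIso (S K m n) (localCohGrading (gradS K m e) (varFam K g) ℳ q)
      (hyperGrading (gradS K m e) (varFam K g) (freeGr (varDeg m e) F.basisDeg) F.homologyD
        (freeLevel K (Fin m ⊕ Fin n) fun p => -F.level p) q) := by
  obtain ⟨φ, hφ, -, hinj, hsurj⟩ := (F.isCohomologyAt_aug hℳ).exists_hyperCohMap
    F.gradedComplex_homologyD (varFam_mem _ g) hs hℳ (zero_add q).symm
    (fun γ J j hj => F.locExact_homologyD g J hj.ne γ)
  have h2 := F.gradedComplex_homologyD.isGrading_hyperCoh (varFam_mem (K := K) _ g) q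
  obtain ⟨f, -, hf⟩ := exists_equiv_of_bijective hφ
    (injective_of_homogeneous (isGrading_localCoh (varFam_mem _ g) hℳ hs q) h2 hφ
      fun γ => hinj γ fun J j hj _ => F.locExact_homologyD g J hj.ne' γ)
    (fun γ => hsurj γ fun J j hj _ => F.locExact_homologyD g J hj.ne' γ) h2.mem_span
  exact ⟨f, hf⟩

end Augmentation

/-- The hypercohomology of `Hom(F, ω)` with respect to the `x_i` is dual to the local cohomology of
`M` with respect to the `y_j`. -/
theorem gradedIso_hyperCoh_gradedDual (hℳ : IsGrading ℳ) (hs : GradedSMul (gradS K m e) ℳ) {t t' : ℤ}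
    (ht : t + t' = m + n) :
    GradedIso (S K m n)
      (hyperGrading (gradS K m e) (xS K m n) (freeGr (varDeg m e) F.dualDeg) F.cohomologyD
        (freeLevel K (Fin m ⊕ Fin n) F.level) t)
      (gradedDualGrading K (S K m n) (localCohGrading (gradS K m e) (yS K m n) ℳ t')) := by
  have h1 := F.isDualPair.gradedIso_hyperCoh (t := t) (t' := t')
    (by rw [Fintype.card_fin, Fintype.card_fin]; exact ht)
  exact h1.trans (F.gradedIso_localCoh_hyperCoh Sum.inr hℳ hs t').symm.gradedDual

theorem isGrading_ext (j : ℕ) : IsGrading (F.extGrading j) :=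
  (F.isCohomologyAt_ext j).isGrading F.gradedComplex_cohomologyD (Submodule.mkQ_surjective _)

theorem gradedSMul_ext (j : ℕ) : GradedSMul (gradS K m e) (F.extGrading j) :=
  (F.isCohomologyAt_ext j).gradedSMul F.gradedComplex_cohomologyD

section Rows

variable {α : Type*} [LinearOrder α] [Fintype α] (f : α → Fin m ⊕ Fin n)

/-- The localized complex `Hom(F, ω)` is exact where `Ext` is torsion. -/
theorem locExact_cohomologyD {J : Finset α} {j : ℤ} {γ : ℤ × ℤ}
    (h : ∀ i : ℕ, (i : ℤ) = j → ∀ β, ∀ s : cechDen (varFam K f) J, (s : S K m n) ∈ gradS K m e β →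
      ∀ v ∈ F.extGrading i (γ + β), ∃ u : cechDen (varFam K f) J, (u : S K m n) • v = 0) :
    LocExact (gradS K m e) (varFam K f) (freeGr (varDeg m e) F.dualDeg) F.cohomologyD
      (freeLevel K (Fin m ⊕ Fin n) F.level) J j γ := by
  rcases lt_or_ge j 0 with hj | hj
  · refine F.gradedComplex_cohomologyD.locExact_of_eq_bot (varFam_mem _ f) fun a ha =>
      Finsupp.ext fun p => mem_freeLevel.1 ha p ?_
    simp only [level]
    omega
  · obtain ⟨i, rfl⟩ := Int.eq_ofNat_of_zero_le hj
    exact (F.isCohomologyAt_ext i).locExact F.gradedComplex_cohomologyD (varFam_mem _ f)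
      (h i rfl)

end Rows

/-- With respect to the empty family, the `0`-th local cohomology of a module is the module itself.
-/
theorem eq_zero_of_localCoh_empty {x : Fin 0 → S K m n} {N : Type*} [AddCommGroup N]
    [Module (S K m n) N] {v : N}
    (h : (fun J => cechMk x J 1 v) ∈ cechCoboundary x N 0) : v = 0 := by
  have h1 := congrFun (cechCoboundary_zero h) ∅
  obtain ⟨u, hu⟩ := cechMk_eq_zero.1 h1
  rw [mem_cechDen_empty u] at hu
  exact (one_smul _ v).symm.trans hu

/-- `Ext^j(M, ω) = 0` for `j < s - dim M`. -/
theorem ext_eq_zero [Module.Finite (S K m n) M] (hℳ : IsGrading ℳ)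
    (hs : GradedSMul (gradS K m e) ℳ) {d : ℕ}
    (hd : Module.supportDim (S K m n) M = (d : WithBot ℕ∞)) {j : ℕ} (hj : j + d < m + n)
    (v : F.Ext j) : v = 0 := by
  induction j using Nat.strong_induction_on with
  | _ j ih =>
  -- By induction `Ext^j` is the lowest non-zero `Ext`, so it embeds into the hypercohomology of
  -- `Hom(F, ω)` with respect to the empty family. This is dual to the local cohomology of `M` with
  -- respect to all variables in degree `s - j > d`, which vanishes.
  let x₀ := varFam K (Fin.elim0 : Fin 0 → Fin m ⊕ Fin n)
  let y₀ := varFam K (finSumFinEquiv.symm : Fin (m + n) → Fin m ⊕ Fin n)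
  have hvan : cechCocycle y₀ M ((m + n : ℤ) - j) ≤ cechCoboundary y₀ M ((m + n : ℤ) - j) :=
    cechCocycle_le_of_supportDim_lt y₀ (d + 1) M (by
      rw [hd]
      exact_mod_cast Nat.lt_succ_self d) (by push_cast; omega)
  have h1 : Subsingleton (LocalCoh y₀ M ((m + n : ℤ) - j)) := by
    refine ⟨fun a b => ?_⟩
    obtain ⟨a, rfl⟩ := Submodule.mkQ_surjective _ a
    obtain ⟨b, rfl⟩ := Submodule.mkQ_surjective _ b
    rw [(subquotient_mk_eq_zero a).2 (hvan a.2), (subquotient_mk_eq_zero b).2 (hvan b.2)]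
  have h2 := F.isDualPair_all.gradedIso_hyperCoh (t := j) (t' := (m + n : ℤ) - j)
    (by rw [Fintype.card_fin, Fintype.card_fin]; push_cast; ring)
  obtain ⟨Θ, -⟩ := h2.trans
    (F.gradedIso_localCoh_hyperCoh finSumFinEquiv.symm hℳ hs _).symm.gradedDual
  have h3 : Subsingleton (GradedDual K (S K m n)
      (localCohGrading (gradS K m e) y₀ ℳ ((m + n : ℤ) - j))) := subsingleton_gradedDual
  obtain ⟨g, -, -, hinj, -⟩ := (F.isCohomologyAt_ext j).exists_hyperCohMap
    F.gradedComplex_cohomologyD (varFam_mem _ (Fin.elim0 : Fin 0 → Fin m ⊕ Fin n))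
    (F.gradedSMul_ext j) (F.isGrading_ext j) (add_zero (j : ℤ)).symm
    (fun γ J i hi => F.locExact_cohomologyD _ fun i' hi' β s hs v hv =>
      ⟨1, (one_smul _ v).trans (ih i' (by omega) (by omega) v)⟩)
  refine (F.isGrading_ext j).induction (P := fun v => v = 0) rfl
    (fun a b ha hb => by rw [ha, hb, add_zero]) (fun γ v hv => ?_) v
  refine eq_zero_of_localCoh_empty (x := x₀) ?_
  have hempty : ∀ J : Finset (Fin 0), J = ∅ := fun J => Finset.eq_empty_of_isEmpty J
  have hc : (fun J => cechMk x₀ J 1 v) ∈ cechCocycle x₀ (F.Ext j) 0 := by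
    refine ⟨funext fun J => ?_, fun J hJ => absurd (by rw [hempty J]; rfl) hJ⟩
    rw [cechD_apply, hempty J]
    rfl
  refine (subquotient_mk_eq_zero ⟨_, hc⟩).1 (hinj γ (fun J i hi hi' => by omega) _
    ⟨⟨_, hc⟩, fun J _ => cechMk_mem_grading (β := 0) SetLike.GradedOne.one_mem (by
      rwa [add_zero]), rfl⟩ (Θ.injective (Subsingleton.elim _ _)))

end FreeResolution

/-! ### The comparison map and the exact sequences -/

section Comparison

variable {ι K Γ R A Z N D : Type*} [LinearOrder ι] [Finite ι] [Field K] [CommRing R] [Algebra K R]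
  [AddCommGroup Γ] [DecidableEq Γ] {𝒜 : Γ → Submodule K R} [GradedAlgebra 𝒜] [AddCommGroup A]
  [Module R A] [AddCommGroup Z] [Module R Z] [AddCommGroup N] [Module R N] [AddCommGroup D]
  [Module R D] {x : ι → R} {𝒢 : Γ → AddSubgroup A} {V : ℤ → Submodule R A} {δ : A →ₗ[R] A}
  {𝒵 : Γ → AddSubgroup Z} {𝒩 : Γ → AddSubgroup N} {incl : Z →ₗ[R] A} {quot : Z →ₗ[R] N} {c : ℤ}
  {Z' N' Z'' N'' : Type*} [AddCommGroup Z'] [Module R Z'] [AddCommGroup N'] [Module R N']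
  {𝒵' : Γ → AddSubgroup Z'} {𝒩' : Γ → AddSubgroup N'} {incl' : Z' →ₗ[R] A} {quot' : Z' →ₗ[R] N'}
  [AddCommGroup Z''] [Module R Z''] [AddCommGroup N''] [Module R N'']
  {𝒵'' : Γ → AddSubgroup Z''} {𝒩'' : Γ → AddSubgroup N''} {incl'' : Z'' →ₗ[R] A}
  {quot'' : Z'' →ₗ[R] N''} {c' c'' : ℤ} {𝒟 : Γ → AddSubgroup D}

namespace IsCohomologyAt

variable (hC : IsCohomologyAt 𝒢 V δ c 𝒵 𝒩 incl quot) (hA : GradedComplex 𝒜 𝒢 V δ)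
  (hx : ∀ i, ∃ β, x i ∈ 𝒜 β) (hN : GradedSMul 𝒜 𝒩) (hNg : IsGrading 𝒩)
  (hex : ∀ γ (J : Finset ι) (j : ℤ), j < c → LocExact 𝒜 x 𝒢 δ V J j γ) {i t : ℤ} (ht : t = c + i)
  (hD : GradedIso R (hyperGrading 𝒜 x 𝒢 δ V t) 𝒟)
include hC hA hx hN hNg hex ht hD

/-- The comparison map from the local cohomology of the lowest cohomology module to a model of
hypercohomology; it is bijective in the internal degrees in which the higher cohomology modules do
not contribute. -/
theorem exists_comparisonMap :
    ∃ g : LocalCoh x N i →ₗ[R] D, IsGradedHom (localCohGrading 𝒜 x 𝒩 i) 𝒟 g ∧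
      (∀ γ, (∀ (J : Finset ι) (j : ℤ), c < j → j < c + i → LocExact 𝒜 x 𝒢 δ V J j γ) →
        ∀ a ∈ localCohGrading 𝒜 x 𝒩 i γ, g a = 0 → a = 0) ∧
      (∀ γ, (∀ (J : Finset ι) (j : ℤ), c < j → j ≤ c + i → LocExact 𝒜 x 𝒢 δ V J j γ) →
        ∀ b ∈ 𝒟 γ, ∃ a ∈ localCohGrading 𝒜 x 𝒩 i γ, g a = b) := by
  obtain ⟨g, hg, -, hinj, hsurj⟩ := hC.exists_hyperCohMap hA hx hN hNg ht hex
  obtain ⟨Θ, hΘ⟩ := hD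
  refine ⟨Θ.toLinearMap ∘ₗ g, fun γ a ha => (hΘ γ _).1 (hg γ a ha), fun γ h a ha h0 =>
    hinj γ h a ha (Θ.map_eq_zero_iff.1 h0), fun γ h b hb => ?_⟩
  obtain ⟨a, ha, hab⟩ := hsurj γ h (Θ.symm b) ((hΘ γ _).2 (by rwa [Θ.apply_symm_apply]))
  exact ⟨a, ha, by rw [LinearMap.comp_apply, hab]; exact Θ.apply_symm_apply b⟩

/-- In degree `0` there are no obstructions: the comparison map is an isomorphism. -/
theorem gradedIso_of_eq_zero (hi : i = 0) : GradedIso R (localCohGrading 𝒜 x 𝒩 i) 𝒟 := by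
  obtain ⟨g, hg, -, hinj, hsurj⟩ := hC.exists_hyperCohMap hA hx hN hNg ht hex
  have h1 := hA.isGrading_hyperCoh hx t
  obtain ⟨f, -, hf⟩ := exists_equiv_of_bijective hg
    (injective_of_homogeneous (isGrading_localCoh hx hNg hN i) h1 hg
      fun γ => hinj γ fun J j hj hj' => by omega)
    (fun γ => hsurj γ fun J j hj hj' => by omega) h1.mem_span
  exact GradedIso.trans ⟨f, hf⟩ hD

variable (hC' : IsCohomologyAt 𝒢 V δ c' 𝒵' 𝒩' incl' quot') (hc' : c' = t) (hN' : GradedSMul 𝒜 𝒩')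
  (hNg' : IsGrading 𝒩')
include hC' hc' hN' hNg'

/-- In degree `1` the comparison map is injective, and its image is the kernel of the edge map. The
target is a model `𝒟` of hypercohomology. -/
theorem exists_exact_first (hi : i = 1) :
    ∃ (f : LocalCoh x N i →ₗ[R] D) (g : D →ₗ[R] LocalCoh x N' 0),
      IsGradedHom (localCohGrading 𝒜 x 𝒩 i) 𝒟 f ∧ IsGradedHom 𝒟 (localCohGrading 𝒜 x 𝒩' 0) g ∧
      Function.Injective f ∧ Function.Exact f g := by
  subst hc'
  obtain ⟨g, hg, hrel, hinj, -⟩ := hC.exists_hyperCohMap hA hx hN hNg ht hex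
  obtain ⟨h, hh, hgh⟩ := hC.exists_exact_edge hA hx hN hNg hC' hN' hNg' hi.ge ht hex
    (fun γ J j _ hj hj' => by omega) hrel
  obtain ⟨Θ, hΘ⟩ := hD
  have hinj' : Function.Injective g :=
    injective_of_homogeneous (isGrading_localCoh hx hNg hN i) (hA.isGrading_hyperCoh hx _) hg
      fun γ => hinj γ fun J j hj hj' => by omega
  exact ⟨Θ.toLinearMap ∘ₗ g, h ∘ₗ Θ.symm.toLinearMap, fun γ a ha => (hΘ γ _).1 (hg γ a ha),
    fun γ b hb => hh γ _ ((hΘ γ _).2 (by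
      rw [LinearEquiv.coe_coe, Θ.apply_symm_apply]; exact hb)),
    Θ.injective.comp hinj', (LinearEquiv.conj_exact_iff_exact g h Θ).2 hgh⟩

/-- In degrees `i ≥ 2` the comparison map fits between the connecting map and the edge map, if the
higher cohomology modules do not contribute to the non-trivial localizations. The target is a model
`𝒟` of hypercohomology. -/
theorem exists_exact_higher (hC'' : IsCohomologyAt 𝒢 V δ c'' 𝒵'' 𝒩'' incl'' quot'')
    (hc'' : c'' = c + i - 1) (hNg'' : IsGrading 𝒩'') (hi : 2 ≤ i)
    (hex' : ∀ γ (J : Finset ι) (j : ℤ), J.Nonempty → c < j → j < c + i →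
      LocExact 𝒜 x 𝒢 δ V J j γ) :
    ∃ (f : N'' →ₗ[R] LocalCoh x N i) (g : LocalCoh x N i →ₗ[R] D) (h : D →ₗ[R] LocalCoh x N' 0),
      IsGradedHom 𝒩'' (localCohGrading 𝒜 x 𝒩 i) f ∧ IsGradedHom (localCohGrading 𝒜 x 𝒩 i) 𝒟 g ∧
      IsGradedHom 𝒟 (localCohGrading 𝒜 x 𝒩' 0) h ∧ Function.Exact f g ∧ Function.Exact g h := by
  subst hc'
  obtain ⟨g, hg, hrel, -, -⟩ := hC.exists_hyperCohMap hA hx hN hNg ht hex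
  obtain ⟨h, hh, hgh⟩ := hC.exists_exact_edge hA hx hN hNg hC' hN' hNg' (by omega) ht hex hex' hrel
  obtain ⟨f, hf, hfg⟩ := hC.exists_exact_connecting hA hx hN hNg hC'' hi ht hc'' hNg'' hex hex' hg
    hrel
  obtain ⟨Θ, hΘ⟩ := hD
  exact ⟨f, Θ.toLinearMap ∘ₗ g, h ∘ₗ Θ.symm.toLinearMap, hf,
    fun γ a ha => (hΘ γ _).1 (hg γ a ha), fun γ b hb => hh γ _ ((hΘ γ _).2 (by
      rw [LinearEquiv.coe_coe, Θ.apply_symm_apply]; exact hb)),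
    fun a => (Θ.map_eq_zero_iff (x := g a)).trans (hfg a),
    (LinearEquiv.conj_exact_iff_exact g h Θ).2 hgh⟩

end IsCohomologyAt

end Comparison

namespace FreeResolution

variable {K : Type*} [Field K] {m n : ℕ} {M : Type*} [AddCommGroup M] [Module (S K m n) M]
  {e : Fin n → ℕ} {ℳ : ℤ × ℤ → AddSubgroup M} (F : FreeResolution K m e ℳ)

attribute [local instance] weightedGradedAlgebra

section Main

variable [Module.Finite (S K m n) M] (hℳ : IsGrading ℳ) (hs : GradedSMul (gradS K m e) ℳ) {d : ℕ}
  (hd : Module.supportDim (S K m n) M = (d : WithBot ℕ∞))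
include hℳ hs hd

theorem le_dim : d ≤ m + n := by
  have h1 := Module.supportDim_le_ringKrullDim (S K m n) M
  rw [hd, MvPolynomial.ringKrullDim_of_isNoetherianRing, ringKrullDim_eq_zero_of_field,
    Nat.card_eq_fintype_card, Fintype.card_sum, Fintype.card_fin, Fintype.card_fin, zero_add] at h1
  exact_mod_cast h1

/-- The vanishing of the lower `Ext`-modules, as exactness of `Hom(F, ω)`. -/
theorem locExact_of_lt {γ : ℤ × ℤ} {J : Finset (Fin m)} {j : ℤ} (hj : j < (m + n - d : ℕ)) :
    LocExact (gradS K m e) (xS K m n) (freeGr (varDeg m e) F.dualDeg) F.cohomologyD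
      (freeLevel K (Fin m ⊕ Fin n) F.level) J j γ :=
  F.locExact_cohomologyD Sum.inl fun i hi β s _ v _ =>
    ⟨1, (one_smul _ v).trans (F.ext_eq_zero hℳ hs hd (by omega) v)⟩

/-- The comparison map from the local cohomology of the lowest `Ext` to the dual of the local
cohomology of `M`; it is bijective in the internal degrees in which the higher `Ext`-modules do not
contribute. -/
theorem exists_comparisonMap {i q : ℤ} (hq : (m + n - d : ℕ) + i + q = m + n) :
    ∃ g : LocalCoh (xS K m n) (F.Ext (m + n - d)) i →ₗ[S K m n]
        GradedDual K (S K m n) (localCohGrading (gradS K m e) (yS K m n) ℳ q),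
      IsGradedHom (localCohGrading (gradS K m e) (xS K m n) (F.extGrading (m + n - d)) i)
        (gradedDualGrading K (S K m n) (localCohGrading (gradS K m e) (yS K m n) ℳ q)) g ∧
      (∀ γ, (∀ (J : Finset (Fin m)) (j : ℤ), (m + n - d : ℕ) < j → j < (m + n - d : ℕ) + i →
        LocExact (gradS K m e) (xS K m n) (freeGr (varDeg m e) F.dualDeg) F.cohomologyD
          (freeLevel K (Fin m ⊕ Fin n) F.level) J j γ) →
        ∀ a ∈ localCohGrading (gradS K m e) (xS K m n) (F.extGrading (m + n - d)) i γ,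
          g a = 0 → a = 0) ∧
      (∀ γ, (∀ (J : Finset (Fin m)) (j : ℤ), (m + n - d : ℕ) < j → j ≤ (m + n - d : ℕ) + i →
        LocExact (gradS K m e) (xS K m n) (freeGr (varDeg m e) F.dualDeg) F.cohomologyD
          (freeLevel K (Fin m ⊕ Fin n) F.level) J j γ) →
        ∀ b ∈ gradedDualGrading K (S K m n) (localCohGrading (gradS K m e) (yS K m n) ℳ q) γ,
          ∃ a ∈ localCohGrading (gradS K m e) (xS K m n) (F.extGrading (m + n - d)) i γ,
            g a = b) := by
  exact (F.isCohomologyAt_ext (m + n - d)).exists_comparisonMap F.gradedComplex_cohomologyD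
    (varFam_mem _ Sum.inl) (F.gradedSMul_ext _) (F.isGrading_ext _)
    (fun γ J j hj => F.locExact_of_lt hℳ hs hd hj) rfl (F.gradedIso_hyperCoh_gradedDual hℳ hs hq)

/-- The sections of the lowest `Ext` with support in `P` are dual to the top local cohomology of `M`
with respect to `Q`. -/
theorem gradedIso_zeroth :
    GradedIso (S K m n)
      (localCohGrading (gradS K m e) (xS K m n) (F.extGrading (m + n - d)) 0)
      (gradedDualGrading K (S K m n) (localCohGrading (gradS K m e) (yS K m n) ℳ d)) := by
  have hle := le_dim hℳ hs hd
  exact (F.isCohomologyAt_ext (m + n - d)).gradedIso_of_eq_zero F.gradedComplex_cohomologyD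
    (varFam_mem _ Sum.inl) (F.gradedSMul_ext _) (F.isGrading_ext _)
    (fun γ J j hj => F.locExact_of_lt hℳ hs hd hj) (add_zero _).symm
    (F.gradedIso_hyperCoh_gradedDual hℳ hs (by omega)) rfl

/-- The exact sequence for the first local cohomology of the lowest `Ext`. -/
theorem exists_exact_first :
    ∃ (f : LocalCoh (xS K m n) (F.Ext (m + n - d)) 1 →ₗ[S K m n]
          GradedDual K (S K m n) (localCohGrading (gradS K m e) (yS K m n) ℳ (d - 1)))
        (g : GradedDual K (S K m n) (localCohGrading (gradS K m e) (yS K m n) ℳ (d - 1))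
          →ₗ[S K m n] LocalCoh (xS K m n) (F.Ext (m + n - d + 1)) 0),
      IsGradedHom
        (localCohGrading (gradS K m e) (xS K m n) (F.extGrading (m + n - d)) 1)
        (gradedDualGrading K (S K m n) (localCohGrading (gradS K m e) (yS K m n) ℳ (d - 1))) f ∧
      IsGradedHom
        (gradedDualGrading K (S K m n) (localCohGrading (gradS K m e) (yS K m n) ℳ (d - 1)))
        (localCohGrading (gradS K m e) (xS K m n) (F.extGrading (m + n - d + 1)) 0) g ∧
      Function.Injective f ∧ Function.Exact f g := by
  have hle := le_dim hℳ hs hd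
  exact (F.isCohomologyAt_ext (m + n - d)).exists_exact_first F.gradedComplex_cohomologyD
    (varFam_mem _ Sum.inl) (F.gradedSMul_ext _) (F.isGrading_ext _)
    (fun γ J j hj => F.locExact_of_lt hℳ hs hd hj) (Nat.cast_succ (m + n - d))
    (F.gradedIso_hyperCoh_gradedDual hℳ hs (by omega)) (F.isCohomologyAt_ext (m + n - d + 1)) rfl
    (F.gradedSMul_ext _) (F.isGrading_ext _) rfl

/-- The exact sequence for the higher local cohomology of the lowest `Ext`, under the assumption
that the intermediate `Ext`-modules are annihilated by powers of `P`. -/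
theorem exists_exact_higher {i : ℕ} (hi : 2 ≤ i)
    (hann : ∀ j : ℕ, m + n - d < j → j < m + n - d + i →
      ∃ t : ℕ, idealP K m n ^ t ≤ Module.annihilator (S K m n) (F.Ext j)) :
    ∃ (f : F.Ext (m + n - d + i - 1) →ₗ[S K m n] LocalCoh (xS K m n) (F.Ext (m + n - d)) i)
        (g : LocalCoh (xS K m n) (F.Ext (m + n - d)) i →ₗ[S K m n]
            GradedDual K (S K m n) (localCohGrading (gradS K m e) (yS K m n) ℳ (d - i)))
        (h : GradedDual K (S K m n) (localCohGrading (gradS K m e) (yS K m n) ℳ (d - i))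
            →ₗ[S K m n] LocalCoh (xS K m n) (F.Ext (m + n - d + i)) 0),
        IsGradedHom (F.extGrading (m + n - d + i - 1))
          (localCohGrading (gradS K m e) (xS K m n) (F.extGrading (m + n - d)) i) f ∧
        IsGradedHom
          (localCohGrading (gradS K m e) (xS K m n) (F.extGrading (m + n - d)) i)
          (gradedDualGrading K (S K m n) (localCohGrading (gradS K m e) (yS K m n) ℳ (d - i))) g ∧
        IsGradedHom
          (gradedDualGrading K (S K m n) (localCohGrading (gradS K m e) (yS K m n) ℳ (d - i)))
          (localCohGrading (gradS K m e) (xS K m n) (F.extGrading (m + n - d + i)) 0) h ∧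
        Function.Exact f g ∧ Function.Exact g h := by
  have hle := le_dim hℳ hs hd
  have hex' : ∀ (γ : ℤ × ℤ) (J : Finset (Fin m)) (j : ℤ), J.Nonempty → (m + n - d : ℕ) < j →
      j < (m + n - d : ℕ) + (i : ℤ) →
      LocExact (gradS K m e) (xS K m n) (freeGr (varDeg m e) F.dualDeg) F.cohomologyD
        (freeLevel K (Fin m ⊕ Fin n) F.level) J j γ := by
    -- For `l ∈ J` a power of `x_l` is a denominator which annihilates the `Ext`-module; at `J = ∅`
    -- there is none.
    rintro γ J j ⟨l, hl⟩ hj hj'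
    refine F.locExact_cohomologyD Sum.inl fun j' hj'' β s _ v _ => ?_
    obtain ⟨t, ht⟩ := hann j' (by omega) (by omega)
    refine ⟨⟨xS K m n l ^ t, pow_mem (Submonoid.subset_closure
      (Set.mem_image_of_mem (xS K m n) (Finset.mem_coe.2 hl))) t⟩, ?_⟩
    exact Module.mem_annihilator.1 (ht (Ideal.pow_mem_pow
      (Ideal.subset_span (Set.mem_range_self l)) t)) v
  exact (F.isCohomologyAt_ext (m + n - d)).exists_exact_higher F.gradedComplex_cohomologyD
    (varFam_mem _ Sum.inl) (F.gradedSMul_ext _) (F.isGrading_ext _)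
    (fun γ J j hj => F.locExact_of_lt hℳ hs hd hj) (Nat.cast_add (m + n - d) i)
    (F.gradedIso_hyperCoh_gradedDual hℳ hs (by omega)) (F.isCohomologyAt_ext (m + n - d + i)) rfl
    (F.gradedSMul_ext _) (F.isGrading_ext _) (F.isCohomologyAt_ext (m + n - d + i - 1)) (by omega)
    (F.isGrading_ext _) (by omega) hex'

end Main

end FreeResolution

/-! ### Čech complexes under a change of rings -/

section ChangeOfRings

variable {ι R' R N' N : Type*} [CommRing R'] [CommRing R] [AddCommGroup N'] [Module R' N']
  [AddCommGroup N] [Module R N] {ρ : R' →+* R} {φ : N' →+ N} {x' : ι → R'} {x : ι → R}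

theorem map_mem_cechDen (hx : ∀ i, ρ (x' i) = x i) {J : Finset ι} {s : R'} (hs : s ∈ cechDen x' J) :
    ρ s ∈ cechDen x J := by
  induction hs using Submonoid.closure_induction with
  | mem y hy =>
    obtain ⟨i, hi, rfl⟩ := hy
    rw [hx]
    exact Submonoid.subset_closure ⟨i, hi, rfl⟩
  | one => rw [map_one]; exact one_mem _
  | mul a b _ _ ha hb => rw [map_mul]; exact mul_mem ha hb

theorem exists_of_mem_cechDen (hx : ∀ i, ρ (x' i) = x i) {J : Finset ι} (s : cechDen x J) :
    ∃ s' : cechDen x' J, ρ s' = s := by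
  obtain ⟨s, hs⟩ := s
  induction hs using Submonoid.closure_induction with
  | mem y hy =>
    obtain ⟨i, hi, rfl⟩ := hy
    exact ⟨⟨x' i, Submonoid.subset_closure ⟨i, hi, rfl⟩⟩, hx i⟩
  | one => exact ⟨1, map_one ρ⟩
  | mul a b _ _ ha hb =>
    obtain ⟨a', ha'⟩ := ha
    obtain ⟨b', hb'⟩ := hb
    exact ⟨a' * b', by rw [Submonoid.coe_mul, map_mul, ha', hb']⟩

/-- The map of localizations induced by a homomorphism of modules over a homomorphism of rings. -/
def locChange (hx : ∀ i, ρ (x' i) = x i) (hφ : ∀ r v, φ (r • v) = ρ r • φ v) (J : Finset ι) :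
    CechLocal x' N' J →+ CechLocal x N J where
  toFun z := z.liftOn (fun p => cechMk x J ⟨ρ p.2, map_mem_cechDen hx p.2.2⟩ (φ p.1)) (by
    rintro ⟨v, s⟩ ⟨w, t⟩ ⟨u, hu⟩
    refine cechMk_eq_iff.2 ⟨⟨ρ u, map_mem_cechDen hx u.2⟩, ?_⟩
    have h1 : (u : R') • (t : R') • v = (u : R') • (s : R') • w := hu
    have h2 := congrArg φ h1
    rwa [hφ, hφ, hφ, hφ] at h2)
  map_zero' := by
    rw [← LocalizedModule.zero_mk 1, LocalizedModule.liftOn_mk, map_zero, map_zero]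
  map_add' z w := by
    obtain ⟨s, v, rfl⟩ := exists_cechMk z
    obtain ⟨t, u, rfl⟩ := exists_cechMk w
    change LocalizedModule.liftOn (LocalizedModule.mk v s + LocalizedModule.mk u t) _ _ =
      cechMk x J _ (φ v) + cechMk x J _ (φ u)
    rw [LocalizedModule.mk_add_mk, LocalizedModule.liftOn_mk]
    have h1 : ∀ (a b : cechDen x J) (p q : N), cechMk x J a p + cechMk x J b q =
        cechMk x J (a * b) ((b : R) • p + (a : R) • q) := fun a b p q =>
      LocalizedModule.mk_add_mk
    rw [h1]
    refine cechMk_eq_iff.2 ⟨1, ?_⟩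
    have h2 : φ (t • v + s • u) = ρ t • φ v + ρ s • φ u := by
      rw [map_add]
      exact congrArg₂ (· + ·) (hφ t v) (hφ s u)
    dsimp only
    rw [h2]
    simp only [Submonoid.coe_mul, map_mul]

variable (hx : ∀ i, ρ (x' i) = x i) (hφ : ∀ r v, φ (r • v) = ρ r • φ v)

theorem locChange_cechMk {J : Finset ι} (s : cechDen x' J) (v : N') :
    locChange hx hφ J (cechMk x' J s v) = cechMk x J ⟨ρ s, map_mem_cechDen hx s.2⟩ (φ v) := rfl

theorem locChange_smul {J : Finset ι} (r : R') (z : CechLocal x' N' J) :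
    locChange hx hφ J (r • z) = ρ r • locChange hx hφ J z := by
  obtain ⟨s, v, rfl⟩ := exists_cechMk z
  rw [← map_smul, locChange_cechMk, hφ, map_smul, locChange_cechMk]

theorem locChange_injective (hinj : Function.Injective φ) {J : Finset ι} :
    Function.Injective (locChange hx hφ J) := by
  rw [injective_iff_map_eq_zero]
  intro z hz
  obtain ⟨s, v, rfl⟩ := exists_cechMk z
  rw [locChange_cechMk, cechMk_eq_zero] at hz
  obtain ⟨u, hu⟩ := hz
  obtain ⟨u', hu'⟩ := exists_of_mem_cechDen hx u
  rw [← hu', ← hφ] at hu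
  exact cechMk_eq_zero.2 ⟨u', hinj (by rw [hu, map_zero])⟩

theorem locChange_cechRestrict {I J : Finset ι} (h : I ⊆ J) (z : CechLocal x' N' I) :
    locChange hx hφ J (cechRestrict x' N' h z) = cechRestrict x N h (locChange hx hφ I z) := by
  obtain ⟨s, v, rfl⟩ := exists_cechMk z
  rw [cechRestrict_cechMk, locChange_cechMk, locChange_cechMk, cechRestrict_cechMk]

/-- The map of Čech cochains induced by a homomorphism of modules over a homomorphism of rings. -/
def cechChange : CechCochain x' N' →+ CechCochain x N where
  toFun c := fun J => locChange hx hφ J (c J)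
  map_zero' := funext fun _ => map_zero _
  map_add' _ _ := funext fun _ => map_add _ _ _

theorem cechChange_apply (c : CechCochain x' N') (J : Finset ι) :
    cechChange hx hφ c J = locChange hx hφ J (c J) := rfl

theorem cechChange_smul (r : R') (c : CechCochain x' N') :
    cechChange hx hφ (r • c) = ρ r • cechChange hx hφ c :=
  funext fun J => locChange_smul hx hφ r (c J)

theorem cechChange_injective (hinj : Function.Injective φ) :
    Function.Injective (cechChange hx hφ) := by
  intro b c h
  funext J
  apply locChange_injective hx hφ hinj
  rw [← cechChange_apply, h, cechChange_apply]

theorem cechChange_mem_cechDegree {p : ℤ} {c : CechCochain x' N'} (hc : c ∈ cechDegree x' N' p) :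
    cechChange hx hφ c ∈ cechDegree x N p := fun J hJ => by
  rw [cechChange_apply, hc J hJ, map_zero]

theorem mem_cechDegree_of_cechChange (hinj : Function.Injective φ) {p : ℤ} {c : CechCochain x' N'}
    (hc : cechChange hx hφ c ∈ cechDegree x N p) : c ∈ cechDegree x' N' p := fun J hJ => by
  apply locChange_injective hx hφ hinj
  rw [map_zero, ← cechChange_apply, hc J hJ]

variable [LinearOrder ι]

theorem cechChange_cechD (c : CechCochain x' N') :
    cechChange hx hφ (cechD x' N' c) = cechD x N (cechChange hx hφ c) := by
  funext J
  rw [cechChange_apply, cechD_apply, cechD_apply, map_sum]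
  refine Finset.sum_congr rfl fun i _ => ?_
  rw [locChange_smul, locChange_cechRestrict, map_pow, map_neg, map_one, cechChange_apply]

theorem cechChange_mem_cechCocycle {p : ℤ} {c : CechCochain x' N'} (hc : c ∈ cechCocycle x' N' p) :
    cechChange hx hφ c ∈ cechCocycle x N p :=
  ⟨LinearMap.mem_ker.2 (by rw [← cechChange_cechD, LinearMap.mem_ker.1 hc.1, map_zero]),
    cechChange_mem_cechDegree hx hφ hc.2⟩

theorem mem_cechCocycle_of_cechChange (hinj : Function.Injective φ) {p : ℤ} {c : CechCochain x' N'}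
    (hc : cechChange hx hφ c ∈ cechCocycle x N p) : c ∈ cechCocycle x' N' p :=
  ⟨LinearMap.mem_ker.2 (cechChange_injective hx hφ hinj (by
    rw [cechChange_cechD, LinearMap.mem_ker.1 hc.1, map_zero])),
    mem_cechDegree_of_cechChange hx hφ hinj hc.2⟩

theorem cechChange_mem_cechCoboundary {p : ℤ} {c : CechCochain x' N'}
    (hc : c ∈ cechCoboundary x' N' p) : cechChange hx hφ c ∈ cechCoboundary x N p := by
  obtain ⟨b, hb, rfl⟩ := hc
  exact ⟨cechChange hx hφ b, cechChange_mem_cechDegree hx hφ hb, (cechChange_cechD hx hφ b).symm⟩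

end ChangeOfRings

section GradedChange

variable {ι K Γ' Γ R' R N' N : Type*} [LinearOrder ι] [Finite ι] [Field K] [CommRing R'] [Algebra K R']
  [CommRing R] [Algebra K R] [AddCommGroup Γ'] [DecidableEq Γ'] [AddCommGroup Γ] [DecidableEq Γ]
  {𝒜' : Γ' → Submodule K R'} [GradedAlgebra 𝒜'] {𝒜 : Γ → Submodule K R} [GradedAlgebra 𝒜]
  [AddCommGroup N'] [Module R' N'] [AddCommGroup N] [Module R N] {𝒩' : Γ' → AddSubgroup N'}
  {𝒩 : Γ → AddSubgroup N} {ρ : R' →+* R} {φ : N' →+ N} {x' : ι → R'} {x : ι → R}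
  (hx : ∀ i, ρ (x' i) = x i) (hφ : ∀ r v, φ (r • v) = ρ r • φ v) {δ : Γ' →+ Γ} {κ : Γ}
  (hρ : ∀ β, ∀ r ∈ 𝒜' β, ρ r ∈ 𝒜 (δ β)) (hN' : GradedSMul 𝒜' 𝒩') (hN : GradedSMul 𝒜 𝒩)

include hρ hN'

theorem cechChange_mem_grading (hφg : ∀ γ, ∀ v ∈ 𝒩' γ, φ v ∈ 𝒩 (δ γ + κ)) {γ : Γ'}
    {c : CechCochain x' N'} (hc : c ∈ cechGrading 𝒜' x' 𝒩' γ) :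
    cechChange hx hφ c ∈ cechGrading 𝒜 x 𝒩 (δ γ + κ) := fun J _ => by
  obtain ⟨β, s, v, hv, hs, h⟩ := (mem_cechLocalGrading hN').1 (hc J trivial)
  have h1 : cechChange hx hφ c J = cechMk x J ⟨ρ s, map_mem_cechDen hx s.2⟩ (φ v) :=
    (congrArg (locChange hx hφ J) h).trans (locChange_cechMk hx hφ s v)
  change cechChange hx hφ c J ∈ _
  rw [h1]
  refine cechMk_mem_grading (hρ β s hs) ?_
  have := hφg _ v hv
  rwa [map_add, add_right_comm] at this

include hN

/-- A homogeneous cochain of the right degree comes from the smaller ring. -/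
theorem exists_cechChange_eq (hx' : ∀ i, ∃ β, x' i ∈ 𝒜' β)
    (hsurj : ∀ γ, ∀ v ∈ 𝒩 (δ γ + κ), ∃ w ∈ 𝒩' γ, φ w = v) {γ : Γ'} {c : CechCochain x N}
    (hc : c ∈ cechGrading 𝒜 x 𝒩 (δ γ + κ)) :
    ∃ b ∈ cechGrading 𝒜' x' 𝒩' γ, cechChange hx hφ b = c := by
  have h : ∀ J, ∃ z ∈ cechLocalGrading 𝒜' x' 𝒩' J γ, locChange hx hφ J z = c J := fun J => by
    obtain ⟨β, s, v, hv, hs, hcJ⟩ := (mem_cechLocalGrading hN).1 (hc J trivial)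
    change c J = _ at hcJ
    rw [hcJ]
    obtain ⟨s', hs'⟩ := exists_of_mem_cechDen hx s
    obtain ⟨β', hβ'⟩ := exists_degree hx' s'
    -- The denominator `s` has the degree `δ β'` by construction and the degree `β` by assumption;
    -- if these differ, then `s = 0` and the localization is trivial.
    by_cases hβ : β = δ β'
    · subst hβ
      rw [add_right_comm, ← map_add] at hv
      obtain ⟨w, hw, rfl⟩ := hsurj _ v hv
      refine ⟨cechMk x' J s' w, cechMk_mem_grading hβ' hw, ?_⟩
      rw [locChange_cechMk]
      congr 2
      exact Subtype.ext hs'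
    · have h0 : (s : R) = 0 := by
        have h1 := hρ _ _ hβ'
        rw [hs'] at h1
        rw [← DirectSum.decompose_of_mem_same 𝒜 hs, DirectSum.decompose_of_mem_ne 𝒜 h1 (Ne.symm hβ)]
      refine ⟨0, zero_mem _, ?_⟩
      rw [map_zero, eq_comm, cechMk_eq_zero]
      exact ⟨s, by rw [h0, zero_smul]⟩
  choose b hb hbc using h
  exact ⟨b, fun J _ => hb J, funext hbc⟩

end GradedChange

/-! ### Strands of graded modules -/

section AbstractStrand

variable {Γ' Γ K R' R : Type*} [Field K] [CommRing R'] [Algebra K R'] [CommRing R] [Algebra K R]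
  [AddCommGroup Γ'] [DecidableEq Γ'] [AddCommGroup Γ] [DecidableEq Γ]
  {𝒜' : Γ' → Submodule K R'} [GradedAlgebra 𝒜'] {𝒜 : Γ → Submodule K R} [GradedAlgebra 𝒜]
  {ρ : R' →+* R} {δ : Γ' →+ Γ} {κ : Γ}
  {N' N B' B : Type*} [AddCommGroup N'] [Module R' N'] [AddCommGroup N] [Module R N]
  [AddCommGroup B'] [Module R' B'] [AddCommGroup B] [Module R B] {𝒩' : Γ' → AddSubgroup N'}
  {𝒩 : Γ → AddSubgroup N} {ℬ' : Γ' → AddSubgroup B'} {ℬ : Γ → AddSubgroup B}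

/-- The graded module `N'` over the smaller ring consists, through `ω`, of the components of `N` in
the degrees `δ γ + κ`. -/
structure IsStrand (𝒜' : Γ' → Submodule K R') (δ : Γ' →+ Γ) (κ : Γ) (𝒩' : Γ' → AddSubgroup N')
    (𝒩 : Γ → AddSubgroup N) (ω : N' →ₛₗ[ρ] N) : Prop where
  grading : IsGrading 𝒩'
  smul : GradedSMul 𝒜' 𝒩'
  injective : Function.Injective ω
  mem_iff : ∀ γ v, v ∈ 𝒩' γ ↔ ω v ∈ 𝒩 (δ γ + κ)
  exists_eq : ∀ γ, ∀ v ∈ 𝒩 (δ γ + κ), ∃ w, ω w = v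

theorem IsStrand.exists_mem {ω : N' →ₛₗ[ρ] N} (h : IsStrand 𝒜' δ κ 𝒩' 𝒩 ω) {γ : Γ'} {v : N}
    (hv : v ∈ 𝒩 (δ γ + κ)) : ∃ w ∈ 𝒩' γ, ω w = v := by
  obtain ⟨w, rfl⟩ := h.exists_eq γ v hv
  exact ⟨w, (h.mem_iff γ w).2 hv, rfl⟩

/-- A homogeneous semilinear map which is bijective in the degrees `δ γ + κ` identifies its source
with the strand of its target. -/
theorem IsStrand.gradedIso {ω : B' →ₛₗ[ρ] B} (h : IsStrand 𝒜' δ κ ℬ' ℬ ω) (hN' : IsGrading 𝒩')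
    (f : N' →ₛₗ[ρ] B) (hf : ∀ γ, ∀ a ∈ 𝒩' γ, f a ∈ ℬ (δ γ + κ))
    (hinj : ∀ γ, ∀ a ∈ 𝒩' γ, f a = 0 → a = 0)
    (hsurj : ∀ γ, ∀ b ∈ ℬ (δ γ + κ), ∃ a ∈ 𝒩' γ, f a = b) : GradedIso R' 𝒩' ℬ' := by
  have h1 : ∀ a, ∃ b, ω b = f a := hN'.induction ⟨0, by rw [map_zero, map_zero]⟩
    (by
      rintro a a' ⟨b, hb⟩ ⟨b', hb'⟩
      exact ⟨b + b', by rw [map_add, map_add, hb, hb']⟩)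
    fun γ a ha => h.exists_eq γ _ (hf γ a ha)
  choose F hF using h1
  let F' : N' →ₗ[R'] B' :=
    { toFun := F
      map_add' := fun a b => h.injective (by rw [map_add, hF, hF, hF, map_add])
      map_smul' := fun r a => h.injective (by
        rw [RingHom.id_apply, map_smulₛₗ, hF, hF, map_smulₛₗ]) }
  have hF' : ∀ a, ω (F' a) = f a := hF
  have hg : IsGradedHom 𝒩' ℬ' F' := fun γ a ha =>
    (h.mem_iff γ _).2 (by rw [hF']; exact hf γ a ha)
  obtain ⟨e, -, he⟩ := exists_equiv_of_bijective hg
    (injective_of_homogeneous hN' h.grading hg fun γ a ha h0 => hinj γ a ha (by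
      rw [← hF', h0, map_zero]))
    (fun γ b hb => by
      obtain ⟨a, ha, hab⟩ := hsurj γ _ ((h.mem_iff γ b).1 hb)
      exact ⟨a, ha, h.injective (by rw [hF', hab])⟩) h.grading.mem_span
  exact ⟨e, he⟩

/-- A graded linear map which is bijective in the degrees of the strands induces an isomorphism of
the strands. -/
theorem IsStrand.gradedIso_of_map {ω : N' →ₛₗ[ρ] N} (hω : IsStrand 𝒜' δ κ 𝒩' 𝒩 ω)
    {ω' : B' →ₛₗ[ρ] B} (h : IsStrand 𝒜' δ κ ℬ' ℬ ω') {g : N →ₗ[R] B} (hg : IsGradedHom 𝒩 ℬ g)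
    (hinj : ∀ γ, ∀ a ∈ 𝒩 (δ γ + κ), g a = 0 → a = 0)
    (hsurj : ∀ γ, ∀ b ∈ ℬ (δ γ + κ), ∃ a ∈ 𝒩 (δ γ + κ), g a = b) : GradedIso R' 𝒩' ℬ' := by
  refine h.gradedIso hω.grading (g.comp ω) (fun γ a ha => hg _ _ ((hω.mem_iff γ a).1 ha))
    (fun γ a ha h0 => hω.injective ?_) fun γ b hb => ?_
  · rw [map_zero]
    exact hinj γ _ ((hω.mem_iff γ a).1 ha) h0
  · obtain ⟨a, ha, rfl⟩ := hsurj γ b hb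
    obtain ⟨a', ha', rfl⟩ := hω.exists_mem ha
    exact ⟨a', ha', rfl⟩

section LocalCohomology

variable {ι : Type*} [LinearOrder ι] [Fintype ι] {x' : ι → R'} {x : ι → R}
  {H' : Type*} [AddCommGroup H'] [Module R' H'] {ℋ' : Γ' → AddSubgroup H'}

/-- Local cohomology of a strand is the strand of local cohomology. -/
theorem IsStrand.gradedIso_localCoh {ω : N' →ₛₗ[ρ] N} (h : IsStrand 𝒜' δ κ 𝒩' 𝒩 ω)
    (hx : ∀ i, ρ (x' i) = x i) (hx' : ∀ i, ∃ β, x' i ∈ 𝒜' β)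
    (hρ : ∀ β, ∀ r ∈ 𝒜' β, ρ r ∈ 𝒜 (δ β)) (hNg : IsGrading 𝒩) (hN : GradedSMul 𝒜 𝒩) (p : ℤ)
    {ω' : H' →ₛₗ[ρ] LocalCoh x N p} (hH : IsStrand 𝒜' δ κ ℋ' (localCohGrading 𝒜 x 𝒩 p) ω') :
    GradedIso R' (localCohGrading 𝒜' x' 𝒩' p) ℋ' := by
  have hφ : ∀ r v, ω.toAddMonoidHom (r • v) = ρ r • ω.toAddMonoidHom v := ω.map_smulₛₗ
  have hxg : ∀ i, ∃ β, x i ∈ 𝒜 β := fun i => by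
    obtain ⟨β, hβ⟩ := hx' i
    exact ⟨δ β, by rw [← hx]; exact hρ β _ hβ⟩
  have hsurj : ∀ γ, ∀ v ∈ 𝒩 (δ γ + κ), ∃ w ∈ 𝒩' γ, ω.toAddMonoidHom w = v :=
    fun γ v hv => h.exists_mem hv
  let f₀ : cechCocycle x' N' p →ₛₗ[ρ] LocalCoh x N p :=
    { toFun := fun z => subquotientMk _ _
        ⟨cechChange hx hφ z, cechChange_mem_cechCocycle hx hφ z.2⟩
      map_add' := fun z w => by
        rw [← map_add]
        exact congrArg _ (Subtype.ext (map_add (cechChange hx hφ) _ _))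
      map_smul' := fun r z => by
        rw [← map_smul]
        exact congrArg _ (Subtype.ext (cechChange_smul hx hφ r z)) }
  have hf₀ : ∀ z : cechCocycle x' N' p, f₀ z = 0 ↔ cechChange hx hφ z ∈ cechCoboundary x N p :=
    fun z => subquotient_mk_eq_zero _
  have hle : (cechCoboundary x' N' p).submoduleOf (cechCocycle x' N' p) ≤ LinearMap.ker f₀ :=
    fun z hz => LinearMap.mem_ker.2 ((hf₀ z).2 (cechChange_mem_cechCoboundary hx hφ hz))
  refine hH.gradedIso (isGrading_localCoh hx' h.grading h.smul p)
    (((cechCoboundary x' N' p).submoduleOf (cechCocycle x' N' p)).liftQ f₀ hle) ?_ ?_ ?_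
  · rintro γ _ ⟨z, hz, rfl⟩
    exact ⟨⟨_, cechChange_mem_cechCocycle hx hφ z.2⟩, cechChange_mem_grading hx hφ hρ h.smul
      (fun γ v hv => (h.mem_iff γ v).1 hv) hz, rfl⟩
  · rintro γ _ ⟨z, hz, rfl⟩ h0
    have h1 : f₀ z = 0 := h0
    rw [hf₀] at h1
    obtain ⟨b, hb, hbz⟩ := h1
    refine (subquotient_mk_eq_zero z).2 ?_
    have hzg : cechChange hx hφ z ∈ cechGrading 𝒜 x 𝒩 (δ γ + κ) :=
      cechChange_mem_grading hx hφ hρ h.smul (fun γ v hv => (h.mem_iff γ v).1 hv) hz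
    have hgr := isGrading_cechCochain hxg hNg hN
    -- The component of degree `δ γ + κ` of a primitive over the larger ring descends to the smaller
    -- ring.
    obtain ⟨a, -, ha⟩ := exists_cechChange_eq hx hφ hρ h.smul hN hx' hsurj
      (hgr.proj_mem (δ γ + κ) b)
    have hbd := isHomog_cechDegree hgr (fun J => isGrading_cechLocal hxg hNg hN J) (p - 1)
      (δ γ + κ) b hb
    rw [← ha] at hbd
    refine ⟨a, mem_cechDegree_of_cechChange hx hφ h.injective hbd,
      cechChange_injective hx hφ h.injective ?_⟩
    rw [cechChange_cechD, ha]
    have h2 := hgr.map_proj hgr (cechD x N).toAddMonoidHom (isGradedHom_cechD hN) (δ γ + κ) b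
    refine h2.trans ?_
    change hgr.proj _ (cechD x N b) = _
    rw [hbz]
    exact hgr.proj_of_mem hzg
  · rintro γ _ ⟨c, hc, rfl⟩
    obtain ⟨b, hb, hbc⟩ := exists_cechChange_eq hx hφ hρ h.smul hN hx' hsurj hc
    have hbz : b ∈ cechCocycle x' N' p :=
      mem_cechCocycle_of_cechChange hx hφ h.injective (by rw [hbc]; exact c.2)
    refine ⟨Submodule.mkQ _ ⟨b, hbz⟩, ⟨⟨b, hbz⟩, hb, rfl⟩, ?_⟩
    change subquotientMk _ _ _ = subquotientMk _ _ _
    exact congrArg _ (Subtype.ext hbc)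

end LocalCohomology

section Dual

variable {D' : Type*} [AddCommGroup D'] [Module R' D'] {𝒟' : Γ' → AddSubgroup D'}

/-- The strand of a graded dual is the graded dual of the opposite strand. -/
theorem IsStrand.gradedIso_gradedDual {ω : N' →ₛₗ[ρ] N} (h : IsStrand 𝒜' δ (-κ) 𝒩' 𝒩 ω)
    (hδ : Function.Injective δ) (hρK : ∀ a : K, ρ (algebraMap K R' a) = algebraMap K R a)
    (hNg : IsGrading 𝒩) (hN : GradedSMul 𝒜 𝒩)
    {ω' : D' →ₛₗ[ρ] GradedDual K R 𝒩} (hD : IsStrand 𝒜' δ κ 𝒟' (gradedDualGrading K R 𝒩) ω') :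
    GradedIso R' 𝒟' (gradedDualGrading K R' 𝒩') := by
  let F₀ : D' →ₗ[R'] FullDual K R' N' :=
    { toFun := fun a => ⟨(ω' a).1.1.comp ω.toAddMonoidHom, fun c v => by
        have h1 : ω (algebraMap K R' c • v) = algebraMap K R c • ω v := by
          rw [map_smulₛₗ, hρK]
        exact (congrArg (ω' a).1.1 h1).trans ((ω' a).1.2 c (ω v))⟩
      map_add' := fun a b => Subtype.ext <| AddMonoidHom.ext fun v => by
        change (ω' (a + b)).1.1 (ω v) = (ω' a).1.1 (ω v) + (ω' b).1.1 (ω v)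
        rw [map_add]
        rfl
      map_smul' := fun r a => Subtype.ext <| AddMonoidHom.ext fun v => by
        change (ω' (r • a)).1.1 (ω v) = (ω' a).1.1 (ω (r • v))
        rw [map_smulₛₗ, map_smulₛₗ]
        rfl }
  have hF₀ : ∀ a v, (F₀ a).1 v = (ω' a).1.1 (ω v) := fun a v => rfl
  have hdeg : ∀ γ β, β ≠ -γ → δ β + -κ ≠ -(δ γ + κ) := fun γ β hβ h0 => by
    rw [neg_add, add_left_inj, ← map_neg] at h0
    exact hβ (hδ h0)
  have hF₀g : ∀ γ, ∀ a ∈ 𝒟' γ, F₀ a ∈ fullDualGrading K R' 𝒩' γ := fun γ a ha β hβ v hv =>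
    (hD.mem_iff γ a).1 ha _ (hdeg γ β hβ) _ ((h.mem_iff β v).1 hv)
  have hmem : ∀ a, F₀ a ∈ GradedDual K R' 𝒩' := hD.grading.induction (by
    rw [map_zero]; exact zero_mem _) (fun a b ha hb => by rw [map_add]; exact add_mem ha hb)
    fun γ a ha => Submodule.subset_span ⟨γ, hF₀g γ a ha⟩
  let F : D' →ₗ[R'] GradedDual K R' 𝒩' := F₀.codRestrict _ hmem
  have hF : IsGradedHom 𝒟' (gradedDualGrading K R' 𝒩') F := hF₀g
  obtain ⟨e, -, he⟩ := exists_equiv_of_bijective hF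
    (injective_of_homogeneous hD.grading (isGrading_gradedDual h.grading h.smul) hF
      fun γ a ha h0 => hD.injective (by
        rw [map_zero]
        refine Subtype.ext (fullDual_ext_homogeneous hNg fun β v hv => ?_)
        by_cases hβ : β = -(δ γ + κ)
        · subst hβ
          rw [neg_add, ← map_neg] at hv
          obtain ⟨w, rfl⟩ := h.exists_eq _ v hv
          have h1 : F₀ a = 0 := congrArg Subtype.val h0
          rw [← hF₀, h1]
          rfl
        · exact (hD.mem_iff γ a).1 ha β hβ v hv))
    (fun γ ψ hψ => by
      -- Extend `ψ` to a functional on `N` by composing it with the projection `π` to the component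
      -- of degree `-(δ γ + κ)`, viewed as a component of `N'`.
      have h1 : ∀ v, ∃ w, ω w = hNg.proj (-(δ γ + κ)) v := fun v =>
        h.exists_eq (-γ) _ (by
          rw [map_neg, ← neg_add]
          exact hNg.proj_mem _ v)
      choose π hπ using h1
      have hπadd : ∀ v w, π (v + w) = π v + π w := fun v w =>
        h.injective (by rw [map_add, hπ, hπ, hπ, map_add])
      have hπsmul : ∀ (c : K) v, π (algebraMap K R c • v) = algebraMap K R' c • π v := fun c v =>
        h.injective (by
          rw [map_smulₛₗ, hπ, hπ, hρK]
          refine ((hNg.map_proj hNg (DistribSMul.toAddMonoidHom N (algebraMap K R c))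
            (fun β w hw => ?_) _ v)).symm
          have := hN 0 β _ (SetLike.algebraMap_mem_graded 𝒜 c) w hw
          rwa [zero_add] at this)
      let χ : FullDual K R N := ⟨AddMonoidHom.mk' (fun v => ψ.1.1 (π v)) fun v w => by
        rw [hπadd, map_add], fun c v => by
          change ψ.1.1 (π _) = c * ψ.1.1 (π v)
          rw [hπsmul]
          exact ψ.1.2 c (π v)⟩
      have hχv : ∀ v, χ.1 v = ψ.1.1 (π v) := fun v => rfl
      have hχ : χ ∈ fullDualGrading K R 𝒩 (δ γ + κ) := fun β hβ v hv => by
        have h2 : π v = 0 := h.injective (by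
          rw [hπ, map_zero, hNg.proj_of_mem_ne hv hβ.symm])
        rw [hχv, h2, map_zero]
      obtain ⟨χ', hχ', hχχ'⟩ := exists_gradedDual hχ
      obtain ⟨a, ha, rfl⟩ := hD.exists_mem hχ'
      refine ⟨a, ha, Subtype.ext (fullDual_ext_homogeneous h.grading fun β v hv => ?_)⟩
      have h2 : (F a).1.1 v = χ.1 (ω v) := congrArg (fun φ : FullDual K R N => φ.1 (ω v)) hχχ'
      rw [h2]
      by_cases hβ : β = -γ
      · subst hβ
        have h3 : π (ω v) = v := h.injective (by
          rw [hπ]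
          refine hNg.proj_of_mem ?_
          have := (h.mem_iff _ v).1 hv
          rwa [map_neg, ← neg_add] at this)
        rw [hχv, h3]
      · rw [hχ _ (hdeg γ β hβ) _ ((h.mem_iff β v).1 hv)]
        exact (hψ β hβ v hv).symm)
    gradedDual_mem_span
  exact ⟨e, he⟩

end Dual

end AbstractStrand

section Strand

variable {K : Type*} [Field K] {m n : ℕ} {e : Fin n → ℕ} {N : Type*} [AddCommGroup N]
  [Module (S K m n) N] {𝒩 : ℤ × ℤ → AddSubgroup N}

attribute [local instance] weightedGradedAlgebra

theorem rename_mem_gradS {b : ℤ} {p : T K m} (hp : p ∈ gradT K m b) :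
    rename (Sum.inl : Fin m → Fin m ⊕ Fin n) p ∈ gradS K m e (b, 0) := by
  intro a ha
  obtain ⟨u, rfl, hu⟩ := coeff_rename_ne_zero _ _ _ ha
  have h1 := hp hu
  rw [Finsupp.weight_apply] at h1 ⊢
  rw [Finsupp.sum_mapDomain_index (h := fun i (c : ℕ) => c • varDeg m e i)
    (fun i => zero_smul ℕ _) fun i a b => add_smul a b _, ← h1]
  simp [varDeg, Finsupp.sum, Prod.ext_iff, Prod.fst_sum, Prod.snd_sum]

/-- The inclusion of a strand. -/
def strandIncl (𝒩 : ℤ × ℤ → AddSubgroup N) (k : ℤ) :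
    Strand K m n 𝒩 k →ₛₗ[(rename Sum.inl : T K m →ₐ[K] S K m n).toRingHom] N where
  toFun v := ofOverT K m n N v
  map_add' _ _ := rfl
  map_smul' _ _ := rfl

theorem isStrand_strand (h𝒩 : IsGrading 𝒩) (hs : GradedSMul (gradS K m e) 𝒩) (k : ℤ) :
    IsStrand (gradT K m) (AddMonoidHom.inl ℤ ℤ) (0, k) (strandGrading K m n 𝒩 k) 𝒩
      (strandIncl 𝒩 k) := by
  let 𝒢 : ℤ → AddSubgroup (OverT K m n N) := fun j =>
    (𝒩 (j, k)).comap (ofOverT K m n N).toAddMonoidHom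
  have hsmul : GradedSMul (gradT K m) 𝒢 := fun b j p hp v hv => by
    have := hs _ _ _ (rename_mem_gradS (e := e) hp) _ hv
    rw [Prod.mk_add_mk, zero_add] at this
    exact this
  have hdeg : ∀ j : ℤ, AddMonoidHom.inl ℤ ℤ j + (0, k) = (j, k) := fun j => by simp
  have hind : ∀ (s : Finset ℤ) (b : ℤ → OverT K m n N), (∀ j, b j ∈ 𝒢 j) → ∑ j ∈ s, b j = 0 →
      ∀ j ∈ s, b j = 0 := by
    intro s b hb h0 j hj
    have h1 := h𝒩.eq_zero (s.map ⟨fun j => (j, k), fun _ _ h => congrArg Prod.fst h⟩)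
      (fun γ => if γ.2 = k then ofOverT K m n N (b γ.1) else 0) (fun γ => ?_) ?_ (j, k)
      (Finset.mem_map_of_mem _ hj)
    · rw [if_pos rfl] at h1
      exact h1
    · split_ifs with h
      · obtain ⟨l, k'⟩ := γ
        subst h
        exact hb l
      · exact zero_mem _
    · rw [Finset.sum_map]
      have h2 := congrArg (ofOverT K m n N) h0
      rw [map_sum, map_zero] at h2
      rw [← h2]
      exact Finset.sum_congr rfl fun j _ => if_pos rfl
  refine ⟨isGrading_span (A := OverT K m n N) (𝒢 := 𝒢) hsmul hind,
    fun b j p hp v hv => hsmul b j p hp v.1 hv, fun v w h => Subtype.ext h, fun j v => ?_,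
    fun j v hv => ?_⟩
  · rw [hdeg]
    exact Iff.rfl
  · rw [hdeg] at hv
    exact ⟨⟨v, Submodule.subset_span ⟨j, hv⟩⟩, rfl⟩

end Strand

/-! ### Modules of finite length -/

section FiniteLength

variable {Γ K R N : Type*} [Field K] [CommRing R] [Algebra K R] [AddCommGroup Γ] [DecidableEq Γ]
  {𝒜 : Γ → Submodule K R} [GradedAlgebra 𝒜] [AddCommGroup N] [Module R N]
  {𝒩 : Γ → AddSubgroup N} {τ : Γ →+ ℤ}

/-- The elements of a graded module all of whose components have `τ`-degree at least `k`, over a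
ring without elements of negative `τ`-degree. -/
def degreeAtLeast (h : IsGrading 𝒩) (hN : GradedSMul 𝒜 𝒩)
    (hτ : ∀ β, ∀ r ∈ 𝒜 β, r ≠ 0 → 0 ≤ τ β) (k : ℤ) : Submodule R N where
  carrier := {v | ∀ γ, τ γ < k → h.proj γ v = 0}
  zero_mem' _ _ := map_zero _
  add_mem' hv hw γ hγ := by rw [map_add, hv γ hγ, hw γ hγ, add_zero]
  smul_mem' r v hv γ hγ := by
    induction r using DirectSum.Decomposition.inductionOn 𝒜 with
    | zero => rw [zero_smul, map_zero]
    | add r r' hr hr' => rw [add_smul, map_add, hr, hr', add_zero]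
    | @homogeneous β r =>
      by_cases hr : (r : R) = 0
      · rw [hr, zero_smul, map_zero]
      obtain ⟨s, -, hs⟩ := h.sum_proj v
      rw [← hs, Finset.smul_sum, map_sum]
      refine Finset.sum_eq_zero fun δ _ => ?_
      by_cases hδ : τ δ < k
      · rw [hv δ hδ, smul_zero, map_zero]
      · refine h.proj_of_mem_ne (hN β δ _ r.2 _ (h.proj_mem δ v)) fun h' => ?_
        have h1 := hτ β _ r.2 hr
        rw [h', map_add] at hγ
        omega

/-- A graded module of finite length is bounded above, in any degree function which is nonnegative
on the ring. -/
theorem exists_forall_eq_zero_of_isFiniteLength (h : IsGrading 𝒩) (hN : GradedSMul 𝒜 𝒩)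
    (hτ : ∀ β, ∀ r ∈ 𝒜 β, r ≠ 0 → 0 ≤ τ β) (hfin : IsFiniteLength R N) :
    ∃ k₀ : ℤ, ∀ γ, k₀ ≤ τ γ → ∀ v ∈ 𝒩 γ, v = 0 := by
  have hart := (isFiniteLength_iff_isNoetherian_isArtinian.1 hfin).2
  -- The submodules of elements of degree at least `k` form a descending chain, which becomes
  -- stationary because `N` is artinian.
  let U : ℕ →o (Submodule R N)ᵒᵈ :=
    ⟨fun k => OrderDual.toDual (degreeAtLeast h hN hτ k), fun k l hkl v hv γ hγ =>
      hv γ (hγ.trans_le (by exact_mod_cast hkl))⟩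
  obtain ⟨k₀, hk₀⟩ := IsArtinian.monotone_stabilizes U
  refine ⟨k₀, fun γ hγ v hv => ?_⟩
  have h1 : v ∈ degreeAtLeast h hN hτ k₀ := fun β hβ =>
    h.proj_of_mem_ne hv fun h' => by subst h'; omega
  have h2 : degreeAtLeast h hN hτ k₀ = degreeAtLeast h hN hτ ((τ γ + 1).toNat : ℕ) :=
    hk₀ _ (by omega)
  rw [h2] at h1
  rw [← h.proj_of_mem hv]
  exact h1 γ (by omega)

end FiniteLength

/-! ### Strands to which the higher `Ext`-modules do not contribute -/

section

variable {K : Type*} [Field K] {m n : ℕ} {e : Fin n → ℕ}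

theorem weight_varDeg_snd (a : Fin m ⊕ Fin n →₀ ℕ) :
    (Finsupp.weight (varDeg m e) a).2 = a.sum fun i c => c * (varDeg m e i).2 := by
  rw [Finsupp.weight_apply, Finsupp.sum, Prod.snd_sum]
  exact Finset.sum_congr rfl fun i _ => by simp

theorem snd_nonneg_of_mem_gradS {β : ℤ × ℤ} {p : S K m n} (hp : p ∈ gradS K m e β) (h0 : p ≠ 0) :
    0 ≤ β.2 := by
  obtain ⟨a, ha⟩ := MvPolynomial.ne_zero_iff.1 h0
  rw [← hp ha, weight_varDeg_snd]
  refine Finset.sum_nonneg fun i _ => ?_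
  rcases i with i | i <;> simp [varDeg]

/-- Inverting the `x_i` does not change the `y`-degree. -/
theorem snd_eq_zero_of_mem_cechDen {J : Finset (Fin m)} {β : ℤ × ℤ}
    (s : cechDen (varFam K (Sum.inl : Fin m → Fin m ⊕ Fin n)) J)
    (hs : (s : S K m n) ∈ gradS K m e β) : β.2 = 0 := by
  obtain ⟨a, ha, hsa⟩ := exists_monomial_of_mem_cechDen s
  rw [hsa] at hs
  have h1 := hs (d := a) (by rw [coeff_monomial, if_pos rfl]; exact one_ne_zero)
  rw [← h1, weight_varDeg_snd]
  refine Finset.sum_eq_zero fun i _ => ?_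
  rcases i with i | i
  · simp [varDeg]
  · rw [ha (Sum.inr i) (by rintro ⟨j, -, hj⟩; cases hj)]
    simp

end

section Bounds

variable {ι R N : Type*} [Fintype ι] [LinearOrder ι] [CommRing R] [AddCommGroup N] [Module R N]

/-- Čech cohomology is concentrated in the degrees from `0` to the number of elements. -/
theorem subsingleton_localCoh (x : ι → R) {p : ℤ} (hp : p < 0 ∨ (Fintype.card ι : ℤ) < p) :
    Subsingleton (LocalCoh x N p) := by
  refine ⟨fun a b => ?_⟩
  have h1 : ∀ a : LocalCoh x N p, a = 0 := fun a => by
    obtain ⟨z, rfl⟩ := Submodule.mkQ_surjective _ a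
    refine (subquotient_mk_eq_zero z).2 ?_
    have h2 : (z : CechCochain x N) = 0 := funext fun J => z.2.2 J fun hJ => by
      have := J.card_le_univ
      omega
    rw [h2]
    exact zero_mem _
  rw [h1 a, h1 b]

end Bounds

theorem subsingleton_strand {K N : Type*} [Field K] {m n : ℕ} [AddCommGroup N]
    [Module (S K m n) N] [Subsingleton N] (𝒩 : ℤ × ℤ → AddSubgroup N) (k : ℤ) :
    Subsingleton (Strand K m n 𝒩 k) :=
  ⟨fun a b => Subtype.ext (Subsingleton.elim (α := N) a.1 b.1)⟩

section

variable {K : Type*} [Field K] {m n : ℕ} {e : Fin n → ℕ} {N B : Type*} [AddCommGroup N]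
  [Module (S K m n) N] [AddCommGroup B] [Module (S K m n) B] {𝒩 : ℤ × ℤ → AddSubgroup N}
  {ℬ : ℤ × ℤ → AddSubgroup B}

attribute [local instance] weightedGradedAlgebra

/-- A graded map which is bijective in the degrees `(l, k)` induces an isomorphism of the `k`-th
strands. -/
theorem gradedIso_strand_of_exists (h𝒩 : IsGrading 𝒩) (hN : GradedSMul (gradS K m e) 𝒩)
    (hℬ : IsGrading ℬ) (hB : GradedSMul (gradS K m e) ℬ) {k : ℤ} {P Q : ℤ × ℤ → Prop}
    (hg : ∃ g : N →ₗ[S K m n] B, IsGradedHom 𝒩 ℬ g ∧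
      (∀ γ, P γ → ∀ a ∈ 𝒩 γ, g a = 0 → a = 0) ∧ (∀ γ, Q γ → ∀ b ∈ ℬ γ, ∃ a ∈ 𝒩 γ, g a = b))
    (hP : ∀ l, P (l, k)) (hQ : ∀ l, Q (l, k)) :
    GradedIso (T K m) (strandGrading K m n 𝒩 k) (strandGrading K m n ℬ k) := by
  obtain ⟨g, hg, hinj, hsurj⟩ := hg
  have hdeg : ∀ l : ℤ, AddMonoidHom.inl ℤ ℤ l + (0, k) = (l, k) := fun l => by simp
  refine IsStrand.gradedIso_of_map (isStrand_strand h𝒩 hN k) (isStrand_strand hℬ hB k) hg ?_ ?_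
  · intro l
    rw [hdeg]
    exact hinj _ (hP l)
  · intro l
    rw [hdeg]
    exact hsurj _ (hQ l)

/-- Local cohomology with respect to the `x_i` commutes with strands. -/
theorem gradedIso_strand_localCoh (h𝒩 : IsGrading 𝒩) (hN : GradedSMul (gradS K m e) 𝒩) (k i : ℤ) :
    GradedIso (T K m)
      (localCohGrading (gradT K m) (xT K m) (strandGrading K m n 𝒩 k) i)
      (strandGrading K m n (localCohGrading (gradS K m e) (xS K m n) 𝒩 i) k) :=
  (isStrand_strand h𝒩 hN k).gradedIso_localCoh (fun _ => rename_X _ _) (varFam_mem _ id)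
    (fun _ _ hr => rename_mem_gradS hr) h𝒩 hN i
    (isStrand_strand (isGrading_localCoh (varFam_mem _ Sum.inl) h𝒩 hN i)
      (gradedSMul_subquotient (gradedSMul_cechCochain hN) _ _) k)

/-- The graded dual of the strand in the opposite degree. -/
theorem gradedIso_strand_gradedDual (h𝒩 : IsGrading 𝒩) (hN : GradedSMul (gradS K m e) 𝒩) (k : ℤ) :
    GradedIso (T K m) (strandGrading K m n (gradedDualGrading K (S K m n) 𝒩) k)
      (gradedDualGrading K (T K m) (strandGrading K m n 𝒩 (-k))) := by
  have h3 := isStrand_strand h𝒩 hN (-k)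
  have h4 : ((0, -k) : ℤ × ℤ) = -(0, k) := by rw [Prod.neg_mk, neg_zero]
  rw [h4] at h3
  exact h3.gradedIso_gradedDual (fun a b h => congrArg Prod.fst h) (fun a => rename_C _ a) h𝒩 hN
    (isStrand_strand (isGrading_gradedDual h𝒩 hN) (gradedSMul_gradedDual hN) k)

end

namespace FreeResolution

variable {K : Type*} [Field K] {m n : ℕ} {M : Type*} [AddCommGroup M] [Module (S K m n) M]
  {e : Fin n → ℕ} {ℳ : ℤ × ℤ → AddSubgroup M} (F : FreeResolution K m e ℳ)

attribute [local instance] weightedGradedAlgebra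

/-- The isomorphism `H^i_{P₀}(Ext^j(M, ω)_k) ≅ (H^q_Q(M)_{-k})^*` of graded `T`-modules. -/
def StrandDuality (j : ℕ) (k i q : ℤ) : Prop :=
  GradedIso (T K m)
    (localCohGrading (gradT K m) (xT K m) (strandGrading K m n (F.extGrading j) k) i)
    (gradedDualGrading K (T K m)
      (strandGrading K m n (localCohGrading (gradS K m e) (yS K m n) ℳ q) (-k)))

variable [Module.Finite (S K m n) M] (hℳ : IsGrading ℳ) (hs : GradedSMul (gradS K m e) ℳ) {d : ℕ}
  (hd : Module.supportDim (S K m n) M = (d : WithBot ℕ∞))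

/-- `Ext`-modules of finite length do not contribute in large `y`-degrees. -/
theorem exists_forall_locExact {i₀ : ℤ} {c : ℕ}
    (h : ∀ j : ℕ, c < j → (j : ℤ) ≤ c + i₀ → IsFiniteLength (S K m n) (F.Ext j)) :
    ∃ k₀ : ℤ, ∀ k ≥ k₀, ∀ (l : ℤ) (J : Finset (Fin m)) (j : ℤ), c < j → j ≤ c + i₀ →
      LocExact (gradS K m e) (xS K m n) (freeGr (varDeg m e) F.dualDeg) F.cohomologyD
        (freeLevel K (Fin m ⊕ Fin n) F.level) J j (l, k) := by
  have h1 : ∀ j : ℕ, ∃ k₀ : ℤ, c < j → (j : ℤ) ≤ c + i₀ →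
      ∀ γ : ℤ × ℤ, k₀ ≤ γ.2 → ∀ v ∈ F.extGrading j γ, v = 0 := fun j => by
    by_cases hj : c < j ∧ (j : ℤ) ≤ c + i₀
    · obtain ⟨k₀, hk₀⟩ := exists_forall_eq_zero_of_isFiniteLength (τ := AddMonoidHom.snd ℤ ℤ)
        (F.isGrading_ext j) (F.gradedSMul_ext j)
        (fun β p hp h0 => snd_nonneg_of_mem_gradS hp h0) (h j hj.1 hj.2)
      exact ⟨k₀, fun _ _ => hk₀⟩
    · exact ⟨0, fun h1 h2 => absurd ⟨h1, h2⟩ hj⟩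
  -- The largest of the bounds of the finitely many `Ext`-modules in question.
  choose κ hκ using h1
  obtain ⟨k₀, hk₀⟩ := ((Finset.range (c + i₀.toNat + 1)).image κ).bddAbove
  refine ⟨k₀, fun k hk l J j hj hj' => F.locExact_cohomologyD Sum.inl fun i hi β s hsβ v hv => ?_⟩
  have h2 : κ i ≤ k₀ := hk₀ (Finset.mem_coe.2 (Finset.mem_image_of_mem κ
    (Finset.mem_range.2 (by omega))))
  refine ⟨1, (one_smul _ v).trans (hκ i (by omega) (by omega) _ ?_ v hv)⟩
  rw [Prod.snd_add, snd_eq_zero_of_mem_cechDen s hsβ, add_zero]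
  exact h2.trans hk

include hℳ hs hd in
/-- The comparison map is an isomorphism on the strands to which the higher `Ext`-modules do not
contribute. -/
theorem strandDuality_of_locExact {k i : ℤ}
    (h : ∀ (l : ℤ) (J : Finset (Fin m)) (j : ℤ), (m + n - d : ℕ) < j → j ≤ (m + n - d : ℕ) + i →
      LocExact (gradS K m e) (xS K m n) (freeGr (varDeg m e) F.dualDeg) F.cohomologyD
        (freeLevel K (Fin m ⊕ Fin n) F.level) J j (l, k)) :
    F.StrandDuality (m + n - d) k i (d - i) := by
  have hle := le_dim hℳ hs hd
  have h1 := isGrading_localCoh (varFam_mem (varDeg m e) Sum.inl) (F.isGrading_ext (m + n - d))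
    (F.gradedSMul_ext (m + n - d)) i
  have h2 : GradedSMul (gradS K m e)
      (localCohGrading (gradS K m e) (xS K m n) (F.extGrading (m + n - d)) i) :=
    gradedSMul_subquotient (gradedSMul_cechCochain (F.gradedSMul_ext _)) _ _
  have h3 := isGrading_localCoh (varFam_mem (varDeg m e) Sum.inr) hℳ hs (d - i)
  have h4 : GradedSMul (gradS K m e) (localCohGrading (gradS K m e) (yS K m n) ℳ (d - i)) :=
    gradedSMul_subquotient (gradedSMul_cechCochain hs) _ _
  have h5 := gradedIso_strand_of_exists (k := k) h1 h2 (isGrading_gradedDual h3 h4)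
    (gradedSMul_gradedDual h4)
    (F.exists_comparisonMap hℳ hs hd (i := i) (q := d - i) (by omega))
    (fun l J j hj hj' => h l J j hj hj'.le) h
  exact ((gradedIso_strand_localCoh (F.isGrading_ext _) (F.gradedSMul_ext _) k i).trans h5).trans
    (gradedIso_strand_gradedDual h3 h4 k)

include hℳ hs hd in
/-- Duality for strands of large degree, in a range in which the higher `Ext`-modules have finite
length. -/
theorem exists_strandDuality (i₀ : ℤ)
    (h : ∀ j : ℕ, m + n - d < j → (j : ℤ) ≤ (m + n - d : ℕ) + i₀ →
      IsFiniteLength (S K m n) (F.Ext j)) :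
    ∃ k₀ : ℤ, ∀ k ≥ k₀, ∀ i ≤ i₀,
      F.StrandDuality (m + n - d) k i (d - i) :=
  (F.exists_forall_locExact h).imp fun _ hk₀ k hk _ hi =>
    F.strandDuality_of_locExact hℳ hs hd fun l J j hj hj' =>
      hk₀ k hk l J j hj (hj'.trans (by linarith))

/-- If `i > m` and `q < 0` then both local cohomology modules vanish. -/
theorem strandDuality_of_lt (j : ℕ) {k i q : ℤ} (hi : (m : ℤ) < i) (hq : q < 0) :
    F.StrandDuality j k i q := by
  have h1 : Subsingleton (LocalCoh (xT K m) (Strand K m n (F.extGrading j) k) i) :=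
    subsingleton_localCoh _ (Or.inr (by rw [Fintype.card_fin]; exact hi))
  have h2 : Subsingleton (LocalCoh (yS K m n) M q) := subsingleton_localCoh _ (Or.inl hq)
  have h3 := subsingleton_strand (K := K) (m := m) (n := n)
    (localCohGrading (gradS K m e) (yS K m n) ℳ q) (-k)
  have h4 : Subsingleton (GradedDual K (T K m) (strandGrading K m n
      (localCohGrading (gradS K m e) (yS K m n) ℳ q) (-k))) := subsingleton_gradedDual
  exact GradedIso.of_subsingleton

include hℳ hs hd in
/-- Duality for strands of large degree in all cohomological degrees: for `i > m + d` both sides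
vanish. -/
theorem exists_strandDuality_of_generalizedCM
    (h : ∀ j : ℕ, j ≠ m + n - d → IsFiniteLength (S K m n) (F.Ext j)) :
    ∃ k₀ : ℤ, ∀ k ≥ k₀, ∀ i : ℤ,
      F.StrandDuality (m + n - d) k i (d - i) :=
  (F.exists_strandDuality hℳ hs hd (m + d) fun j hj _ => h j hj.ne').imp
    fun k₀ hk₀ k hk i => by
      by_cases hi : i ≤ m + d
      · exact hk₀ k hk i hi
      · exact F.strandDuality_of_lt (m + n - d) (k := k) (q := d - i) (by omega)
          (by omega)

end FreeResolution

end

end BigradedDuality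

open BigradedDuality in
theorem corollary1p6 {K : Type*} [Field K] {m n : ℕ} (e : Fin n → ℕ)
    {M : Type*} [AddCommGroup M] [Module (S K m n) M] [Module.Finite (S K m n) M]
    (ℳ : ℤ × ℤ → AddSubgroup M) [DirectSum.Decomposition ℳ]
    [SetLike.GradedSMul (gradS K m e) ℳ]
    (d : ℕ) (hd : Module.supportDim (S K m n) M = (d : WithBot ℕ∞))
    (F : FreeResolution K m e ℳ) :
    -- (a)
    GradedIso (S K m n)
      (localCohGrading (gradS K m e) (xS K m n) (F.extGrading (m + n - d)) 0)
      (gradedDualGrading K (S K m n) (localCohGrading (gradS K m e) (yS K m n) ℳ d)) ∧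
    -- (b)
    (∃ (f : LocalCoh (xS K m n) (F.Ext (m + n - d)) 1 →ₗ[S K m n]
          GradedDual K (S K m n) (localCohGrading (gradS K m e) (yS K m n) ℳ (d - 1)))
        (g : GradedDual K (S K m n) (localCohGrading (gradS K m e) (yS K m n) ℳ (d - 1))
          →ₗ[S K m n] LocalCoh (xS K m n) (F.Ext (m + n - d + 1)) 0),
      IsGradedHom
        (localCohGrading (gradS K m e) (xS K m n) (F.extGrading (m + n - d)) 1)
        (gradedDualGrading K (S K m n) (localCohGrading (gradS K m e) (yS K m n) ℳ (d - 1))) f ∧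
      IsGradedHom
        (gradedDualGrading K (S K m n) (localCohGrading (gradS K m e) (yS K m n) ℳ (d - 1)))
        (localCohGrading (gradS K m e) (xS K m n) (F.extGrading (m + n - d + 1)) 0) g ∧
      Function.Injective f ∧ Function.Exact f g) ∧
    -- (c)
    (∀ i : ℕ, 2 ≤ i →
      (∀ j : ℕ, m + n - d < j → j < m + n - d + i →
        ∃ t : ℕ, idealP K m n ^ t ≤ Module.annihilator (S K m n) (F.Ext j)) →
      ∃ (f : F.Ext (m + n - d + i - 1) →ₗ[S K m n]
            LocalCoh (xS K m n) (F.Ext (m + n - d)) i)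
        (g : LocalCoh (xS K m n) (F.Ext (m + n - d)) i →ₗ[S K m n]
            GradedDual K (S K m n) (localCohGrading (gradS K m e) (yS K m n) ℳ (d - i)))
        (h : GradedDual K (S K m n) (localCohGrading (gradS K m e) (yS K m n) ℳ (d - i))
            →ₗ[S K m n] LocalCoh (xS K m n) (F.Ext (m + n - d + i)) 0),
        IsGradedHom (F.extGrading (m + n - d + i - 1))
          (localCohGrading (gradS K m e) (xS K m n) (F.extGrading (m + n - d)) i) f ∧
        IsGradedHom
          (localCohGrading (gradS K m e) (xS K m n) (F.extGrading (m + n - d)) i)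
          (gradedDualGrading K (S K m n) (localCohGrading (gradS K m e) (yS K m n) ℳ (d - i))) g ∧
        IsGradedHom
          (gradedDualGrading K (S K m n) (localCohGrading (gradS K m e) (yS K m n) ℳ (d - i)))
          (localCohGrading (gradS K m e) (xS K m n) (F.extGrading (m + n - d + i)) 0) h ∧
        Function.Exact f g ∧ Function.Exact g h) ∧
    -- the consequence for strands
    (∀ i₀ : ℤ,
      (∀ j : ℕ, m + n - d < j → (j : ℤ) ≤ (m + n - d : ℕ) + i₀ →
        IsFiniteLength (S K m n) (F.Ext j)) →
      ∃ k₀ : ℤ, ∀ k ≥ k₀, ∀ i ≤ i₀,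
        GradedIso (T K m)
          (localCohGrading (gradT K m) (xT K m)
            (strandGrading K m n (F.extGrading (m + n - d)) k) i)
          (gradedDualGrading K (T K m)
            (strandGrading K m n
              (localCohGrading (gradS K m e) (yS K m n) ℳ (d - i)) (-k)))) ∧
    -- generalized Cohen–Macaulay modules
    ((∀ j : ℕ, j ≠ m + n - d → IsFiniteLength (S K m n) (F.Ext j)) →
      ∃ k₀ : ℤ, ∀ k ≥ k₀, ∀ i : ℤ,
        GradedIso (T K m)
          (localCohGrading (gradT K m) (xT K m)
            (strandGrading K m n (F.extGrading (m + n - d)) k) i)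
          (gradedDualGrading K (T K m)
            (strandGrading K m n
              (localCohGrading (gradS K m e) (yS K m n) ℳ (d - i)) (-k)))) := by
  have hℳ := IsGrading.of_decomposition ℳ
  have hs : GradedSMul (gradS K m e) ℳ := fun β γ p hp v hv => SetLike.GradedSMul.smul_mem hp hv
  exact ⟨F.gradedIso_zeroth hℳ hs hd, F.exists_exact_first hℳ hs hd,
    fun i hi hann => F.exists_exact_higher hℳ hs hd hi hann,
    fun i₀ h => F.exists_strandDuality hℳ hs hd i₀ h,
    fun h => F.exists_strandDuality_of_generalizedCM hℳ hs hd h⟩
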